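/- **Setting.** A vector $x\in\mathbb Z^n$ starts at $0$ and receives at most $m$ updates $(i,v)\in[n]\times\{-M,\dots,M\}$, each causing $x_i\leftarrow x_i+v$ ($m,M\ge 1$). For $0<p\le 2$ let $F_p=\|x\|_p^p=\sum_i|x_i|^p$. An index $i$ is a $\phi$-heavy hitter if $|x_i|^p\ge\phi\|x\|_p^p$. Logarithms are to base $2$. Space is measured in bits and time on a word RAM with random words whose word size is $\Theta(\log(nmM))$, with a sufficiently large lower constant. For an $F_p$-estimation algorithm $\mathsf{F_pEst}(\varepsilon',d)$, which for every such stream outputs a value in $[(1-\varepsilon')F_p,(1+\varepsilon')F_p]$ with probability at least $1-d$, let $\mathsf{F_pSpace}(\varepsilon',d)$, $\mathsf{F_pUpdate}(\varepsilon',d)$ and $\mathsf{F_pReport}(\varepsilon',d)$ be its space (a whole number of machine words, at least one), update time and reporting time (at least one step each). **Theorem.** There is a word RAM algorithm $\mathsf{F_pHH}$ with the following properties. Let $0<\phi,\delta<1/2$ with $\phi n\ge 2$ and $\log(1/\delta)\le nmM$, and put $\varepsilon'=1/7$ and $\delta'=\phi\delta/(12(\log(\phi n)+1))$. $\mathsf{F_pHH}$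 has black-box access to $\mathsf{F_pEst}(\varepsilon',1/5)$ and $\mathsf{F_pEst}(\varepsilon',\delta')$: it can only create, update and query instances of them. *Correctness.* If $x\neq 0$ at the end of the stream, then with probability at least $1-\delta$ the algorithm outputs a list $L$ of distinct indices that contains all $\phi$-heavy hitters and no index that is not a $\phi/2$-heavy hitter, together with, for each $i\in L$, the correct value $\mathrm{sign}(x_i)$ and an estimate $\tilde x_i\ge 0$ with $\tilde x_i^p\in[(6/7)|x_i|^p,(9/7)|x_i|^p]$. *Costs.* (a) Suppose that each of the three costs of $\mathsf{F_pEst}(\varepsilon',\delta')$ is at least a constant times $\log(1/\delta')$ times the same cost of $\mathsf{F_pEst}(\varepsilon',1/5)$, as is the case when $\mathsf{F_pEst}(\varepsilon',\delta')$ is the median of $\Theta(\log(1/\delta'))$ independent copies of $\mathsf{F_pEst}(\varepsilon',1/5)$. Then, for every outcome of the randomness, $\mathsf{F_pHH}$ uses space $$O\bigl(\phi^{-1}\log(\phi n)\cdot\mathsf{F_pSpace}(\varepsilon',\delta')+\phi^{-1}\log(1/(\delta\phi))\log(nmM)\bigr),$$ has update time $$O\bigl(\log(\phi n)\cdot\mathsf{F_pUpdate}(\varepsilon',\delta')+\log(1/(\delta\phi))\bigr),$$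 and has reporting time $$O\bigl(\phi^{-1}(\log(\phi n)\cdot\mathsf{F_pReport}(\varepsilon',\delta')+\log(1/(\delta\phi)))\bigr).$$ (b) If, for $d\in\{1/5,\delta'\}$, $\mathsf{F_pEst}(\varepsilon',d)$ has space $O(\log(nmM)\log(1/d))$ and update and reporting times $O(\log(1/d))$ (the costs of the algorithm of Kane, Nelson and Woodruff, SODA 2010, at constant accuracy, amplified to failure probability $d$), then $\mathsf{F_pHH}$ uses space $$O\bigl(\phi^{-1}\log(\phi n)\log(nmM)\log(\log(\phi n)/(\delta\phi))\bigr),$$ has update time $$O\bigl(\log(\phi n)\cdot\log(\log(\phi n)/(\delta\phi))\bigr),$$ and has reporting time $$O\bigl(\phi^{-1}\log(\phi n)\cdot\log(\log(\phi n)/(\delta\phi))\bigr).$$ The algorithm is one fixed program, not depending on $p$, the parameters or the black box. The constants in the bounds depend only on the constants in the hypotheses (those of the word size and of the costs of the black box). -/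

import Mathlib

/-!
# Streams, black-box moment estimators, and a randomized word RAM with black-box access

* A stream is a list of updates `(i, v)` to a vector `x : Fin n → ℤ`.
* A black-box estimator is a randomized streaming algorithm with an arbitrary transition law whose
  state consists of machine words and whose update and reporting times are given numbers.
* The algorithm for heavy hitters is a program of a word RAM. A program is a finite syntactic
  object, the same for all values of the parameters; besides the usual instructions it may draw
  random words, and create, update and query instances of the black box.
-/

/-! ## Streams and frequency moments -/

/-- A stream of updates to an `n`-dimensional integer vector. -/
abbrev UpdStream (n : ℕ) : Type := List (Fin n × ℤ)

/-- The vector at the end of the stream: it starts at `0`, and `(i, v)` adds `v` to `x i`. -/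
def UpdStream.vec {n : ℕ} (l : UpdStream n) : Fin n → ℤ :=
  fun i => (l.map fun u => if u.1 = i then u.2 else 0).sum

/-- At most `m` updates, each with `v ∈ {-M, …, M}`. -/
def UpdStream.Valid {n : ℕ} (m M : ℕ) (l : UpdStream n) : Prop :=
  l.length ≤ m ∧ ∀ u ∈ l, |u.2| ≤ (M : ℤ)

/-- The frequency moment `F_p(x) = ∑ i, |x i| ^ p`. -/
noncomputable def moment {n : ℕ} (p : ℝ) (x : Fin n → ℤ) : ℝ :=
  ∑ i, |(x i : ℝ)| ^ p

/-- `i` is a `φ`-heavy hitter of `x` with respect to `F_p`. -/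
def IsHeavy {n : ℕ} (p φ : ℝ) (x : Fin n → ℤ) (i : Fin n) : Prop :=
  φ * moment p x ≤ |(x i : ℝ)| ^ p

/-! ## Black-box estimators -/

/-- A randomized streaming algorithm for vectors of dimension `n` on a machine with `w`-bit words.
Its state consists of `words` machine words; all its randomness that is used again later is part
of the state. Its answer to a query is a fraction of two words, and a query leaves the state
unchanged. An update takes time `updTime`, a query takes time `repTime`. -/
structure Estimator (w n : ℕ) where
  words : ℕ
  updTime : ℕ
  repTime : ℕ
  words_pos : 0 < words
  updTime_pos : 0 < updTime
  repTime_pos : 0 < repTime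
  init : PMF (Fin words → BitVec w)
  update : Fin n → ℤ → (Fin words → BitVec w) → PMF (Fin words → BitVec w)
  report : (Fin words → BitVec w) → PMF (BitVec w × BitVec w)

namespace Estimator

variable {w n : ℕ}

abbrev St (E : Estimator w n) : Type := Fin E.words → BitVec w

/-- Space in bits. -/
def bits (E : Estimator w n) : ℕ := E.words * w

/-- The law of the state after processing a stream from a given state. -/
noncomputable def feed (E : Estimator w n) : UpdStream n → E.St → PMF E.St
  | [], s => PMF.pure s
  | u :: l, s => (E.update u.1 u.2 s).bind (E.feed l)

/-- The law of the answer to a query after a stream. -/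
noncomputable def answer (E : Estimator w n) (l : UpdStream n) : PMF (BitVec w × BitVec w) :=
  (E.init.bind (E.feed l)).bind E.report

/-- `E` is an `F_p`-estimation algorithm `F_pEst(ε, δ)` for streams of at most `m` updates from
`[n] × {-M, …, M}`: for every such stream, with probability at least `1 - δ`, its answer lies
in `[(1 - ε) F_p, (1 + ε) F_p]`. -/
def Estimates (E : Estimator w n) (p : ℝ) (m M : ℕ) (ε δ : ℝ) : Prop :=
  ∀ l : UpdStream n, l.Valid m M →
    ENNReal.ofReal (1 - δ) ≤ (E.answer l).toOuterMeasure
      {a | a.2 ≠ 0 ∧ ((a.1.toNat : ℝ) / (a.2.toNat : ℝ)) ∈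
        Set.Icc ((1 - ε) * moment p l.vec) ((1 + ε) * moment p l.vec)}

end Estimator

/-! ## The word RAM -/

/-- Constant-time operations on machine words. -/
inductive WordOp where
  | add | sub | mul | mulhi | div | mod | and | or | xor | shl | shr | lt | eq

/-- Arithmetic is modulo `2 ^ w` on unsigned words; `mulhi` is the high word of a product; the
comparisons yield `1` or `0`. -/
def WordOp.eval {w : ℕ} : WordOp → BitVec w → BitVec w → BitVec w
  | add, x, y => x + y
  | sub, x, y => x - y
  | mul, x, y => x * y
  | mulhi, x, y => BitVec.ofNat w (x.toNat * y.toNat / 2 ^ w)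
  | div, x, y => x / y
  | mod, x, y => x % y
  | and, x, y => x &&& y
  | or, x, y => x ||| y
  | xor, x, y => x ^^^ y
  | shl, x, y => x <<< y
  | shr, x, y => x >>> y
  | lt, x, y => if x.toNat < y.toNat then 1 else 0
  | eq, x, y => if x = y then 1 else 0

/-- Programs. The numbers `a b c` are addresses of memory cells. The black box comes in two kinds,
named by a `Bool`. -/
inductive Prog where
  /-- `mem[a] := v` -/
  | const (a v : ℕ)
  /-- `mem[a] := mem[b] o mem[c]` -/
  | op (o : WordOp) (a b c : ℕ)
  /-- `mem[a] := mem[mem[b]]` -/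
  | load (a b : ℕ)
  /-- `mem[mem[a]] := mem[b]` -/
  | store (a b : ℕ)
  /-- `mem[a] :=` a uniformly random word -/
  | rand (a : ℕ)
  /-- create instance number `mem[a]` of the black box of kind `k` (only during set-up) -/
  | boxNew (k : Bool) (a : ℕ)
  /-- feed the update `(mem[b], mem[c])`, with `mem[c]` read as a signed number, to instance
  number `mem[a]` of kind `k` -/
  | boxUpdate (k : Bool) (a b c : ℕ)
  /-- query instance number `mem[a]` of kind `k`; the answer is written to `mem[b]`, `mem[c]` -/
  | boxReport (k : Bool) (a b c : ℕ)
  | seq (P Q : Prog)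
  /-- if `mem[a] ≠ 0` then `P` else `Q` -/
  | ite (a : ℕ) (P Q : Prog)
  /-- while `mem[a] ≠ 0` do `P` -/
  | whileNZ (a : ℕ) (P : Prog)

/-- A configuration of the machine, for black boxes `box k` of the two kinds. -/
structure Conf {w n : ℕ} (box : Bool → Estimator w n) where
  /-- the memory, of which the cells below `top` are counted as used -/
  mem : ℕ → BitVec w
  top : ℕ
  /-- the existing instances of the black boxes, with their states -/
  inst : (k : Bool) → ℕ → Option (box k).St
  /-- the instance numbers below `slots k` are counted as used -/
  slots : Bool → ℕ
  /-- time used since the clock was last reset -/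
  time : ℕ
  /-- whether instances may still be created -/
  setup : Bool
  /-- becomes and stays `false` after an illegal instruction or an unfinished loop -/
  ok : Bool

namespace Conf

variable {w n : ℕ} {box : Bool → Estimator w n}

def tick (t : ℕ) (s : Conf box) : Conf box := { s with time := s.time + t }

def fault (s : Conf box) : Conf box := { s with ok := false }

def write (a : ℕ) (v : BitVec w) (s : Conf box) : Conf box :=
  { s with mem := Function.update s.mem a v, top := max s.top (a + 1) }

/-- Set the state of instance number `j` of kind `k`. -/
def setInst (k : Bool) (j : ℕ) (σ : (box k).St) (s : Conf box) : Conf box :=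
  { s with
    inst := Function.update s.inst k (Function.update (s.inst k) j (some σ))
    slots := Function.update s.slots k (max (s.slots k) (j + 1)) }

/-- Space in bits: the memory cells used and the states of the instances of the black boxes. -/
def space (s : Conf box) : ℕ :=
  s.top * w + s.slots false * (box false).bits + s.slots true * (box true).bits

/-- The machine at the start: all memory cells are `0`, and there are no instances. -/
def empty (box : Bool → Estimator w n) : Conf box where
  mem := fun _ => 0
  top := 0
  inst := fun _ _ => none
  slots := fun _ => 0
  time := 0
  setup := true
  ok := true

/-- Reset the clock. -/
def resetTime (s : Conf box) : Conf box := { s with time := 0 }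

/-- End the set-up phase and reset the clock. -/
def endSetup (s : Conf box) : Conf box := { s with setup := false, time := 0 }

end Conf

namespace Prog

variable {w n : ℕ} {box : Bool → Estimator w n}

/-- A uniformly random machine word. -/
noncomputable def randWord (w : ℕ) : PMF (BitVec w) :=
  (PMF.uniformOfFintype (Fin (2 ^ w))).map BitVec.ofFin

/-- `while mem[a] ≠ 0 do body`, cut off with a fault when not finished after `fuel` tests. -/
noncomputable def loop (body : Conf box → PMF (Conf box)) (a : ℕ) :
    ℕ → Conf box → PMF (Conf box)
  | 0, s => PMF.pure s.fault
  | fuel + 1, s =>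
      if s.mem a = 0 then PMF.pure (s.tick 1)
      else (body (s.tick 1)).bind (loop body a fuel)

/-- The law of the configuration after running a program. Every instruction and every test takes
one unit of time, except that an update or a query of a black box takes that box's time. The
number `fuel` bounds the iterations of each loop; a run without a fault does not depend on it. -/
noncomputable def exec (fuel : ℕ) : Prog → Conf box → PMF (Conf box)
  | const a v, s => PMF.pure ((s.tick 1).write a (BitVec.ofNat w v))
  | op o a b c, s => PMF.pure ((s.tick 1).write a (o.eval (s.mem b) (s.mem c)))
  | load a b, s => PMF.pure ((s.tick 1).write a (s.mem (s.mem b).toNat))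
  | store a b, s => PMF.pure ((s.tick 1).write (s.mem a).toNat (s.mem b))
  | rand a, s => (randWord w).map fun v => (s.tick 1).write a v
  | boxNew k a, s =>
      if s.setup = true then
        (box k).init.map fun σ => (s.tick 1).setInst k (s.mem a).toNat σ
      else PMF.pure (s.tick 1).fault
  | boxUpdate k a b c, s =>
      match s.inst k (s.mem a).toNat with
      | none => PMF.pure (s.tick 1).fault
      | some σ =>
          if h : (s.mem b).toNat < n then
            ((box k).update ⟨(s.mem b).toNat, h⟩ (s.mem c).toInt σ).map fun σ' =>
              (s.tick (box k).updTime).setInst k (s.mem a).toNat σ'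
          else PMF.pure (s.tick 1).fault
  | boxReport k a b c, s =>
      match s.inst k (s.mem a).toNat with
      | none => PMF.pure (s.tick 1).fault
      | some σ =>
          ((box k).report σ).map fun r => ((s.tick (box k).repTime).write b r.1).write c r.2
  | seq P Q, s => (exec fuel P s).bind (exec fuel Q)
  | ite a P Q, s => if s.mem a = 0 then exec fuel Q (s.tick 1) else exec fuel P (s.tick 1)
  | whileNZ a P, s => loop (exec fuel P) a fuel s

end Prog

/-! ## Heavy hitter algorithms -/

/-- A streaming algorithm on the word RAM: programs for the set-up, for processing an update and
for reporting. -/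
structure StreamProg where
  setup : Prog
  update : Prog
  report : Prog

/-- The integer parameters that the machine is given: `n`, `m`, `M`, and the parameters `φ` and `δ`
rounded, `φ` in the form `⌊1024 / φ⌋` (a constant relative precision) and `δ` in the form
`⌈log₂ (1 / δ)⌉` (`δ` rounded down to a power of `2`). -/
noncomputable def hhInput (n m M : ℕ) (φ δ : ℝ) : Fin 5 → ℕ :=
  ![n, m, M, ⌊1024 / φ⌋₊, ⌈Real.logb 2 (1 / δ)⌉₊]

/-- An entry of the output list: an index, its sign, and the estimate of its absolute value. -/
structure HHEntry where
  index : ℕ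
  sign : ℤ
  est : ℕ

/-- The output after reporting: `mem[0]` is the length of the list, `mem[1]` the address of its
first entry, and every entry occupies three words. -/
def Conf.output {w n : ℕ} {box : Bool → Estimator w n} (s : Conf box) : List HHEntry :=
  (List.range (s.mem 0).toNat).map fun j =>
    { index := (s.mem ((s.mem 1).toNat + 3 * j)).toNat
      sign := (s.mem ((s.mem 1).toNat + 3 * j + 1)).toInt
      est := (s.mem ((s.mem 1).toNat + 3 * j + 2)).toNat }

/-- `L` is a correct output for the vector `x`: a list of distinct indices which contains all
`φ`-heavy hitters and only `φ/2`-heavy hitters, with correct signs, and with estimates whose `p`-th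
power is in `[(6/7) |x i| ^ p, (9/7) |x i| ^ p]`. -/
def CorrectHH {n : ℕ} (p φ : ℝ) (x : Fin n → ℤ) (L : List HHEntry) : Prop :=
  (L.map HHEntry.index).Nodup ∧
  (∀ i : Fin n, IsHeavy p φ x i → (i : ℕ) ∈ L.map HHEntry.index) ∧
  ∀ e ∈ L, ∃ i : Fin n, e.index = i ∧ IsHeavy p (φ / 2) x i ∧ e.sign = (x i).sign ∧
    (e.est : ℝ) ^ p ∈ Set.Icc (6 / 7 * |(x i : ℝ)| ^ p) (9 / 7 * |(x i : ℝ)| ^ p)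

namespace StreamProg

variable {w n : ℕ}

/-- The law of the configuration after the set-up with the given input in the first five cells. -/
noncomputable def start (A : StreamProg) (box : Bool → Estimator w n) (fuel : ℕ)
    (input : Fin 5 → ℕ) : PMF (Conf box) :=
  (A.setup.exec fuel
    (((((Conf.empty box).write 0 (BitVec.ofNat w (input 0))).write 1
      (BitVec.ofNat w (input 1))).write 2 (BitVec.ofNat w (input 2))).write 3
      (BitVec.ofNat w (input 3)) |>.write 4 (BitVec.ofNat w (input 4)))).map Conf.endSetup

/-- Process updates one by one. For the update `(i, v)`, the clock is reset, the words `i` and `v`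
are put into cells `0` and `1`, and the update program is run. -/
noncomputable def feed (A : StreamProg) {box : Bool → Estimator w n} (fuel : ℕ) :
    UpdStream n → Conf box → PMF (Conf box)
  | [], s => PMF.pure s
  | u :: l, s =>
      (A.update.exec fuel
        ((s.resetTime.write 0 (BitVec.ofNat w u.1)).write 1 (BitVec.ofInt w u.2))).bind
        (A.feed fuel l)

/-- The law of the configuration after a stream; its clock shows the time of the last update. -/
noncomputable def process (A : StreamProg) (box : Bool → Estimator w n) (fuel : ℕ)
    (input : Fin 5 → ℕ) (l : UpdStream n) : PMF (Conf box) :=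
  (A.start box fuel input).bind (A.feed fuel l)

/-- The law of the configuration after a stream and a report; its clock shows the time of the
report. -/
noncomputable def answer (A : StreamProg) (box : Bool → Estimator w n) (fuel : ℕ)
    (input : Fin 5 → ℕ) (l : UpdStream n) : PMF (Conf box) :=
  (A.process box fuel input l).bind fun s => A.report.exec fuel s.resetTime

/-- `A`, with the black boxes `box`, finds heavy hitters for the parameters `φ` and `δ` in streams
of at most `m` updates from `[n] × {-M, …, M}`, with at most `S` bits of space, update time at most
`U` and reporting time at most `R`.

The bounds on space and time hold for every outcome of the randomness. For every stream with a
nonzero final vector, the output is correct with probability at least `1 - δ`. -/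
def FindsHeavyHitters (A : StreamProg) (box : Bool → Estimator w n) (p φ δ : ℝ) (m M : ℕ)
    (S U R : ℝ) : Prop :=
  ∃ fuel : ℕ, ∀ l : UpdStream n, l.Valid m M →
    (∀ s ∈ (A.process box fuel (hhInput n m M φ δ) l).support,
      s.ok = true ∧ (s.space : ℝ) ≤ S ∧ (s.time : ℝ) ≤ U) ∧
    (∀ s ∈ (A.answer box fuel (hhInput n m M φ δ) l).support,
      s.ok = true ∧ (s.space : ℝ) ≤ S ∧ (s.time : ℝ) ≤ R) ∧
    (l.vec ≠ 0 →
      ENNReal.ofReal (1 - δ) ≤ (A.answer box fuel (hhInput n m M φ δ) l).toOuterMeasure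
        {s | CorrectHH p φ l.vec s.output})

end StreamProg

/-- The failure probability `δ' = φ δ / (12 (log₂ (φ n) + 1))` of the black box. -/
noncomputable def hhDelta (n : ℕ) (φ δ : ℝ) : ℝ :=
  φ * δ / (12 * (Real.logb 2 (φ * n) + 1))

/-!
The witness is one fixed program for the word RAM, and the proof compares it with an abstract
random process.

**The algorithm.** The indices are the leaves of a binary tree: the node of `i` at level `s` is
`i / 2 ^ s`, and at the top level `L = O(log (φ n))` at most `q = ⌊1024 / φ⌋` nodes are left. Each
level has `R = O(log (1 / δ'))` rows. A row holds two random affine functions on machine words.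
The top bits of the first one hash the nodes of the level into `B = O(1 / φ)` buckets, and the top
bit of the second one gives a random sign to every index. Every bucket has an instance of the black
box with failure probability `1/5` for the part of the stream that it receives, and a counter for
the signed sum of the coordinates. A single instance of the black box with failure probability `δ'`
estimates `F = ‖x‖_p^p`. The report descends in the tree: a child of a node in the current list is
kept when most rows of its level estimate its bucket above about `0.74 φ F`. Each leaf that is
reached is reported with the majority of the signs of its counters at level `0`, and with a value
near most of their absolute values.

**Why the descent succeeds.** Multiplication by a random word, followed by the addition of another
one, makes the top bits of two nodes collide with probability exactly `1 / B`, since the difference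
of the nodes has a multiple that is the right power of two. Hence, with probability `39/40`, the
bucket of a node contains less than `φ F / 20` from other nodes (`expect_noise_gt_le`). When the
bucket is so clean and its black box succeeds, the row answers correctly for nodes of mass at least
`φ F` and for those of mass less than `φ F / 2` (`separates`). A wrong majority has at least `R / 2`
bad rows, so its probability is at most the expectation of a product over the rows whose factors are
`1/2` for good rows and `2` for bad ones (`expect_majority_le`). The rows are independent
(`expect_stateLaw_prod`, `expect_hashLaw_prod`), and the expectation of a factor is at most `83/100`
(`expect_row_le`). The nodes to be tested depend on earlier random answers, but as long as no test
has failed they are children of nodes of mass at least `φ F / 2`. At most `2 / φ ≤ q` nodes of a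
level are that heavy, and which ones they are is not random. So a union bound over these children
suffices (`expect_levels_le`).

**Signs and estimates.** The second moment of the signed sum of the other coordinates in a bucket is
the sum of their squares (`sum_signed_sq`). As `p ≤ 2`, that sum is small compared with `x i ^ 2`
when the sum of the `p`-th powers is small compared with `|x i| ^ p`. So most rows know the sign of
`x i`, and its absolute value up to a factor `1 ± 1/128` (`expect_not_goodRow_le`). Instead
of a median, whose computation in linear time is awkward, the program runs the majority vote of
Boyer and Moore on the cells of a geometric grid. The points of subdivision of a second grid lie so
far from those of the first one that a short interval is contained in a single cell of at
least one of the grids (`grid_separated`). A value in a cell with a strict majority is within a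
factor `17/16 · 129/128` of `|x i|` (`estimate_near`), and the second power of that factor is less
than `9/7`.

**From the program to the process.** `PMF.Refines` says that a law can be matched, outcome by
outcome, with another one along a relation. It is compatible with sequencing, so every piece of code
is treated on its own, by a loop invariant that relates the memory to the state of the process. Such
a matching transfers the bounds for probabilities, and those for the space and the time, which hold
for every outcome (`refines_process`, `refines_answer`).

**Costs.** The buckets use only the cheap black box, and there are `L R B` of them. This is
`O(φ⁻¹ log (φ n) log (1 / δ'))`, so both hypotheses on the costs bound the total by the claimed
amount: the first one says that `log (1 / δ')` times a cost of the cheap black box is paid for by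
the same cost of the expensive one.
-/

/-! ### Expectations and probabilistic refinement -/

open scoped ENNReal

namespace PMF

variable {α β γ δ : Type}

/-- The expectation of a function with values in `[0, ∞]`. -/
noncomputable def expect (μ : PMF α) (f : α → ℝ≥0∞) : ℝ≥0∞ := ∑' a, μ a * f a

theorem expect_pure (a : α) (f : α → ℝ≥0∞) : (PMF.pure a).expect f = f a := by
  classical
  unfold expect
  rw [tsum_eq_single a]
  · simp
  · intro b hb
    simp [PMF.pure_apply, hb]

theorem expect_bind (μ : PMF α) (k : α → PMF β) (f : β → ℝ≥0∞) :
    (μ.bind k).expect f = μ.expect fun a => (k a).expect f := by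
  unfold expect
  simp only [PMF.bind_apply, ← ENNReal.tsum_mul_right, ← ENNReal.tsum_mul_left]
  rw [ENNReal.tsum_comm]
  simp only [mul_assoc]

theorem expect_map (μ : PMF α) (k : α → β) (f : β → ℝ≥0∞) :
    (μ.map k).expect f = μ.expect fun a => f (k a) := by
  rw [PMF.map, expect_bind]
  simp [expect_pure]

theorem expect_mono (μ : PMF α) {f g : α → ℝ≥0∞} (h : ∀ a, f a ≤ g a) :
    μ.expect f ≤ μ.expect g :=
  ENNReal.tsum_le_tsum fun a => mul_le_mul_right (h a) _

theorem expect_const (μ : PMF α) (c : ℝ≥0∞) : (μ.expect fun _ => c) = c := by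
  unfold expect
  rw [ENNReal.tsum_mul_right, μ.tsum_coe, one_mul]

theorem expect_add (μ : PMF α) (f g : α → ℝ≥0∞) :
    (μ.expect fun a => f a + g a) = μ.expect f + μ.expect g := by
  unfold expect
  simp only [mul_add, ENNReal.tsum_add]

theorem expect_mul_left (μ : PMF α) (c : ℝ≥0∞) (f : α → ℝ≥0∞) :
    (μ.expect fun a => c * f a) = c * μ.expect f := by
  unfold expect
  simp only [← mul_assoc, mul_comm _ c]
  simp only [mul_assoc, ENNReal.tsum_mul_left]

theorem expect_mul_right (μ : PMF α) (c : ℝ≥0∞) (f : α → ℝ≥0∞) :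
    (μ.expect fun a => f a * c) = μ.expect f * c := by
  simp only [mul_comm _ c, expect_mul_left]

theorem expect_sum {ι : Type*} (μ : PMF α) (s : Finset ι) (f : ι → α → ℝ≥0∞) :
    (μ.expect fun a => ∑ i ∈ s, f i a) = ∑ i ∈ s, μ.expect (f i) := by
  classical
  induction s using Finset.induction_on with
  | empty => simp [expect_const]
  | insert i s hi ih => simp [Finset.sum_insert hi, expect_add, ih]

theorem expect_indicator (μ : PMF α) (s : Set α) [DecidablePred (· ∈ s)] :
    (μ.expect fun a => if a ∈ s then 1 else 0) = μ.toOuterMeasure s := by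
  classical
  rw [PMF.toOuterMeasure_apply]
  unfold expect
  refine tsum_congr fun a => ?_
  by_cases h : a ∈ s <;> simp [h]

/-- A lower bound on the probability of an event from an upper bound on the expected indicator of
its failure. -/
theorem le_toOuterMeasure_of_expect_le (μ : PMF α) (s : Set α) (ε : ℝ≥0∞)
    (f : α → ℝ≥0∞) (hf : ∀ a, a ∉ s → 1 ≤ f a) (h : μ.expect f ≤ ε) :
    1 - ε ≤ μ.toOuterMeasure s := by
  classical
  rw [← expect_indicator, tsub_le_iff_right]
  calc (1 : ℝ≥0∞) = μ.expect fun _ => 1 := (expect_const μ 1).symm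
    _ ≤ μ.expect fun a => (if a ∈ s then 1 else 0) + f a := by
        refine expect_mono μ fun a => ?_
        by_cases ha : a ∈ s
        · simp [ha]
        · simpa [ha] using hf a ha
    _ ≤ _ := by
        rw [expect_add]
        gcongr

theorem expect_compl_le (μ : PMF α) (s : Set α) [DecidablePred (· ∈ s)] (ε : ℝ)
    (h : ENNReal.ofReal (1 - ε) ≤ μ.toOuterMeasure s) :
    (μ.expect fun a => if a ∈ s then 0 else 1) ≤ ENNReal.ofReal ε := by
  classical
  have h1 : (μ.expect fun a => if a ∈ s then 0 else 1) + μ.toOuterMeasure s = 1 := by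
    rw [← expect_indicator, ← expect_add]
    refine Eq.trans (congrArg μ.expect (funext fun a => ?_)) (expect_const μ 1)
    by_cases ha : a ∈ s <;> simp [ha]
  have h2 : (1 : ℝ≥0∞) ≤ ENNReal.ofReal ε + μ.toOuterMeasure s := by
    calc (1 : ℝ≥0∞) = ENNReal.ofReal (ε + (1 - ε)) := by simp
      _ ≤ ENNReal.ofReal ε + ENNReal.ofReal (1 - ε) := ENNReal.ofReal_add_le
      _ ≤ _ := by gcongr
  have h3 : μ.toOuterMeasure s ≠ ∞ := by
    intro h4
    rw [h4] at h1
    simp at h1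
  rw [← h1] at h2
  exact (ENNReal.add_le_add_iff_right h3).1 h2

/-- `μ` refines `ν` along the relation `r`: every expectation bound for `ν` transfers to `μ`. This
says that outcomes of `μ` can be matched with related outcomes of `ν` of the same probability. -/
def Refines (μ : PMF α) (ν : PMF β) (r : α → β → Prop) : Prop :=
  ∀ g : β → ℝ≥0∞, (μ.expect fun a => ⨅ b, ⨅ _ : r a b, g b) ≤ ν.expect g

namespace Refines

variable {μ : PMF α} {ν : PMF β} {r : α → β → Prop}

theorem pure {a : α} {b : β} (h : r a b) : Refines (PMF.pure a) (PMF.pure b) r := by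
  intro g
  rw [expect_pure, expect_pure]
  exact iInf₂_le b h

theorem bind {μ' : α → PMF γ} {ν' : β → PMF δ} {r' : γ → δ → Prop} (h : Refines μ ν r)
    (h' : ∀ a b, r a b → Refines (μ' a) (ν' b) r') :
    Refines (μ.bind μ') (ν.bind ν') r' := by
  intro g
  rw [expect_bind, expect_bind]
  refine le_trans (expect_mono μ fun a => ?_) (h _)
  exact le_iInf₂ fun b hb => h' a b hb g

theorem refl (μ : PMF α) : Refines μ μ Eq := fun _ =>
  expect_mono μ fun a => iInf₂_le a rfl

theorem map_map (κ : PMF δ) {F : δ → α} {G : δ → β} (h : ∀ d, r (F d) (G d)) :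
    Refines (κ.map F) (κ.map G) r := by
  intro g
  rw [expect_map, expect_map]
  exact expect_mono κ fun d => iInf₂_le _ (h d)

theorem map_left {F : α → γ} {r' : γ → β → Prop} (h : Refines μ ν r)
    (h' : ∀ a b, r a b → r' (F a) b) : Refines (μ.map F) ν r' := by
  intro g
  rw [expect_map]
  exact le_trans (expect_mono μ fun _ => le_iInf₂ fun b hb => iInf₂_le b (h' _ b hb)) (h g)

theorem map_right {G : β → γ} {r' : α → γ → Prop} (h : Refines μ ν r)
    (h' : ∀ a b, r a b → r' a (G b)) : Refines μ (ν.map G) r' := by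
  intro g
  rw [expect_map]
  exact le_trans (expect_mono μ fun _ => le_iInf₂ fun b hb => iInf₂_le _ (h' _ b hb)) (h _)

theorem exists_of_mem_support (h : Refines μ ν r) {a : α} (ha : a ∈ μ.support) :
    ∃ b, r a b := by
  by_contra hc
  push Not at hc
  have h1 := h fun _ => 0
  rw [expect_const] at h1
  have h2 : μ a * (⨅ b, ⨅ _ : r a b, (0 : ℝ≥0∞)) = 0 :=
    ENNReal.tsum_eq_zero.1 (le_antisymm h1 zero_le) a
  simp only [hc, iInf_false, iInf_top, mul_eq_zero] at h2
  rcases h2 with h2 | h2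
  · exact (PMF.mem_support_iff _ _).1 ha h2
  · simp at h2

end Refines

variable {β : Type}

/-- Countdown iteration: the steps with the numbers `k - 1, …, 0`, in this order. -/
noncomputable def iter (step : ℕ → β → PMF β) : ℕ → β → PMF β
  | 0, b => PMF.pure b
  | k + 1, b => (step k b).bind (iter step k)

end PMF

/-! ### Straight-line code and loops of the word RAM -/

open scoped ENNReal

/-- Instructions without control flow that write a fixed cell. -/
inductive Instr where
  | const (a v : ℕ)
  | op (o : WordOp) (a b c : ℕ)
  | load (a b : ℕ)

namespace Instr

variable {w : ℕ}

/-- An instruction as a program. -/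
def toProg : Instr → Prog
  | const a v => .const a v
  | op o a b c => .op o a b c
  | load a b => .load a b

/-- The cell that the instruction writes. -/
def dest : Instr → ℕ
  | const a _ => a
  | op _ a _ _ => a
  | load a _ => a

/-- The effect on the memory. -/
def run (m : ℕ → BitVec w) : Instr → ℕ → BitVec w
  | const a v => Function.update m a (BitVec.ofNat w v)
  | op o a b c => Function.update m a (o.eval (m b) (m c))
  | load a b => Function.update m a (m (m b).toNat)

/-- The effect of a list of instructions on the memory. -/
def runs : List Instr → (ℕ → BitVec w) → ℕ → BitVec w
  | [], m => m
  | i :: is, m => runs is (i.run m)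

theorem runs_nil (m : ℕ → BitVec w) : runs [] m = m := rfl

theorem runs_cons (i : Instr) (is : List Instr) (m : ℕ → BitVec w) :
    runs (i :: is) m = runs is (i.run m) := rfl

theorem runs_append (is js : List Instr) (m : ℕ → BitVec w) :
    runs (is ++ js) m = runs js (runs is m) := by
  induction is generalizing m with
  | nil => rfl
  | cons i is ih => exact ih _

/-- The content of a cell after a list of instructions, in reverse order, by recursion on the
instructions that the cell depends on. -/
def back : List Instr → (ℕ → BitVec w) → ℕ → BitVec w
  | [], m, x => m x
  | const a v :: is, m, x => if x = a then BitVec.ofNat w v else back is m x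
  | op o a b c :: is, m, x => if x = a then o.eval (back is m b) (back is m c) else back is m x
  | load a b :: is, m, x => if x = a then back is m (back is m b).toNat else back is m x

@[simp] theorem back_nil (m : ℕ → BitVec w) (x : ℕ) : back [] m x = m x := rfl

@[simp] theorem back_const (a v : ℕ) (is : List Instr) (m : ℕ → BitVec w) (x : ℕ) :
    back (const a v :: is) m x = if x = a then BitVec.ofNat w v else back is m x := rfl

@[simp] theorem back_op (o : WordOp) (a b c : ℕ) (is : List Instr) (m : ℕ → BitVec w) (x : ℕ) :
    back (op o a b c :: is) m x =
      if x = a then o.eval (back is m b) (back is m c) else back is m x := rfl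

@[simp] theorem back_load (a b : ℕ) (is : List Instr) (m : ℕ → BitVec w) (x : ℕ) :
    back (load a b :: is) m x =
      if x = a then back is m (back is m b).toNat else back is m x := rfl

theorem runs_eq_back (is : List Instr) (m : ℕ → BitVec w) (x : ℕ) :
    runs is m x = back is.reverse m x := by
  have key : ∀ (is : List Instr) (x : ℕ), runs is.reverse m x = back is m x := by
    intro is
    induction is with
    | nil => intro x; rfl
    | cons i is ih =>
      intro x
      rw [List.reverse_cons, runs_append, runs_cons, runs_nil]
      cases i <;> simp [run, Function.update_apply, ih]
  rw [← key, List.reverse_reverse]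

/-- Instructions with a target among the first `64` cells leave the other cells alone. -/
theorem back_far (is : List Instr) (m : ℕ → BitVec w) (x : ℕ) (h : 64 ≤ x)
    (his : is.all fun i => decide (i.dest < 64)) : back is m x = m x := by
  induction is with
  | nil => rfl
  | cons i is ih =>
    simp only [List.all_cons, Bool.and_eq_true, decide_eq_true_eq] at his
    cases i with
    | const a v => simp only [dest] at his; rw [back_const, if_neg (by omega), ih his.2]
    | op o a b c => simp only [dest] at his; rw [back_op, if_neg (by omega), ih his.2]
    | load a b => simp only [dest] at his; rw [back_load, if_neg (by omega), ih his.2]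

theorem runs_of_forall_ne (is : List Instr) (m : ℕ → BitVec w) (a : ℕ)
    (h : ∀ i ∈ is, i.dest ≠ a) : runs is m a = m a := by
  induction is generalizing m with
  | nil => rfl
  | cons i is ih =>
    rw [runs_cons, ih _ fun j hj => h j (List.mem_cons_of_mem _ hj)]
    have := h i List.mem_cons_self
    cases i <;> exact Function.update_of_ne (Ne.symm this) _ _

end Instr

namespace Conf

variable {w n : ℕ} {box : Bool → Estimator w n}

/-- The configuration after a list of instructions. -/
def after (s : Conf box) (is : List Instr) : Conf box :=
  { s with
    mem := Instr.runs is s.mem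
    top := is.foldl (fun t i => max t (i.dest + 1)) s.top
    time := s.time + is.length }

theorem top_after_le (s : Conf box) (is : List Instr) (T : ℕ) (h : s.top ≤ T)
    (h' : ∀ i ∈ is, i.dest < T) : (s.after is).top ≤ T := by
  change is.foldl (fun t i => max t (i.dest + 1)) s.top ≤ T
  generalize s.top = t at h
  induction is generalizing t with
  | nil => exact h
  | cons i is ih =>
    refine ih (fun j hj => h' j (List.mem_cons_of_mem _ hj)) _ ?_
    exact max_le h (h' i List.mem_cons_self)

end Conf

namespace Prog

variable {w n : ℕ} {box : Bool → Estimator w n}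

/-- A list of instructions, followed by a program. -/
def blk : List Instr → Prog → Prog
  | [], P => P
  | i :: is, P => seq i.toProg (blk is P)

theorem exec_blk (fuel : ℕ) (is : List Instr) (P : Prog) (s : Conf box) :
    exec fuel (blk is P) s = exec fuel P (s.after is) := by
  induction is generalizing s with
  | nil => rfl
  | cons i is ih =>
    have h : exec fuel i.toProg s = PMF.pure (s.after [i]) := by
      cases i <;> rfl
    rw [blk, exec, h, PMF.pure_bind, ih]
    congr 1
    simp only [Conf.after, Instr.runs, List.foldl_cons, List.foldl_nil, List.length_cons,
      List.length_nil]
    congr 1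
    omega

theorem exec_op (fuel : ℕ) (o : WordOp) (a b c : ℕ) (s : Conf box) :
    exec fuel (op o a b c) s = PMF.pure (s.after [.op o a b c]) := rfl

theorem exec_seq (fuel : ℕ) (P Q : Prog) (s : Conf box) :
    exec fuel (seq P Q) s = (exec fuel P s).bind (exec fuel Q) := by
  rw [exec]

theorem exec_store (fuel a b : ℕ) (s : Conf box) :
    exec fuel (store a b) s = PMF.pure ((s.tick 1).write (s.mem a).toNat (s.mem b)) := by
  rw [exec]

/-- A countdown loop refines an iteration when its body refines the steps. -/
theorem refines_whileNZ {β : Type} {fuel g : ℕ} {body : Prog} {step : ℕ → β → PMF β}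
    {I : ℕ → Conf box → β → Prop} {N : ℕ}
    (hI : ∀ k s b, I k s b → s.mem g = BitVec.ofNat w k)
    (hstep : ∀ k < N, ∀ s b, I (k + 1) s b →
      (exec fuel body (s.tick 1)).Refines (step k b) (I k))
    (hw : N < 2 ^ w) (hfuel : N < fuel) {s : Conf box} {b : β} (h : I N s b) :
    (exec fuel (whileNZ g body) s).Refines (PMF.iter step N b)
      fun s' b' => ∃ s'', I 0 s'' b' ∧ s' = s''.tick 1 := by
  have key : ∀ (k f : ℕ) (s : Conf box) (b : β), k ≤ N → k < f → I k s b →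
      (loop (exec fuel body) g f s).Refines (PMF.iter step k b)
        fun s' b' => ∃ s'', I 0 s'' b' ∧ s' = s''.tick 1 := by
    intro k
    induction k with
    | zero =>
      intro f s b _ hf hs
      obtain ⟨f, rfl⟩ : ∃ f', f = f' + 1 := ⟨f - 1, by omega⟩
      rw [loop, if_pos (show s.mem g = 0 from hI 0 s b hs), PMF.iter]
      exact PMF.Refines.pure ⟨s, hs, rfl⟩
    | succ k ih =>
      intro f s b hk hf hs
      obtain ⟨f, rfl⟩ : ∃ f', f = f' + 1 := ⟨f - 1, by omega⟩
      have hne : s.mem g ≠ 0 := by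
        rw [hI _ s b hs]
        intro h0
        have h1 := congrArg BitVec.toNat h0
        simp only [BitVec.toNat_ofNat, BitVec.ofNat_eq_ofNat] at h1
        rw [Nat.mod_eq_of_lt (by omega), Nat.zero_mod] at h1
        omega
      rw [loop, if_neg hne, PMF.iter]
      exact (hstep k hk s b hs).bind fun s' b' h' => ih f s' b' (by omega) (by omega) h'
  rw [exec]
  exact key N fuel s b le_rfl hfuel h

/-- A loop with a deterministic body; `k` is the number of iterations that remain. -/
theorem exec_whileNZ_of_iff {fuel g : ℕ} {body : Prog} {I : ℕ → Conf box → Prop} {N : ℕ}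
    (hI : ∀ k ≤ N, ∀ s, I k s → (s.mem g = 0 ↔ k = 0))
    (hstep : ∀ k < N, ∀ s, I (k + 1) s → ∃ s', exec fuel body (s.tick 1) = PMF.pure s' ∧ I k s')
    (hfuel : N < fuel) {s : Conf box} (h : I N s) :
    ∃ s', exec fuel (whileNZ g body) s = PMF.pure (s'.tick 1) ∧ I 0 s' := by
  have key : ∀ (k f : ℕ) (s : Conf box), k ≤ N → k < f → I k s →
      ∃ s', loop (exec fuel body) g f s = PMF.pure (s'.tick 1) ∧ I 0 s' := by
    intro k
    induction k with
    | zero =>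
      intro f s hk hf hs
      obtain ⟨f, rfl⟩ : ∃ f', f = f' + 1 := ⟨f - 1, by omega⟩
      rw [loop, if_pos ((hI 0 hk s hs).2 rfl)]
      exact ⟨s, rfl, hs⟩
    | succ k ih =>
      intro f s hk hf hs
      obtain ⟨f, rfl⟩ : ∃ f', f = f' + 1 := ⟨f - 1, by omega⟩
      have hne : ¬ s.mem g = 0 := fun h0 => absurd ((hI _ hk s hs).1 h0) (Nat.succ_ne_zero k)
      obtain ⟨s', h1, h2⟩ := hstep k hk s hs
      rw [loop, if_neg hne, h1, PMF.pure_bind]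
      exact ih f s' (by omega) (by omega) h2
  rw [exec]
  exact key N fuel s le_rfl hfuel h

theorem ofNat_eq_zero_iff {k : ℕ} (h : k < 2 ^ w) : BitVec.ofNat w k = 0 ↔ k = 0 := by
  rw [← BitVec.toNat_inj, BitVec.toNat_ofNat, Nat.mod_eq_of_lt h]
  simp

/-- A countdown loop with a deterministic body. -/
theorem exec_whileNZ {fuel g : ℕ} {body : Prog} {I : ℕ → Conf box → Prop} {N : ℕ}
    (hI : ∀ k s, I k s → s.mem g = BitVec.ofNat w k)
    (hstep : ∀ k < N, ∀ s, I (k + 1) s → ∃ s', exec fuel body (s.tick 1) = PMF.pure s' ∧ I k s')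
    (hw : N < 2 ^ w) (hfuel : N < fuel) {s : Conf box} (h : I N s) :
    ∃ s', exec fuel (whileNZ g body) s = PMF.pure (s'.tick 1) ∧ I 0 s' :=
  exec_whileNZ_of_iff (fun k hk s hs => by rw [hI k s hs, ofNat_eq_zero_iff (hk.trans_lt hw)])
    hstep hfuel h

end Prog

/-! ### The program -/

namespace HeavyHitters

open Instr WordOp

/-- From a row number in cell `20` and the number of a node in cell `21`, compute the address of
the row in cell `22`, the bucket of the node in cell `24` and the number of the instance of the
black box in cell `27`. -/
def bucketCode : List Instr :=
  [op mul 22 20 13, const 23 64, op add 22 22 23, load 24 22, op add 23 22 5, load 25 23,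
    op mul 24 24 21, op add 24 24 25, op shr 24 24 11, op mul 27 20 10, op add 27 27 24]

/-- From the results of `bucketCode` and an index in cell `29`, compute the random sign of the
index in cell `28`, the address of the counter in cell `25` and the counter in cell `30`. -/
def counterCode : List Instr :=
  [op add 25 23 5, load 28 25, op add 25 25 5, load 30 25, op mul 28 28 29, op add 28 28 30,
    op shr 28 28 12, op add 28 28 28, op sub 28 5 28, op add 25 25 5, op add 25 25 24, load 30 25]

/-- The fraction of the words in the cells `30` and `31`, as a fixed point number with `12` binary
places in cell `32`. -/
def fixedPointCode : List Instr :=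
  [const 33 24, op shr 34 31 33, op eq 34 34 16, const 33 12, op shl 32 30 33, op div 32 32 31,
    op mul 32 32 34, op shr 33 31 33, op div 33 30 33, op sub 34 5 34, op mul 33 33 34,
    op add 32 32 33]

/-- The absolute value (cell `30`) and the sign bit (cell `31`) of the estimate which row number
`mem[20]` yields for the index in the cells `21` and `29`. -/
def rowValueCode : List Instr :=
  bucketCode ++ (counterCode ++ [op mul 30 30 28, op shr 31 30 12, op add 32 31 31, op sub 32 5 32,
    op mul 30 30 32])

/-- Add `1` to cell `33` unless the multiples of the cells `30` and `c` by `k` have the same number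
of binary digits. -/
def gridStep (c k : ℕ) : List Instr :=
  [const 34 k, op mul 35 34 30, op mul 34 34 c, op and 36 34 35, op xor 34 34 35, op lt 34 36 34,
    op add 33 33 34]

/-- Whether the cells `30` and `c` hold numbers in the same cell of a geometric grid. -/
def sameCellCode (ks : List ℕ) (c : ℕ) : List Instr :=
  const 33 0 :: (ks.flatMap (gridStep c) ++ [op eq 33 33 16])

/-- The multipliers of the first geometric grid. -/
def gridA : List ℕ := (List.range 16).map fun j => 32 + 2 * j

/-- The multipliers of the second geometric grid. -/
def gridB : List ℕ := (List.range 16).map fun j => 33 + 2 * j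

/-- The number of binary digits of cell `a`, in cell `d`. -/
def sizeProg (a d : ℕ) : Prog :=
  .blk [const d 0] (.whileNZ a (.blk [op shr a a 5] (.op add d d 5)))

/-- Draw the random words of row number `mem[53] - 1`. -/
def drawProg : Prog :=
  .blk [op sub 53 53 5, op mul 22 53 13, const 23 64, op add 22 22 23] <|
  .seq (.rand 23) <| .seq (.store 22 23) <| .blk [op add 22 22 5] <|
  .seq (.rand 23) <| .seq (.store 22 23) <| .blk [op add 22 22 5] <|
  .seq (.rand 23) <| .seq (.store 22 23) <| .blk [op add 22 22 5] <|
  .seq (.rand 23) (.store 22 23)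

/-- The computation of the parameters. The cells `5`, …, `18` receive `1`, the number `q`, the
number `R` of rows per level, the number `L` of levels, `L * R`, the number `B = 2 ^ l` of buckets
per row, `w - l`, `w - 1`, the length `B + 4` of a row in memory, the address of the lists of
nodes, the address of the output, `0`, `50 * q`, and `q + 1`. -/
def paramProg (P : Prog) : Prog :=
  .blk [const 5 1, const 16 0, op sub 20 16 5] <|
  .seq (sizeProg 20 21) <|
  .blk [op sub 12 21 5, op add 18 3 5, op div 20 0 18] <|
  .seq (sizeProg 20 22) <|
  .blk [op add 8 22 5, op mul 20 3 8] <|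
  .seq (sizeProg 20 23) <|
  .blk [op add 23 23 4, const 24 3, op add 23 23 24, const 24 5, op mul 7 23 24, const 24 262144,
    op mul 20 3 24] <|
  .seq (sizeProg 20 25) <|
  .blk [op shl 10 5 25, op sub 11 21 25, op add 6 3 16, op mul 9 8 7, const 24 4, op add 13 10 24,
    op mul 14 9 13, const 24 64, op add 14 14 24, op add 15 8 5, op mul 15 15 18, op add 15 15 14,
    const 24 50, op mul 17 6 24, op add 53 9 16] P

/-- The set-up: compute the parameters, draw the random words of all rows, and create the `L * R *
B` instances of the first black box and one instance of the second. -/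
def setupProg : Prog :=
  paramProg <|
  .seq (.whileNZ 53 drawProg) <|
  .blk [op mul 53 9 10] <|
  .seq (.whileNZ 53 (.blk [op sub 53 53 5] (.boxNew false 53))) <|
  .boxNew true 16

/-- Process the update in row number `mem[20] - 1`. -/
def rowUpdateProg : Prog :=
  .blk ([op sub 20 20 5, op div 21 20 7, op shr 21 0 21] ++ bucketCode) <|
  .seq (.boxUpdate false 27 0 1) <|
  .blk (counterCode ++ [op mul 28 28 1, op add 30 30 28]) (.store 25 30)

/-- Process the update of the index in cell `0` by the value in cell `1`. -/
def updateProg : Prog :=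
  .blk [op add 20 9 16, op add 29 0 16] <|
  .seq (.whileNZ 20 rowUpdateProg) (.boxUpdate true 16 0 1)

/-- Query row number `mem[57] - 1` of the current level about the node in cell `21`, and count in
cell `58` the answers above the threshold. -/
def rowTestProg : Prog :=
  .blk ([op sub 57 57 5, op add 20 59 57] ++ bucketCode) <|
  .seq (.boxReport false 27 30 31) <|
  .blk (fixedPointCode ++ [op mul 32 32 17, op lt 32 32 50, op sub 32 5 32]) (.op add 58 58 32)

/-- Test one child of a node in the list of the previous level, and add it to the list of the
current level when most rows accept it. -/
def nodeProg : Prog :=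
  .blk [op sub 53 53 5, op shr 21 53 5, op add 22 55 21, load 22 22, op add 21 21 21,
    op sub 21 53 21, op add 22 22 22, op add 21 21 22, op add 57 7 16, const 58 0] <|
  .seq (.whileNZ 57 rowTestProg) <|
  .blk [op add 58 58 58, op lt 58 7 58, op lt 22 54 6, op add 23 56 54] <|
  .seq (.store 23 21) (.blk [op mul 58 58 22] (.op add 54 54 58))

/-- Compute the list of nodes of a level from that of the previous level. -/
def levelProg : Prog :=
  .blk [op sub 52 52 5, op add 53 51 51, op mul 56 52 18, op add 56 56 14, op add 55 56 18,
    const 54 0, op mul 59 52 7] <|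
  .seq (.whileNZ 53 nodeProg) (.op add 51 54 16)

/-- One step of the majority vote, with the candidate in cell `c` and its weight in cell `40`. -/
def voteStepProg (ks : List ℕ) (c : ℕ) : Prog :=
  .blk (op sub 20 20 5 :: (rowValueCode ++ (sameCellCode ks c ++
    [op eq 34 40 16, op sub 35 30 c, op mul 35 35 34, op add c c 35, op or 34 34 33,
      op add 34 34 34, op add 40 40 34]))) (.op sub 40 40 5)

/-- The majority vote of Boyer and Moore, among the rows of level `0`, for the cell of a geometric
grid that contains the estimate; a member of the winning cell is put into cell `c`. -/
def voteProg (ks : List ℕ) (c : ℕ) : Prog :=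
  .blk [op add 20 7 16, const c 0, const 40 0] (.whileNZ 20 (voteStepProg ks c))

/-- Count the rows in the winning cell of the first grid, and the rows with negative estimate. -/
def countProg : Prog :=
  .blk [op add 20 7 16, const 41 0, const 42 0] <|
  .whileNZ 20 <| .blk (op sub 20 20 5 :: (rowValueCode ++ (sameCellCode gridA 60 ++
    [op add 41 41 33]))) (.op add 42 42 31)

/-- Write one entry of the output. -/
def entryProg : Prog :=
  .blk [op sub 53 53 5, op add 29 14 53, load 29 29, op add 21 29 16] <|
  .seq (voteProg gridA 60) <| .seq (voteProg gridB 61) <| .seq countProg <|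
  .blk [op add 41 41 41, op lt 41 7 41, op sub 60 60 61, op mul 60 60 41, op add 61 61 60,
    op add 42 42 42, op lt 42 7 42, op add 42 42 42, op sub 42 5 42, op add 22 53 53,
    op add 22 22 53, op add 22 22 15] <|
  .seq (.store 22 29) <| .blk [op add 22 22 5] <|
  .seq (.store 22 42) <| .blk [op add 22 22 5] (.store 22 61)

/-- The report: compute the threshold from the answer about the whole stream, descend from the list
of all nodes of the top level, and write an entry for every leaf that is reached. -/
def reportProg : Prog :=
  .seq (.boxReport true 16 30 31) <|
  .blk (fixedPointCode ++ [const 33 37888, op mul 50 32 33, op add 53 6 16, op mul 55 8 18,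
    op add 55 55 14, op add 51 6 16]) <|
  .seq (.whileNZ 53 (.blk [op sub 53 53 5, op add 56 55 53] (.store 56 53))) <|
  .blk [op add 52 8 16] <|
  .seq (.whileNZ 52 levelProg) <|
  .blk [op add 53 51 16] <|
  .seq (.whileNZ 53 entryProg) <|
  .blk [op add 0 51 16] (.op add 1 15 16)

/-- The streaming algorithm. -/
def algorithm : StreamProg where
  setup := setupProg
  update := updateProg
  report := reportProg

end HeavyHitters

/-! ### The layout of the memory -/

open scoped ENNReal

namespace HeavyHitters

open Instr WordOp

/-- The parameters computed by the set-up: the rounded value `q` of `1024 / φ`, the number `R` of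
rows per level, the number `L` of levels, and the logarithm `l` of the number of buckets per row. -/
structure Layout where
  q : ℕ
  R : ℕ
  L : ℕ
  l : ℕ

namespace Layout

variable (P : Layout)

/-- The number of buckets of a row. -/
def B : ℕ := 2 ^ P.l
/-- The total number of rows. -/
def N : ℕ := P.L * P.R
/-- The address of a row: four random words and `B` counters. -/
def row (t : ℕ) : ℕ := 64 + t * (P.B + 4)
/-- The address of the list of nodes of level `s`. -/
def list (s : ℕ) : ℕ := 64 + P.N * (P.B + 4) + s * (P.q + 1)
/-- The address of the output. -/
def out : ℕ := P.list (P.L + 1)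
/-- The number of memory cells used. -/
def top : ℕ := P.out + 3 * P.q

/-- The word size suffices for the layout. -/
structure Fits (w : ℕ) : Prop where
  top_lt : P.top < 2 ^ w
  inst_lt : P.N * P.B < 2 ^ w
  l_lt : P.l < w
  R_pos : 0 < P.R
  two_R : 2 * P.R < 2 ^ w

theorem list_zero : P.list 0 = 64 + P.N * (P.B + 4) := by simp [list]

theorem le_row (t : ℕ) : 64 ≤ P.row t := by unfold row; omega

theorem row_succ (t : ℕ) : P.row (t + 1) = P.row t + P.B + 4 := by unfold row; ring

theorem row_mono {t t' : ℕ} (h : t ≤ t') : P.row t ≤ P.row t' := by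
  unfold row; gcongr

theorem row_add_lt_list {t j : ℕ} (ht : t < P.N) (hj : j < P.B + 4) :
    P.row t + j < P.list 0 := by
  have h1 := P.row_mono (Nat.succ_le_of_lt ht)
  have h2 := P.row_succ t
  have h3 : P.list 0 = P.row P.N := by simp [list, row]
  simp only [Nat.succ_eq_add_one] at h1
  omega

theorem row_add_inj {t t' j j' : ℕ} (hj : j < P.B + 4) (hj' : j' < P.B + 4)
    (h : P.row t + j = P.row t' + j') : t = t' ∧ j = j' := by
  rcases lt_trichotomy t t' with h1 | h1 | h1
  · have h2 := P.row_mono (Nat.succ_le_of_lt h1)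
    have h3 := P.row_succ t
    simp only [Nat.succ_eq_add_one] at h2
    omega
  · subst h1; omega
  · have h2 := P.row_mono (Nat.succ_le_of_lt h1)
    have h3 := P.row_succ t'
    simp only [Nat.succ_eq_add_one] at h2
    omega

theorem list_mono {s s' : ℕ} (h : s ≤ s') : P.list s ≤ P.list s' := by
  unfold list; gcongr

theorem list_succ (s : ℕ) : P.list (s + 1) = P.list s + P.q + 1 := by unfold list; ring

theorem list_add_lt_out {s j : ℕ} (hs : s ≤ P.L) (hj : j ≤ P.q) : P.list s + j < P.out := by
  have h1 := P.list_mono (Nat.succ_le_succ hs)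
  have h2 := P.list_succ s
  unfold out
  simp only [Nat.succ_eq_add_one] at h1
  omega

theorem list_zero_le_out : P.list 0 ≤ P.out := P.list_mono (Nat.zero_le _)

theorem B_pos : 0 < P.B := Nat.two_pow_pos _

theorem inst_lt' {t b : ℕ} (ht : t < P.N) (hb : b < P.B) : t * P.B + b < P.N * P.B := by
  calc t * P.B + b < t * P.B + P.B := by omega
    _ = (t + 1) * P.B := by ring
    _ ≤ P.N * P.B := Nat.mul_le_mul_right _ ht

end Layout

/-- The random words of a row: a hash function for its buckets, and one for the signs. -/
structure RowHash (w : ℕ) where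
  a : BitVec w
  b : BitVec w
  c : BitVec w
  d : BitVec w

namespace RowHash

variable {w : ℕ} (h : RowHash w)

/-- The bucket of a node, given by the upper bits of a random affine function. -/
def bucket (sh : ℕ) (x : BitVec w) : BitVec w := (h.a * x + h.b) >>> sh

/-- The random sign of an index, given by the upper bit of a random affine function. -/
def sgn (x : BitVec w) : BitVec w :=
  1#w - ((h.c * x + h.d) >>> (w - 1) + (h.c * x + h.d) >>> (w - 1))

theorem bucket_lt {l : ℕ} (hl : l < w) (x : BitVec w) :
    (h.bucket (w - l) x).toNat < 2 ^ l := by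
  rw [bucket, BitVec.toNat_ushiftRight, Nat.shiftRight_eq_div_pow, Nat.div_lt_iff_lt_mul (by positivity),
    ← pow_add, show l + (w - l) = w by omega]
  exact BitVec.isLt _

end RowHash

variable {w n : ℕ} {box : Bool → Estimator w n} {P : Layout}

/-- The cells with the parameters. -/
structure Params (P : Layout) (m : ℕ → BitVec w) : Prop where
  c5 : m 5 = 1#w
  c6 : m 6 = BitVec.ofNat w P.q
  c7 : m 7 = BitVec.ofNat w P.R
  c8 : m 8 = BitVec.ofNat w P.L
  c9 : m 9 = BitVec.ofNat w P.N
  c10 : m 10 = BitVec.ofNat w P.B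
  c11 : m 11 = BitVec.ofNat w (w - P.l)
  c12 : m 12 = BitVec.ofNat w (w - 1)
  c13 : m 13 = BitVec.ofNat w (P.B + 4)
  c14 : m 14 = BitVec.ofNat w (P.list 0)
  c15 : m 15 = BitVec.ofNat w P.out
  c16 : m 16 = 0#w
  c17 : m 17 = BitVec.ofNat w (50 * P.q)
  c18 : m 18 = BitVec.ofNat w (P.q + 1)

/-- The rows in memory, with the random words `H` and the counters `cn`. -/
structure Rows (P : Layout) (H : ℕ → RowHash w) (cn : ℕ → ℕ → BitVec w) (m : ℕ → BitVec w) :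
    Prop where
  a : ∀ t < P.N, m (P.row t) = (H t).a
  b : ∀ t < P.N, m (P.row t + 1) = (H t).b
  c : ∀ t < P.N, m (P.row t + 2) = (H t).c
  d : ∀ t < P.N, m (P.row t + 3) = (H t).d
  cnt : ∀ t < P.N, ∀ b < P.B, m (P.row t + 4 + b) = cn t b

/-- Instructions that write only cells for scratch computations. -/
def Scratch (is : List Instr) : Prop :=
  ∀ i ∈ is, i.dest < 5 ∨ (20 ≤ i.dest ∧ i.dest < 64)

instance (is : List Instr) : Decidable (Scratch is) := by unfold Scratch; infer_instance

theorem Scratch.append {is js : List Instr} (h : Scratch is) (h' : Scratch js) :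
    Scratch (is ++ js) := by
  intro i hi
  rcases List.mem_append.1 hi with hi | hi
  exacts [h i hi, h' i hi]

theorem Scratch.runs {is : List Instr} (h : Scratch is) (m : ℕ → BitVec w) {a : ℕ}
    (ha : (5 ≤ a ∧ a < 20) ∨ 64 ≤ a) : runs is m a = m a :=
  runs_of_forall_ne _ _ _ fun i hi => by have := h i hi; omega

theorem Params.congr {m m' : ℕ → BitVec w} (h : Params P m)
    (h' : ∀ a, 5 ≤ a → a < 20 → m' a = m a) : Params P m' := by
  constructor
  all_goals rw [h' _ (by norm_num) (by norm_num)]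
  exacts [h.c5, h.c6, h.c7, h.c8, h.c9, h.c10, h.c11, h.c12, h.c13, h.c14, h.c15, h.c16, h.c17,
    h.c18]

theorem Rows.congr {m m' : ℕ → BitVec w} {H : ℕ → RowHash w} {cn : ℕ → ℕ → BitVec w}
    (h : Rows P H cn m) (h' : ∀ a, 64 ≤ a → a < P.list 0 → m' a = m a) : Rows P H cn m' := by
  constructor
  · intro t ht
    rw [h' _ (P.le_row t) (P.row_add_lt_list ht (j := 0) (by omega)), h.a t ht]
  · intro t ht
    have := P.le_row t
    rw [h' _ (by omega) (P.row_add_lt_list ht (by omega)), h.b t ht]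
  · intro t ht
    have := P.le_row t
    rw [h' _ (by omega) (P.row_add_lt_list ht (by omega)), h.c t ht]
  · intro t ht
    have := P.le_row t
    rw [h' _ (by omega) (P.row_add_lt_list ht (by omega)), h.d t ht]
  · intro t ht b hb
    have := P.le_row t
    rw [h' _ (by omega) (by rw [add_assoc]; exact P.row_add_lt_list ht (by omega)), h.cnt t ht b hb]

theorem Params.runs {m : ℕ → BitVec w} {is : List Instr} (h : Params P m) (hs : Scratch is) :
    Params P (runs is m) := h.congr fun _ h1 h2 => hs.runs m (.inl ⟨h1, h2⟩)

theorem Rows.runs {m : ℕ → BitVec w} {H : ℕ → RowHash w} {cn : ℕ → ℕ → BitVec w} {is : List Instr}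
    (h : Rows P H cn m) (hs : Scratch is) : Rows P H cn (runs is m) :=
  h.congr fun _ h1 _ => hs.runs m (.inr h1)

/-! Arithmetic of words that represent natural numbers. -/

theorem ofNat_add_ofNat (x y : ℕ) :
    BitVec.ofNat w x + BitVec.ofNat w y = BitVec.ofNat w (x + y) := (BitVec.ofNat_add x y).symm

theorem ofNat_mul_ofNat (x y : ℕ) :
    BitVec.ofNat w x * BitVec.ofNat w y = BitVec.ofNat w (x * y) := (BitVec.ofNat_mul x y).symm

theorem ofNat_succ_sub_one (x : ℕ) :
    BitVec.ofNat w (x + 1) - 1#w = BitVec.ofNat w x := by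
  rw [BitVec.ofNat_add]
  exact add_sub_cancel_right _ _

theorem toNat_ofNat_of_lt {x : ℕ} (h : x < 2 ^ w) : (BitVec.ofNat w x).toNat = x := by
  rw [BitVec.toNat_ofNat, Nat.mod_eq_of_lt h]

theorem w_lt : w < 2 ^ w := Nat.lt_two_pow_self

variable {H : ℕ → RowHash w} {cn : ℕ → ℕ → BitVec w}

/-- In terms of the layout, `bucketCode` computes the address of a row, the bucket of a node, and
the number of the instance of the black box in that bucket. -/
theorem runs_bucketCode {m : ℕ → BitVec w} {t : ℕ} (hP : Params P m) (hR : Rows P H cn m)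
    (hf : P.Fits w) (ht : t < P.N) (h20 : m 20 = BitVec.ofNat w t) :
    runs bucketCode m 22 = BitVec.ofNat w (P.row t) ∧
    runs bucketCode m 23 = BitVec.ofNat w (P.row t + 1) ∧
    runs bucketCode m 24 = (H t).bucket (w - P.l) (m 21) ∧
    runs bucketCode m 27 =
      BitVec.ofNat w (t * P.B + ((H t).bucket (w - P.l) (m 21)).toNat) := by
  have hT := hf.top_lt
  have h64 := P.le_row t
  have hlt : P.row t + 4 < 2 ^ w := by
    have h1 := P.row_add_lt_list ht (j := 3) (by omega)
    have h2 := P.list_zero_le_out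
    unfold Layout.top at hT
    omega
  have hrow : t * (P.B + 4) + 64 = P.row t := by unfold Layout.row; ring
  have hsh : w - P.l < 2 ^ w := lt_of_le_of_lt (Nat.sub_le _ _) w_lt
  have e1 : (BitVec.ofNat w (P.row t)).toNat = P.row t := toNat_ofNat_of_lt (by omega)
  have e2 : (BitVec.ofNat w (P.row t + 1)).toNat = P.row t + 1 := toNat_ofNat_of_lt (by omega)
  have e3 : (BitVec.ofNat w (w - P.l)).toNat = w - P.l := toNat_ofNat_of_lt hsh
  have key : BitVec.ofNat w (t * P.B + ((H t).bucket (w - P.l) (m 21)).toNat) =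
      BitVec.ofNat w (t * P.B) + (H t).bucket (w - P.l) (m 21) := by
    rw [BitVec.ofNat_add, BitVec.ofNat_toNat, BitVec.setWidth_eq]
  rw [key]
  have h64' : 64 ≤ P.row t + 1 := by omega
  refine ⟨?_, ?_, ?_, ?_⟩ <;>
    simp [bucketCode, runs_eq_back, WordOp.eval, h20, hP.c5, hP.c10, hP.c11,
      hP.c13, ofNat_add_ofNat, ofNat_mul_ofNat, hrow, e1, e2, e3, back_far, Instr.dest, h64, h64',
      hR.a t ht, hR.b t ht, RowHash.bucket, -BitVec.toNat_ofNat]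

/-- In terms of the layout, `counterCode` computes the address of a counter, the sign of an index,
and the value of the counter. -/
theorem runs_counterCode {m : ℕ → BitVec w} {t b : ℕ} (hP : Params P m) (hR : Rows P H cn m)
    (hf : P.Fits w) (ht : t < P.N) (hb : b < P.B) (h23 : m 23 = BitVec.ofNat w (P.row t + 1))
    (h24 : m 24 = BitVec.ofNat w b) :
    runs counterCode m 25 = BitVec.ofNat w (P.row t + 4 + b) ∧
    runs counterCode m 28 = (H t).sgn (m 29) ∧
    runs counterCode m 30 = cn t b := by
  have hT := hf.top_lt
  have h64 := P.le_row t
  have hlt : P.row t + 4 + b < 2 ^ w := by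
    have h1 := P.row_add_lt_list ht (j := 4 + b) (by omega)
    have h2 := P.list_zero_le_out
    unfold Layout.top at hT
    omega
  have hw : w - 1 < 2 ^ w := lt_of_le_of_lt (Nat.sub_le _ _) w_lt
  have e1 : (BitVec.ofNat w (P.row t + 2)).toNat = P.row t + 2 := toNat_ofNat_of_lt (by omega)
  have e2 : (BitVec.ofNat w (P.row t + 3)).toNat = P.row t + 3 := toNat_ofNat_of_lt (by omega)
  have e4 : (BitVec.ofNat w (P.row t + 4 + b)).toNat = P.row t + 4 + b :=
    toNat_ofNat_of_lt (by omega)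
  have e3 : (BitVec.ofNat w (w - 1)).toNat = w - 1 := toNat_ofNat_of_lt hw
  have g1 : 64 ≤ P.row t + 2 := by omega
  have g2 : 64 ≤ P.row t + 3 := by omega
  have g3 : 64 ≤ P.row t + 4 + b := by omega
  refine ⟨?_, ?_, ?_⟩ <;>
    simp [counterCode, runs_eq_back, WordOp.eval, h23, h24, hP.c5, hP.c12,
      ofNat_add_ofNat, e1, e2, e3, back_far, Instr.dest, g1, g2, add_assoc,
      hR.c t ht, hR.d t ht, RowHash.sgn, -BitVec.toNat_ofNat]
  · simp only [add_assoc] at e4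
    have := hR.cnt t ht b hb
    simp only [add_assoc] at this g3
    rw [e4]
    simp [show P.row t + (4 + b) ≠ 25 from by omega, show P.row t + (4 + b) ≠ 28 from by omega,
      show P.row t + (4 + b) ≠ 30 from by omega, this]

/-- The value of the fraction `a / b` as a fixed point number with `12` binary places, as the
machine computes it. -/
def fixedPoint (a b : BitVec w) : BitVec w :=
  (a <<< 12) / b * (if b >>> 24 = 0#w then 1#w else 0#w) +
    a / (b >>> 12) * (1#w - (if b >>> 24 = 0#w then 1#w else 0#w))

theorem runs_fixedPointCode {m : ℕ → BitVec w} (hP : Params P m) (hf : P.Fits w) :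
    runs fixedPointCode m 32 = fixedPoint (m 30) (m 31) := by
  have hT := hf.top_lt
  have h64 : 64 ≤ P.top := by
    have := P.list_zero_le_out
    rw [Layout.list_zero] at this
    unfold Layout.top
    omega
  have e1 : (24#w).toNat = 24 := toNat_ofNat_of_lt (by omega)
  have e2 : (12#w).toNat = 12 := toNat_ofNat_of_lt (by omega)
  simp [fixedPointCode, runs_eq_back, WordOp.eval, hP.c5, hP.c16, e1, e2,
    fixedPoint, -BitVec.toNat_ofNat]

/-- The sign bit of the estimate of row `h` with counter `y` for the index `x`. -/
def signBit (h : RowHash w) (y x : BitVec w) : BitVec w := (y * h.sgn x) >>> (w - 1)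

/-- The absolute value of the estimate of row `h` with counter `y` for the index `x`. -/
def absValue (h : RowHash w) (y x : BitVec w) : BitVec w :=
  y * h.sgn x * (1#w - (signBit h y x + signBit h y x))

/-- The counter of the bucket of the index `x` in row `t`. -/
def counterOf (P : Layout) (H : ℕ → RowHash w) (cn : ℕ → ℕ → BitVec w) (t : ℕ) (x : BitVec w) :
    BitVec w := cn t ((H t).bucket (w - P.l) x).toNat

theorem runs_rowValueCode {m : ℕ → BitVec w} {t : ℕ} {x : BitVec w} (hP : Params P m)
    (hR : Rows P H cn m) (hf : P.Fits w) (ht : t < P.N) (h20 : m 20 = BitVec.ofNat w t)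
    (h21 : m 21 = x) (h29 : m 29 = x) :
    runs rowValueCode m 30 = absValue (H t) (counterOf P H cn t x) x ∧
    runs rowValueCode m 31 = signBit (H t) (counterOf P H cn t x) x := by
  obtain ⟨-, h23, h24, -⟩ := runs_bucketCode hP hR hf ht h20
  have hb := (H t).bucket_lt hf.l_lt x
  have hs : Scratch bucketCode := by decide
  have h29' : runs bucketCode m 29 = x := by
    rw [runs_of_forall_ne _ _ _ (by decide), h29]
  rw [h21, show (H t).bucket (w - P.l) x = BitVec.ofNat w ((H t).bucket (w - P.l) x).toNat by simp]
    at h24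
  obtain ⟨-, h28, h30⟩ := runs_counterCode (hP.runs hs) (hR.runs hs) hf ht hb h23 h24
  rw [h29'] at h28
  have hP2 : Params P (runs counterCode (runs bucketCode m)) :=
    (hP.runs hs).runs (by decide)
  have hw : w - 1 < 2 ^ w := lt_of_le_of_lt (Nat.sub_le _ _) w_lt
  have e3 : (BitVec.ofNat w (w - 1)).toNat = w - 1 := toNat_ofNat_of_lt hw
  rw [rowValueCode, runs_append, runs_append]
  generalize runs counterCode (runs bucketCode m) = m' at h28 h30 hP2 ⊢
  constructor <;>
    simp [runs_eq_back, WordOp.eval, h28, h30, hP2.c5, hP2.c12, e3, absValue,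
      signBit, counterOf, -BitVec.toNat_ofNat]

/-- Whether two words lie in the same cell of the geometric grid with multipliers `ks`: their
multiples by each `k` in `ks` have the same number of binary digits. -/
def sameCell (ks : List ℕ) (x y : BitVec w) : Bool :=
  ks.all fun k => decide (¬ (BitVec.ofNat w k * y &&& BitVec.ofNat w k * x).toNat <
    (BitVec.ofNat w k * y ^^^ BitVec.ofNat w k * x).toNat)

/-- The number of multipliers for which the numbers of digits differ. -/
def gridDiff (ks : List ℕ) (x y : BitVec w) : ℕ :=
  ks.countP fun k => decide ((BitVec.ofNat w k * y &&& BitVec.ofNat w k * x).toNat <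
    (BitVec.ofNat w k * y ^^^ BitVec.ofNat w k * x).toNat)

theorem sameCell_eq (ks : List ℕ) (x y : BitVec w) :
    sameCell ks x y = decide (gridDiff ks x y = 0) := by
  rw [Bool.eq_iff_iff]
  simp [sameCell, gridDiff, List.countP_eq_zero]

theorem runs_gridSteps {c : ℕ} (hc : c ∉ [30, 33, 34, 35, 36]) (ks : List ℕ) (m : ℕ → BitVec w)
    (j : ℕ) (h : m 33 = BitVec.ofNat w j) :
    runs (ks.flatMap (gridStep c)) m 33 = BitVec.ofNat w (j + gridDiff ks (m 30) (m c)) := by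
  simp only [List.mem_cons, List.not_mem_nil, or_false, not_or] at hc
  obtain ⟨c0, c1, c2, c3, c4⟩ := hc
  induction ks generalizing m j with
  | nil => simp [runs_nil, gridDiff, h]
  | cons k ks ih =>
    have h30 : runs (gridStep c k) m 30 = m 30 := by
      simp [gridStep, runs_eq_back]
    have hc : runs (gridStep c k) m c = m c := by
      simp [gridStep, runs_eq_back, c1, c2, c3, c4]
    rw [List.flatMap_cons, runs_append, ih _
      (j + if (BitVec.ofNat w k * m c &&& BitVec.ofNat w k * m 30).toNat <
        (BitVec.ofNat w k * m c ^^^ BitVec.ofNat w k * m 30).toNat then 1 else 0), h30, hc]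
    · congr 1
      rw [gridDiff, gridDiff, List.countP_cons]
      simp only [decide_eq_true_eq]
      ring
    · rw [BitVec.ofNat_add, ← h]
      simp [gridStep, runs_eq_back, WordOp.eval, c2, c3, BitVec.mul_comm]
      split_ifs <;> rfl

theorem scratch_gridSteps (ks : List ℕ) (c : ℕ) : Scratch (ks.flatMap (gridStep c)) := by
  intro i hi
  obtain ⟨k, -, hk⟩ := List.mem_flatMap.1 hi
  simp only [gridStep, List.mem_cons, List.not_mem_nil, or_false] at hk
  rcases hk with rfl | rfl | rfl | rfl | rfl | rfl | rfl <;> simp [Instr.dest]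

theorem runs_sameCellCode {c : ℕ} (hc : c ∉ [30, 33, 34, 35, 36]) (ks : List ℕ)
    (hw : ks.length < 2 ^ w) (m : ℕ → BitVec w) (h16 : m 16 = 0#w) :
    runs (sameCellCode ks c) m 33 = if sameCell ks (m 30) (m c) then 1#w else 0#w := by
  have hc' := hc
  simp only [List.mem_cons, List.not_mem_nil, or_false, not_or] at hc'
  have h16' : runs (ks.flatMap (gridStep c)) (Function.update m 33 0#w) 16 = 0#w := by
    rw [(scratch_gridSteps ks c).runs _ (by decide), Function.update_of_ne (by decide), h16]
  rw [sameCellCode, runs_cons, runs_append]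
  simp only [Instr.run, runs_cons, runs_nil, WordOp.eval, Function.update_self, h16']
  rw [runs_gridSteps hc ks _ 0 (by simp), Function.update_of_ne (by decide),
    Function.update_of_ne hc'.2.1, zero_add, sameCell_eq]
  have hlt : gridDiff ks (m 30) (m c) < 2 ^ w := lt_of_le_of_lt List.countP_le_length hw
  have : BitVec.ofNat w (gridDiff ks (m 30) (m c)) = 0#w ↔ gridDiff ks (m 30) (m c) = 0 := by
    rw [← BitVec.toNat_inj, toNat_ofNat_of_lt hlt]
    simp
  simp only [this, decide_eq_true_eq]
  rfl

end HeavyHitters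

/-! ### Processing an update -/

open scoped ENNReal

namespace HeavyHitters

open Instr WordOp

variable {w n : ℕ} {box : Bool → Estimator w n} {P : Layout}

/-- The configuration between two phases of the algorithm: `H` are the random words of the rows,
`cn` the counters, `ι` the states of the instances of kind `false`, and `σ` the state of the
instance of kind `true`. -/
structure Core (P : Layout) (H : ℕ → RowHash w) (cn : ℕ → ℕ → BitVec w)
    (ι : ℕ → (box false).St) (σ : (box true).St) (s : Conf box) : Prop where
  params : Params P s.mem
  rows : Rows P H cn s.mem
  inst : ∀ j < P.N * P.B, s.inst false j = some (ι j)
  total : s.inst true 0 = some σ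
  slots : s.slots false ≤ P.N * P.B
  slots_total : s.slots true ≤ 1
  top : s.top ≤ P.top
  ok : s.ok = true

namespace Layout

theorem le_top (P : Layout) : 64 ≤ P.top := by
  have := P.list_zero_le_out
  rw [Layout.list_zero] at this
  unfold Layout.top
  omega

variable {P : Layout}

theorem row_add_lt_top {t j : ℕ} (ht : t < P.N) (hj : j < P.B + 4) : P.row t + j < P.top := by
  have h1 := P.row_add_lt_list ht hj
  have h2 := P.list_zero_le_out
  unfold Layout.top
  omega

theorem Fits.N_lt (hf : P.Fits w) : P.N < 2 ^ w := by
  have h1 := hf.top_lt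
  have h2 := P.list_zero_le_out
  have h3 : P.N ≤ P.list 0 := by rw [P.list_zero]; nlinarith
  have h4 : P.out ≤ P.top := Nat.le_add_right _ _
  omega

end Layout

variable {H : ℕ → RowHash w} {cn : ℕ → ℕ → BitVec w} {ι : ℕ → (box false).St} {σ : (box true).St}
  {s : Conf box}

theorem Core.after (h : Core P H cn ι σ s) {is : List Instr} (hs : Scratch is) :
    Core P H cn ι σ (s.after is) where
  params := h.params.runs hs
  rows := h.rows.runs hs
  inst := h.inst
  total := h.total
  slots := h.slots
  slots_total := h.slots_total
  top := s.top_after_le is _ h.top fun i hi => by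
    have := hs i hi
    have := P.le_top
    omega
  ok := h.ok

theorem Core.tick (h : Core P H cn ι σ s) (t : ℕ) : Core P H cn ι σ (s.tick t) :=
  ⟨h.params, h.rows, h.inst, h.total, h.slots, h.slots_total, h.top, h.ok⟩

theorem Core.resetTime (h : Core P H cn ι σ s) : Core P H cn ι σ s.resetTime :=
  ⟨h.params, h.rows, h.inst, h.total, h.slots, h.slots_total, h.top, h.ok⟩

/-- Writing a cell that holds neither a parameter nor a part of a row. -/
theorem Core.write (h : Core P H cn ι σ s) {a : ℕ} {v : BitVec w}
    (ha : a < 5 ∨ (20 ≤ a ∧ a < 64) ∨ (P.list 0 ≤ a ∧ a < P.top)) :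
    Core P H cn ι σ (s.write a v) where
  params := h.params.congr fun b h1 h2 => Function.update_of_ne (by
    have := P.list_zero; omega) _ _
  rows := h.rows.congr fun b h1 h2 => Function.update_of_ne (by omega) _ _
  inst := h.inst
  total := h.total
  slots := h.slots
  slots_total := h.slots_total
  top := by
    have := P.le_top
    have := h.top
    change max s.top (a + 1) ≤ P.top
    omega
  ok := h.ok

theorem Core.writeCounter (h : Core P H cn ι σ s) {t b : ℕ} {v : BitVec w} (ht : t < P.N)
    (hb : b < P.B) :
    Core P H (fun t' b' => if t' = t ∧ b' = b then v else cn t' b') ι σ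
      (s.write (P.row t + 4 + b) v) where
  params := h.params.congr fun a h1 h2 => Function.update_of_ne (by
    have := P.le_row t; omega) _ _
  rows := by
    have key : ∀ t', ∀ j < 4, (s.write (P.row t + 4 + b) v).mem (P.row t' + j) =
        s.mem (P.row t' + j) := by
      intro t' j hj
      refine Function.update_of_ne (fun he => ?_) _ _
      rw [add_assoc] at he
      have := (P.row_add_inj (by omega) (by omega) he).2
      omega
    refine ⟨fun t' ht' => ?_, fun t' ht' => ?_, fun t' ht' => ?_, fun t' ht' => ?_,
      fun t' ht' b' hb' => ?_⟩
    · rw [← h.rows.a t' ht']; exact key t' 0 (by norm_num)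
    · rw [← h.rows.b t' ht']; exact key t' 1 (by norm_num)
    · rw [← h.rows.c t' ht']; exact key t' 2 (by norm_num)
    · rw [← h.rows.d t' ht']; exact key t' 3 (by norm_num)
    · by_cases hc : t' = t ∧ b' = b
      · obtain ⟨rfl, rfl⟩ := hc
        simp [Conf.write]
      · rw [if_neg hc, ← h.rows.cnt t' ht' b' hb']
        refine Function.update_of_ne (fun he => hc ?_) _ _
        rw [add_assoc, add_assoc] at he
        have := P.row_add_inj (by omega) (by omega) he
        omega
  inst := h.inst
  total := h.total
  slots := h.slots
  slots_total := h.slots_total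
  top := by
    have := h.top
    have := P.row_add_lt_top ht (j := 4 + b) (by omega)
    change max s.top (P.row t + 4 + b + 1) ≤ P.top
    omega
  ok := h.ok

theorem Core.setInst (h : Core P H cn ι σ s) {j : ℕ} (hj : j < P.N * P.B) (x : (box false).St) :
    Core P H cn (Function.update ι j x) σ (s.setInst false j x) where
  params := h.params
  rows := h.rows
  inst := fun i hi => by
    simp only [Conf.setInst, Function.update_self]
    by_cases hij : i = j
    · subst hij; simp
    · simp [hij, h.inst i hi]
  total := by
    simp only [Conf.setInst]
    rw [Function.update_of_ne (by decide)]
    exact h.total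
  slots := by
    have := h.slots
    simp only [Conf.setInst, Function.update_self]
    omega
  slots_total := by
    simp only [Conf.setInst]
    rw [Function.update_of_ne (by decide)]
    exact h.slots_total
  top := h.top
  ok := h.ok

theorem Core.setTotal (h : Core P H cn ι σ s) (x : (box true).St) :
    Core P H cn ι x (s.setInst true 0 x) where
  params := h.params
  rows := h.rows
  inst := fun i hi => by
    simp only [Conf.setInst]
    rw [Function.update_of_ne (by decide)]
    exact h.inst i hi
  total := by simp [Conf.setInst]
  slots := by
    simp only [Conf.setInst]
    rw [Function.update_of_ne (by decide)]
    exact h.slots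
  slots_total := by
    have := h.slots_total
    simp only [Conf.setInst, Function.update_self]
    omega
  top := h.top
  ok := h.ok

theorem exec_boxUpdate_false {fuel a b c : ℕ} {j : ℕ} {i : Fin n} {v : ℤ}
    (h : Core P H cn ι σ s) (hj : j < P.N * P.B) (ha : (s.mem a).toNat = j)
    (hb : (s.mem b).toNat = i) (hc : (s.mem c).toInt = v) :
    Prog.exec fuel (.boxUpdate false a b c) s = ((box false).update i v (ι j)).map fun x =>
      (s.tick (box false).updTime).setInst false j x := by
  have h1 : (s.mem b).toNat < n := hb ▸ i.isLt
  have h2 : (⟨(s.mem b).toNat, h1⟩ : Fin n) = i := Fin.ext hb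
  simp only [Prog.exec, ha, h.inst j hj, h1, dif_pos, h2, hc]

theorem exec_boxUpdate_true {fuel a b c : ℕ} {i : Fin n} {v : ℤ}
    (h : Core P H cn ι σ s) (ha : (s.mem a).toNat = 0)
    (hb : (s.mem b).toNat = i) (hc : (s.mem c).toInt = v) :
    Prog.exec fuel (.boxUpdate true a b c) s = ((box true).update i v σ).map fun x =>
      (s.tick (box true).updTime).setInst true 0 x := by
  have h1 : (s.mem b).toNat < n := hb ▸ i.isLt
  have h2 : (⟨(s.mem b).toNat, h1⟩ : Fin n) = i := Fin.ext hb
  simp only [Prog.exec, ha, h.total, h1, dif_pos, h2, hc]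

/-- The bucket of the index `i` in row `t`. -/
def bucketOf (P : Layout) (H : ℕ → RowHash w) (t : ℕ) (i : ℕ) : ℕ :=
  ((H t).bucket (w - P.l) (BitVec.ofNat w (i / 2 ^ (t / P.R)))).toNat

/-- The counters after an update. -/
def addUpdate (P : Layout) (H : ℕ → RowHash w) (i : ℕ) (v : ℤ) (cn : ℕ → ℕ → BitVec w) (t b : ℕ) :
    BitVec w :=
  if b = bucketOf P H t i then cn t b + (H t).sgn (BitVec.ofNat w i) * BitVec.ofInt w v else cn t b

/-- The counters when the rows from `k` on have been updated. -/
def addUpdateFrom (P : Layout) (H : ℕ → RowHash w) (i : ℕ) (v : ℤ) (k : ℕ)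
    (cn : ℕ → ℕ → BitVec w) (t b : ℕ) : BitVec w :=
  if k ≤ t then addUpdate P H i v cn t b else cn t b

/-- Update the instance for the bucket of `i` in row `t`. -/
noncomputable def rowUpdate (P : Layout) (H : ℕ → RowHash w) (E : Estimator w n) (i : Fin n) (v : ℤ)
    (t : ℕ) (ι : ℕ → E.St) : PMF (ℕ → E.St) :=
  (E.update i v (ι (t * P.B + bucketOf P H t i))).map
    (Function.update ι (t * P.B + bucketOf P H t i))

/-- The states of all instances after an update. -/
noncomputable def updateAll (P : Layout) (H : ℕ → RowHash w) (box : Bool → Estimator w n)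
    (u : Fin n × ℤ) (x : (ℕ → (box false).St) × (box true).St) :
    PMF ((ℕ → (box false).St) × (box true).St) :=
  (PMF.iter (rowUpdate P H (box false) u.1 u.2) P.N x.1).bind fun ι =>
    ((box true).update u.1 u.2 x.2).map fun σ => (ι, σ)

/-- The invariant of the loop over the rows. -/
structure UpdInv (P : Layout) (H : ℕ → RowHash w) (cn : ℕ → ℕ → BitVec w) (σ : (box true).St)
    (i : Fin n) (v : ℤ) (tot : ℕ) (k : ℕ) (s : Conf box) (ι : ℕ → (box false).St) : Prop where
  core : Core P H (addUpdateFrom P H i v k cn) ι σ s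
  guard : s.mem 20 = BitVec.ofNat w k
  index : s.mem 0 = BitVec.ofNat w i
  index' : s.mem 29 = BitVec.ofNat w i
  val : s.mem 1 = BitVec.ofInt w v
  le : k ≤ P.N
  time : s.time + k * (40 + (box false).updTime) ≤ tot

/-- One pass of the loop over the rows, while an update is processed. -/
theorem refines_rowUpdate (hf : P.Fits w) {fuel : ℕ} {i : Fin n} {v : ℤ} (hi : n < 2 ^ w)
    (hv : (BitVec.ofInt w v).toInt = v) {tot k : ℕ} {s : Conf box}
    (h : UpdInv P H cn σ i v tot (k + 1) s ι) :
    (Prog.exec fuel rowUpdateProg (s.tick 1)).Refines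
      (rowUpdate P H (box false) i v k ι) (UpdInv P H cn σ i v tot k) := by
  have hk : k < P.N := h.le
  have hil : (i : ℕ) < 2 ^ w := lt_trans i.isLt hi
  have hT := hf.top_lt
  rw [rowUpdateProg, Prog.exec_blk]
  set is := [op sub 20 20 5, op div 21 20 7, op shr 21 0 21] ++ bucketCode with his
  have hsc : Scratch is := by decide
  have hcore := (h.core.tick 1).after hsc
  have hkT : k < 2 ^ w := hk.trans hf.N_lt
  have hRT : P.R < 2 ^ w := by
    have := hf.two_R
    omega
  have hdiv : k / P.R < 2 ^ w := lt_of_le_of_lt (Nat.div_le_self _ _) hkT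
  set m0 := runs [op sub 20 20 5, op div 21 20 7, op shr 21 0 21] s.mem with hm0
  have h20 : m0 20 = BitVec.ofNat w k := by
    simp [hm0, runs_eq_back, WordOp.eval, h.guard, h.core.params.c5,
      ofNat_succ_sub_one]
  have h21 : m0 21 = BitVec.ofNat w (i / 2 ^ (k / P.R)) := by
    have e1 : BitVec.ofNat w k / BitVec.ofNat w P.R = BitVec.ofNat w (k / P.R) := by
      rw [← BitVec.toNat_inj, BitVec.toNat_udiv, toNat_ofNat_of_lt hkT, toNat_ofNat_of_lt hRT,
        toNat_ofNat_of_lt hdiv]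
    have e2 : BitVec.ofNat w i >>> (k / P.R) = BitVec.ofNat w (i / 2 ^ (k / P.R)) := by
      rw [← BitVec.toNat_inj, BitVec.toNat_ushiftRight, toNat_ofNat_of_lt hil,
        Nat.shiftRight_eq_div_pow, toNat_ofNat_of_lt (lt_of_le_of_lt (Nat.div_le_self _ _) hil)]
    simp [hm0, runs_eq_back, WordOp.eval, h.guard, h.core.params.c5,
      h.core.params.c7, h.index, ofNat_succ_sub_one, e1, e2, toNat_ofNat_of_lt hdiv,
      -BitVec.toNat_ofNat]
  have hP0 : Params P m0 := h.core.params.runs (by decide)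
  have hR0 := h.core.rows.runs (is := [op sub 20 20 5, op div 21 20 7, op shr 21 0 21]) (by decide)
  obtain ⟨-, h23, h24, h27⟩ := runs_bucketCode hP0 hR0 hf hk h20
  have hmem : ((s.tick 1).after is).mem = runs bucketCode m0 := by
    rw [hm0, ← runs_append]; rfl
  rw [h21] at h24 h27
  have hb : bucketOf P H k i < P.B := (H k).bucket_lt hf.l_lt _
  rw [← hmem] at h23 h24 h27
  change _ = BitVec.ofNat w (k * P.B + bucketOf P H k i) at h27
  set j := k * P.B + bucketOf P H k i with hj
  have hjN : j < P.N * P.B := P.inst_lt' hk hb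
  have m1 : ((s.tick 1).after is).mem 0 = BitVec.ofNat w i := by
    rw [← h.index]; exact runs_of_forall_ne _ _ _ (by decide)
  have m2 : ((s.tick 1).after is).mem 1 = BitVec.ofInt w v := by
    rw [← h.val]; exact runs_of_forall_ne _ _ _ (by decide)
  have m3 : ((s.tick 1).after is).mem 29 = BitVec.ofNat w i := by
    rw [← h.index']; exact runs_of_forall_ne _ _ _ (by decide)
  have m4 : ((s.tick 1).after is).mem 20 = BitVec.ofNat w k := by
    rw [← h20, hmem]; exact runs_of_forall_ne _ _ _ (by decide)
  have htime : ((s.tick 1).after is).time = s.time + 15 := by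
    simp only [Conf.after, Conf.tick]; rfl
  generalize (s.tick 1).after is = s1 at *
  rw [Prog.exec_seq, exec_boxUpdate_false hcore hjN
    (by rw [h27, toNat_ofNat_of_lt (lt_trans hjN hf.inst_lt)]) (i := i) (v := v)
    (by rw [m1, toNat_ofNat_of_lt hil]) (by rw [m2, hv])]
  rw [rowUpdate, ← hj, PMF.bind_map, ← PMF.bind_pure_comp]
  refine (PMF.Refines.refl _).bind fun x _ hx => ?_
  subst hx
  have hcore2 := (hcore.tick (box false).updTime).setInst hjN x
  have m5 : ((s1.tick (box false).updTime).setInst false j x).mem = s1.mem := rfl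
  have htime2 : ((s1.tick (box false).updTime).setInst false j x).time =
    s.time + 15 + (box false).updTime := by rw [← htime]; rfl
  simp only [Function.comp_apply]
  generalize (s1.tick (box false).updTime).setInst false j x = s2 at *
  rw [Prog.exec_blk, Prog.exec_store]
  set is2 := counterCode ++ [op mul 28 28 1, op add 30 30 28] with his2
  have hcore3 := hcore2.after (is := is2) (by decide)
  rw [← m5] at h23 h24 m1 m2 m3 m4
  have h24' : s2.mem 24 = BitVec.ofNat w (bucketOf P H k i) := by
    rw [h24]; simp [bucketOf]
  obtain ⟨c25, c28, c30⟩ := runs_counterCode hcore2.params hcore2.rows hf hk hb h23 h24'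
  have d25 : (s2.after is2).mem 25 = BitVec.ofNat w (P.row k + 4 + bucketOf P H k i) := by
    simp only [Conf.after, his2, runs_append]
    generalize runs counterCode s2.mem = m' at c25
    simp [runs_eq_back, c25]
  have c1 : runs counterCode s2.mem 1 = BitVec.ofInt w v := by
    rw [← m2]; exact runs_of_forall_ne _ _ _ (by decide)
  have d30 : (s2.after is2).mem 30 = addUpdateFrom P H i v (k + 1) cn k (bucketOf P H k i) +
      (H k).sgn (BitVec.ofNat w i) * BitVec.ofInt w v := by
    simp only [Conf.after, his2, runs_append]
    generalize runs counterCode s2.mem = m' at c28 c30 c1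
    simp [runs_eq_back, WordOp.eval, c28, c30, c1, m3]
  have hlt := P.row_add_lt_top hk (j := 4 + bucketOf P H k i) (by omega)
  rw [d30, d25, toNat_ofNat_of_lt (by omega)]
  refine PMF.Refines.pure ⟨?_, ?_, ?_, ?_, ?_, ?_, ?_⟩
  · have := (hcore3.tick 1).writeCounter hk hb (v := addUpdateFrom P H i v (k + 1) cn k
      (bucketOf P H k i) + (H k).sgn (BitVec.ofNat w i) * BitVec.ofInt w v)
    convert this using 1
    funext t b
    by_cases ht : t = k
    · subst ht
      by_cases hbb : b = bucketOf P H t i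
      · subst hbb; simp [addUpdateFrom, addUpdate]
      · simp [addUpdateFrom, addUpdate, hbb]
    · have : (k ≤ t) = (k + 1 ≤ t) := by
        rw [eq_iff_iff]; omega
      simp [addUpdateFrom, ht, this]
  all_goals have h64 := P.le_row k
  · rw [← m4]
    exact (Function.update_of_ne (by omega) _ _).trans (runs_of_forall_ne _ _ _ (by decide))
  · rw [← m1]
    exact (Function.update_of_ne (by omega) _ _).trans (runs_of_forall_ne _ _ _ (by decide))
  · rw [← m3]
    exact (Function.update_of_ne (by omega) _ _).trans (runs_of_forall_ne _ _ _ (by decide))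
  · rw [← m2]
    exact (Function.update_of_ne (by omega) _ _).trans (runs_of_forall_ne _ _ _ (by decide))
  · exact hk.le
  · have : (((s2.after is2).tick 1).write (P.row k + 4 + bucketOf P H k i)
        (addUpdateFrom P H i v (k + 1) cn k (bucketOf P H k i) +
          (H k).sgn (BitVec.ofNat w i) * BitVec.ofInt w v)).time = s2.time + 15 := by
      simp only [Conf.after, Conf.tick, Conf.write]; rfl
    have h2 := h.time
    rw [this, htime2]
    linarith

theorem addUpdateFrom_zero (P : Layout) (H : ℕ → RowHash w) (i : ℕ) (v : ℤ)
    (cn : ℕ → ℕ → BitVec w) : addUpdateFrom P H i v 0 cn = addUpdate P H i v cn := by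
  funext t b; simp [addUpdateFrom]

/-- The invariant between updates, with the time of the last update. -/
structure Between (P : Layout) (H : ℕ → RowHash w) (cn : ℕ → ℕ → BitVec w) (tot : ℕ) (s : Conf box)
    (x : (ℕ → (box false).St) × (box true).St) : Prop where
  core : Core P H cn x.1 x.2 s
  time : s.time ≤ tot

/-- A bound for the update time. -/
def updBound (P : Layout) (box : Bool → Estimator w n) : ℕ :=
  P.N * (40 + (box false).updTime) + (box true).updTime + 10

theorem refines_update (hf : P.Fits w) {fuel : ℕ} (hfuel : P.N < fuel) {i : Fin n} {v : ℤ}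
    (hi : n < 2 ^ w) (hv : (BitVec.ofInt w v).toInt = v) {s : Conf box} (h : Core P H cn ι σ s) :
    (Prog.exec fuel updateProg
      ((s.resetTime.write 0 (BitVec.ofNat w i)).write 1 (BitVec.ofInt w v))).Refines
      (updateAll P H box (i, v) (ι, σ)) (Between P H (addUpdate P H i v cn) (updBound P box)) := by
  have hc0 := ((h.resetTime.write (a := 0) (v := BitVec.ofNat w i) (by omega)).write
    (a := 1) (v := BitVec.ofInt w v) (by omega)).after
      (is := [op add 20 9 16, op add 29 0 16]) (by decide)
  have hN : P.N < 2 ^ w := hf.N_lt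
  rw [updateProg, Prog.exec_blk, Prog.exec_seq]
  have hinv : UpdInv P H cn σ i v (P.N * (40 + (box false).updTime) + 2) P.N
      (((s.resetTime.write 0 (BitVec.ofNat w i)).write 1 (BitVec.ofInt w v)).after
        [op add 20 9 16, op add 29 0 16]) ι := by
    refine ⟨?_, ?_, ?_, ?_, ?_, le_rfl, ?_⟩
    · refine { hc0 with rows := ⟨hc0.rows.a, hc0.rows.b, hc0.rows.c, hc0.rows.d, ?_⟩ }
      intro t ht b hb
      rw [hc0.rows.cnt t ht b hb, addUpdateFrom, if_neg (by omega)]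
    · simp [Conf.after, Conf.write, Conf.resetTime, runs_eq_back, WordOp.eval,
        h.params.c9, h.params.c16]
    · simp [Conf.after, Conf.write, Conf.resetTime, runs_eq_back]
    · simp [Conf.after, Conf.write, Conf.resetTime, runs_eq_back, WordOp.eval,
        h.params.c16]
    · simp [Conf.after, Conf.write, Conf.resetTime, runs_eq_back]
    · simp only [Conf.after, Conf.write, Conf.resetTime, List.length_cons, List.length_nil]
      omega
  refine (Prog.refines_whileNZ (I := UpdInv P H cn σ i v _) (fun k s b hk => hk.guard)
    (fun k hk s b hs => refines_rowUpdate hf hi hv hs) hN hfuel hinv).bind ?_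
  rintro s' ι' ⟨s'', hs, rfl⟩
  rw [exec_boxUpdate_true (hs.core.tick 1) (i := i) (v := v)
    (by change (s''.mem 16).toNat = 0; rw [hs.core.params.c16]; rfl)
    (by
      change (s''.mem 0).toNat = i
      rw [hs.index, toNat_ofNat_of_lt (lt_trans i.isLt hi)])
    (by change (s''.mem 1).toInt = v; rw [hs.val, hv])]
  refine PMF.Refines.map_map _ fun x => ⟨?_, ?_⟩
  · have := ((hs.core.tick 1).tick (box true).updTime).setTotal x
    rw [addUpdateFrom_zero] at this
    exact this
  · have := hs.time
    simp only [Conf.setInst, Conf.tick, updBound]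
    omega

/-- The counters after a stream. -/
def counters (P : Layout) (H : ℕ → RowHash w) (l : UpdStream n) : ℕ → ℕ → BitVec w :=
  l.foldl (fun cn u => addUpdate P H u.1 u.2 cn) fun _ _ => 0#w

theorem counters_append_singleton (P : Layout) (H : ℕ → RowHash w) (l : UpdStream n)
    (u : Fin n × ℤ) : counters P H (l ++ [u]) = addUpdate P H u.1 u.2 (counters P H l) := by
  simp [counters]

/-- The states of all instances after a stream. -/
noncomputable def feedAll (P : Layout) (H : ℕ → RowHash w) (box : Bool → Estimator w n) :
    UpdStream n → (ℕ → (box false).St) × (box true).St →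
      PMF ((ℕ → (box false).St) × (box true).St)
  | [], x => PMF.pure x
  | u :: l, x => (updateAll P H box u x).bind (feedAll P H box l)

theorem refines_feed (hf : P.Fits w) {fuel : ℕ} (hfuel : P.N < fuel) (hi : n < 2 ^ w)
    (l : UpdStream n) (hv : ∀ u ∈ l, (BitVec.ofInt w u.2).toInt = u.2) (l₀ : UpdStream n)
    {s : Conf box} {x : (ℕ → (box false).St) × (box true).St}
    (h : Between P H (counters P H l₀) (updBound P box) s x) :
    (algorithm.feed fuel l s).Refines (feedAll P H box l x)
      (Between P H (counters P H (l₀ ++ l)) (updBound P box)) := by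
  induction l generalizing l₀ s x with
  | nil =>
    rw [StreamProg.feed, feedAll, List.append_nil]
    exact PMF.Refines.pure h
  | cons u l ih =>
    rw [StreamProg.feed, feedAll]
    refine (refines_update hf hfuel hi (hv u List.mem_cons_self) h.core).bind fun s' x' h' => ?_
    rw [← counters_append_singleton] at h'
    have := ih (fun v hv' => hv v (List.mem_cons_of_mem _ hv')) _ h'
    rwa [List.append_assoc] at this

end HeavyHitters

/-! ### The set-up -/

open scoped ENNReal

namespace HeavyHitters

open Instr WordOp

variable {w n : ℕ} {box : Bool → Estimator w n} {P : Layout}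

theorem size_half {y k : ℕ} (h : Nat.size y = k + 1) : Nat.size (y / 2) = k := by
  apply le_antisymm
  · rw [Nat.size_le]
    have := Nat.size_le.1 h.le
    rw [pow_succ] at this
    omega
  · rcases k with _ | k
    · exact Nat.zero_le _
    · rw [Nat.succ_le_iff, Nat.lt_size]
      have := Nat.lt_size.1 (show k + 1 < Nat.size y by omega)
      rw [pow_succ] at this
      omega

/-- Everything but the memory and the clock agrees. -/
structure SameRest (s s' : Conf box) : Prop where
  inst : s'.inst = s.inst
  slots : s'.slots = s.slots
  setup : s'.setup = s.setup
  ok : s'.ok = s.ok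
  top : s.top ≤ 64 → s'.top ≤ 64

theorem SameRest.trans {s s' s'' : Conf box} (h : SameRest s s') (h' : SameRest s' s'') :
    SameRest s s'' :=
  ⟨h'.inst.trans h.inst, h'.slots.trans h.slots, h'.setup.trans h.setup, h'.ok.trans h.ok,
    fun ht => h'.top (h.top ht)⟩

theorem sameRest_after (s : Conf box) {is : List Instr} (h : ∀ i ∈ is, i.dest < 64) :
    SameRest s (s.after is) :=
  ⟨rfl, rfl, rfl, rfl, fun ht => s.top_after_le is _ ht h⟩

theorem sameRest_tick (s : Conf box) (t : ℕ) : SameRest s (s.tick t) :=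
  ⟨rfl, rfl, rfl, rfl, id⟩

/-- The loop of `sizeProg` counts the binary digits of a word. -/
theorem exec_sizeProg {fuel a d x : ℕ} {s : Conf box} (h5 : s.mem 5 = 1#w)
    (ha : s.mem a = BitVec.ofNat w x) (hx : x < 2 ^ w) (hfuel : Nat.size x < fuel)
    (had : a ≠ d) (ha5 : a ≠ 5) (hd5 : d ≠ 5) (ha64 : a < 64) (hd64 : d < 64) :
    ∃ s', Prog.exec fuel (sizeProg a d) s = PMF.pure s' ∧
      s'.mem d = BitVec.ofNat w (Nat.size x) ∧ (∀ b, b ≠ a → b ≠ d → s'.mem b = s.mem b) ∧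
      SameRest s s' := by
  rw [sizeProg, Prog.exec_blk]
  have key : ∃ s', Prog.exec fuel (.whileNZ a (.blk [op shr a a 5] (.op add d d 5)))
      (s.after [const d 0]) = PMF.pure (s'.tick 1) ∧
      (∃ y < 2 ^ w, s'.mem a = BitVec.ofNat w y ∧ Nat.size y = 0) ∧
      (∃ z, s'.mem d = BitVec.ofNat w z ∧ z + 0 = Nat.size x) ∧
      (∀ b, b ≠ a → b ≠ d → s'.mem b = s.mem b) ∧ SameRest s s' := by
    refine Prog.exec_whileNZ_of_iff (N := Nat.size x)
      (I := fun k s' => (∃ y < 2 ^ w, s'.mem a = BitVec.ofNat w y ∧ Nat.size y = k) ∧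
      (∃ z, s'.mem d = BitVec.ofNat w z ∧ z + k = Nat.size x) ∧
      (∀ b, b ≠ a → b ≠ d → s'.mem b = s.mem b) ∧ SameRest s s') ?_ ?_ hfuel ?_
    · rintro k hk s1 ⟨⟨y, hy, h1, h2⟩, -⟩
      rw [h1, Prog.ofNat_eq_zero_iff hy, ← h2, Nat.size_eq_zero]
    · rintro k hk s1 ⟨⟨y, hy, h1, h2⟩, ⟨z, h3, h4⟩, h6, h7⟩
      have h51 : s1.mem 5 = 1#w := by rw [h6 5 (Ne.symm ha5) (Ne.symm hd5), h5]
      have hw1 : 1 < 2 ^ w := by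
        have h0 : 0 < Nat.size y := by omega
        have h8 : y ≠ 0 := by
          rintro rfl; simp at h0
        omega
      have e1 : (1#w).toNat = 1 := toNat_ofNat_of_lt hw1
      rw [Prog.exec_blk, Prog.exec_op]
      refine ⟨_, rfl, ⟨y / 2, by omega, ?_, size_half h2⟩, ⟨z + 1, ?_, by omega⟩, ?_, ?_⟩
      · have e2 : BitVec.ofNat w y >>> 1 = BitVec.ofNat w (y / 2) := by
          rw [← BitVec.toNat_inj, BitVec.toNat_ushiftRight, toNat_ofNat_of_lt hy,
            toNat_ofNat_of_lt (by omega), Nat.shiftRight_eq_div_pow, pow_one]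
        simp [Conf.after, Conf.tick, runs_eq_back, WordOp.eval, h1, h51, had, e1, e2,
          -BitVec.toNat_ofNat]
      · simp [Conf.after, Conf.tick, runs_eq_back, WordOp.eval, h3, h51, had.symm,
          ha5.symm, BitVec.ofNat_add]
      · intro b hb hb'
        rw [← h6 b hb hb']
        simp [Conf.after, Conf.tick, runs_eq_back, hb, hb']
      · refine h7.trans ((sameRest_tick _ 1).trans ((sameRest_after _ ?_).trans (sameRest_after _ ?_)))
        · simp [Instr.dest, ha64]
        · simp [Instr.dest, hd64]
    · refine ⟨⟨x, hx, ?_, rfl⟩, ⟨0, ?_, zero_add _⟩, ?_, sameRest_after _ (by simp [Instr.dest, hd64])⟩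
      · simp [Conf.after, runs_eq_back, had, ha]
      · simp [Conf.after, runs_eq_back]
      · intro b hb hb'
        simp [Conf.after, runs_eq_back, hb']
  obtain ⟨s', h1, h2⟩ := key
  refine ⟨s'.tick 1, h1, ?_, h2.2.2.1, h2.2.2.2.trans (sameRest_tick _ _)⟩
  obtain ⟨z, h3, h4⟩ := h2.2.1
  rw [add_zero] at h4
  rw [← h4]
  exact h3

/-- The layout for the inputs `n`, `q = ⌊1024 / φ⌋` and `D = ⌈log₂ (1 / δ)⌉`. -/
def layout (n q D : ℕ) : Layout where
  q := q
  R := (Nat.size (q * (Nat.size (n / (q + 1)) + 1)) + D + 3) * 5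
  L := Nat.size (n / (q + 1)) + 1
  l := Nat.size (q * 262144)

/-- Conditions on the word size for the set-up. -/
structure SetupFits (n q D w : ℕ) : Prop where
  fits : (layout n q D).Fits w
  n_lt : n < 2 ^ w
  qL_lt : q * (layout n q D).L < 2 ^ w
  q_lt : q * 262144 < 2 ^ w

theorem size_lt {x w : ℕ} (hx : x < 2 ^ w) : Nat.size x ≤ w := Nat.size_le.2 hx

/-- A block of instructions that computes a number in cell `20`, and then its number of binary
digits in cell `d`. -/
theorem exec_blk_sizeProg {fuel d x : ℕ} {is : List Instr} {s : Conf box}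
    (h5 : runs is s.mem 5 = 1#w) (ha : runs is s.mem 20 = BitVec.ofNat w x) (hx : x < 2 ^ w)
    (hfuel : 2 ^ w ≤ fuel) (hd : 20 < d ∧ d < 64) (his : ∀ i ∈ is, i.dest < 64) (Q : Prog) :
    ∃ s', Prog.exec fuel (.blk is (.seq (sizeProg 20 d) Q)) s = Prog.exec fuel Q s' ∧
      s'.mem d = BitVec.ofNat w (Nat.size x) ∧
      (∀ b, b ≠ 20 → b ≠ d → s'.mem b = runs is s.mem b) ∧ SameRest s s' := by
  obtain ⟨s1, e1, a1, b1, r1⟩ := exec_sizeProg (fuel := fuel) (a := 20) (d := d)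
    (x := x) (s := s.after is) h5 ha hx ((size_lt hx).trans_lt (w_lt.trans_le hfuel))
    (by omega) (by decide) (by omega) (by decide) hd.2
  refine ⟨s1, ?_, a1, b1, (sameRest_after s his).trans r1⟩
  rw [Prog.exec_blk, Prog.exec_seq, e1, PMF.pure_bind]

/-- The parameters are those of the layout. In particular the program finds the word size, as the
number of binary digits of the word `0 - 1`. -/
theorem exec_paramProg {n' q D fuel : ℕ} (hf : SetupFits n' q D w) (hfuel : 2 ^ w ≤ fuel) (Q : Prog)
    {s : Conf box} (h0 : s.mem 0 = BitVec.ofNat w n') (h3 : s.mem 3 = BitVec.ofNat w q)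
    (h4 : s.mem 4 = BitVec.ofNat w D) :
    ∃ s', Prog.exec fuel (paramProg Q) s = Prog.exec fuel Q s' ∧ Params (layout n' q D) s'.mem ∧
      s'.mem 53 = BitVec.ofNat w (layout n' q D).N ∧ (∀ a, 64 ≤ a → s'.mem a = s.mem a) ∧
      SameRest s s' := by
  have hw := (w_lt : w < 2 ^ w)
  have hw0 := hf.fits.l_lt
  have hq := hf.q_lt
  have one_lt : 1 < 2 ^ w := by omega
  have far : ∀ {is : List Instr} {s : Conf box} {a : ℕ}, (∀ i ∈ is, i.dest < 64) → 64 ≤ a →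
      runs is s.mem a = s.mem a := fun h ha => runs_of_forall_ne _ _ _ fun i hi => by
    have := h i hi
    omega
  have hsize : Nat.size (2 ^ w - 1) = w := by
    apply le_antisymm (size_lt (by omega))
    obtain ⟨v, rfl⟩ : ∃ v, w = v + 1 := ⟨w - 1, by omega⟩
    rw [Nat.succ_le_iff, Nat.lt_size, pow_succ]
    have := Nat.two_pow_pos v
    omega
  rw [paramProg]
  -- the number of binary digits of the word with all bits set is the word size
  obtain ⟨s1, e1, a1, b1, r1⟩ := exec_blk_sizeProg (fuel := fuel) (d := 21) (x := 2 ^ w - 1)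
    (s := s) (is := [const 5 1, const 16 0, op sub 20 16 5])
    (by simp [runs_eq_back])
    (by
      simp only [runs_cons, runs_nil, Instr.run, WordOp.eval, Function.update_self]
      rw [← BitVec.toNat_inj, toNat_ofNat_of_lt (by omega)]
      simp [Nat.mod_eq_of_lt one_lt, Nat.mod_eq_of_lt (show 2 ^ w - 1 < 2 ^ w by omega)])
    (by omega) hfuel (by decide) (by decide) _
  rw [e1]
  clear e1
  rw [hsize] at a1
  have f0 : s1.mem 0 = BitVec.ofNat w n' := by
    rw [b1 _ (by decide) (by decide)]; simp [runs_eq_back, h0]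
  have f3 : s1.mem 3 = BitVec.ofNat w q := by
    rw [b1 _ (by decide) (by decide)]; simp [runs_eq_back, h3]
  have f4 : s1.mem 4 = BitVec.ofNat w D := by
    rw [b1 _ (by decide) (by decide)]; simp [runs_eq_back, h4]
  have f5 : s1.mem 5 = 1#w := by
    rw [b1 _ (by decide) (by decide)]; simp [runs_eq_back]
  have f16 : s1.mem 16 = 0#w := by
    rw [b1 _ (by decide) (by decide)]; simp [runs_eq_back]
  have g1 : ∀ a, 64 ≤ a → s1.mem a = s.mem a := fun a ha => by
    rw [b1 _ (by omega) (by omega), far (by decide) ha]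
  clear b1
  -- the number of levels
  have hw1 : BitVec.ofNat w w - 1#w = BitVec.ofNat w (w - 1) := by
    obtain ⟨v, hv⟩ : ∃ v, w = v + 1 := ⟨w - 1, by omega⟩
    have := ofNat_succ_sub_one (w := w) v
    rw [← hv] at this
    rw [this, hv, Nat.add_sub_cancel]
  obtain ⟨s2, e2, a2, b2, r2⟩ := exec_blk_sizeProg (fuel := fuel) (d := 22) (x := n' / (q + 1))
    (s := s1) (is := [op sub 12 21 5, op add 18 3 5, op div 20 0 18])
    (by simp [runs_eq_back, f5])
    (by
      simp only [runs_cons, runs_nil, Instr.run, WordOp.eval, Function.update_self]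
      rw [← BitVec.toNat_inj, toNat_ofNat_of_lt ((Nat.div_le_self _ _).trans_lt hf.n_lt)]
      simp [f0, f3, f5, ofNat_add_ofNat, toNat_ofNat_of_lt hf.n_lt,
        toNat_ofNat_of_lt (show q + 1 < 2 ^ w by omega), -BitVec.toNat_ofNat])
    ((Nat.div_le_self _ _).trans_lt hf.n_lt) hfuel (by decide) (by decide) _
  rw [e2]
  clear e2
  have p3 : s2.mem 3 = BitVec.ofNat w q := by
    rw [b2 _ (by decide) (by decide)]; simp [runs_eq_back, f3]
  have p4 : s2.mem 4 = BitVec.ofNat w D := by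
    rw [b2 _ (by decide) (by decide)]; simp [runs_eq_back, f4]
  have p5 : s2.mem 5 = 1#w := by
    rw [b2 _ (by decide) (by decide)]; simp [runs_eq_back, f5]
  have p16 : s2.mem 16 = 0#w := by
    rw [b2 _ (by decide) (by decide)]; simp [runs_eq_back, f16]
  have p21 : s2.mem 21 = BitVec.ofNat w w := by
    rw [b2 _ (by decide) (by decide)]; simp [runs_eq_back, a1]
  have p12 : s2.mem 12 = BitVec.ofNat w (w - 1) := by
    rw [b2 _ (by decide) (by decide)]
    simp [runs_eq_back, WordOp.eval, a1, f5, hw1]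
  have p18 : s2.mem 18 = BitVec.ofNat w (q + 1) := by
    rw [b2 _ (by decide) (by decide)]
    simp [runs_eq_back, WordOp.eval, f3, f5, ofNat_add_ofNat]
  have g2 : ∀ a, 64 ≤ a → s2.mem a = s.mem a := fun a ha => by
    rw [b2 _ (by omega) (by omega), far (by decide) ha, g1 a ha]
  clear b2 f0 f3 f4 f5 f16 g1 a1
  -- the number of rows per level
  obtain ⟨s3, e3, a3, b3, r3⟩ := exec_blk_sizeProg (fuel := fuel) (d := 23)
    (x := q * (layout n' q D).L) (s := s2) (is := [op add 8 22 5, op mul 20 3 8])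
    (by simp [runs_eq_back, p5])
    (by simp [runs_eq_back, WordOp.eval, p3, a2, p5, ofNat_add_ofNat,
        ofNat_mul_ofNat, layout])
    hf.qL_lt hfuel (by decide) (by decide) _
  rw [e3]
  clear e3
  have q3 : s3.mem 3 = BitVec.ofNat w q := by
    rw [b3 _ (by decide) (by decide)]; simp [runs_eq_back, p3]
  have q4 : s3.mem 4 = BitVec.ofNat w D := by
    rw [b3 _ (by decide) (by decide)]; simp [runs_eq_back, p4]
  have q5 : s3.mem 5 = 1#w := by
    rw [b3 _ (by decide) (by decide)]; simp [runs_eq_back, p5]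
  have q8 : s3.mem 8 = BitVec.ofNat w (layout n' q D).L := by
    rw [b3 _ (by decide) (by decide)]
    simp [runs_eq_back, WordOp.eval, a2, p5, ofNat_add_ofNat, layout]
  have q16 : s3.mem 16 = 0#w := by
    rw [b3 _ (by decide) (by decide)]; simp [runs_eq_back, p16]
  have q21 : s3.mem 21 = BitVec.ofNat w w := by
    rw [b3 _ (by decide) (by decide)]; simp [runs_eq_back, p21]
  have q12 : s3.mem 12 = BitVec.ofNat w (w - 1) := by
    rw [b3 _ (by decide) (by decide)]; simp [runs_eq_back, p12]
  have q18 : s3.mem 18 = BitVec.ofNat w (q + 1) := by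
    rw [b3 _ (by decide) (by decide)]; simp [runs_eq_back, p18]
  have g3 : ∀ a, 64 ≤ a → s3.mem a = s.mem a := fun a ha => by
    rw [b3 _ (by omega) (by omega), far (by decide) ha, g2 a ha]
  clear b3 p3 p4 p5 p16 p21 p12 p18 g2 a2
  -- the number of buckets
  obtain ⟨s4, e4, a4, b4, r4⟩ := exec_blk_sizeProg (fuel := fuel) (d := 25)
    (x := q * 262144) (s := s3) (is := [op add 23 23 4, const 24 3, op add 23 23 24, const 24 5,
      op mul 7 23 24, const 24 262144, op mul 20 3 24])
    (by simp [runs_eq_back, q5])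
    (by simp [runs_eq_back, WordOp.eval, q3, ofNat_mul_ofNat])
    hf.q_lt hfuel (by decide) (by decide) _
  rw [e4]
  clear e4
  have u3 : s4.mem 3 = BitVec.ofNat w q := by
    rw [b4 _ (by decide) (by decide)]; simp [runs_eq_back, q3]
  have u5 : s4.mem 5 = 1#w := by
    rw [b4 _ (by decide) (by decide)]; simp [runs_eq_back, q5]
  have u8 : s4.mem 8 = BitVec.ofNat w (layout n' q D).L := by
    rw [b4 _ (by decide) (by decide)]; simp [runs_eq_back, q8]
  have u16 : s4.mem 16 = 0#w := by
    rw [b4 _ (by decide) (by decide)]; simp [runs_eq_back, q16]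
  have u21 : s4.mem 21 = BitVec.ofNat w w := by
    rw [b4 _ (by decide) (by decide)]; simp [runs_eq_back, q21]
  have u12 : s4.mem 12 = BitVec.ofNat w (w - 1) := by
    rw [b4 _ (by decide) (by decide)]; simp [runs_eq_back, q12]
  have u18 : s4.mem 18 = BitVec.ofNat w (q + 1) := by
    rw [b4 _ (by decide) (by decide)]; simp [runs_eq_back, q18]
  have u7 : s4.mem 7 = BitVec.ofNat w (layout n' q D).R := by
    rw [b4 _ (by decide) (by decide)]
    simp [runs_eq_back, WordOp.eval, a3, q4, ofNat_add_ofNat, ofNat_mul_ofNat,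
      layout]
  have g4 : ∀ a, 64 ≤ a → s4.mem a = s.mem a := fun a ha => by
    rw [b4 _ (by omega) (by omega), far (by decide) ha, g3 a ha]
  clear b4 q3 q4 q5 q8 q16 q21 q12 q18 g3 a3
  change s4.mem 25 = BitVec.ofNat w (layout n' q D).l at a4
  have hq' : (layout n' q D).q = q := rfl
  generalize layout n' q D = P at *
  have hll : P.l < 2 ^ w := by omega
  have hshl : 1#w <<< P.l = BitVec.ofNat w P.B := by
    rw [← BitVec.toNat_inj, BitVec.toNat_shiftLeft, toNat_ofNat_of_lt one_lt, BitVec.toNat_ofNat,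
      Nat.shiftLeft_eq, one_mul, Layout.B]
  have hsub : BitVec.ofNat w w - BitVec.ofNat w P.l = BitVec.ofNat w (w - P.l) := by
    have h1 : BitVec.ofNat w w = BitVec.ofNat w (w - P.l) + BitVec.ofNat w P.l := by
      rw [ofNat_add_ofNat, Nat.sub_add_cancel hw0.le]
    rw [h1]
    exact add_sub_cancel_right _ _
  have e1 : (BitVec.ofNat w P.l).toNat = P.l := toNat_ofNat_of_lt hll
  rw [Prog.exec_blk]
  set m1 := runs [op shl 10 5 25, op sub 11 21 25, op add 6 3 16, op mul 9 8 7, const 24 4,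
    op add 13 10 24] s4.mem with hm1
  set m2 := runs [op mul 14 9 13, const 24 64, op add 14 14 24] m1 with hm2
  have v9 : m1 9 = BitVec.ofNat w P.N := by
    simp [hm1, runs_eq_back, WordOp.eval, u7, u8, ofNat_mul_ofNat, Layout.N]
  have v10 : m1 10 = BitVec.ofNat w P.B := by
    simp [hm1, runs_eq_back, WordOp.eval, u5, a4, e1, hshl, -BitVec.toNat_ofNat]
  have v13 : m1 13 = BitVec.ofNat w (P.B + 4) := by
    simp [hm1, runs_eq_back, WordOp.eval, u5, a4, e1, hshl, ofNat_add_ofNat,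
      -BitVec.toNat_ofNat]
  have v11 : m1 11 = BitVec.ofNat w (w - P.l) := by
    simp [hm1, runs_eq_back, WordOp.eval, u21, a4, hsub]
  have v6 : m1 6 = BitVec.ofNat w P.q := by
    simp [hm1, runs_eq_back, WordOp.eval, u3, u16, hq']
  have vs : ∀ a, 15 ≤ a → a < 20 → m1 a = s4.mem a := fun a h1 h2 =>
    runs_of_forall_ne _ _ _ (by simp [Instr.dest]; omega)
  have v5 : m1 5 = 1#w := by rw [← u5]; exact runs_of_forall_ne _ _ _ (by decide)
  have v7 : m1 7 = _ := (runs_of_forall_ne _ _ _ (by decide)).trans u7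
  have v8 : m1 8 = _ := (runs_of_forall_ne _ _ _ (by decide)).trans u8
  have v12 : m1 12 = _ := (runs_of_forall_ne _ _ _ (by decide)).trans u12
  have x14 : m2 14 = BitVec.ofNat w (P.list 0) := by
    simp [hm2, runs_eq_back, WordOp.eval, v9, v13, ofNat_add_ofNat,
      ofNat_mul_ofNat, Layout.list_zero]
    congr 1
    ring
  have xs : ∀ a, a ≠ 14 → a ≠ 24 → m2 a = m1 a := fun a h1 h2 =>
    runs_of_forall_ne _ _ _ (by simp [Instr.dest]; omega)
  have hmem : (s4.after [op shl 10 5 25, op sub 11 21 25, op add 6 3 16, op mul 9 8 7,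
      const 24 4, op add 13 10 24, op mul 14 9 13, const 24 64, op add 14 14 24, op add 15 8 5,
      op mul 15 15 18, op add 15 15 14, const 24 50, op mul 17 6 24, op add 53 9 16]).mem =
      runs [op add 15 8 5, op mul 15 15 18, op add 15 15 14, const 24 50, op mul 17 6 24,
        op add 53 9 16] m2 := rfl
  refine ⟨_, rfl, ?_, ?_, ?_, r1.trans (r2.trans (r3.trans (r4.trans (sameRest_after _ (by decide)))))⟩
  · rw [hmem]
    clear_value m2 m1
    constructor
    case c15 =>
      simp [runs_eq_back, WordOp.eval, x14, xs, v8, v5, vs, u18, ofNat_add_ofNat,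
        ofNat_mul_ofNat]
      congr 1
      simp only [Layout.out, Layout.list, hq']
      ring
    case c17 =>
      simp [runs_eq_back, WordOp.eval, xs, v6, ofNat_mul_ofNat, mul_comm]
    all_goals
      rw [runs_of_forall_ne _ _ _ (by decide)]
      first
      | exact x14
      | rw [xs _ (by decide) (by decide)]; assumption
      | rw [xs _ (by decide) (by decide), vs _ (by decide) (by decide)]; assumption
      | rw [xs _ (by decide) (by decide), vs _ (by decide) (by decide), hq']; assumption
  · rw [hmem]
    clear_value m2 m1
    simp [runs_eq_back, WordOp.eval, xs, v9, vs, u16]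
  · intro a ha
    rw [← g4 a ha]
    exact far (by decide) ha

end HeavyHitters

/-! ### Drawing random words and creating instances -/

open scoped ENNReal

namespace HeavyHitters

open Instr WordOp

variable {w n : ℕ} {box : Bool → Estimator w n} {P : Layout}

/-- Independent uniformly random words for a row. -/
noncomputable def drawRow (w : ℕ) : PMF (RowHash w) :=
  (Prog.randWord w).bind fun a => (Prog.randWord w).bind fun b =>
    (Prog.randWord w).bind fun c => (Prog.randWord w).bind fun d => PMF.pure ⟨a, b, c, d⟩

/-- Draw the random words of row `t`. -/
noncomputable def drawStep (w : ℕ) (t : ℕ) (H : ℕ → RowHash w) : PMF (ℕ → RowHash w) :=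
  (drawRow w).map (Function.update H t)

/-- Initialize instance `j` of the black box. -/
noncomputable def initStep (E : Estimator w n) (j : ℕ) (ι : ℕ → E.St) : PMF (ℕ → E.St) :=
  E.init.map (Function.update ι j)

/-- The invariant while the random words are drawn; the rows from `k` on are finished. -/
structure DrawInv (P : Layout) (k : ℕ) (s : Conf box) (H : ℕ → RowHash w) : Prop where
  params : Params P s.mem
  guard : s.mem 53 = BitVec.ofNat w k
  a : ∀ t < P.N, k ≤ t → s.mem (P.row t) = (H t).a
  b : ∀ t < P.N, k ≤ t → s.mem (P.row t + 1) = (H t).b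
  c : ∀ t < P.N, k ≤ t → s.mem (P.row t + 2) = (H t).c
  d : ∀ t < P.N, k ≤ t → s.mem (P.row t + 3) = (H t).d
  cnt : ∀ t < P.N, ∀ b < P.B, s.mem (P.row t + 4 + b) = 0#w
  slots : s.slots = fun _ => 0
  top : s.top ≤ P.top
  ok : s.ok = true
  setup : s.setup = true

/-- The configuration after a random word has been drawn and stored at address `A`. -/
def drawn (s : Conf box) (A : ℕ) (v : BitVec w) : Conf box :=
  (((s.tick 1).write 23 v).tick 1).write A v

theorem exec_rand_store {fuel A : ℕ} {s : Conf box} (hA : A < 2 ^ w)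
    (h : s.mem 22 = BitVec.ofNat w A) (Q : Prog) :
    Prog.exec fuel (.seq (.rand 23) (.seq (.store 22 23) Q)) s =
      (Prog.randWord w).bind fun v => Prog.exec fuel Q (drawn s A v) := by
  rw [Prog.exec_seq, Prog.exec, PMF.bind_map]
  congr 1
  funext v
  simp only [Function.comp_apply]
  rw [Prog.exec_seq, Prog.exec_store, PMF.pure_bind]
  simp [drawn, Conf.write, Conf.tick, h, Nat.mod_eq_of_lt hA]

theorem exec_rand_store' {fuel A : ℕ} {s : Conf box} (hA : A < 2 ^ w)
    (h : s.mem 22 = BitVec.ofNat w A) :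
    Prog.exec fuel (.seq (.rand 23) (.store 22 23)) s =
      (Prog.randWord w).bind fun v => PMF.pure (drawn s A v) := by
  rw [Prog.exec_seq, Prog.exec, PMF.bind_map]
  congr 1
  funext v
  simp only [Function.comp_apply]
  rw [Prog.exec_store]
  simp [drawn, Conf.write, Conf.tick, h, Nat.mod_eq_of_lt hA]

theorem drawn_mem (s : Conf box) (A : ℕ) (v : BitVec w) (a : ℕ) :
    (drawn s A v).mem a = if a = A then v else if a = 23 then v else s.mem a := by
  simp [drawn, Conf.write, Conf.tick, Function.update_apply]

theorem refines_draw (hf : P.Fits w) {fuel k : ℕ} (hk : k < P.N) {s : Conf box}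
    {H : ℕ → RowHash w} (h : DrawInv P (k + 1) s H) :
    (Prog.exec fuel drawProg (s.tick 1)).Refines (drawStep w k H) (DrawInv P k) := by
  have h64 := P.le_row k
  have hlt := P.row_add_lt_top hk (j := 3) (by omega)
  have hT := hf.top_lt
  have hrow : k * (P.B + 4) + 64 = P.row k := by unfold Layout.row; ring
  rw [drawProg, Prog.exec_blk]
  set s0 := (s.tick 1).after [op sub 53 53 5, op mul 22 53 13, const 23 64, op add 22 22 23] with hs0
  have m22 : s0.mem 22 = BitVec.ofNat w (P.row k) := by
    simp [hs0, Conf.after, Conf.tick, runs_eq_back, WordOp.eval, h.guard,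
      h.params.c5, h.params.c13, ofNat_succ_sub_one, ofNat_add_ofNat, ofNat_mul_ofNat, hrow]
  have m53 : s0.mem 53 = BitVec.ofNat w k := by
    simp [hs0, Conf.after, Conf.tick, runs_eq_back, WordOp.eval, h.guard,
      h.params.c5, ofNat_succ_sub_one]
  have mem0 : ∀ a, (5 ≤ a ∧ a < 20) ∨ 64 ≤ a → s0.mem a = s.mem a := fun a ha =>
    Scratch.runs (by decide) _ ha
  have m5 : s0.mem 5 = 1#w := by rw [mem0 5 (by decide), h.params.c5]
  have t0 : s0.top ≤ P.top := Conf.top_after_le _ _ _ h.top fun i hi => by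
    have := P.le_top
    have : i.dest < 64 := by revert i; decide
    omega
  have sl0 : s0.slots = fun _ => 0 := h.slots
  have ok0 : s0.ok = true := h.ok
  have su0 : s0.setup = true := h.setup
  clear_value s0
  rw [exec_rand_store (by omega) m22, drawStep, drawRow]
  simp only [PMF.map_bind, PMF.pure_map]
  refine (PMF.Refines.refl _).bind fun a _ ha => ?_
  subst ha
  rw [Prog.exec_blk, exec_rand_store (A := P.row k + 1) (by omega) (by
    simp [Conf.after, runs_eq_back, WordOp.eval, drawn_mem, m22, m5,
      ofNat_add_ofNat, show 22 ≠ P.row k by omega, show 5 ≠ P.row k by omega])]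
  refine (PMF.Refines.refl _).bind fun b _ hb => ?_
  subst hb
  rw [Prog.exec_blk, exec_rand_store (A := P.row k + 2) (by omega) (by
    simp [Conf.after, runs_eq_back, WordOp.eval, drawn_mem, m22, m5,
      ofNat_add_ofNat, show 22 ≠ P.row k by omega, show 5 ≠ P.row k by omega,
      show 22 ≠ P.row k + 1 by omega, show 5 ≠ P.row k + 1 by omega])]
  refine (PMF.Refines.refl _).bind fun c _ hc => ?_
  subst hc
  rw [Prog.exec_blk, exec_rand_store' (A := P.row k + 3) (by omega) (by
    simp [Conf.after, runs_eq_back, WordOp.eval, drawn_mem, m22, m5,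
      ofNat_add_ofNat, show 22 ≠ P.row k by omega, show 5 ≠ P.row k by omega,
      show 22 ≠ P.row k + 1 by omega, show 5 ≠ P.row k + 1 by omega,
      show 22 ≠ P.row k + 2 by omega, show 5 ≠ P.row k + 2 by omega])]
  refine (PMF.Refines.refl _).bind fun d _ hd => ?_
  subst hd
  refine PMF.Refines.pure ?_
  set s4 := drawn ((drawn ((drawn ((drawn s0 (P.row k) a).after [op add 22 22 5]) (P.row k + 1)
    b).after [op add 22 22 5]) (P.row k + 2) c).after [op add 22 22 5]) (P.row k + 3) d with hs4
  have hmem : ∀ x, x ≠ 22 → x ≠ 23 → s4.mem x = if x = P.row k + 3 then d else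
      if x = P.row k + 2 then c else if x = P.row k + 1 then b else if x = P.row k then a
      else s0.mem x := by
    intro x h1 h2
    simp [hs4, Conf.after, runs_eq_back, drawn_mem, h1, h2]
  have htop : s4.top ≤ P.top := by
    simp only [hs4, drawn, Conf.write, Conf.tick, Conf.after, List.foldl_cons, List.foldl_nil,
      Instr.dest]
    omega
  have hrest : s4.slots = s0.slots ∧ s4.ok = s0.ok ∧ s4.setup = s0.setup := ⟨rfl, rfl, rfl⟩
  clear_value s4
  have hne : ∀ t, t ≠ k → ∀ j < P.B + 4, s4.mem (P.row t + j) = s.mem (P.row t + j) := by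
    intro t ht j hj
    have h64' := P.le_row t
    have hx : ∀ j' < 4, P.row t + j ≠ P.row k + j' := fun j' hj' he =>
      ht (P.row_add_inj hj (by omega) he).1
    have x0 := hx 0 (by norm_num)
    rw [hmem _ (by omega) (by omega), if_neg (hx 3 (by norm_num)), if_neg (hx 2 (by norm_num)),
      if_neg (hx 1 (by norm_num)), if_neg (by simpa using x0), mem0 _ (by omega)]
  refine ⟨?_, ?_, ?_, ?_, ?_, ?_, ?_, ?_, htop, ?_, ?_⟩
  · refine h.params.congr fun x h1 h2 => ?_
    rw [hmem x (by omega) (by omega), if_neg (by omega), if_neg (by omega), if_neg (by omega),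
      if_neg (by omega), mem0 x (by omega)]
  · rw [hmem 53 (by omega) (by omega), if_neg (by omega), if_neg (by omega), if_neg (by omega),
      if_neg (by omega), m53]
  · intro t ht hkt
    by_cases htk : t = k
    · subst htk; simp [hmem (P.row t) (by omega) (by omega)]
    · rw [Function.update_of_ne htk, ← h.a t ht (by omega)]
      exact hne t htk 0 (by omega)
  · intro t ht hkt
    by_cases htk : t = k
    · subst htk; simp [hmem (P.row t + 1) (by omega) (by omega)]
    · rw [Function.update_of_ne htk, ← h.b t ht (by omega)]
      exact hne t htk 1 (by omega)
  · intro t ht hkt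
    by_cases htk : t = k
    · subst htk; simp [hmem (P.row t + 2) (by omega) (by omega)]
    · rw [Function.update_of_ne htk, ← h.c t ht (by omega)]
      exact hne t htk 2 (by omega)
  · intro t ht hkt
    by_cases htk : t = k
    · subst htk; simp [hmem (P.row t + 3) (by omega) (by omega)]
    · rw [Function.update_of_ne htk, ← h.d t ht (by omega)]
      exact hne t htk 3 (by omega)
  · intro t ht b' hb'
    rw [← h.cnt t ht b' hb']
    by_cases htk : t = k
    · subst htk
      rw [hmem _ (by omega) (by omega), if_neg (by omega), if_neg (by omega), if_neg (by omega),
        if_neg (by omega), mem0 _ (by omega)]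
    · have := hne t htk (4 + b') (by omega)
      rwa [← add_assoc] at this
  · rw [hrest.1, sl0]
  · rw [hrest.2.1, ok0]
  · rw [hrest.2.2, su0]

/-- The invariant while the instances of kind `false` are created. -/
structure InitInv (P : Layout) (H : ℕ → RowHash w) (k : ℕ) (s : Conf box)
    (ι : ℕ → (box false).St) : Prop where
  params : Params P s.mem
  guard : s.mem 53 = BitVec.ofNat w k
  rows : Rows P H (fun _ _ => 0#w) s.mem
  inst : ∀ j < P.N * P.B, k ≤ j → s.inst false j = some (ι j)
  slots : s.slots false ≤ P.N * P.B
  slots_total : s.slots true = 0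
  top : s.top ≤ P.top
  ok : s.ok = true
  setup : s.setup = true

theorem refines_init (hf : P.Fits w) {fuel k : ℕ} (hk : k < P.N * P.B) {s : Conf box}
    {H : ℕ → RowHash w} {ι : ℕ → (box false).St} (h : InitInv P H (k + 1) s ι) :
    (Prog.exec fuel (.blk [op sub 53 53 5] (.boxNew false 53)) (s.tick 1)).Refines
      (initStep (box false) k ι) (InitInv P H k) := by
  rw [Prog.exec_blk]
  set s0 := (s.tick 1).after [op sub 53 53 5] with hs0
  have m53 : s0.mem 53 = BitVec.ofNat w k := by
    simp [hs0, Conf.after, Conf.tick, runs_eq_back, WordOp.eval, h.guard,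
      h.params.c5, ofNat_succ_sub_one]
  have hsu : s0.setup = true := h.setup
  have htop : s0.top ≤ P.top := Conf.top_after_le _ _ _ h.top fun i hi => by
    have := P.le_top
    have : i.dest < 64 := by revert i; decide
    omega
  rw [Prog.exec, if_pos hsu, m53, toNat_ofNat_of_lt (hk.trans hf.inst_lt)]
  refine PMF.Refines.map_map _ fun x => ⟨?_, ?_, ?_, ?_, ?_, ?_, ?_, ?_, ?_⟩
  · exact h.params.runs (is := [op sub 53 53 5]) (by decide)
  · exact m53
  · exact h.rows.runs (is := [op sub 53 53 5]) (by decide)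
  · intro j hj hkj
    simp only [Conf.setInst, Function.update_self]
    by_cases hjk : j = k
    · subst hjk; simp
    · rw [Function.update_of_ne hjk, Function.update_of_ne hjk]
      exact h.inst j hj (by omega)
  · simp only [Conf.setInst, Function.update_self]
    exact max_le h.slots hk
  · simp only [Conf.setInst]
    rw [Function.update_of_ne (by decide)]
    exact h.slots_total
  · exact htop
  · exact h.ok
  · exact h.setup

/-- The outcome of the set-up: the random words of the rows and the states of the black boxes. -/
noncomputable def setupLaw (P : Layout) (box : Bool → Estimator w n) :
    PMF ((ℕ → RowHash w) × (ℕ → (box false).St) × (box true).St) :=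
  (PMF.iter (drawStep w) P.N fun _ => ⟨0, 0, 0, 0⟩).bind fun H =>
    (PMF.iter (initStep (box false)) (P.N * P.B) fun _ _ => 0).bind fun ι =>
      (box true).init.map fun σ => (H, ι, σ)

/-- The machine after the set-up matches independent random words and fresh instances, with all
counters zero. -/
theorem refines_start {n' q D fuel : ℕ} {input : Fin 5 → ℕ} (h0 : input 0 = n') (h3 : input 3 = q)
    (h4 : input 4 = D) (hf : SetupFits n' q D w) (hfuel : 2 ^ w ≤ fuel) (tot : ℕ) :
    (algorithm.start box fuel input).Refines (setupLaw (layout n' q D) box)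
      fun s x => Between (layout n' q D) x.1 (fun _ _ => 0#w) tot s x.2 := by
  rw [StreamProg.start]
  set s0 := ((((Conf.empty box).write 0 (BitVec.ofNat w (input 0))).write 1
      (BitVec.ofNat w (input 1))).write 2 (BitVec.ofNat w (input 2))).write 3
      (BitVec.ofNat w (input 3)) |>.write 4 (BitVec.ofNat w (input 4)) with hs0
  set P := layout n' q D with hP
  have hN : P.N < 2 ^ w := hf.fits.N_lt
  obtain ⟨s1, e1, p1, g1, f1, r1⟩ := exec_paramProg (box := box) hf hfuel
    (.seq (.whileNZ 53 drawProg) <| .blk [op mul 53 9 10] <|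
      .seq (.whileNZ 53 (.blk [op sub 53 53 5] (.boxNew false 53))) <| .boxNew true 16)
    (s := s0) (by simp [hs0, Conf.write, h0]) (by simp [hs0, Conf.write, h3])
    (by simp [hs0, Conf.write, h4])
  have hz : ∀ a, 64 ≤ a → s1.mem a = 0#w := by
    intro a ha
    rw [f1 a ha]
    simp [hs0, Conf.write, Conf.empty, show a ≠ 0 by omega,
      show a ≠ 1 by omega, show a ≠ 2 by omega, show a ≠ 3 by omega, show a ≠ 4 by omega]
  have hle := P.le_top
  have hinv : DrawInv P P.N s1 fun _ => ⟨0, 0, 0, 0⟩ :=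
    ⟨p1, g1, fun t h1 h2 => by omega, fun t h1 h2 => by omega, fun t h1 h2 => by omega,
      fun t h1 h2 => by omega, fun t ht b hb => hz _ (by have := P.le_row t; omega),
      by rw [r1.slots]; rfl, (r1.top (by simp [hs0, Conf.write, Conf.empty])).trans hle,
      by rw [r1.ok]; rfl, by rw [r1.setup]; rfl⟩
  refine PMF.Refines.map_left (r := fun s x => Between P x.1 (fun _ _ => 0#w) tot s.endSetup x.2) ?_
    fun s x hx => hx
  change (Prog.exec fuel setupProg s0).Refines _ _
  rw [setupProg, e1, Prog.exec_seq, setupLaw]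
  refine (Prog.refines_whileNZ (I := DrawInv P) (fun k s b hk => hk.guard)
    (fun k hk s b hs => refines_draw hf.fits hk hs) hN (hN.trans_le hfuel) hinv).bind ?_
  rintro s2 H ⟨s2, hs, rfl⟩
  rw [Prog.exec_blk, Prog.exec_seq]
  have hinv2 : InitInv P H (P.N * P.B) ((s2.tick 1).after [op mul 53 9 10]) (fun _ _ => 0) := by
    refine ⟨hs.params.runs (is := [op mul 53 9 10]) (by decide), ?_, ?_, fun j h1 h2 => by omega,
      ?_, ?_, Conf.top_after_le _ _ _ hs.top fun i hi => ?_, hs.ok, hs.setup⟩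
    · simp [Conf.after, Conf.tick, runs_eq_back, WordOp.eval, hs.params.c9,
        hs.params.c10, ofNat_mul_ofNat]
    · exact Rows.runs (is := [op mul 53 9 10]) ⟨fun t ht => hs.a t ht (Nat.zero_le _),
        fun t ht => hs.b t ht (Nat.zero_le _), fun t ht => hs.c t ht (Nat.zero_le _),
        fun t ht => hs.d t ht (Nat.zero_le _), hs.cnt⟩ (by decide)
    · change s2.slots false ≤ _
      rw [hs.slots]; exact Nat.zero_le _
    · change s2.slots true = _
      rw [hs.slots]
    · have : i.dest < 64 := by revert i; decide
      omega
  refine (Prog.refines_whileNZ (I := InitInv P H) (fun k s b hk => hk.guard)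
    (fun k hk s b hs => refines_init hf.fits hk hs) hf.fits.inst_lt
    (hf.fits.inst_lt.trans_le hfuel) hinv2).bind ?_
  rintro s3 ι ⟨s3, hs, rfl⟩
  rw [Prog.exec, if_pos (show (s3.tick 1).setup = true from hs.setup)]
  have h16 : ((s3.tick 1).mem 16).toNat = 0 := by
    change (s3.mem 16).toNat = 0
    rw [hs.params.c16]; rfl
  rw [h16]
  refine PMF.Refines.map_map _ fun x => ⟨⟨hs.params, hs.rows, ?_, ?_, ?_, ?_, hs.top, hs.ok⟩, ?_⟩
  · intro j hj
    simp only [Conf.endSetup, Conf.setInst]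
    rw [Function.update_of_ne (by decide)]
    exact hs.inst j hj (Nat.zero_le _)
  · simp [Conf.endSetup, Conf.setInst]
  · simp only [Conf.endSetup, Conf.setInst]
    rw [Function.update_of_ne (by decide)]
    exact hs.slots
  · simp only [Conf.endSetup, Conf.setInst, Function.update_self]
    exact max_le (hs.slots_total.le.trans zero_le_one) le_rfl
  · exact Nat.zero_le _

end HeavyHitters

/-! ### The descent in the tree of nodes -/

open scoped ENNReal

namespace HeavyHitters

open Instr WordOp

variable {w n : ℕ} {box : Bool → Estimator w n} {P : Layout}
  {H : ℕ → RowHash w} {cn : ℕ → ℕ → BitVec w} {ι : ℕ → (box false).St} {σ : (box true).St}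
  {s : Conf box}

theorem exec_boxReport_false {fuel a b c j : ℕ} (h : Core P H cn ι σ s) (hj : j < P.N * P.B)
    (ha : (s.mem a).toNat = j) :
    Prog.exec fuel (.boxReport false a b c) s = ((box false).report (ι j)).map fun r =>
      ((s.tick (box false).repTime).write b r.1).write c r.2 := by
  simp only [Prog.exec, ha, h.inst j hj]

theorem exec_boxReport_true {fuel a b c : ℕ} (h : Core P H cn ι σ s)
    (ha : (s.mem a).toNat = 0) :
    Prog.exec fuel (.boxReport true a b c) s = ((box true).report σ).map fun r =>
      ((s.tick (box true).repTime).write b r.1).write c r.2 := by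
  simp only [Prog.exec, ha, h.total]

/-- The bucket of node `v` in row `t`. -/
def nodeBucket (P : Layout) (H : ℕ → RowHash w) (t v : ℕ) : ℕ :=
  ((H t).bucket (w - P.l) (BitVec.ofNat w v)).toNat

theorem nodeBucket_lt (hl : P.l < w) (t v : ℕ) : nodeBucket P H t v < P.B :=
  (H t).bucket_lt hl _

/-- Whether an answer of the black box exceeds the threshold. -/
def Accepts (q : ℕ) (thr : BitVec w) (r : BitVec w × BitVec w) : Prop :=
  thr.toNat ≤ (fixedPoint r.1 r.2 * BitVec.ofNat w (50 * q)).toNat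

instance (q : ℕ) (thr : BitVec w) (r : BitVec w × BitVec w) : Decidable (Accepts q thr r) := by
  unfold Accepts; infer_instance

/-- Query row `r` of level `s` about node `v`, and count the acceptances. -/
noncomputable def testStep (P : Layout) (H : ℕ → RowHash w) (E : Estimator w n) (ι : ℕ → E.St)
    (thr : BitVec w) (s v r c : ℕ) : PMF ℕ :=
  (E.report (ι ((s * P.R + r) * P.B + nodeBucket P H (s * P.R + r) v))).map fun a =>
    if Accepts P.q thr a then c + 1 else c

/-- The cells and lists that a test leaves unchanged. -/
def TestFrame (P : Layout) (m m' : ℕ → BitVec w) : Prop :=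
  ∀ a, (50 ≤ a ∧ a ≤ 56) ∨ a = 59 ∨ a = 21 ∨ P.list 0 ≤ a → m' a = m a

/-- The invariant while the rows of level `lev` are queried about node `v`. -/
structure TestInv (P : Layout) (H : ℕ → RowHash w) (cn : ℕ → ℕ → BitVec w)
    (ι : ℕ → (box false).St) (σ : (box true).St) (m : ℕ → BitVec w) (lev v tot : ℕ)
    (k : ℕ) (s : Conf box) (c : ℕ) : Prop where
  core : Core P H cn ι σ s
  guard : s.mem 57 = BitVec.ofNat w k
  count : s.mem 58 = BitVec.ofNat w c
  node : s.mem 21 = BitVec.ofNat w v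
  base : s.mem 59 = BitVec.ofNat w (lev * P.R)
  frame : TestFrame P m s.mem
  le : k ≤ P.R
  c_le : c + k ≤ P.R
  time : s.time + k * (40 + (box false).repTime) ≤ tot

theorem level_row_lt {lev r : ℕ} (hl : lev < P.L) (hr : r < P.R) : lev * P.R + r < P.N := by
  unfold Layout.N
  calc lev * P.R + r < lev * P.R + P.R := by omega
    _ = (lev + 1) * P.R := by ring
    _ ≤ P.L * P.R := Nat.mul_le_mul_right _ hl

/-- One pass of the loop over the rows that votes on a node. -/
theorem refines_rowTest (hf : P.Fits w) {fuel : ℕ} {m : ℕ → BitVec w} {thr : BitVec w}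
    (hthr : m 50 = thr) {lev v tot k : ℕ} (hlev : lev < P.L) {c : ℕ}
    (h : TestInv P H cn ι σ m lev v tot (k + 1) s c) :
    (Prog.exec fuel rowTestProg (s.tick 1)).Refines
      (testStep P H (box false) ι thr lev v k c) (TestInv P H cn ι σ m lev v tot k) := by
  have hk : k < P.R := h.le
  have ht := level_row_lt hlev hk
  have hT := hf.top_lt
  have h64 := P.list_zero
  rw [rowTestProg, Prog.exec_blk]
  set is := [op sub 57 57 5, op add 20 59 57] ++ bucketCode with his
  have hcore := (h.core.tick 1).after (is := is) (by decide)
  set m0 := runs [op sub 57 57 5, op add 20 59 57] s.mem with hm0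
  have h20 : m0 20 = BitVec.ofNat w (lev * P.R + k) := by
    simp [hm0, runs_eq_back, WordOp.eval, h.guard, h.base, h.core.params.c5,
      ofNat_succ_sub_one, ofNat_add_ofNat]
  have h21 : m0 21 = BitVec.ofNat w v := by
    rw [← h.node]; exact runs_of_forall_ne _ _ _ (by decide)
  have h57 : m0 57 = BitVec.ofNat w k := by
    simp [hm0, runs_eq_back, WordOp.eval, h.guard, h.core.params.c5,
      ofNat_succ_sub_one]
  obtain ⟨-, -, -, h27⟩ := runs_bucketCode
    (h.core.params.runs (is := [op sub 57 57 5, op add 20 59 57]) (by decide))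
    (h.core.rows.runs (is := [op sub 57 57 5, op add 20 59 57]) (by decide)) hf ht h20
  change runs bucketCode m0 27 = BitVec.ofNat w ((lev * P.R + k) * P.B +
    ((H (lev * P.R + k)).bucket (w - P.l) (m0 21)).toNat) at h27
  rw [h21] at h27
  have hmem : ((s.tick 1).after is).mem = runs bucketCode m0 := by
    rw [hm0, ← runs_append]; rfl
  change _ = BitVec.ofNat w ((lev * P.R + k) * P.B + nodeBucket P H (lev * P.R + k) v) at h27
  rw [← hmem] at h27
  have hj := P.inst_lt' ht (nodeBucket_lt (H := H) hf.l_lt (lev * P.R + k) v)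
  have m57 : ((s.tick 1).after is).mem 57 = BitVec.ofNat w k := by
    rw [hmem, ← h57]; exact runs_of_forall_ne _ _ _ (by decide)
  have mfr : ∀ a, (50 ≤ a ∧ a ≤ 56) ∨ a = 59 ∨ a = 21 ∨ a = 58 ∨ P.list 0 ≤ a →
      ((s.tick 1).after is).mem a = s.mem a := fun a ha => runs_of_forall_ne _ _ _ fun i hi => by
    have : i.dest = 57 ∨ i.dest = 20 ∨ (22 ≤ i.dest ∧ i.dest ≤ 27) := by revert i; decide
    omega
  have htime : ((s.tick 1).after is).time = s.time + 14 := by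
    simp only [Conf.after, Conf.tick]; rfl
  generalize (s.tick 1).after is = s1 at *
  rw [Prog.exec_seq, exec_boxReport_false hcore hj
    (by rw [h27, toNat_ofNat_of_lt (hj.trans hf.inst_lt)]), PMF.bind_map, testStep,
    ← PMF.bind_pure_comp]
  refine (PMF.Refines.refl _).bind fun r _ hr => ?_
  subst hr
  simp only [Function.comp_apply]
  have hcore2 := ((hcore.tick (box false).repTime).write (a := 30) (v := r.1) (by omega)).write
    (a := 31) (v := r.2) (by omega)
  have htime2 : (((s1.tick (box false).repTime).write 30 r.1).write 31 r.2).time =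
    s.time + 14 + (box false).repTime := by rw [← htime]; rfl
  have n30 : (((s1.tick (box false).repTime).write 30 r.1).write 31 r.2).mem 30 = r.1 := by
    simp [Conf.write, Conf.tick]
  have n31 : (((s1.tick (box false).repTime).write 30 r.1).write 31 r.2).mem 31 = r.2 := by
    simp [Conf.write, Conf.tick]
  have nfr : ∀ a, a ≠ 30 → a ≠ 31 →
      (((s1.tick (box false).repTime).write 30 r.1).write 31 r.2).mem a = s1.mem a := by
    intro a h1 h2
    simp [Conf.write, Conf.tick, h1, h2]
  generalize ((s1.tick (box false).repTime).write 30 r.1).write 31 r.2 = s2 at *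
  rw [Prog.exec_blk, Prog.exec_op]
  refine PMF.Refines.pure ?_
  set is2 := fixedPointCode ++ [op mul 32 32 17, op lt 32 32 50, op sub 32 5 32] with his2
  have hcore3 := (hcore2.after (is := is2) (by decide)).after (is := [op add 58 58 32]) (by decide)
  have hfx := runs_fixedPointCode hcore2.params hf
  rw [n30, n31] at hfx
  have hfr : ∀ a, a ≠ 58 → ¬ (32 ≤ a ∧ a ≤ 36) →
      ((s2.after is2).after [op add 58 58 32]).mem a = s2.mem a := fun a h1 h2 =>
    (runs_of_forall_ne _ _ _ (by simp [Instr.dest]; omega)).trans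
      (runs_of_forall_ne _ _ _ fun i hi => by
        have : 32 ≤ i.dest ∧ i.dest ≤ 36 := by revert i; decide
        omega)
  have p5 : runs fixedPointCode s2.mem 5 = 1#w := by
    rw [← hcore2.params.c5]; exact runs_of_forall_ne _ _ _ (by decide)
  have p17 : runs fixedPointCode s2.mem 17 = BitVec.ofNat w (50 * P.q) := by
    rw [← hcore2.params.c17]; exact runs_of_forall_ne _ _ _ (by decide)
  have p50 : runs fixedPointCode s2.mem 50 = thr := by
    rw [runs_of_forall_ne _ _ _ (by decide), nfr _ (by decide) (by decide), mfr _ (by omega),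
      h.frame _ (by omega), hthr]
  have p58 : runs fixedPointCode s2.mem 58 = BitVec.ofNat w c := by
    rw [runs_of_forall_ne _ _ _ (by decide), nfr _ (by decide) (by decide), mfr _ (by omega),
      h.count]
  have q58 : ((s2.after is2).after [op add 58 58 32]).mem 58 =
      BitVec.ofNat w (if Accepts P.q thr r then c + 1 else c) := by
    change runs [op add 58 58 32] (runs is2 s2.mem) 58 = _
    rw [his2, runs_append]
    generalize runs fixedPointCode s2.mem = m' at hfx p5 p17 p50 p58
    rw [← runs_append]
    simp [runs_eq_back, WordOp.eval, hfx, p5, p17, p50, p58, -BitVec.toNat_mul,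
      -BitVec.toNat_ofNat]
    by_cases ha : Accepts P.q thr r
    · rw [if_pos ha, if_neg (by rw [not_lt]; exact ha), BitVec.ofNat_add]
      simp
    · rw [if_neg ha, if_pos (by rw [← not_le]; exact ha)]
      simp
  refine ⟨hcore3, ?_, q58, ?_, ?_, ?_, hk.le, ?_, ?_⟩
  · rw [hfr _ (by decide) (by decide), nfr _ (by decide) (by decide), m57]
  · rw [hfr _ (by decide) (by decide), nfr _ (by decide) (by decide), mfr _ (by omega), h.node]
  · rw [hfr _ (by decide) (by decide), nfr _ (by decide) (by decide), mfr _ (by omega), h.base]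
  · intro a ha
    rw [hfr _ (by omega) (by omega), nfr _ (by omega) (by omega), mfr _ (by omega), h.frame a ha]
  · have := h.c_le
    split_ifs <;> omega
  · have h2 := h.time
    have : ((s2.after is2).after [op add 58 58 32]).time = s2.time + 16 := by
      simp only [Conf.after]; rfl
    rw [this, htime2]
    linarith

/-- The number of rows of level `s` that accept the node `v`. -/
noncomputable def testCount (P : Layout) (H : ℕ → RowHash w) (E : Estimator w n) (ι : ℕ → E.St)
    (thr : BitVec w) (s v : ℕ) : PMF ℕ :=
  PMF.iter (testStep P H E ι thr s v) P.R 0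

/-- The `k`-th child of the nodes in a list. -/
def child (cur : List ℕ) (k : ℕ) : ℕ := 2 * cur.getD (k / 2) 0 + k % 2

/-- Test a child of a node in the list `cur`, and add it to the list `new` if most rows accept. -/
noncomputable def nodeStep (P : Layout) (H : ℕ → RowHash w) (E : Estimator w n) (ι : ℕ → E.St)
    (thr : BitVec w) (s : ℕ) (cur : List ℕ) (k : ℕ) (new : List ℕ) : PMF (List ℕ) :=
  (testCount P H E ι thr s (child cur k)).map fun c =>
    if P.R < 2 * c ∧ new.length < P.q then new ++ [child cur k] else new

/-- An array in memory. -/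
def HasList (m : ℕ → BitVec w) (a : ℕ) (x : List ℕ) : Prop :=
  ∀ i < x.length, m (a + i) = BitVec.ofNat w (x.getD i 0)

/-- The cost of testing a node. -/
def nodeCost (P : Layout) (E : Estimator w n) : ℕ := P.R * (40 + E.repTime) + 30

/-- The invariant while the children of the nodes in `cur` are tested. -/
structure NodeInv (P : Layout) (H : ℕ → RowHash w) (cn : ℕ → ℕ → BitVec w)
    (ι : ℕ → (box false).St) (σ : (box true).St) (thr : BitVec w) (lev : ℕ) (cur : List ℕ) (tot : ℕ)
    (k : ℕ) (s : Conf box) (new : List ℕ) : Prop where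
  core : Core P H cn ι σ s
  thr : s.mem 50 = thr
  level : s.mem 52 = BitVec.ofNat w lev
  guard : s.mem 53 = BitVec.ofNat w k
  newLen : s.mem 54 = BitVec.ofNat w new.length
  curAddr : s.mem 55 = BitVec.ofNat w (P.list (lev + 1))
  newAddr : s.mem 56 = BitVec.ofNat w (P.list lev)
  base : s.mem 59 = BitVec.ofNat w (lev * P.R)
  curList : HasList s.mem (P.list (lev + 1)) cur
  newList : HasList s.mem (P.list lev) new
  curLen_le : cur.length ≤ P.q
  newLen_le : new.length ≤ P.q
  le : k ≤ 2 * cur.length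
  time : s.time + k * nodeCost P (box false) ≤ tot

/-- One pass of the loop over the children of the current list. -/
theorem refines_node (hf : P.Fits w) {fuel : ℕ} (hfuel : 2 ^ w ≤ fuel) {thr : BitVec w}
    {lev tot k : ℕ} (hlev : lev < P.L) {cur new : List ℕ}
    (h : NodeInv P H cn ι σ thr lev cur tot (k + 1) s new) :
    (Prog.exec fuel nodeProg (s.tick 1)).Refines
      (nodeStep P H (box false) ι thr lev cur k new) (NodeInv P H cn ι σ thr lev cur tot k) := by
  have hT := hf.top_lt
  have h64 := P.list_zero
  have hcl := h.curLen_le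
  have hle := h.le
  have hout : P.out ≤ P.top := Nat.le_add_right _ _
  have htop : P.top = P.out + 3 * P.q := rfl
  have hw1 : 1 < 2 ^ w := by have := P.le_top; omega
  have hk2 : k / 2 < cur.length := by omega
  have hadr : P.list (lev + 1) + k / 2 < P.out := P.list_add_lt_out hlev (by omega)
  have hge : 64 ≤ P.list (lev + 1) := by
    have := P.list_mono (Nat.zero_le (lev + 1)); omega
  have hge' : P.list 0 ≤ P.list lev := P.list_mono (Nat.zero_le lev)
  rw [nodeProg, Prog.exec_blk]
  set is := [op sub 53 53 5, op shr 21 53 5, op add 22 55 21, load 22 22, op add 21 21 21,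
    op sub 21 53 21, op add 22 22 22, op add 21 21 22, op add 57 7 16, const 58 0] with his
  have hcore := (h.core.tick 1).after (is := is) (by decide)
  have e1 : (1#w).toNat = 1 := toNat_ofNat_of_lt hw1
  have e2 : BitVec.ofNat w k >>> 1 = BitVec.ofNat w (k / 2) := by
    rw [← BitVec.toNat_inj, BitVec.toNat_ushiftRight, toNat_ofNat_of_lt (by omega),
      toNat_ofNat_of_lt (by omega), Nat.shiftRight_eq_div_pow, pow_one]
  have e3 : (BitVec.ofNat w (P.list (lev + 1) + k / 2)).toNat = P.list (lev + 1) + k / 2 :=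
    toNat_ofNat_of_lt (by omega)
  have e4 : BitVec.ofNat w k - BitVec.ofNat w (k / 2 + k / 2) = BitVec.ofNat w (k % 2) := by
    have h1 : BitVec.ofNat w k = BitVec.ofNat w (k % 2) + BitVec.ofNat w (k / 2 + k / 2) := by
      rw [ofNat_add_ofNat]; congr 1; omega
    rw [h1]
    exact add_sub_cancel_right _ _
  have e5 : 64 ≤ P.list (lev + 1) + k / 2 := by omega
  have m21 : ((s.tick 1).after is).mem 21 = BitVec.ofNat w (child cur k) := by
    set m0 := runs [op sub 53 53 5, op shr 21 53 5, op add 22 55 21, load 22 22] s.mem with hm0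
    have x53 : m0 53 = BitVec.ofNat w k := by
      simp [hm0, runs_eq_back, WordOp.eval, h.guard, h.core.params.c5,
        ofNat_succ_sub_one]
    have x21 : m0 21 = BitVec.ofNat w (k / 2) := by
      simp [hm0, runs_eq_back, WordOp.eval, h.guard, h.core.params.c5,
        ofNat_succ_sub_one, e1, e2, -BitVec.toNat_ofNat]
    have x22 : m0 22 = BitVec.ofNat w (cur.getD (k / 2) 0) := by
      simp [hm0, runs_eq_back, WordOp.eval, h.guard, h.curAddr,
        h.core.params.c5, ofNat_succ_sub_one, e1, e2, ofNat_add_ofNat, e3, back_far, Instr.dest, e5,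
        h.curList _ hk2, -BitVec.toNat_ofNat]
    change runs [op add 21 21 21, op sub 21 53 21, op add 22 22 22, op add 21 21 22, op add 57 7 16,
      const 58 0] m0 21 = _
    clear_value m0
    simp [runs_eq_back, WordOp.eval, x53, x21, x22, e4, ofNat_add_ofNat, child]
    congr 1
    ring
  have m53 : ((s.tick 1).after is).mem 53 = BitVec.ofNat w k := by
    have x53 : runs [op sub 53 53 5] s.mem 53 = BitVec.ofNat w k := by
      simp [runs_eq_back, WordOp.eval, h.guard, h.core.params.c5,
        ofNat_succ_sub_one]
    rw [← x53]
    exact runs_of_forall_ne [op shr 21 53 5, op add 22 55 21, load 22 22, op add 21 21 21,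
      op sub 21 53 21, op add 22 22 22, op add 21 21 22, op add 57 7 16, const 58 0] _ 53 (by decide)
  set m8 := runs [op sub 53 53 5, op shr 21 53 5, op add 22 55 21, load 22 22, op add 21 21 21,
    op sub 21 53 21, op add 22 22 22, op add 21 21 22] s.mem with hm8
  have hp8 : Params P m8 := h.core.params.runs (by decide)
  have hm : ((s.tick 1).after is).mem = runs [op add 57 7 16, const 58 0] m8 := rfl
  have m57 : ((s.tick 1).after is).mem 57 = BitVec.ofNat w P.R := by
    rw [hm]
    clear_value m8
    simp [runs_eq_back, WordOp.eval, hp8.c7, hp8.c16]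
  have m58 : ((s.tick 1).after is).mem 58 = BitVec.ofNat w 0 := by
    rw [hm]
    clear_value m8
    simp [runs_eq_back]
  clear hm hp8 hm8
  clear m8
  have mfr : ∀ a, (50 ≤ a ∧ a ≤ 56 ∧ a ≠ 53) ∨ a = 59 ∨ P.list 0 ≤ a →
      ((s.tick 1).after is).mem a = s.mem a := fun a ha => runs_of_forall_ne _ _ _ fun i hi => by
    have : i.dest = 53 ∨ i.dest = 21 ∨ i.dest = 22 ∨ i.dest = 57 ∨ i.dest = 58 := by
      revert i; decide
    omega
  have htime : ((s.tick 1).after is).time = s.time + 11 := by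
    simp only [Conf.after, Conf.tick]; rfl
  generalize (s.tick 1).after is = s1 at *
  have hRw : P.R < 2 ^ w := by have := hf.two_R; omega
  have hinv : TestInv P H cn ι σ s1.mem lev (child cur k)
      (s.time + 11 + P.R * (40 + (box false).repTime)) P.R s1 0 :=
    ⟨hcore, m57, m58, m21, by rw [mfr _ (by omega), h.base], fun _ _ => rfl, le_rfl, by omega,
      by rw [htime]⟩
  have hm50 : s1.mem 50 = thr := by rw [mfr _ (by omega), h.thr]
  rw [Prog.exec_seq, nodeStep, ← PMF.bind_pure_comp]
  refine (Prog.refines_whileNZ (I := TestInv P H cn ι σ s1.mem lev (child cur k) _)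
    (fun k s b hk => hk.guard) (fun k hk s b hs => refines_rowTest hf hm50 hlev hs) hRw
    (hRw.trans_le hfuel) hinv).bind ?_
  rintro s2 c ⟨s2, hs, rfl⟩
  have hc : c ≤ P.R := by have := hs.c_le; omega
  simp only [Function.comp_apply]
  rw [Prog.exec_blk]
  set is2 := [op add 58 58 58, op lt 58 7 58, op lt 22 54 6, op add 23 56 54] with his2
  have hcore2 := (hs.core.tick 1).after (is := is2) (by decide)
  have f54 : s2.mem 54 = BitVec.ofNat w new.length := by
    rw [hs.frame _ (by omega), mfr _ (by omega), h.newLen]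
  have f56 : s2.mem 56 = BitVec.ofNat w (P.list lev) := by
    rw [hs.frame _ (by omega), mfr _ (by omega), h.newAddr]
  have hnl := h.newLen_le
  have htR := hf.two_R
  have a1 : (BitVec.ofNat w P.R).toNat = P.R := toNat_ofNat_of_lt hRw
  have a2 : (BitVec.ofNat w (c + c)).toNat = c + c := toNat_ofNat_of_lt (by omega)
  have a3 : (BitVec.ofNat w new.length).toNat = new.length := toNat_ofNat_of_lt (by omega)
  have a4 : (BitVec.ofNat w P.q).toNat = P.q := toNat_ofNat_of_lt (by omega)
  have g58 : ((s2.tick 1).after is2).mem 58 = if P.R < 2 * c then 1#w else 0#w := by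
    simp [his2, Conf.after, Conf.tick, runs_eq_back, WordOp.eval, hs.count,
      hs.core.params.c7, ofNat_add_ofNat, a1, a2, -BitVec.toNat_ofNat]
    rw [two_mul]
  have g22 : ((s2.tick 1).after is2).mem 22 = if new.length < P.q then 1#w else 0#w := by
    simp [his2, Conf.after, Conf.tick, runs_eq_back, WordOp.eval, f54,
      hs.core.params.c6, a3, a4, -BitVec.toNat_ofNat]
  have g23 : ((s2.tick 1).after is2).mem 23 = BitVec.ofNat w (P.list lev + new.length) := by
    simp [his2, Conf.after, Conf.tick, runs_eq_back, WordOp.eval, f54, f56,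
      ofNat_add_ofNat]
  have gfr : ∀ a, (50 ≤ a ∧ a ≤ 56) ∨ a = 59 ∨ a = 21 ∨ P.list 0 ≤ a →
      ((s2.tick 1).after is2).mem a = s1.mem a := fun a ha => by
    rw [← hs.frame a ha]
    exact runs_of_forall_ne _ _ _ fun i hi => by
      have : i.dest = 58 ∨ i.dest = 22 ∨ i.dest = 23 := by revert i; decide
      omega
  have gtime : ((s2.tick 1).after is2).time = s2.time + 5 := by
    simp only [Conf.after, Conf.tick]; rfl
  have hst := hs.time
  generalize (s2.tick 1).after is2 = s3 at *
  have hlo : P.list lev + new.length < P.out := P.list_add_lt_out hlev.le hnl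
  rw [Prog.exec_seq, Prog.exec_store, PMF.pure_bind, g23, toNat_ofNat_of_lt (by omega),
    Prog.exec_blk, Prog.exec_op]
  refine PMF.Refines.pure ?_
  have hcore4 := (((hcore2.tick 1).write (a := P.list lev + new.length) (v := s3.mem 21)
    (by omega)).after (is := [op mul 58 58 22]) (by decide)).after (is := [op add 54 54 58])
      (by decide)
  set s4 := ((s3.tick 1).write (P.list lev + new.length) (s3.mem 21)).after [op mul 58 58 22]
    with hs4
  have g54 : s3.mem 54 = BitVec.ofNat w new.length := by
    rw [gfr _ (by omega), mfr _ (by omega), h.newLen]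
  have z54 : (s4.after [op add 54 54 58]).mem 54 = BitVec.ofNat w
      (if P.R < 2 * c ∧ new.length < P.q then new ++ [child cur k] else new).length := by
    simp [hs4, Conf.after, Conf.tick, Conf.write, runs_eq_back, WordOp.eval, g58,
      g22, g54, show 58 ≠ P.list lev + new.length by omega,
      show 54 ≠ P.list lev + new.length by omega, show 22 ≠ P.list lev + new.length by omega]
    by_cases h1 : P.R < 2 * c <;> by_cases h2 : new.length < P.q <;>
      simp [h1, h2, BitVec.ofNat_add]
  have zfr : ∀ a, a ≠ 54 → a ≠ 58 → a ≠ P.list lev + new.length →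
      (s4.after [op add 54 54 58]).mem a = s3.mem a := fun a h1 h2 h3 => by
    simp [hs4, Conf.after, Conf.tick, Conf.write, runs_eq_back, h1, h2, h3]
  have zad : (s4.after [op add 54 54 58]).mem (P.list lev + new.length) =
      BitVec.ofNat w (child cur k) := by
    rw [← m21, ← gfr 21 (by omega)]
    simp [hs4, Conf.after, Conf.tick, Conf.write, runs_eq_back,
      show P.list lev + new.length ≠ 54 by omega, show P.list lev + new.length ≠ 58 by omega]
  have ztime : (s4.after [op add 54 54 58]).time = s3.time + 3 := by
    simp only [hs4, Conf.after, Conf.tick, Conf.write]; rfl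
  generalize s4.after [op add 54 54 58] = s5 at *
  have hsucc := P.list_succ lev
  refine ⟨hcore4, ?_, ?_, ?_, z54, ?_, ?_, ?_, ?_, ?_, hcl, ?_, by omega, ?_⟩
  · rw [zfr _ (by omega) (by omega) (by omega), gfr _ (by omega), hm50]
  · rw [zfr _ (by omega) (by omega) (by omega), gfr _ (by omega), mfr _ (by omega), h.level]
  · rw [zfr _ (by omega) (by omega) (by omega), gfr _ (by omega), m53]
  · rw [zfr _ (by omega) (by omega) (by omega), gfr _ (by omega), mfr _ (by omega), h.curAddr]
  · rw [zfr _ (by omega) (by omega) (by omega), gfr _ (by omega), mfr _ (by omega), h.newAddr]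
  · rw [zfr _ (by omega) (by omega) (by omega), gfr _ (by omega), mfr _ (by omega), h.base]
  · intro i hi
    rw [zfr _ (by omega) (by omega) (by omega), gfr _ (by omega), mfr _ (by omega),
      h.curList i hi]
  · have hold : ∀ i < new.length, s5.mem (P.list lev + i) = BitVec.ofNat w (new.getD i 0) := by
      intro i hi
      rw [zfr _ (by omega) (by omega) (by omega), gfr _ (by omega), mfr _ (by omega),
        h.newList i hi]
    split_ifs with hcond
    · intro i hi
      rw [List.length_append, List.length_singleton] at hi
      by_cases hin : i < new.length
      · rw [hold i hin, List.getD_append _ _ _ _ hin]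
      · obtain rfl : i = new.length := by omega
        rw [zad, List.getD_append_right _ _ _ _ le_rfl]
        simp
    · exact hold
  · split_ifs with hcond
    · rw [List.length_append, List.length_singleton]; omega
    · exact hnl
  · have h2 := h.time
    rw [ztime, gtime]
    unfold nodeCost at *
    have : (k + 1) * (P.R * (40 + (box false).repTime) + 30) =
      k * (P.R * (40 + (box false).repTime) + 30) + P.R * (40 + (box false).repTime) + 30 := by ring
    omega

/-- The list of nodes of a level, computed from that of the previous level. -/
noncomputable def levelStep (P : Layout) (H : ℕ → RowHash w) (E : Estimator w n) (ι : ℕ → E.St)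
    (thr : BitVec w) (s : ℕ) (cur : List ℕ) : PMF (List ℕ) :=
  PMF.iter (nodeStep P H E ι thr s cur) (2 * cur.length) []

/-- The cost of a level. -/
def levelCost (P : Layout) (E : Estimator w n) : ℕ := 2 * P.q * nodeCost P E + 15

/-- The invariant between levels. -/
structure LevelInv (P : Layout) (H : ℕ → RowHash w) (cn : ℕ → ℕ → BitVec w)
    (ι : ℕ → (box false).St) (σ : (box true).St) (thr : BitVec w) (tot : ℕ)
    (k : ℕ) (s : Conf box) (cur : List ℕ) : Prop where
  core : Core P H cn ι σ s
  thr : s.mem 50 = thr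
  len : s.mem 51 = BitVec.ofNat w cur.length
  level : s.mem 52 = BitVec.ofNat w k
  list : HasList s.mem (P.list k) cur
  len_le : cur.length ≤ P.q
  le : k ≤ P.L
  time : s.time + k * levelCost P (box false) ≤ tot

/-- The address computations at the start of a level. -/
def levelCode : List Instr :=
  [op sub 52 52 5, op add 53 51 51, op mul 56 52 18, op add 56 56 14, op add 55 56 18,
    const 54 0, op mul 59 52 7]

theorem runs_levelCode {m : ℕ → BitVec w} (hP : Params P m) {k j : ℕ}
    (h51 : m 51 = BitVec.ofNat w j) (h52 : m 52 = BitVec.ofNat w (k + 1)) :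
    runs levelCode m 52 = BitVec.ofNat w k ∧ runs levelCode m 53 = BitVec.ofNat w (2 * j) ∧
    runs levelCode m 54 = BitVec.ofNat w 0 ∧
    runs levelCode m 55 = BitVec.ofNat w (P.list (k + 1)) ∧
    runs levelCode m 56 = BitVec.ofNat w (P.list k) ∧
    runs levelCode m 59 = BitVec.ofNat w (k * P.R) := by
  have e1 : k * (P.q + 1) + P.list 0 = P.list k := by
    simp only [Layout.list]; ring
  have e2 : P.list k + (P.q + 1) = P.list (k + 1) := by rw [P.list_succ]; ring
  refine ⟨?_, ?_, ?_, ?_, ?_, ?_⟩ <;>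
    simp [levelCode, runs_eq_back, WordOp.eval, h51, h52, hP.c5, hP.c7, hP.c14, hP.c18,
      ofNat_succ_sub_one, ofNat_add_ofNat, ofNat_mul_ofNat, e1, e2, two_mul]

/-- One pass of the loop over the levels. -/
theorem refines_level (hf : P.Fits w) {fuel : ℕ} (hfuel : 2 ^ w ≤ fuel) {thr : BitVec w}
    {tot k : ℕ} {cur : List ℕ} (h : LevelInv P H cn ι σ thr tot (k + 1) s cur) :
    (Prog.exec fuel levelProg (s.tick 1)).Refines
      (levelStep P H (box false) ι thr k cur) (LevelInv P H cn ι σ thr tot k) := by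
  have hT := hf.top_lt
  have h64 := P.list_zero
  have hlev : k < P.L := h.le
  have hout : P.out ≤ P.top := Nat.le_add_right _ _
  have htop : P.top = P.out + 3 * P.q := rfl
  have hlen := h.len_le
  have hge : P.list 0 ≤ P.list (k + 1) := P.list_mono (Nat.zero_le _)
  rw [levelProg, Prog.exec_blk]
  change (Prog.exec fuel _ ((s.tick 1).after levelCode)).Refines _ _
  have hcore := (h.core.tick 1).after (is := levelCode) (by decide)
  obtain ⟨m52, m53, m54, m55, m56, m59⟩ := runs_levelCode h.core.params h.len h.level
  have hfr : ∀ a, a = 50 ∨ P.list 0 ≤ a → ((s.tick 1).after levelCode).mem a = s.mem a := fun a ha =>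
    runs_of_forall_ne _ _ _ fun i hi => by
      have : 52 ≤ i.dest ∧ i.dest ≤ 59 := by revert i; decide
      omega
  have hinv : NodeInv P H cn ι σ thr k cur (s.time + 8 + 2 * cur.length * nodeCost P (box false))
      (2 * cur.length) ((s.tick 1).after levelCode) [] := by
    refine ⟨hcore, ?_, ?_, ?_, ?_, ?_, ?_, ?_, ?_, ?_, hlen, Nat.zero_le _, le_rfl, le_of_eq ?_⟩
    · rw [hfr _ (.inl rfl), h.thr]
    · exact m52
    · exact m53
    · exact m54
    · exact m55
    · exact m56
    · exact m59
    · intro i hi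
      rw [hfr _ (by omega), h.list i hi]
    · intro i hi
      simp at hi
    · rfl
  have hlw : 2 * cur.length < 2 ^ w := by omega
  rw [Prog.exec_seq, levelStep, ← PMF.bind_pure (PMF.iter _ _ _)]
  refine (Prog.refines_whileNZ (I := NodeInv P H cn ι σ thr k cur _)
    (fun k s b hk => hk.guard) (fun j hj s b hs => refines_node hf hfuel hlev hs) hlw
    (hlw.trans_le hfuel) hinv).bind ?_
  rintro s2 new ⟨s2, hs, rfl⟩
  rw [Prog.exec_op]
  refine PMF.Refines.pure ⟨(hs.core.tick 1).after (by decide), ?_, ?_, ?_, ?_, hs.newLen_le,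
    hlev.le, ?_⟩
  · rw [← hs.thr]; exact runs_of_forall_ne _ _ _ (by decide)
  · simp [Conf.after, Conf.tick, runs_eq_back, WordOp.eval, hs.newLen,
      hs.core.params.c16]
  · rw [← hs.level]; exact runs_of_forall_ne _ _ _ (by decide)
  · intro i hi
    have hge' : P.list 0 ≤ P.list k := P.list_mono (Nat.zero_le _)
    rw [← hs.newList i hi]
    exact runs_of_forall_ne _ _ _ (by simp [Instr.dest]; omega)
  · have h1 := hs.time
    have h2 := h.time
    have h3 : 2 * cur.length * nodeCost P (box false) ≤ 2 * P.q * nodeCost P (box false) := by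
      gcongr
    have h5 : ((s2.tick 1).after [op add 51 54 16]).time = s2.time + 2 := rfl
    rw [h5]
    have h6 : (k + 1) * levelCost P (box false) = k * levelCost P (box false) +
      2 * P.q * nodeCost P (box false) + 15 := by unfold levelCost; ring
    omega

end HeavyHitters

/-! ### Reporting -/

open scoped ENNReal

namespace HeavyHitters

open Instr WordOp

variable {w n : ℕ} {box : Bool → Estimator w n} {P : Layout}
  {H : ℕ → RowHash w} {cn : ℕ → ℕ → BitVec w} {ι : ℕ → (box false).St} {σ : (box true).St}
  {s : Conf box}

/-- The absolute value of the estimate of row `r` for the index `i`. -/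
def rowAbs (P : Layout) (H : ℕ → RowHash w) (cn : ℕ → ℕ → BitVec w) (i r : ℕ) : BitVec w :=
  absValue (H r) (counterOf P H cn r (BitVec.ofNat w i)) (BitVec.ofNat w i)

/-- The sign bit of the estimate of row `r` for the index `i`. -/
def rowSign (P : Layout) (H : ℕ → RowHash w) (cn : ℕ → ℕ → BitVec w) (i r : ℕ) : BitVec w :=
  signBit (H r) (counterOf P H cn r (BitVec.ofNat w i)) (BitVec.ofNat w i)

/-- One step of the majority vote of Boyer and Moore. The state consists of the candidate and its
weight. -/
def voteStep (ks : List ℕ) (y : BitVec w) (c : BitVec w × ℕ) : BitVec w × ℕ :=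
  if c.2 = 0 then (y, 1) else if sameCell ks y c.1 then (c.1, c.2 + 1) else (c.1, c.2 - 1)

/-- The state of the vote after the last `j` of the rows `x 0`, …, `x (R - 1)`. -/
def vote (ks : List ℕ) (x : ℕ → BitVec w) (R : ℕ) : ℕ → BitVec w × ℕ
  | 0 => (0#w, 0)
  | j + 1 => voteStep ks (x (R - (j + 1))) (vote ks x R j)

theorem vote_weight_le (ks : List ℕ) (x : ℕ → BitVec w) (R j : ℕ) : (vote ks x R j).2 ≤ j := by
  induction j with
  | zero => exact le_rfl
  | succ j ih =>
    rw [vote, voteStep]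
    split_ifs <;> simp <;> omega

/-- Go to the previous row, evaluate its estimate, and compare it with the candidate in cell `c`. -/
def rowCellCode (ks : List ℕ) (c : ℕ) : List Instr :=
  op sub 20 20 5 :: (rowValueCode ++ sameCellCode ks c)

theorem rowCellCode_dest (ks : List ℕ) (c : ℕ) :
    ∀ i ∈ rowCellCode ks c, i.dest = 20 ∨ (22 ≤ i.dest ∧ i.dest ≤ 36 ∧ i.dest ≠ 29) := by
  have h1 : ∀ i ∈ op sub 20 20 5 :: rowValueCode,
      i.dest = 20 ∨ (22 ≤ i.dest ∧ i.dest ≤ 36 ∧ i.dest ≠ 29) := by decide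
  intro i hi
  rw [rowCellCode, ← List.cons_append] at hi
  rcases List.mem_append.1 hi with hi | hi
  · exact h1 i hi
  · rw [sameCellCode] at hi
    rcases List.mem_cons.1 hi with rfl | hi
    · simp [Instr.dest]
    rcases List.mem_append.1 hi with hi | hi
    · obtain ⟨k, -, hk⟩ := List.mem_flatMap.1 hi
      simp only [gridStep, List.mem_cons, List.not_mem_nil, or_false] at hk
      rcases hk with rfl | rfl | rfl | rfl | rfl | rfl | rfl <;> simp [Instr.dest]
    · simp only [List.mem_singleton] at hi
      subst hi; simp [Instr.dest]

theorem scratch_rowCellCode (ks : List ℕ) (c : ℕ) : Scratch (rowCellCode ks c) := fun i hi => by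
  have := rowCellCode_dest ks c i hi
  omega

theorem runs_rowCellCode {m : ℕ → BitVec w} {t i c : ℕ} {ks : List ℕ} (hks : ks.length = 16)
    (hc : 40 ≤ c) (hP : Params P m) (hR : Rows P H cn m) (hf : P.Fits w) (ht : t < P.N)
    (h20 : m 20 = BitVec.ofNat w (t + 1)) (h21 : m 21 = BitVec.ofNat w i)
    (h29 : m 29 = BitVec.ofNat w i) :
    runs (rowCellCode ks c) m 20 = BitVec.ofNat w t ∧
    runs (rowCellCode ks c) m 30 = rowAbs P H cn i t ∧
    runs (rowCellCode ks c) m 31 = rowSign P H cn i t ∧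
    runs (rowCellCode ks c) m 33 = if sameCell ks (rowAbs P H cn i t) (m c) then 1#w else 0#w := by
  have hw : ks.length < 2 ^ w := by
    have := P.le_top
    have := hf.top_lt
    omega
  have hc' : c ∉ [30, 33, 34, 35, 36] := by
    simp only [List.mem_cons, List.not_mem_nil, or_false]; omega
  rw [rowCellCode, runs_cons, runs_append]
  set m0 := Instr.run m (op sub 20 20 5) with hm0
  have e0 : runs [op sub 20 20 5] m = m0 := rfl
  have x20 : m0 20 = BitVec.ofNat w t := by
    simp [hm0, Instr.run, WordOp.eval, h20, hP.c5, ofNat_succ_sub_one]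
  have x21 : m0 21 = BitVec.ofNat w i := by simp [hm0, Instr.run, h21]
  have x29 : m0 29 = BitVec.ofNat w i := by simp [hm0, Instr.run, h29]
  have xc : m0 c = m c := by simp [hm0, Instr.run, show c ≠ 20 by omega]
  have hP0 : Params P m0 := e0 ▸ hP.runs (by decide)
  have hR0 : Rows P H cn m0 := e0 ▸ hR.runs (by decide)
  obtain ⟨x30, x31⟩ := runs_rowValueCode hP0 hR0 hf ht x20 x21 x29
  have hd : ∀ i ∈ rowValueCode, i.dest ≤ 36 ∧ i.dest ≠ 20 := by decide
  have xc2 : runs rowValueCode m0 c = m c := by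
    rw [← xc]
    exact runs_of_forall_ne _ _ _ fun i hi => by have := (hd i hi).1; omega
  have x20' : runs rowValueCode m0 20 = BitVec.ofNat w t := by
    rw [← x20]; exact runs_of_forall_ne _ _ _ fun i hi => (hd i hi).2
  have hP1 : Params P (runs rowValueCode m0) := hP0.runs (by decide)
  have hd2 : ∀ i ∈ sameCellCode ks c, 33 ≤ i.dest := by
    intro i hi
    rw [sameCellCode] at hi
    rcases List.mem_cons.1 hi with rfl | hi
    · simp [Instr.dest]
    rcases List.mem_append.1 hi with hi | hi
    · obtain ⟨k, -, hk⟩ := List.mem_flatMap.1 hi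
      simp only [gridStep, List.mem_cons, List.not_mem_nil, or_false] at hk
      rcases hk with rfl | rfl | rfl | rfl | rfl | rfl | rfl <;> simp [Instr.dest]
    · simp only [List.mem_singleton] at hi
      subst hi; simp [Instr.dest]
  have hfr : ∀ a < 33, runs (sameCellCode ks c) (runs rowValueCode m0) a =
      runs rowValueCode m0 a := fun a ha =>
    runs_of_forall_ne _ _ _ fun i hi => by have := hd2 i hi; omega
  refine ⟨?_, ?_, ?_, ?_⟩
  · rw [hfr _ (by norm_num), x20']
  · rw [hfr _ (by norm_num), x30]; rfl
  · rw [hfr _ (by norm_num), x31]; rfl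
  · rw [runs_sameCellCode hc' ks hw _ hP1.c16, x30, xc2]; rfl

theorem length_rowCellCode {ks : List ℕ} (hks : ks.length = 16) (c : ℕ) :
    (rowCellCode ks c).length = 143 := by
  have h : ∀ ks : List ℕ, (ks.flatMap (gridStep c)).length = 7 * ks.length := by
    intro ks
    induction ks with
    | nil => rfl
    | cons k ks ih =>
      rw [List.flatMap_cons, List.length_append, ih, List.length_cons]
      simp only [gridStep, List.length_cons, List.length_nil]
      omega
  simp only [rowCellCode, sameCellCode, List.length_cons, List.length_append, h, hks,
    List.length_nil]
  rfl

/-- The cells that the evaluation of an index may change. -/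
def EntryFrame (m m' : ℕ → BitVec w) : Prop :=
  ∀ a, a = 21 ∨ a = 29 ∨ (50 ≤ a ∧ a < 60) ∨ 64 ≤ a → m' a = m a

/-- The invariant of the majority vote. -/
structure VoteInv (P : Layout) (H : ℕ → RowHash w) (cn : ℕ → ℕ → BitVec w)
    (ι : ℕ → (box false).St) (σ : (box true).St) (m : ℕ → BitVec w) (ks : List ℕ) (i c tot k : ℕ)
    (s : Conf box) : Prop where
  core : Core P H cn ι σ s
  guard : s.mem 20 = BitVec.ofNat w k
  node : s.mem 21 = BitVec.ofNat w i
  index : s.mem 29 = BitVec.ofNat w i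
  cand : s.mem c = (vote ks (rowAbs P H cn i) P.R (P.R - k)).1
  weight : s.mem 40 = BitVec.ofNat w (vote ks (rowAbs P H cn i) P.R (P.R - k)).2
  frame : EntryFrame m s.mem
  other : ∀ a, (a = 60 ∨ a = 61) → a ≠ c → s.mem a = m a
  le : k ≤ P.R
  time : s.time + k * 160 ≤ tot

theorem exec_voteStep (hf : P.Fits w) (hL : 0 < P.L) {fuel : ℕ} {m : ℕ → BitVec w} {ks : List ℕ}
    (hks : ks.length = 16) {i c tot k : ℕ} (hc : c = 60 ∨ c = 61)
    (h : VoteInv P H cn ι σ m ks i c tot (k + 1) s) :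
    ∃ s', Prog.exec fuel (voteStepProg ks c) (s.tick 1) = PMF.pure s' ∧
      VoteInv P H cn ι σ m ks i c tot k s' := by
  have hk : k < P.R := h.le
  have hkN : k < P.N := by simpa using level_row_lt hL hk
  set tail := [op eq 34 40 16, op sub 35 30 c, op mul 35 35 34, op add c c 35, op or 34 34 33,
      op add 34 34 34, op add 40 40 34] with htail
  have hcode : (op sub 20 20 5 :: (rowValueCode ++ (sameCellCode ks c ++ tail))) =
      rowCellCode ks c ++ tail := by simp [rowCellCode]
  rw [voteStepProg, hcode, Prog.exec_blk, Prog.exec_op]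
  refine ⟨_, rfl, ?_⟩
  have hst : Scratch tail := by rcases hc with rfl | rfl <;> decide
  have hcore := ((h.core.tick 1).after (is := rowCellCode ks c ++ tail)
    ((scratch_rowCellCode ks c).append hst)).after (is := [op sub 40 40 5]) (by decide)
  obtain ⟨x20, x30, x31, x33⟩ := runs_rowCellCode hks (show 40 ≤ c by omega) h.core.params
    h.core.rows hf hkN h.guard h.node h.index
  have hmem : (((s.tick 1).after (rowCellCode ks c ++ tail)).after [op sub 40 40 5]).mem =
      runs (tail ++ [op sub 40 40 5]) (runs (rowCellCode ks c) s.mem) := by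
    rw [runs_append, ← runs_append (rowCellCode ks c)]; rfl
  have hfr : ∀ a, a = 21 ∨ a = 29 ∨ 37 ≤ a → runs (rowCellCode ks c) s.mem a = s.mem a :=
    fun a ha => runs_of_forall_ne _ _ _ fun i hi => by
      have := rowCellCode_dest ks c i hi
      omega
  have hP1 : Params P (runs (rowCellCode ks c) s.mem) := h.core.params.runs (scratch_rowCellCode _ _)
  have htime : (((s.tick 1).after (rowCellCode ks c ++ tail)).after [op sub 40 40 5]).time =
      s.time + 152 := by
    simp only [Conf.after, Conf.tick, List.length_append, length_rowCellCode hks, htail,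
      List.length_cons, List.length_nil]
  rw [h.cand] at x33
  have hc1 := hfr c (by omega)
  have hc2 := hfr 40 (by omega)
  rw [h.cand] at hc1
  rw [h.weight] at hc2
  have y16 := hP1.c16
  have y5 := hP1.c5
  have hRk : P.R - k = P.R - (k + 1) + 1 := by omega
  have hRk' : P.R - (P.R - (k + 1) + 1) = k := by omega
  have hv : vote ks (rowAbs P H cn i) P.R (P.R - k) = voteStep ks (rowAbs P H cn i k)
      (vote ks (rowAbs P H cn i) P.R (P.R - (k + 1))) := by
    rw [hRk, vote, hRk']
  have hwt := vote_weight_le ks (rowAbs P H cn i) P.R (P.R - (k + 1))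
  have htR := hf.two_R
  generalize vote ks (rowAbs P H cn i) P.R (P.R - (k + 1)) = v at *
  generalize ((s.tick 1).after (rowCellCode ks c ++ tail)).after [op sub 40 40 5] = s1 at *
  generalize runs (rowCellCode ks c) s.mem = m1 at *
  obtain ⟨c1, c2⟩ := v
  simp only at hwt hc1 hc2 x33
  have hz : BitVec.ofNat w c2 = 0#w ↔ c2 = 0 := Prog.ofNat_eq_zero_iff (by omega)
  refine ⟨hcore, ?_, ?_, ?_, ?_, ?_, ?_, ?_, hk.le, ?_⟩
  · rw [hmem, ← x20]; exact runs_of_forall_ne _ _ _ (by rcases hc with rfl | rfl <;> decide)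
  · rw [hmem, ← h.node, ← hfr 21 (by omega)]
    exact runs_of_forall_ne _ _ _ (by rcases hc with rfl | rfl <;> decide)
  · rw [hmem, ← h.index, ← hfr 29 (by omega)]
    exact runs_of_forall_ne _ _ _ (by rcases hc with rfl | rfl <;> decide)
  · rw [hmem, hv, voteStep]
    have : runs (tail ++ [op sub 40 40 5]) m1 c = m1 c +
        (m1 30 - m1 c) * if m1 40 = m1 16 then 1#w else 0#w := by
      rcases hc with rfl | rfl <;> rfl
    rw [this, hc1, x30, hc2, y16]
    simp only [hz]
    split_ifs <;> simp
  · rw [hmem, hv, voteStep]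
    have : runs (tail ++ [op sub 40 40 5]) m1 40 = m1 40 +
        (((if m1 40 = m1 16 then 1#w else 0#w) ||| m1 33) +
          ((if m1 40 = m1 16 then 1#w else 0#w) ||| m1 33)) - m1 5 := by
      rcases hc with rfl | rfl <;> rfl
    rw [this, hc2, y16, x33, y5]
    simp only [hz]
    have one : (1#w ||| 1#w) = 1#w := BitVec.or_self
    by_cases h0 : c2 = 0
    · subst h0
      have hor : ∀ b : Bool, (1#w ||| if b then 1#w else 0#w) = 1#w := by
        intro b; cases b <;> simp
      simp only [if_true, hor]
      change 0#w + (1#w + 1#w) - 1#w = 1#w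
      simp
    · obtain ⟨d, rfl⟩ : ∃ d, c2 = d + 1 := ⟨c2 - 1, by omega⟩
      by_cases h1 : sameCell ks (rowAbs P H cn i k) c1
      · simp [h1, BitVec.ofNat_add, ← add_assoc]
      · simp [h1, BitVec.ofNat_add]
  · intro a ha
    rw [← h.frame a ha, hmem, ]
    by_cases h21 : 37 ≤ a ∨ a = 21 ∨ a = 29
    · rw [← hfr a (by omega)]
      refine runs_of_forall_ne _ _ _ ?_
      rcases hc with rfl | rfl <;> simp [htail, Instr.dest] <;> omega
    · omega
  · intro a ha hac
    rw [← h.other a ha hac, hmem, ← hfr a (by omega)]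
    refine runs_of_forall_ne _ _ _ ?_
    simp [htail, Instr.dest]; omega
  · have h2 := h.time
    rw [htime]
    omega

theorem exec_vote (hf : P.Fits w) (hL : 0 < P.L) {fuel : ℕ} (hfuel : 2 ^ w ≤ fuel) {ks : List ℕ}
    (hks : ks.length = 16) {i c : ℕ} (hc : c = 60 ∨ c = 61) (h : Core P H cn ι σ s)
    (h21 : s.mem 21 = BitVec.ofNat w i) (h29 : s.mem 29 = BitVec.ofNat w i) :
    ∃ s', Prog.exec fuel (voteProg ks c) s = PMF.pure s' ∧ Core P H cn ι σ s' ∧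
      s'.mem c = (vote ks (rowAbs P H cn i) P.R P.R).1 ∧ EntryFrame s.mem s'.mem ∧
      (∀ a, (a = 60 ∨ a = 61) → a ≠ c → s'.mem a = s.mem a) ∧
      s'.time ≤ s.time + P.R * 160 + 5 := by
  have htR := hf.two_R
  rw [voteProg, Prog.exec_blk]
  set is := [op add 20 7 16, const c 0, const 40 0] with his
  have hs : Scratch is := by rcases hc with rfl | rfl <;> decide
  have hfr : ∀ a, a ≠ 20 → a ≠ c → a ≠ 40 → (s.after is).mem a = s.mem a := fun a h1 h2 h3 => by
    refine runs_of_forall_ne _ _ _ ?_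
    simp [his, Instr.dest]; omega
  have hinv : VoteInv P H cn ι σ s.mem ks i c (s.time + 3 + P.R * 160) P.R (s.after is) := by
    refine ⟨h.after hs, ?_, ?_, ?_, ?_, ?_, ?_, ?_, le_rfl, le_of_eq ?_⟩
    · rcases hc with rfl | rfl <;>
        simp [his, Conf.after, runs_eq_back, WordOp.eval, h.params.c7, h.params.c16]
    · rw [hfr _ (by omega) (by omega) (by omega), h21]
    · rw [hfr _ (by omega) (by omega) (by omega), h29]
    · rcases hc with rfl | rfl <;> simp [his, Conf.after, runs_eq_back, vote]
    · simp [his, Conf.after, runs_eq_back, vote]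
    · exact fun a ha => hfr a (by omega) (by omega) (by omega)
    · exact fun a ha hac => hfr a (by omega) (by omega) (by omega)
    · rfl
  obtain ⟨s', e, hs'⟩ := Prog.exec_whileNZ (fuel := fuel) (body := voteStepProg ks c)
    (I := VoteInv P H cn ι σ s.mem ks i c _) (N := P.R) (fun k s hk => hk.guard)
    (fun k _ s hk => exec_voteStep hf hL hks hc hk) (by omega) (by omega) hinv
  refine ⟨_, e, hs'.core.tick 1, hs'.cand, hs'.frame, hs'.other, ?_⟩
  have := hs'.time
  simp only [Conf.tick]
  omega

end HeavyHitters

/-! ### The entries of the output -/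

open scoped ENNReal

namespace HeavyHitters

open Instr WordOp

variable {w n : ℕ} {box : Bool → Estimator w n} {P : Layout}
  {H : ℕ → RowHash w} {cn : ℕ → ℕ → BitVec w} {ι : ℕ → (box false).St} {σ : (box true).St}
  {s : Conf box}

/-- The number of the rows `k, …, R - 1` whose value lies in the same cell of the grid as `c`. -/
def cellCount (ks : List ℕ) (x : ℕ → BitVec w) (c : BitVec w) (R k : ℕ) : ℕ :=
  ∑ r ∈ Finset.Ico k R, if sameCell ks (x r) c then 1 else 0

/-- The number of ones among the bits `x k, …, x (R - 1)`. -/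
def signCount (x : ℕ → BitVec w) (R k : ℕ) : ℕ := ∑ r ∈ Finset.Ico k R, (x r).toNat

/-- The invariant of the loop that counts the members of a cell and the sign bits. -/
structure CountInv (P : Layout) (H : ℕ → RowHash w) (cn : ℕ → ℕ → BitVec w)
    (ι : ℕ → (box false).St) (σ : (box true).St) (m : ℕ → BitVec w) (i tot k : ℕ)
    (s : Conf box) : Prop where
  core : Core P H cn ι σ s
  guard : s.mem 20 = BitVec.ofNat w k
  node : s.mem 21 = BitVec.ofNat w i
  index : s.mem 29 = BitVec.ofNat w i
  cells : s.mem 41 = BitVec.ofNat w (cellCount gridA (rowAbs P H cn i) (m 60) P.R k)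
  signs : s.mem 42 = BitVec.ofNat w (signCount (rowSign P H cn i) P.R k)
  frame : EntryFrame m s.mem
  other : ∀ a, (a = 60 ∨ a = 61) → s.mem a = m a
  le : k ≤ P.R
  time : s.time + k * 160 ≤ tot

theorem exec_countStep (hf : P.Fits w) (hL : 0 < P.L) {fuel : ℕ} {m : ℕ → BitVec w}
    {i tot k : ℕ} (h : CountInv P H cn ι σ m i tot (k + 1) s) :
    ∃ s', Prog.exec fuel (.blk (op sub 20 20 5 :: (rowValueCode ++ (sameCellCode gridA 60 ++
      [op add 41 41 33]))) (.op add 42 42 31)) (s.tick 1) = PMF.pure s' ∧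
      CountInv P H cn ι σ m i tot k s' := by
  have hk : k < P.R := h.le
  have hkN : k < P.N := by simpa using level_row_lt hL hk
  have hcode : (op sub 20 20 5 :: (rowValueCode ++ (sameCellCode gridA 60 ++ [op add 41 41 33]))) =
      rowCellCode gridA 60 ++ [op add 41 41 33] := by simp [rowCellCode]
  rw [hcode, Prog.exec_blk, Prog.exec_op]
  refine ⟨_, rfl, ?_⟩
  have hks : gridA.length = 16 := rfl
  have hcore := ((h.core.tick 1).after (is := rowCellCode gridA 60 ++ [op add 41 41 33])
    ((scratch_rowCellCode _ _).append (by decide))).after (is := [op add 42 42 31]) (by decide)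
  obtain ⟨x20, x30, x31, x33⟩ := runs_rowCellCode hks (c := 60) (by norm_num) h.core.params
    h.core.rows hf hkN h.guard h.node h.index
  have hmem : (((s.tick 1).after (rowCellCode gridA 60 ++ [op add 41 41 33])).after
      [op add 42 42 31]).mem =
      runs [op add 41 41 33, op add 42 42 31] (runs (rowCellCode gridA 60) s.mem) := by
    simp only [Conf.after, Conf.tick]
    rw [runs_append, show [op add 41 41 33, op add 42 42 31] =
      [op add 41 41 33] ++ [op add 42 42 31] from rfl, runs_append [op add 41 41 33]]
  have hfr : ∀ a, a = 21 ∨ a = 29 ∨ 37 ≤ a → runs (rowCellCode gridA 60) s.mem a = s.mem a :=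
    fun a ha => runs_of_forall_ne _ _ _ fun i hi => by
      have := rowCellCode_dest gridA 60 i hi
      omega
  have htime : (((s.tick 1).after (rowCellCode gridA 60 ++ [op add 41 41 33])).after
      [op add 42 42 31]).time = s.time + 146 := by
    simp only [Conf.after, Conf.tick, List.length_append, length_rowCellCode hks,
      List.length_cons, List.length_nil]
  have h41 := hfr 41 (by omega)
  have h42 := hfr 42 (by omega)
  rw [h.cells] at h41
  rw [h.signs] at h42
  rw [h.other 60 (.inl rfl)] at x33
  generalize ((s.tick 1).after (rowCellCode gridA 60 ++ [op add 41 41 33])).after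
    [op add 42 42 31] = s1 at *
  generalize runs (rowCellCode gridA 60) s.mem = m1 at *
  have hd : ∀ a, a ≠ 41 → a ≠ 42 → s1.mem a = m1 a := fun a h1 h2 => by
    rw [hmem]; exact runs_of_forall_ne _ _ _ (by simp [Instr.dest]; omega)
  refine ⟨hcore, ?_, ?_, ?_, ?_, ?_, ?_, ?_, hk.le, ?_⟩
  · rw [hd _ (by decide) (by decide), x20]
  · rw [hd _ (by decide) (by decide), hfr _ (by omega), h.node]
  · rw [hd _ (by decide) (by decide), hfr _ (by omega), h.index]
  · have : s1.mem 41 = m1 41 + m1 33 := by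
      rw [hmem]; simp [runs_eq_back, WordOp.eval]
    rw [this, h41, x33, cellCount, cellCount, Finset.sum_eq_sum_Ico_succ_bot hk, add_comm,
      BitVec.ofNat_add]
    congr 1
    split_ifs <;> rfl
  · have : s1.mem 42 = m1 42 + m1 31 := by
      rw [hmem]; simp [runs_eq_back, WordOp.eval]
    rw [this, h42, x31, signCount, signCount, Finset.sum_eq_sum_Ico_succ_bot hk, add_comm,
      BitVec.ofNat_add]
    simp
  · intro a ha
    by_cases h21 : 37 ≤ a ∨ a = 21 ∨ a = 29
    · rw [hd _ (by omega) (by omega), hfr _ (by omega), h.frame _ ha]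
    · omega
  · intro a ha
    rw [hd _ (by omega) (by omega), hfr _ (by omega), h.other _ ha]
  · have h2 := h.time
    rw [htime]
    omega

theorem exec_count (hf : P.Fits w) (hL : 0 < P.L) {fuel : ℕ} (hfuel : 2 ^ w ≤ fuel) {i : ℕ}
    (h : Core P H cn ι σ s)
    (h21 : s.mem 21 = BitVec.ofNat w i) (h29 : s.mem 29 = BitVec.ofNat w i) :
    ∃ s', Prog.exec fuel countProg s = PMF.pure s' ∧ Core P H cn ι σ s' ∧
      s'.mem 41 = BitVec.ofNat w (cellCount gridA (rowAbs P H cn i) (s.mem 60) P.R 0) ∧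
      s'.mem 42 = BitVec.ofNat w (signCount (rowSign P H cn i) P.R 0) ∧
      EntryFrame s.mem s'.mem ∧ (∀ a, (a = 60 ∨ a = 61) → s'.mem a = s.mem a) ∧
      s'.time ≤ s.time + P.R * 160 + 5 := by
  have htR := hf.two_R
  rw [countProg, Prog.exec_blk]
  set is := [op add 20 7 16, const 41 0, const 42 0] with his
  have hs : Scratch is := by decide
  have hfr : ∀ a, a ≠ 20 → a ≠ 41 → a ≠ 42 → (s.after is).mem a = s.mem a := fun a h1 h2 h3 => by
    refine runs_of_forall_ne _ _ _ ?_
    simp [his, Instr.dest]; omega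
  have hinv : CountInv P H cn ι σ s.mem i (s.time + 3 + P.R * 160) P.R (s.after is) := by
    refine ⟨h.after hs, ?_, ?_, ?_, ?_, ?_, ?_, ?_, le_rfl, le_of_eq ?_⟩
    · simp [his, Conf.after, runs_eq_back, WordOp.eval, h.params.c7, h.params.c16]
    · rw [hfr _ (by omega) (by omega) (by omega), h21]
    · rw [hfr _ (by omega) (by omega) (by omega), h29]
    · simp [his, Conf.after, runs_eq_back, cellCount]
    · simp [his, Conf.after, runs_eq_back, signCount]
    · exact fun a ha => hfr a (by omega) (by omega) (by omega)
    · exact fun a ha => hfr a (by omega) (by omega) (by omega)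
    · rfl
  obtain ⟨s', e, hs'⟩ := Prog.exec_whileNZ (fuel := fuel)
    (I := CountInv P H cn ι σ s.mem i _) (N := P.R) (fun k s hk => hk.guard)
    (fun k _ s hk => exec_countStep hf hL hk) (by omega) (by omega) hinv
  refine ⟨_, e, hs'.core.tick 1, hs'.cells, hs'.signs, hs'.frame, hs'.other, ?_⟩
  have := hs'.time
  simp only [Conf.tick]
  omega

/-- The estimate of the absolute value, for rows with the values `x`: the winner of the vote for the
first grid when a majority confirms it, and otherwise the winner for the second grid. -/
def estimate (x : ℕ → BitVec w) (R : ℕ) : BitVec w :=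
  if R < 2 * cellCount gridA x (vote gridA x R R).1 R 0 then (vote gridA x R R).1
  else (vote gridB x R R).1

/-- The majority of sign bits, as a signed word. -/
def signWord (x : ℕ → BitVec w) (R : ℕ) : BitVec w :=
  if R < 2 * signCount x R 0 then 1#w - (1#w + 1#w) else 1#w

/-- The three words of an entry of the output. -/
def EntryAt (P : Layout) (H : ℕ → RowHash w) (cn : ℕ → ℕ → BitVec w) (m : ℕ → BitVec w)
    (a i : ℕ) : Prop :=
  m a = BitVec.ofNat w i ∧ m (a + 1) = signWord (rowSign P H cn i) P.R ∧
    m (a + 2) = estimate (rowAbs P H cn i) P.R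

theorem cellCount_le (ks : List ℕ) (x : ℕ → BitVec w) (c : BitVec w) (R : ℕ) :
    cellCount ks x c R 0 ≤ R := by
  calc cellCount ks x c R 0 ≤ ∑ r ∈ Finset.Ico 0 R, 1 :=
        Finset.sum_le_sum fun r _ => by split_ifs <;> simp
    _ = R := by simp

theorem signBit_le_one (h : RowHash w) (y x : BitVec w) : (signBit h y x).toNat ≤ 1 := by
  rw [signBit, BitVec.toNat_ushiftRight, Nat.shiftRight_eq_div_pow]
  rcases Nat.eq_zero_or_pos w with rfl | hw
  · have := (y * h.sgn x).isLt
    simp only [pow_zero] at this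
    simp only [Nat.zero_sub, pow_zero, Nat.div_one]
    omega
  · rw [← Nat.lt_succ_iff, Nat.div_lt_iff_lt_mul (by positivity)]
    have := (y * h.sgn x).isLt
    calc _ < 2 ^ w := this
      _ = 2 * 2 ^ (w - 1) := by rw [← pow_succ']; congr 1; omega

theorem signCount_le (P : Layout) (H : ℕ → RowHash w) (cn : ℕ → ℕ → BitVec w) (i R : ℕ) :
    signCount (rowSign P H cn i) R 0 ≤ R := by
  calc signCount (rowSign P H cn i) R 0 ≤ ∑ r ∈ Finset.Ico 0 R, 1 :=
        Finset.sum_le_sum fun r _ => signBit_le_one _ _ _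
    _ = R := by simp

/-- The cost of an entry of the output. -/
def entryCost (P : Layout) : ℕ := 3 * (P.R * 160) + 60

/-- The invariant of the loop over the leaves. -/
structure EntryInv (P : Layout) (H : ℕ → RowHash w) (cn : ℕ → ℕ → BitVec w)
    (ι : ℕ → (box false).St) (σ : (box true).St) (leaves : List ℕ) (tot k : ℕ)
    (s : Conf box) : Prop where
  core : Core P H cn ι σ s
  guard : s.mem 53 = BitVec.ofNat w k
  len : s.mem 51 = BitVec.ofNat w leaves.length
  list : HasList s.mem (P.list 0) leaves
  entries : ∀ j, k ≤ j → j < leaves.length → EntryAt P H cn s.mem (P.out + 3 * j) (leaves.getD j 0)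
  len_le : leaves.length ≤ P.q
  le : k ≤ leaves.length
  time : s.time + k * entryCost P ≤ tot

/-- The choice of estimate and sign, and the address of the entry. -/
def chooseCode : List Instr :=
  [op add 41 41 41, op lt 41 7 41, op sub 60 60 61, op mul 60 60 41, op add 61 61 60,
    op add 42 42 42, op lt 42 7 42, op add 42 42 42, op sub 42 5 42, op add 22 53 53,
    op add 22 22 53, op add 22 22 15]

/-- The second vote is used unless the winner of the first one has a strict majority. The sign is
`1`, or `1 - 2` when most sign bits are set. -/
theorem runs_chooseCode {m : ℕ → BitVec w} (hP : Params P m) (hf : P.Fits w) {k c₁ c₂ : ℕ}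
    (h1 : c₁ ≤ P.R) (h2 : c₂ ≤ P.R) (h41 : m 41 = BitVec.ofNat w c₁)
    (h42 : m 42 = BitVec.ofNat w c₂) (h53 : m 53 = BitVec.ofNat w k) :
    runs chooseCode m 61 = (if P.R < 2 * c₁ then m 60 else m 61) ∧
    runs chooseCode m 42 = (if P.R < 2 * c₂ then 1#w - (1#w + 1#w) else 1#w) ∧
    runs chooseCode m 22 = BitVec.ofNat w (P.out + 3 * k) := by
  have htR := hf.two_R
  have a0 : (BitVec.ofNat w P.R).toNat = P.R := toNat_ofNat_of_lt (by omega)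
  have a1 : (BitVec.ofNat w (2 * c₁)).toNat = 2 * c₁ := toNat_ofNat_of_lt (by omega)
  have a2 : (BitVec.ofNat w (2 * c₂)).toNat = 2 * c₂ := toNat_ofNat_of_lt (by omega)
  refine ⟨?_, ?_, ?_⟩
  · have : runs chooseCode m 61 = m 61 + (m 60 - m 61) *
        (if (m 7).toNat < (m 41 + m 41).toNat then 1#w else 0#w) := rfl
    rw [this, h41, hP.c7, ofNat_add_ofNat, ← two_mul c₁, a0, a1]
    split_ifs <;> simp
  · have : runs chooseCode m 42 = m 5 - ((if (m 7).toNat < (m 42 + m 42).toNat then 1#w else 0#w) +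
        (if (m 7).toNat < (m 42 + m 42).toNat then 1#w else 0#w)) := rfl
    rw [this, h42, hP.c7, hP.c5, ofNat_add_ofNat, ← two_mul c₂, a0, a2]
    split_ifs <;> simp
  · have : runs chooseCode m 22 = m 53 + m 53 + m 53 + m 15 := rfl
    rw [this, h53, hP.c15]
    simp only [ofNat_add_ofNat]
    congr 1
    ring

/-- One pass of the loop that writes the entries of the output. -/
theorem exec_entry (hf : P.Fits w) (hL : 0 < P.L) {fuel : ℕ} (hfuel : 2 ^ w ≤ fuel)
    {leaves : List ℕ} {tot k : ℕ} (h : EntryInv P H cn ι σ leaves tot (k + 1) s) :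
    ∃ s', Prog.exec fuel entryProg (s.tick 1) = PMF.pure s' ∧
      EntryInv P H cn ι σ leaves tot k s' := by
  have hk : k < leaves.length := h.le
  have hT := hf.top_lt
  have h64 := P.list_zero
  have hout : P.list 0 + k < P.out := P.list_add_lt_out (Nat.zero_le _) (by have := h.len_le; omega)
  have htop : P.top = P.out + 3 * P.q := rfl
  have hlen := h.len_le
  set i := leaves.getD k 0 with hi
  rw [entryProg, Prog.exec_blk]
  set is := [op sub 53 53 5, op add 29 14 53, load 29 29, op add 21 29 16] with his
  have hcore := (h.core.tick 1).after (is := is) (by decide)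
  have e1 : (BitVec.ofNat w (P.list 0 + k)).toNat = P.list 0 + k := toNat_ofNat_of_lt (by omega)
  have e2 : 64 ≤ P.list 0 + k := by omega
  have x53 : ((s.tick 1).after is).mem 53 = BitVec.ofNat w k := by
    change runs is s.mem 53 = _
    simp [his, runs_eq_back, WordOp.eval, h.guard, h.core.params.c5, ofNat_succ_sub_one]
  have x29 : ((s.tick 1).after is).mem 29 = BitVec.ofNat w i := by
    change runs is s.mem 29 = _
    simp [his, runs_eq_back, WordOp.eval, h.guard, h.core.params.c5, h.core.params.c14,
      ofNat_succ_sub_one, ofNat_add_ofNat, e1, back_far, Instr.dest, e2, h.list k hk,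
      -BitVec.toNat_ofNat, hi]
  have x21 : ((s.tick 1).after is).mem 21 = BitVec.ofNat w i := by
    have : ((s.tick 1).after is).mem 21 = ((s.tick 1).after is).mem 29 +
      ((s.tick 1).after is).mem 16 := rfl
    rw [this, x29, hcore.params.c16]
    simp
  have hfr : ∀ a, (50 ≤ a ∧ a < 60 ∧ a ≠ 53) ∨ 64 ≤ a →
      ((s.tick 1).after is).mem a = s.mem a := fun a ha => by
    refine runs_of_forall_ne _ _ _ ?_
    simp [his, Instr.dest]; omega
  have htime : ((s.tick 1).after is).time = s.time + 5 := rfl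
  generalize (s.tick 1).after is = s1 at *
  obtain ⟨s2, r1, k2, c2, f2, o2, t2⟩ := exec_vote hf hL hfuel (ks := gridA) rfl (.inl rfl) hcore
    x21 x29
  rw [Prog.exec_seq, r1, PMF.pure_bind]
  have y21 : s2.mem 21 = BitVec.ofNat w i := by rw [f2 _ (by omega), x21]
  have y29 : s2.mem 29 = BitVec.ofNat w i := by rw [f2 _ (by omega), x29]
  obtain ⟨s3, r2, k3, c3, f3, o3, t3⟩ := exec_vote hf hL hfuel (ks := gridB) rfl (.inr rfl) k2
    y21 y29
  rw [Prog.exec_seq, r2, PMF.pure_bind]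
  have z21 : s3.mem 21 = BitVec.ofNat w i := by rw [f3 _ (by omega), y21]
  have z29 : s3.mem 29 = BitVec.ofNat w i := by rw [f3 _ (by omega), y29]
  obtain ⟨s4, r3, k4, c4, d4, f4, o4, t4⟩ := exec_count hf hL hfuel k3 z21 z29
  rw [Prog.exec_seq, r3, PMF.pure_bind, Prog.exec_blk]
  change ∃ s', Prog.exec fuel _ (s4.after chooseCode) = _ ∧ _
  have v60 : s3.mem 60 = (vote gridA (rowAbs P H cn i) P.R P.R).1 := by
    rw [o3 _ (.inl rfl) (by decide), c2]
  have v53 : s4.mem 53 = BitVec.ofNat w k := by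
    rw [f4 _ (by omega), f3 _ (by omega), f2 _ (by omega), x53]
  obtain ⟨g61, g42, g22⟩ := runs_chooseCode k4.params hf (cellCount_le _ _ _ _)
    (signCount_le _ _ _ _ _) c4 d4 v53
  rw [o4 _ (.inl rfl), o4 _ (.inr rfl), v60, c3] at g61
  change _ = estimate _ _ at g61
  change _ = signWord _ _ at g42
  have k5 := k4.after (is := chooseCode) (by decide)
  have fr5 : ∀ a, (50 ≤ a ∧ a < 60 ∧ a ≠ 53) ∨ 64 ≤ a →
      (s4.after chooseCode).mem a = s.mem a := fun a ha => by
    rw [← hfr a ha, ← f2 a (by omega), ← f3 a (by omega), ← f4 a (by omega)]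
    refine runs_of_forall_ne _ _ _ fun j hj => ?_
    have : j.dest < 50 ∨ j.dest = 60 ∨ j.dest = 61 := by revert j; decide
    omega
  have w53 : (s4.after chooseCode).mem 53 = BitVec.ofNat w k := by
    rw [← v53]; exact runs_of_forall_ne _ _ _ (by decide)
  have w29 : (s4.after chooseCode).mem 29 = BitVec.ofNat w i := by
    rw [← z29, ← f4 29 (by omega)]; exact runs_of_forall_ne _ _ _ (by decide)
  have time5 : (s4.after chooseCode).time = s4.time + 12 := rfl
  have g61' : (s4.after chooseCode).mem 61 = estimate (rowAbs P H cn i) P.R := g61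
  have g42' : (s4.after chooseCode).mem 42 = signWord (rowSign P H cn i) P.R := g42
  have g22' : (s4.after chooseCode).mem 22 = BitVec.ofNat w (P.out + 3 * k) := g22
  clear g61 g42 g22
  generalize s4.after chooseCode = s5 at *
  set o := P.out + 3 * k with ho
  have f0 : (BitVec.ofNat w o).toNat = o := toNat_ofNat_of_lt (by omega)
  rw [Prog.exec_seq, Prog.exec_store, PMF.pure_bind, Prog.exec_blk, g22', f0, w29]
  have k6 := ((k5.tick 1).write (a := o) (v := BitVec.ofNat w i) (by omega)).after
    (is := [op add 22 22 5]) (by decide)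
  have h22 : (((s5.tick 1).write o (BitVec.ofNat w i)).after [op add 22 22 5]).mem 22 =
      BitVec.ofNat w (o + 1) := by
    simp [Conf.after, Conf.tick, Conf.write, runs_eq_back, WordOp.eval, g22',
      show 22 ≠ o by omega, show 5 ≠ o by omega, k5.params.c5, ofNat_add_ofNat]
  have h42 : (((s5.tick 1).write o (BitVec.ofNat w i)).after [op add 22 22 5]).mem 42 =
      signWord (rowSign P H cn i) P.R := by
    simp [Conf.after, Conf.tick, Conf.write, runs_eq_back, g42', show 42 ≠ o by omega]
  have h61 : (((s5.tick 1).write o (BitVec.ofNat w i)).after [op add 22 22 5]).mem 61 =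
      estimate (rowAbs P H cn i) P.R := by
    simp [Conf.after, Conf.tick, Conf.write, runs_eq_back, g61', show 61 ≠ o by omega]
  have ho6 : (((s5.tick 1).write o (BitVec.ofNat w i)).after [op add 22 22 5]).mem o =
      BitVec.ofNat w i := by
    simp [Conf.after, Conf.tick, Conf.write, runs_eq_back, show o ≠ 22 by omega]
  have hfr6 : ∀ a, a ≠ 22 → a ≠ o →
      (((s5.tick 1).write o (BitVec.ofNat w i)).after [op add 22 22 5]).mem a = s5.mem a := by
    intro a h1 h2
    simp [Conf.after, Conf.tick, Conf.write, runs_eq_back, h1, h2]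
  have ht6 : (((s5.tick 1).write o (BitVec.ofNat w i)).after [op add 22 22 5]).time =
    s5.time + 2 := rfl
  generalize ((s5.tick 1).write o (BitVec.ofNat w i)).after [op add 22 22 5] = s6 at *
  have f1 : (BitVec.ofNat w (o + 1)).toNat = o + 1 := toNat_ofNat_of_lt (by omega)
  rw [Prog.exec_seq, Prog.exec_store, PMF.pure_bind, Prog.exec_blk, Prog.exec_store, h22, f1, h42]
  have k7 := ((k6.tick 1).write (a := o + 1) (v := signWord (rowSign P H cn i) P.R)
    (by omega)).after (is := [op add 22 22 5]) (by decide)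
  have i22 : (((s6.tick 1).write (o + 1) (signWord (rowSign P H cn i) P.R)).after
      [op add 22 22 5]).mem 22 = BitVec.ofNat w (o + 2) := by
    simp [Conf.after, Conf.tick, Conf.write, runs_eq_back, WordOp.eval, h22,
      show 22 ≠ o + 1 by omega, show 5 ≠ o + 1 by omega, k6.params.c5, ofNat_add_ofNat]
  have i61 : (((s6.tick 1).write (o + 1) (signWord (rowSign P H cn i) P.R)).after
      [op add 22 22 5]).mem 61 = estimate (rowAbs P H cn i) P.R := by
    simp [Conf.after, Conf.tick, Conf.write, runs_eq_back, h61, show 61 ≠ o + 1 by omega]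
  have io7 : (((s6.tick 1).write (o + 1) (signWord (rowSign P H cn i) P.R)).after
      [op add 22 22 5]).mem (o + 1) = signWord (rowSign P H cn i) P.R := by
    simp [Conf.after, Conf.tick, Conf.write, runs_eq_back, show o + 1 ≠ 22 by omega]
  have hfr7 : ∀ a, a ≠ 22 → a ≠ o + 1 →
      (((s6.tick 1).write (o + 1) (signWord (rowSign P H cn i) P.R)).after
        [op add 22 22 5]).mem a = s6.mem a := by
    intro a h1 h2
    simp [Conf.after, Conf.tick, Conf.write, runs_eq_back, h1, h2]
  have ht7 : (((s6.tick 1).write (o + 1) (signWord (rowSign P H cn i) P.R)).after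
    [op add 22 22 5]).time = s6.time + 2 := rfl
  generalize ((s6.tick 1).write (o + 1) (signWord (rowSign P H cn i) P.R)).after
    [op add 22 22 5] = s7 at *
  have f2' : (BitVec.ofNat w (o + 2)).toNat = o + 2 := toNat_ofNat_of_lt (by omega)
  rw [i22, f2', i61]
  refine ⟨_, rfl, ?_⟩
  have k8 := (k7.tick 1).write (a := o + 2) (v := estimate (rowAbs P H cn i) P.R) (by omega)
  have hfr8 : ∀ a, a ≠ o + 2 →
      ((s7.tick 1).write (o + 2) (estimate (rowAbs P H cn i) P.R)).mem a = s7.mem a := by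
    intro a h1
    simp [Conf.tick, Conf.write, h1]
  have io8 : ((s7.tick 1).write (o + 2) (estimate (rowAbs P H cn i) P.R)).mem (o + 2) =
    estimate (rowAbs P H cn i) P.R := by simp [Conf.tick, Conf.write]
  have ht8 : ((s7.tick 1).write (o + 2) (estimate (rowAbs P H cn i) P.R)).time =
    s7.time + 1 := rfl
  generalize (s7.tick 1).write (o + 2) (estimate (rowAbs P H cn i) P.R) = s8 at *
  have hall : ∀ a, a ≠ 22 → a < o ∨ o + 3 ≤ a → s8.mem a = s5.mem a := fun a h1 h2 => by
    rw [hfr8 _ (by omega), hfr7 _ (by omega) (by omega), hfr6 _ (by omega) (by omega)]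
  refine ⟨k8, ?_, ?_, ?_, ?_, hlen, hk.le, ?_⟩
  · rw [hall _ (by omega) (by omega), w53]
  · rw [hall _ (by omega) (by omega), fr5 _ (by omega), h.len]
  · intro j hj
    have := P.list_add_lt_out (s := 0) (j := j) (Nat.zero_le _) (by omega)
    rw [hall _ (by omega) (by omega), fr5 _ (by omega), h.list j hj]
  · intro j hj hj'
    rcases Nat.eq_or_lt_of_le hj with rfl | hj
    · refine ⟨?_, ?_, ?_⟩
      · rw [← ho, hfr8 _ (by omega), hfr7 _ (by omega) (by omega), ho6]
      · rw [← ho, hfr8 _ (by omega), io7]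
      · rw [← ho, io8]
    · obtain ⟨q1, q2, q3⟩ := h.entries j hj hj'
      refine ⟨?_, ?_, ?_⟩
      · rw [hall _ (by omega) (by omega), fr5 _ (by omega), q1]
      · rw [hall _ (by omega) (by omega), fr5 _ (by omega), q2]
      · rw [hall _ (by omega) (by omega), fr5 _ (by omega), q3]
  · have h2 := h.time
    have h3 : (k + 1) * entryCost P = k * entryCost P + (3 * (P.R * 160) + 60) := by
      unfold entryCost; ring
    omega

end HeavyHitters

/-! ### The whole report -/

open scoped ENNReal

namespace HeavyHitters

open Instr WordOp

variable {w n : ℕ} {box : Bool → Estimator w n} {P : Layout}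
  {H : ℕ → RowHash w} {cn : ℕ → ℕ → BitVec w} {ι : ℕ → (box false).St} {σ : (box true).St}
  {s : Conf box}

/-- The entry of the output for the index `i`. -/
def entry (P : Layout) (H : ℕ → RowHash w) (cn : ℕ → ℕ → BitVec w) (i : ℕ) : HHEntry where
  index := (BitVec.ofNat w i).toNat
  sign := (signWord (rowSign P H cn i) P.R).toInt
  est := (estimate (rowAbs P H cn i) P.R).toNat

/-- The threshold for the queries, from an answer about the whole stream. -/
def threshold (r : BitVec w × BitVec w) : BitVec w := fixedPoint r.1 r.2 * BitVec.ofNat w 37888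

/-- The law of the list of leaves, given the random words and the states of the black boxes. -/
noncomputable def reportLaw (P : Layout) (H : ℕ → RowHash w) (box : Bool → Estimator w n)
    (x : (ℕ → (box false).St) × (box true).St) : PMF (List ℕ) :=
  ((box true).report x.2).bind fun r =>
    PMF.iter (levelStep P H (box false) x.1 (threshold r)) P.L (List.range P.q)

/-- A bound for the reporting time. -/
def repBound (P : Layout) (box : Bool → Estimator w n) : ℕ :=
  (box true).repTime + P.L * levelCost P (box false) + P.q * (entryCost P + 4) + 40

/-- The configuration at the end. -/
structure Reported (P : Layout) (H : ℕ → RowHash w) (cn : ℕ → ℕ → BitVec w) (s : Conf box)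
    (leaves : List ℕ) : Prop where
  ok : s.ok = true
  slots : s.slots false ≤ P.N * P.B
  slots_total : s.slots true ≤ 1
  top : s.top ≤ P.top
  time : s.time ≤ repBound P box
  output : s.output = leaves.map (entry P H cn)

/-- The invariant while the list of all nodes of the top level is written. -/
structure ListInv (P : Layout) (H : ℕ → RowHash w) (cn : ℕ → ℕ → BitVec w)
    (ι : ℕ → (box false).St) (σ : (box true).St) (thr : BitVec w) (tot k : ℕ)
    (s : Conf box) : Prop where
  core : Core P H cn ι σ s
  guard : s.mem 53 = BitVec.ofNat w k
  thr : s.mem 50 = thr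
  len : s.mem 51 = BitVec.ofNat w P.q
  addr : s.mem 55 = BitVec.ofNat w (P.list P.L)
  list : ∀ j, k ≤ j → j < P.q → s.mem (P.list P.L + j) = BitVec.ofNat w j
  le : k ≤ P.q
  time : s.time + k * 4 ≤ tot

theorem exec_listStep (hf : P.Fits w) {fuel : ℕ} {thr : BitVec w} {tot k : ℕ}
    (h : ListInv P H cn ι σ thr tot (k + 1) s) :
    ∃ s', Prog.exec fuel (.blk [op sub 53 53 5, op add 56 55 53] (.store 56 53)) (s.tick 1) =
      PMF.pure s' ∧ ListInv P H cn ι σ thr tot k s' := by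
  have hk : k < P.q := h.le
  have hT := hf.top_lt
  have h64 := P.list_zero
  have h0 := P.list_mono (Nat.zero_le P.L)
  have hout := P.list_add_lt_out (le_refl P.L) hk.le
  have htop : P.top = P.out + 3 * P.q := rfl
  rw [Prog.exec_blk, Prog.exec_store]
  set is := [op sub 53 53 5, op add 56 55 53] with his
  have x53 : ((s.tick 1).after is).mem 53 = BitVec.ofNat w k := by
    simp [his, Conf.after, Conf.tick, runs_eq_back, WordOp.eval, h.guard, h.core.params.c5,
      ofNat_succ_sub_one]
  have x56 : ((s.tick 1).after is).mem 56 = BitVec.ofNat w (P.list P.L + k) := by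
    simp [his, Conf.after, Conf.tick, runs_eq_back, WordOp.eval, h.guard, h.addr, h.core.params.c5,
      ofNat_succ_sub_one, ofNat_add_ofNat]
  have hfr : ∀ a, a ≠ 53 → a ≠ 56 → ((s.tick 1).after is).mem a = s.mem a := fun a h1 h2 => by
    refine runs_of_forall_ne _ _ _ ?_
    simp [his, Instr.dest]; omega
  have hcore := (h.core.tick 1).after (is := is) (by decide)
  have htime : ((s.tick 1).after is).time = s.time + 3 := rfl
  generalize (s.tick 1).after is = s1 at *
  rw [x56, x53, toNat_ofNat_of_lt (by omega)]
  refine ⟨_, rfl, (hcore.tick 1).write (by omega), ?_, ?_, ?_, ?_, ?_, hk.le, ?_⟩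
  · rw [← x53]; exact Function.update_of_ne (by omega) _ _
  · rw [← h.thr, ← hfr 50 (by omega) (by omega)]; exact Function.update_of_ne (by omega) _ _
  · rw [← h.len, ← hfr 51 (by omega) (by omega)]; exact Function.update_of_ne (by omega) _ _
  · rw [← h.addr, ← hfr 55 (by omega) (by omega)]; exact Function.update_of_ne (by omega) _ _
  · intro j hj hj'
    rcases Nat.eq_or_lt_of_le hj with rfl | hj
    · simp [Conf.write]
    · rw [← h.list j hj hj', ← hfr _ (by omega) (by omega)]
      exact Function.update_of_ne (by omega) _ _
  · have := h.time
    simp only [Conf.write, Conf.tick]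
    omega

theorem refines_report (hf : P.Fits w) (hL : 0 < P.L) (hq : 0 < P.q) {fuel : ℕ}
    (hfuel : 2 ^ w ≤ fuel) {x : (ℕ → (box false).St) × (box true).St}
    (h : Core P H cn x.1 x.2 s) :
    (Prog.exec fuel reportProg s.resetTime).Refines (reportLaw P H box x) (Reported P H cn) := by
  have hT := hf.top_lt
  have h64 := P.list_zero
  have htop : P.top = P.out + 3 * P.q := rfl
  have h0 := h.resetTime
  have hzero : (s.resetTime.mem 16).toNat = 0 := by rw [h0.params.c16]; simp
  rw [reportProg, Prog.exec_seq, exec_boxReport_true h0 hzero, PMF.bind_map, reportLaw]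
  refine (PMF.Refines.refl _).bind fun r _ hr => ?_
  subst hr
  simp only [Function.comp_apply]
  have h1 := ((h0.tick (box true).repTime).write (a := 30) (v := r.1) (by omega)).write
    (a := 31) (v := r.2) (by omega)
  have t1 : (((s.resetTime.tick (box true).repTime).write 30 r.1).write 31 r.2).time =
    (box true).repTime := by simp [Conf.write, Conf.tick, Conf.resetTime]
  have n30 : (((s.resetTime.tick (box true).repTime).write 30 r.1).write 31 r.2).mem 30 = r.1 := by
    simp [Conf.write, Conf.tick]
  have n31 : (((s.resetTime.tick (box true).repTime).write 30 r.1).write 31 r.2).mem 31 = r.2 := by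
    simp [Conf.write, Conf.tick]
  generalize ((s.resetTime.tick (box true).repTime).write 30 r.1).write 31 r.2 = s1 at *
  rw [Prog.exec_blk]
  set tail := [const 33 37888, op mul 50 32 33, op add 53 6 16, op mul 55 8 18,
    op add 55 55 14, op add 51 6 16] with htail
  have hfx := runs_fixedPointCode h1.params hf
  rw [n30, n31] at hfx
  have hPf : Params P (runs fixedPointCode s1.mem) := h1.params.runs (by decide)
  have h2 := h1.after (is := fixedPointCode ++ tail) (by decide)
  have hmem : (s1.after (fixedPointCode ++ tail)).mem = runs tail (runs fixedPointCode s1.mem) := by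
    rw [← runs_append]; rfl
  have t2 : (s1.after (fixedPointCode ++ tail)).time = s1.time + 18 := rfl
  generalize s1.after (fixedPointCode ++ tail) = s2 at *
  generalize runs fixedPointCode s1.mem = m at *
  have eL : P.L * (P.q + 1) + P.list 0 = P.list P.L := by simp only [Layout.list]; ring
  have hinv : ListInv P H cn x.1 x.2 (threshold r) ((box true).repTime + 18 + P.q * 4) P.q s2 := by
    refine ⟨h2, ?_, ?_, ?_, ?_, fun j _ _ => by omega, le_rfl, by omega⟩
    · rw [hmem]; simp [htail, runs_eq_back, WordOp.eval, hPf.c6, hPf.c16]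
    · rw [hmem]; simp [htail, runs_eq_back, WordOp.eval, hfx, threshold]
    · rw [hmem]; simp [htail, runs_eq_back, WordOp.eval, hPf.c6, hPf.c16]
    · rw [hmem]
      simp [htail, runs_eq_back, WordOp.eval, hPf.c8, hPf.c18, hPf.c14, ofNat_add_ofNat,
        ofNat_mul_ofNat, eL]
  have hqw : P.q < 2 ^ w := by omega
  obtain ⟨s3, e3, i3⟩ := Prog.exec_whileNZ (fuel := fuel)
    (I := ListInv P H cn x.1 x.2 (threshold r) _) (N := P.q) (fun k s hk => hk.guard)
    (fun k _ s hk => exec_listStep hf hk) hqw (hqw.trans_le hfuel) hinv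
  rw [Prog.exec_seq, e3, PMF.pure_bind, Prog.exec_blk, Prog.exec_seq]
  have h4 := (i3.core.tick 1).after (is := [op add 52 8 16]) (by decide)
  have hfr : ∀ a, a ≠ 52 → ((s3.tick 1).after [op add 52 8 16]).mem a = s3.mem a := fun a ha => by
    refine runs_of_forall_ne _ _ _ ?_
    simp [Instr.dest]; omega
  have x52 : ((s3.tick 1).after [op add 52 8 16]).mem 52 = BitVec.ofNat w P.L := by
    simp [Conf.after, Conf.tick, runs_eq_back, WordOp.eval, i3.core.params.c8, i3.core.params.c16]
  have t4 : ((s3.tick 1).after [op add 52 8 16]).time = s3.time + 2 := rfl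
  have t3 := i3.time
  generalize (s3.tick 1).after [op add 52 8 16] = s4 at *
  have hLL := P.list_mono (Nat.zero_le P.L)
  have hinv2 : LevelInv P H cn x.1 x.2 (threshold r)
      ((box true).repTime + 20 + P.q * 4 + P.L * levelCost P (box false)) P.L s4
      (List.range P.q) := by
    refine ⟨h4, ?_, ?_, x52, ?_, by simp, le_rfl, by omega⟩
    · rw [hfr _ (by omega), i3.thr]
    · rw [hfr _ (by omega), i3.len, List.length_range]
    · intro j hj
      rw [List.length_range] at hj
      rw [hfr _ (by omega), i3.list j (Nat.zero_le _) hj]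
      simp [hj]
  have hLw : P.L < 2 ^ w := by
    have h5 : P.L ≤ P.N := Nat.le_mul_of_pos_right _ hf.R_pos
    exact h5.trans_lt hf.N_lt
  rw [← PMF.bind_pure (PMF.iter _ P.L _)]
  refine (Prog.refines_whileNZ (I := LevelInv P H cn x.1 x.2 (threshold r) _)
    (fun k s b hk => hk.level) (fun k _ s b hs => refines_level hf hfuel hs) hLw
    (hLw.trans_le hfuel) hinv2).bind ?_
  rintro s5 leaves ⟨s5, i5, rfl⟩
  rw [Prog.exec_blk, Prog.exec_seq]
  have h6 := (i5.core.tick 1).after (is := [op add 53 51 16]) (by decide)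
  have hfr6 : ∀ a, a ≠ 53 → ((s5.tick 1).after [op add 53 51 16]).mem a = s5.mem a := fun a ha => by
    refine runs_of_forall_ne _ _ _ ?_
    simp [Instr.dest]; omega
  have x53 : ((s5.tick 1).after [op add 53 51 16]).mem 53 = BitVec.ofNat w leaves.length := by
    simp [Conf.after, Conf.tick, runs_eq_back, WordOp.eval, i5.len, i5.core.params.c16]
  have t6 : ((s5.tick 1).after [op add 53 51 16]).time = s5.time + 2 := rfl
  have t5 := i5.time
  generalize (s5.tick 1).after [op add 53 51 16] = s6 at *
  have hll := i5.len_le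
  have hinv3 : EntryInv P H cn x.1 x.2 leaves ((box true).repTime + 22 + P.q * 4 +
      P.L * levelCost P (box false) + leaves.length * entryCost P) leaves.length s6 := by
    refine ⟨h6, x53, ?_, ?_, fun j _ _ => by omega, hll, le_rfl, by omega⟩
    · rw [hfr6 _ (by omega), i5.len]
    · intro j hj
      rw [hfr6 _ (by omega), i5.list j hj]
  obtain ⟨s7, e7, i7⟩ := Prog.exec_whileNZ (fuel := fuel)
    (I := EntryInv P H cn x.1 x.2 leaves _) (N := leaves.length) (fun k s hk => hk.guard)
    (fun k _ s hk => exec_entry hf hL hfuel hk) (by omega) (by omega) hinv3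
  rw [e7, PMF.pure_bind, Prog.exec_blk, Prog.exec_op]
  refine PMF.Refines.pure ?_
  have h8 := ((i7.core.tick 1).after (is := [op add 0 51 16]) (by decide)).after
    (is := [op add 1 15 16]) (by decide)
  have hm8 : (((s7.tick 1).after [op add 0 51 16]).after [op add 1 15 16]).mem =
    runs [op add 0 51 16, op add 1 15 16] s7.mem := rfl
  have t8 : (((s7.tick 1).after [op add 0 51 16]).after [op add 1 15 16]).time = s7.time + 3 := rfl
  have t7 := i7.time
  generalize ((s7.tick 1).after [op add 0 51 16]).after [op add 1 15 16] = s8 at *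
  have y0 : (s8.mem 0).toNat = leaves.length := by
    rw [hm8, show runs [op add 0 51 16, op add 1 15 16] s7.mem 0 = s7.mem 51 + s7.mem 16 from rfl,
      i7.len, i7.core.params.c16]
    simp only [BitVec.add_zero]
    exact toNat_ofNat_of_lt (by omega)
  have y1 : (s8.mem 1).toNat = P.out := by
    rw [hm8, show runs [op add 0 51 16, op add 1 15 16] s7.mem 1 = s7.mem 15 + s7.mem 16 from rfl,
      i7.core.params.c15, i7.core.params.c16]
    simp only [BitVec.add_zero]
    exact toNat_ofNat_of_lt (by omega)
  have hfr8 : ∀ a, 2 ≤ a → s8.mem a = s7.mem a := fun a ha => by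
    rw [hm8]
    refine runs_of_forall_ne _ _ _ ?_
    simp [Instr.dest]; omega
  have hoo := P.list_zero_le_out
  refine ⟨h8.ok, h8.slots, h8.slots_total, h8.top, ?_, ?_⟩
  · have : leaves.length * entryCost P ≤ P.q * entryCost P := Nat.mul_le_mul_right _ hll
    unfold repBound
    rw [mul_add]
    omega
  · rw [Conf.output, y0, y1]
    refine List.ext_getElem (by simp) fun j hj hj' => ?_
    simp only [List.length_map, List.length_range] at hj
    obtain ⟨q1, q2, q3⟩ := i7.entries j (Nat.zero_le _) hj
    simp only [List.getElem_map, List.getElem_range]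
    rw [hfr8 _ (by omega), hfr8 _ (by omega), hfr8 _ (by omega), q1, q2, q3,
      ← List.getElem_eq_getD (h := hj)]
    rfl

end HeavyHitters

/-! ### The law of the answer -/

open scoped ENNReal

namespace HeavyHitters

variable {w n : ℕ} {box : Bool → Estimator w n}

/-- The law of the random words of the rows and the list of leaves at the end of a stream. -/
noncomputable def answerLaw (P : Layout) (box : Bool → Estimator w n) (l : UpdStream n) :
    PMF ((ℕ → RowHash w) × List ℕ) :=
  (setupLaw P box).bind fun x => (feedAll P x.1 box l x.2).bind fun y =>
    (reportLaw P x.1 box y).map fun leaves => (x.1, leaves)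

variable {q D fuel : ℕ} {input : Fin 5 → ℕ} {l : UpdStream n}

/-- The machine after a stream matches the abstract process. The law of the states of the black
boxes is kept together with the random words, on which the counters depend. -/
theorem refines_process (h0 : input 0 = n) (h3 : input 3 = q)
    (h4 : input 4 = D) (hf : SetupFits n q D w) (hfuel : 2 ^ w ≤ fuel)
    (hv : ∀ u ∈ l, (BitVec.ofInt w u.2).toInt = u.2) :
    (algorithm.process box fuel input l).Refines
      ((setupLaw (layout n q D) box).bind fun x =>
        (feedAll (layout n q D) x.1 box l x.2).map fun y => (x.1, y))
      fun s x => Between (layout n q D) x.1 (counters (layout n q D) x.1 l)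
        (updBound (layout n q D) box) s x.2 := by
  rw [StreamProg.process]
  refine (refines_start h0 h3 h4 hf hfuel (updBound (layout n q D) box)).bind fun s x hx => ?_
  have := refines_feed hf.fits (hf.fits.N_lt.trans_le hfuel) hf.n_lt l hv [] hx
  exact this.map_right fun s y hy => hy

/-- The machine after the report matches the law of the random words and the list of leaves, of
which the output is a function. -/
theorem refines_answer (h0 : input 0 = n) (h3 : input 3 = q)
    (h4 : input 4 = D) (hf : SetupFits n q D w) (hfuel : 2 ^ w ≤ fuel) (hq : 0 < q)
    (hv : ∀ u ∈ l, (BitVec.ofInt w u.2).toInt = u.2) :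
    (algorithm.answer box fuel input l).Refines (answerLaw (layout n q D) box l)
      fun s x => Reported (layout n q D) x.1 (counters (layout n q D) x.1 l) s x.2 := by
  have h := refines_process (box := box) h0 h3 h4 hf hfuel hv
  have e : answerLaw (layout n q D) box l = ((setupLaw (layout n q D) box).bind fun x =>
      (feedAll (layout n q D) x.1 box l x.2).map fun y => (x.1, y)).bind fun x =>
        (reportLaw (layout n q D) x.1 box x.2).map fun leaves => (x.1, leaves) := by
    rw [answerLaw, PMF.bind_bind]
    congr 1
    funext x
    rw [PMF.bind_map]
    rfl
  rw [StreamProg.answer, e]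
  refine h.bind fun s x hx => ?_
  exact (refines_report hf.fits (Nat.succ_pos _) hq hfuel hx.core).map_right fun s y hy => hy

end HeavyHitters

/-! ### The random affine hash functions -/

open scoped ENNReal

namespace HeavyHitters

variable {w : ℕ}

theorem expect_randWord (f : BitVec w → ℝ≥0∞) :
    (Prog.randWord w).expect f = (2 ^ w : ℝ≥0∞)⁻¹ * ∑ x, f x := by
  rw [Prog.randWord, PMF.expect_map, PMF.expect, tsum_fintype, Finset.mul_sum]
  refine Fintype.sum_equiv BitVec.equivFin.symm.toEquiv _ _ fun x => ?_
  rw [PMF.uniformOfFintype_apply, Fintype.card_fin]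
  push_cast
  rfl

/-- A random word is invariant under translations. -/
theorem expect_randWord_add (f : BitVec w → ℝ≥0∞) (t : BitVec w) :
    ((Prog.randWord w).expect fun x => f (x + t)) = (Prog.randWord w).expect f := by
  rw [expect_randWord, expect_randWord]
  congr 1
  exact Fintype.sum_equiv (Equiv.addRight t) _ _ fun x => rfl

/-- A small nonzero difference has a multiple that is a given large power of two. -/
theorem exists_mul_sub_eq {j k e : ℕ} (hjk : j ≠ k) (hj : j < 2 ^ (e + 1)) (hk : k < 2 ^ (e + 1)) :
    ∃ t : BitVec w, t * (BitVec.ofNat w j - BitVec.ofNat w k) = BitVec.ofNat w (2 ^ e) := by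
  set d : ℤ := (j : ℤ) - k with hd
  have hd0 : d ≠ 0 := by omega
  obtain ⟨f, -, hf⟩ := (Nat.dvd_prime_pow Nat.prime_two).1
    (show Int.gcd d ((2 ^ w : ℕ) : ℤ) ∣ 2 ^ w by exact_mod_cast Int.gcd_dvd_right d ((2 ^ w : ℕ) : ℤ))
  have hfe : f ≤ e := by
    have h1 : ((Int.gcd d ((2 ^ w : ℕ) : ℤ) : ℕ) : ℤ) ∣ d := Int.gcd_dvd_left ..
    have h2 := Int.natAbs_le_of_dvd_ne_zero h1 hd0
    rw [Int.natAbs_natCast, hf] at h2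
    have h3 : d.natAbs < 2 ^ (e + 1) := by omega
    have := (Nat.pow_lt_pow_iff_right (a := 2) (by norm_num)).1 (h2.trans_lt h3)
    omega
  have hb := Int.gcd_eq_gcd_ab d ((2 ^ w : ℕ) : ℤ)
  set x := Int.gcdA d ((2 ^ w : ℕ) : ℤ)
  set y := Int.gcdB d ((2 ^ w : ℕ) : ℤ)
  rw [hf] at hb
  have hz : (((2 ^ w : ℕ) : ℤ) : BitVec w) = 0 := by
    rw [Int.cast_natCast, BitVec.natCast_eq_ofNat, ← BitVec.toNat_inj, BitVec.toNat_ofNat,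
      Nat.mod_self]
    rfl
  have hb' := congrArg (Int.cast : ℤ → BitVec w) hb
  rw [Int.cast_add, Int.cast_mul, Int.cast_mul, hz, zero_mul, add_zero, hd, Int.cast_sub,
    Int.cast_natCast, Int.cast_natCast, Int.cast_natCast, BitVec.natCast_eq_ofNat,
    BitVec.natCast_eq_ofNat, BitVec.natCast_eq_ofNat] at hb'
  refine ⟨BitVec.ofNat w (2 ^ (e - f)) * (x : BitVec w), ?_⟩
  rw [mul_assoc, mul_comm (x : BitVec w), ← hb', ofNat_mul_ofNat, ← pow_add, Nat.sub_add_cancel hfe]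

/-- Two distinct nodes fall into the same bucket with probability at most `2 ^ (-l)`: there is a
measure preserving translation that adds `1` to the bucket of the one and keeps that of the
other. -/
theorem expect_collision_le {l : ℕ} (hl : l < w) {j k : ℕ} (hjk : j ≠ k) (hj : j < 2 ^ (w - l))
    (hk : k < 2 ^ (w - l)) :
    ((Prog.randWord w).expect fun a => (Prog.randWord w).expect fun b =>
      if (a * BitVec.ofNat w j + b) >>> (w - l) = (a * BitVec.ofNat w k + b) >>> (w - l) then 1
      else 0) ≤ (2 ^ l : ℝ≥0∞)⁻¹ := by
  set sh := w - l with hsh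
  set x := BitVec.ofNat w j
  set y := BitVec.ofNat w k
  obtain ⟨t, ht⟩ := exists_mul_sub_eq (w := w) hjk
    (hj.trans (Nat.pow_lt_pow_right (by norm_num) (Nat.lt_succ_self _)))
    (hk.trans (Nat.pow_lt_pow_right (by norm_num) (Nat.lt_succ_self _)))
  set c : BitVec w → BitVec w → ℝ≥0∞ := fun a b =>
    if (a * x + b) >>> sh = (a * y + b) >>> sh then 1 else 0 with hc
  set p := (Prog.randWord w).expect fun a => (Prog.randWord w).expect fun b => c a b with hp
  have hshift : ∀ m : ℕ, ((Prog.randWord w).expect fun a => (Prog.randWord w).expect fun b =>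
      c (a + BitVec.ofNat w m * t) (b + -(BitVec.ofNat w m * t * y))) = p := by
    intro m
    rw [hp]
    clear_value c
    have h1 : ∀ a, ((Prog.randWord w).expect fun b =>
        c (a + BitVec.ofNat w m * t) (b + -(BitVec.ofNat w m * t * y))) =
        (Prog.randWord w).expect (c (a + BitVec.ofNat w m * t)) := fun a =>
      expect_randWord_add (c (a + BitVec.ofNat w m * t)) (-(BitVec.ofNat w m * t * y))
    simp only [h1]
    exact expect_randWord_add (fun a => (Prog.randWord w).expect (c a)) (BitVec.ofNat w m * t)
  have hsum : ∀ a b, ∑ m ∈ Finset.range (2 ^ l),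
      c (a + BitVec.ofNat w m * t) (b + -(BitVec.ofNat w m * t * y)) ≤ 1 := by
    intro a b
    have key : ∀ m : ℕ, ((a + BitVec.ofNat w m * t) * x + (b + -(BitVec.ofNat w m * t * y))) >>> sh =
        ((a + BitVec.ofNat w m * t) * y + (b + -(BitVec.ofNat w m * t * y))) >>> sh →
        ((a * x + b).toNat / 2 ^ sh + m) % 2 ^ l = (a * y + b).toNat / 2 ^ sh := by
      intro m hm
      have e1 : (a + BitVec.ofNat w m * t) * x + (b + -(BitVec.ofNat w m * t * y)) =
          (a * x + b) + BitVec.ofNat w (m * 2 ^ sh) := by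
        rw [← ofNat_mul_ofNat, ← ht]; ring
      have e2 : (a + BitVec.ofNat w m * t) * y + (b + -(BitVec.ofNat w m * t * y)) = a * y + b := by
        ring
      rw [e1, e2] at hm
      have hm' := congrArg BitVec.toNat hm
      rw [BitVec.toNat_ushiftRight, BitVec.toNat_ushiftRight, Nat.shiftRight_eq_div_pow,
        Nat.shiftRight_eq_div_pow, BitVec.toNat_add, BitVec.toNat_ofNat, Nat.add_mod_mod] at hm'
      rw [← hm']
      have e3 : (2 : ℕ) ^ w = 2 ^ sh * 2 ^ l := by rw [← pow_add]; congr 1; omega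
      rw [e3, Nat.mod_mul_right_div_self, Nat.add_mul_div_right _ _ (by positivity)]
    rw [hc, Finset.sum_boole, ← Nat.cast_one, Nat.cast_le]
    refine Finset.card_le_one.2 ?_
    intro m hm m' hm'
    rw [Finset.mem_filter, Finset.mem_range] at hm hm'
    have h1 := (key m hm.2).trans (key m' hm'.2).symm
    have h2 : m ≡ m' [MOD 2 ^ l] := Nat.ModEq.add_left_cancel' _ h1
    exact Nat.ModEq.eq_of_lt_of_lt h2 hm.1 hm'.1
  have hmul : (2 ^ l : ℝ≥0∞) * p ≤ 1 := by
    calc (2 ^ l : ℝ≥0∞) * p = ∑ m ∈ Finset.range (2 ^ l), p := by simp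
      _ = ∑ m ∈ Finset.range (2 ^ l), (Prog.randWord w).expect fun a =>
          (Prog.randWord w).expect fun b =>
            c (a + BitVec.ofNat w m * t) (b + -(BitVec.ofNat w m * t * y)) := by
          simp only [hshift]
      _ = (Prog.randWord w).expect fun a => (Prog.randWord w).expect fun b =>
          ∑ m ∈ Finset.range (2 ^ l),
            c (a + BitVec.ofNat w m * t) (b + -(BitVec.ofNat w m * t * y)) := by
          simp only [PMF.expect_sum]
      _ ≤ (Prog.randWord w).expect fun _ => (Prog.randWord w).expect fun _ => 1 :=
          PMF.expect_mono _ fun a => PMF.expect_mono _ fun b => hsum a b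
      _ = 1 := by simp only [PMF.expect_const]
  rw [ENNReal.le_inv_iff_mul_le, mul_comm]
  exact hmul

/-- The random sign of an index as an integer. -/
def signOf (c d x : BitVec w) : ℤ := if (c * x + d).toNat < 2 ^ (w - 1) then 1 else -1

theorem signOf_mul_self (c d x : BitVec w) : signOf c d x * signOf c d x = 1 := by
  unfold signOf; split_ifs <;> norm_num

/-- Pairwise orthogonality of the random signs. -/
theorem sum_signOf_mul (hw : 0 < w) {j k : ℕ} (hjk : j ≠ k) (hj : j < 2 ^ w) (hk : k < 2 ^ w) :
    ∑ c : BitVec w, ∑ d : BitVec w,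
      signOf c d (BitVec.ofNat w j) * signOf c d (BitVec.ofNat w k) = 0 := by
  have hw' : w - 1 + 1 = w := Nat.sub_add_cancel hw
  obtain ⟨t, ht⟩ := exists_mul_sub_eq (w := w) (e := w - 1) hjk (by rwa [hw']) (by rwa [hw'])
  set x := BitVec.ofNat w j
  set y := BitVec.ofNat w k
  have h2 : (2 : ℕ) ^ w = 2 ^ (w - 1) + 2 ^ (w - 1) := by
    rw [← two_mul, ← pow_succ', hw']
  have hflip : ∀ c d, signOf (c + t) (d + -(t * y)) x * signOf (c + t) (d + -(t * y)) y =
      -(signOf c d x * signOf c d y) := by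
    intro c d
    have e1 : (c + t) * x + (d + -(t * y)) = (c * x + d) + BitVec.ofNat w (2 ^ (w - 1)) := by
      rw [← ht]; ring
    have e2 : (c + t) * y + (d + -(t * y)) = c * y + d := by ring
    unfold signOf
    rw [e1, e2, BitVec.toNat_add, BitVec.toNat_ofNat,
      Nat.mod_eq_of_lt (a := 2 ^ (w - 1)) (Nat.pow_lt_pow_right (by norm_num) (by omega))]
    have hlt := (c * x + d).isLt
    generalize (c * x + d).toNat = u at hlt
    generalize (2 : ℕ) ^ (w - 1) = W at *
    rw [h2] at hlt ⊢
    by_cases hu : u < W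
    · rw [Nat.mod_eq_of_lt (by omega), if_pos hu, if_neg (by omega)]
      ring
    · rw [Nat.mod_eq_sub_mod (by omega), Nat.mod_eq_of_lt (by omega), if_neg hu, if_pos (by omega)]
      ring
  have hS : ∑ c : BitVec w, ∑ d : BitVec w, signOf c d x * signOf c d y =
      ∑ c : BitVec w, ∑ d : BitVec w, -(signOf c d x * signOf c d y) := by
    refine (Fintype.sum_equiv (Equiv.addRight t) _ _ fun c => ?_).symm
    refine Fintype.sum_equiv (Equiv.addRight (-(t * y))) _ _ fun d => ?_
    exact (hflip c d).symm
  simp only [Finset.sum_neg_distrib] at hS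
  linarith

/-- The second moment of a random signed sum. -/
theorem sum_signed_sq (hw : 0 < w) {n : ℕ} (hn : n ≤ 2 ^ w) (C : Finset (Fin n)) (x : Fin n → ℤ) :
    ∑ c : BitVec w, ∑ d : BitVec w, (∑ j ∈ C, signOf c d (BitVec.ofNat w j) * x j) ^ 2 =
      2 ^ w * 2 ^ w * ∑ j ∈ C, x j ^ 2 := by
  have h1 : ∀ c d : BitVec w, (∑ j ∈ C, signOf c d (BitVec.ofNat w j) * x j) ^ 2 =
      ∑ j ∈ C, ∑ k ∈ C, (x j * x k) *
        (signOf c d (BitVec.ofNat w j) * signOf c d (BitVec.ofNat w k)) := by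
    intro c d
    rw [sq, Finset.sum_mul_sum]
    refine Finset.sum_congr rfl fun j _ => Finset.sum_congr rfl fun k _ => ?_
    ring
  simp only [h1]
  have h2 : ∑ c : BitVec w, ∑ d : BitVec w, ∑ j ∈ C, ∑ k ∈ C, (x j * x k) *
        (signOf c d (BitVec.ofNat w j) * signOf c d (BitVec.ofNat w k)) =
      ∑ j ∈ C, ∑ k ∈ C, (x j * x k) * ∑ c : BitVec w, ∑ d : BitVec w,
        (signOf c d (BitVec.ofNat w j) * signOf c d (BitVec.ofNat w k)) := by
    simp only [Finset.mul_sum]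
    calc _ = ∑ c : BitVec w, ∑ j ∈ C, ∑ k ∈ C, ∑ d : BitVec w, (x j * x k) *
        (signOf c d (BitVec.ofNat w j) * signOf c d (BitVec.ofNat w k)) := by
          refine Finset.sum_congr rfl fun c _ => ?_
          rw [Finset.sum_comm]
          refine Finset.sum_congr rfl fun j _ => Finset.sum_comm
      _ = _ := by
          rw [Finset.sum_comm]
          refine Finset.sum_congr rfl fun j _ => Finset.sum_comm
  rw [h2, Finset.mul_sum]
  refine Finset.sum_congr rfl fun j hj => ?_
  rw [Finset.sum_eq_single_of_mem j hj]
  · simp only [signOf_mul_self, Finset.sum_const, Finset.card_univ, nsmul_eq_mul, mul_one]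
    have : Fintype.card (BitVec w) = 2 ^ w := by
      rw [Fintype.card_congr BitVec.equivFin.toEquiv, Fintype.card_fin]
    rw [this]
    push_cast
    ring
  · intro k _ hkj
    rw [sum_signOf_mul hw (fun h => hkj (Fin.ext h.symm)) (j.isLt.trans_le hn) (k.isLt.trans_le hn),
      mul_zero]

end HeavyHitters

/-! ### Products over independent rows -/

open scoped ENNReal

namespace HeavyHitters

variable {w n : ℕ} {box : Bool → Estimator w n} {P : Layout}

/-- When a family is filled with independent samples, the expectation of a product of functions of
distinct members is the product of the expectations. -/
theorem expect_iter_update {α : Type} (μ : PMF α) {step : ℕ → (ℕ → α) → PMF (ℕ → α)}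
    (hstep : ∀ j f, step j f = μ.map (Function.update f j)) {S : Finset ℕ} {J : ℕ → ℕ}
    (hJ : Set.InjOn J S) (g : ℕ → α → ℝ≥0∞) (M : ℕ) (f : ℕ → α) :
    (PMF.iter step M f).expect (fun f' => ∏ t ∈ S, g t (f' (J t))) =
      ∏ t ∈ S, if J t < M then μ.expect (g t) else g t (f (J t)) := by
  induction M generalizing f with
  | zero => simp [PMF.iter, PMF.expect_pure]
  | succ M ih =>
    rw [PMF.iter, PMF.expect_bind, hstep, PMF.expect_map]
    simp only [ih]
    by_cases h : ∃ t₀ ∈ S, J t₀ = M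
    · obtain ⟨t₀, ht₀, hM⟩ := h
      have hne : ∀ t ∈ S.erase t₀, J t ≠ M := fun t ht h => by
        rw [Finset.mem_erase] at ht
        exact ht.1 (hJ ht.2 ht₀ (h.trans hM.symm))
      have h1 : ∀ x, (∏ t ∈ S, if J t < M then μ.expect (g t) else
          g t (Function.update f M x (J t))) = g t₀ x * ∏ t ∈ S.erase t₀,
            if J t < M + 1 then μ.expect (g t) else g t (f (J t)) := by
        intro x
        rw [← Finset.mul_prod_erase _ _ ht₀]
        congr 1
        · rw [if_neg (by omega), hM, Function.update_self]
        · refine Finset.prod_congr rfl fun t ht => ?_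
          have := hne t ht
          rw [Function.update_of_ne this]
          by_cases h2 : J t < M
          · rw [if_pos h2, if_pos (by omega)]
          · rw [if_neg h2, if_neg (by omega)]
      simp only [h1, PMF.expect_mul_right]
      rw [← Finset.mul_prod_erase _ _ ht₀, if_pos (by omega)]
    · push Not at h
      have h1 : ∀ x, (∏ t ∈ S, if J t < M then μ.expect (g t) else
          g t (Function.update f M x (J t))) = ∏ t ∈ S,
            if J t < M + 1 then μ.expect (g t) else g t (f (J t)) := by
        intro x
        refine Finset.prod_congr rfl fun t ht => ?_
        have := h t ht
        rw [Function.update_of_ne this]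
        by_cases h2 : J t < M
        · rw [if_pos h2, if_pos (by omega)]
        · rw [if_neg h2, if_neg (by omega)]
      simp only [h1, PMF.expect_const]

theorem div_bucket {t b B : ℕ} (hb : b < B) : (t * B + b) / B = t := by
  rw [mul_comm, Nat.mul_add_div (by omega), Nat.div_eq_of_lt hb, add_zero]

/-- While one update is processed, the instances in one bucket per row evolve independently. -/
theorem expect_rowUpdates (hl : P.l < w) (H : ℕ → RowHash w) (E : Estimator w n) (i : Fin n) (v : ℤ)
    {S : Finset ℕ} {b : ℕ → ℕ} (hb : ∀ t, b t < P.B) (g : ℕ → E.St → ℝ≥0∞) (k : ℕ) (ι : ℕ → E.St) :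
    (PMF.iter (rowUpdate P H E i v) k ι).expect (fun ι' => ∏ t ∈ S, g t (ι' (t * P.B + b t))) =
      ∏ t ∈ S, if t < k ∧ bucketOf P H t i = b t then
        (E.update i v (ι (t * P.B + b t))).expect (g t) else g t (ι (t * P.B + b t)) := by
  induction k generalizing ι with
  | zero => simp [PMF.iter, PMF.expect_pure]
  | succ k ih =>
    rw [PMF.iter, PMF.expect_bind, rowUpdate, PMF.expect_map]
    simp only [ih]
    have hB : bucketOf P H k i < P.B := (H k).bucket_lt hl _
    have hfar : ∀ t, t ≠ k → t * P.B + b t ≠ k * P.B + bucketOf P H k i := by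
      intro t ht h
      have := congrArg (· / P.B) h
      simp only [div_bucket (hb t), div_bucket hB] at this
      exact ht this
    have hother : ∀ t, t ≠ k → ∀ x, (if t < k ∧ bucketOf P H t i = b t then
        (E.update i v (Function.update ι (k * P.B + bucketOf P H k i) x
          (t * P.B + b t))).expect (g t)
        else g t (Function.update ι (k * P.B + bucketOf P H k i) x (t * P.B + b t))) =
        if t < k + 1 ∧ bucketOf P H t i = b t then
        (E.update i v (ι (t * P.B + b t))).expect (g t) else g t (ι (t * P.B + b t)) := by
      intro t ht x
      rw [Function.update_of_ne (hfar t ht)]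
      have : (t < k) = (t < k + 1) := by rw [eq_iff_iff]; omega
      simp only [this]
    by_cases hk : k ∈ S
    · simp only [← Finset.mul_prod_erase _ _ hk]
      have h1 : ∀ x, (∏ t ∈ S.erase k, if t < k ∧ bucketOf P H t i = b t then
          (E.update i v (Function.update ι (k * P.B + bucketOf P H k i) x
            (t * P.B + b t))).expect (g t)
          else g t (Function.update ι (k * P.B + bucketOf P H k i) x (t * P.B + b t))) =
          ∏ t ∈ S.erase k, if t < k + 1 ∧ bucketOf P H t i = b t then
          (E.update i v (ι (t * P.B + b t))).expect (g t) else g t (ι (t * P.B + b t)) :=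
        fun x => Finset.prod_congr rfl fun t ht => hother t (Finset.ne_of_mem_erase ht) x
      simp only [h1, PMF.expect_mul_right]
      congr 1
      by_cases hc : bucketOf P H k i = b k
      · simp [hc]
      · simp only [lt_irrefl, if_false, hc, and_false]
        have h2 : ∀ x, Function.update ι (k * P.B + bucketOf P H k i) x (k * P.B + b k) =
            ι (k * P.B + b k) := fun x => Function.update_of_ne (by omega) _ _
        simp only [h2, PMF.expect_const]
    · have h1 : ∀ x, (∏ t ∈ S, if t < k ∧ bucketOf P H t i = b t then
          (E.update i v (Function.update ι (k * P.B + bucketOf P H k i) x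
            (t * P.B + b t))).expect (g t)
          else g t (Function.update ι (k * P.B + bucketOf P H k i) x (t * P.B + b t))) =
          ∏ t ∈ S, if t < k + 1 ∧ bucketOf P H t i = b t then
          (E.update i v (ι (t * P.B + b t))).expect (g t) else g t (ι (t * P.B + b t)) :=
        fun x => Finset.prod_congr rfl fun t ht => hother t (fun h => hk (h ▸ ht)) x
      simp only [h1, PMF.expect_const]

/-- The part of a stream that falls into bucket `b` of row `t`. -/
def subStream (P : Layout) (H : ℕ → RowHash w) (t b : ℕ) (l : UpdStream n) : UpdStream n :=
  l.filter fun u => bucketOf P H t u.1 = b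

/-- The instances of one bucket per row evolve independently, each on its part of the stream. -/
theorem expect_feedAll (hl : P.l < w) (H : ℕ → RowHash w) {S : Finset ℕ}
    (hS : ∀ t ∈ S, t < P.N) {b : ℕ → ℕ} (hb : ∀ t, b t < P.B) (l : UpdStream n)
    (g : ℕ → (box false).St → ℝ≥0∞) (x : (ℕ → (box false).St) × (box true).St) :
    (feedAll P H box l x).expect (fun y => ∏ t ∈ S, g t (y.1 (t * P.B + b t))) =
      ∏ t ∈ S, ((box false).feed (subStream P H t (b t) l) (x.1 (t * P.B + b t))).expect (g t) := by
  induction l generalizing x with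
  | nil => simp [feedAll, PMF.expect_pure, subStream, Estimator.feed]
  | cons u l ih =>
    rw [feedAll, PMF.expect_bind]
    simp only [ih]
    rw [updateAll, PMF.expect_bind]
    simp only [PMF.expect_map, PMF.expect_const]
    rw [expect_rowUpdates hl H (box false) u.1 u.2 hb (fun t σ =>
      ((box false).feed (subStream P H t (b t) l) σ).expect (g t))]
    refine Finset.prod_congr rfl fun t ht => ?_
    by_cases hc : bucketOf P H t u.1 = b t
    · rw [if_pos ⟨hS t ht, hc⟩, subStream, subStream, List.filter_cons_of_pos (by simpa using hc),
        Estimator.feed, PMF.expect_bind]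
    · rw [if_neg (fun h => hc h.2), subStream, subStream,
        List.filter_cons_of_neg (by simpa using hc)]

theorem expect_feedAll_total (H : ℕ → RowHash w) (l : UpdStream n)
    (g : (box true).St → ℝ≥0∞) (x : (ℕ → (box false).St) × (box true).St) :
    (feedAll P H box l x).expect (fun y => g y.2) = ((box true).feed l x.2).expect g := by
  induction l generalizing x with
  | nil => simp [feedAll, PMF.expect_pure, Estimator.feed]
  | cons u l ih =>
    rw [feedAll, PMF.expect_bind]
    simp only [ih]
    rw [updateAll, PMF.expect_bind]
    simp only [PMF.expect_map, PMF.expect_const]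
    rw [Estimator.feed, PMF.expect_bind]

/-- The law of the random words of all rows. -/
noncomputable def hashLaw (P : Layout) (w : ℕ) : PMF (ℕ → RowHash w) :=
  PMF.iter (drawStep w) P.N fun _ => ⟨0, 0, 0, 0⟩

/-- The law of the random words and of the states of the black boxes at the end of a stream. -/
noncomputable def stateLaw (P : Layout) (box : Bool → Estimator w n) (l : UpdStream n) :
    PMF ((ℕ → RowHash w) × (ℕ → (box false).St) × (box true).St) :=
  (setupLaw P box).bind fun x => (feedAll P x.1 box l x.2).map fun y => (x.1, y)

/-- Given the random words, the instances in one bucket per row are independent, and each is in the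
law of the states after the part of the stream that its bucket receives. -/
theorem expect_stateLaw_prod (hl : P.l < w) {S : Finset ℕ}
    (hS : ∀ t ∈ S, t < P.N) {b : (ℕ → RowHash w) → ℕ → ℕ} (hb : ∀ H t, b H t < P.B)
    (l : UpdStream n) (g : (ℕ → RowHash w) → ℕ → (box false).St → ℝ≥0∞) :
    (stateLaw P box l).expect (fun x => ∏ t ∈ S, g x.1 t (x.2.1 (t * P.B + b x.1 t))) =
      (hashLaw P w).expect fun H => ∏ t ∈ S,
        ((box false).init.bind ((box false).feed (subStream P H t (b H t) l))).expect (g H t) := by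
  rw [stateLaw, PMF.expect_bind, setupLaw, PMF.expect_bind, hashLaw]
  congr 1
  funext H
  simp only [PMF.expect_bind, PMF.expect_map]
  have h1 : ∀ ι : ℕ → (box false).St, ((box true).init.expect fun σ => (feedAll P H box l (ι, σ)).expect
      fun y => ∏ t ∈ S, g H t (y.1 (t * P.B + b H t))) =
      ∏ t ∈ S, ((box false).feed (subStream P H t (b H t) l) (ι (t * P.B + b H t))).expect
        (g H t) := by
    intro ι
    simp only [expect_feedAll hl H hS (hb H) l (g H), PMF.expect_const]
  simp only [h1]
  rw [expect_iter_update (box false).init (step := initStep (box false)) (fun _ _ => rfl)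
    (J := fun t => t * P.B + b H t) ?_ (fun t σ =>
      ((box false).feed (subStream P H t (b H t) l) σ).expect (g H t))]
  · refine Finset.prod_congr rfl fun t ht => ?_
    rw [if_pos (P.inst_lt' (hS t ht) (hb H t))]
  · intro t _ t' _ h
    have := congrArg (· / P.B) h
    simpa only [div_bucket (hb H _)] using this

theorem expect_stateLaw_total (l : UpdStream n) (g : (box true).St → ℝ≥0∞) :
    (stateLaw P box l).expect (fun x => g x.2.2) =
      ((box true).init.bind ((box true).feed l)).expect g := by
  rw [stateLaw, PMF.expect_bind, setupLaw, PMF.expect_bind]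
  simp only [PMF.expect_bind, PMF.expect_map, expect_feedAll_total, PMF.expect_const]

theorem expect_stateLaw_hash (l : UpdStream n) (g : (ℕ → RowHash w) → ℝ≥0∞) :
    (stateLaw P box l).expect (fun x => g x.1) = (hashLaw P w).expect g := by
  rw [stateLaw, PMF.expect_bind, setupLaw, PMF.expect_bind, hashLaw]
  simp only [PMF.expect_bind, PMF.expect_map, PMF.expect_const]

/-- The random words of different rows are independent. -/
theorem expect_hashLaw_prod {S : Finset ℕ} (hS : ∀ t ∈ S, t < P.N) (g : ℕ → RowHash w → ℝ≥0∞) :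
    (hashLaw P w).expect (fun H => ∏ t ∈ S, g t (H t)) = ∏ t ∈ S, (drawRow w).expect (g t) := by
  rw [hashLaw]
  exact (expect_iter_update (drawRow w) (step := drawStep w) (fun _ _ => rfl) (J := id)
    (Function.injective_id.injOn) g _ _).trans
    (Finset.prod_congr rfl fun t ht => if_pos (hS t ht))

end HeavyHitters

/-! ### The errors of a test and of a level, given the random words -/

open scoped ENNReal

namespace HeavyHitters

variable {w n : ℕ} {box : Bool → Estimator w n} {P : Layout}

/-- The union bound for an iteration: an invariant is lost with at most the sum of the probabilities
to lose it in one step. -/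
theorem expect_iter_not_le {β : Type} {step : ℕ → β → PMF β} {I : ℕ → β → Prop} {e : ℕ → ℝ≥0∞}
    {N : ℕ} (h : ∀ k < N, ∀ b, I (k + 1) b →
      (step k b).expect (fun b' => open Classical in if I k b' then 0 else 1) ≤ e k) {b : β}
    (hb : I N b) :
    (PMF.iter step N b).expect (fun b' => open Classical in if I 0 b' then 0 else 1) ≤
      ∑ k ∈ Finset.range N, e k := by
  classical
  have key : ∀ k ≤ N, ∀ b, (PMF.iter step k b).expect (fun b' => if I 0 b' then 0 else 1) ≤
      (if I k b then 0 else 1) + ∑ j ∈ Finset.range k, e j := by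
    intro k
    induction k with
    | zero => intro _ b; simp [PMF.iter, PMF.expect_pure]
    | succ k ih =>
      intro hk b
      by_cases hI : I (k + 1) b
      · rw [if_pos hI, zero_add, PMF.iter, PMF.expect_bind, Finset.sum_range_succ, add_comm]
        refine (PMF.expect_mono _ fun b' => ih (by omega) b').trans ?_
        rw [PMF.expect_add, PMF.expect_const]
        gcongr
        convert h k (by omega) b hI
      · rw [if_neg hI]
        refine le_trans ?_ (le_add_right (le_refl (1 : ℝ≥0∞)))
        refine (PMF.expect_mono _ fun b' => ?_).trans_eq (PMF.expect_const _ 1)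
        split_ifs <;> simp
  have := key N le_rfl b
  rw [if_pos hb, zero_add] at this
  convert this

/-- The exponential moments of the number of acceptances. -/
theorem expect_testSteps (H : ℕ → RowHash w) (E : Estimator w n) (ι : ℕ → E.St) (thr : BitVec w)
    (s v : ℕ) (z : ℝ≥0∞) (k c : ℕ) :
    (PMF.iter (testStep P H E ι thr s v) k c).expect (fun c' => z ^ c') =
      z ^ c * ∏ r ∈ Finset.range k,
        (E.report (ι ((s * P.R + r) * P.B + nodeBucket P H (s * P.R + r) v))).expect fun a =>
          if Accepts P.q thr a then z else 1 := by
  induction k generalizing c with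
  | zero => simp [PMF.iter, PMF.expect_pure]
  | succ k ih =>
    rw [PMF.iter, PMF.expect_bind, testStep, PMF.expect_map, Finset.prod_range_succ]
    simp only [ih, PMF.expect_mul_right]
    have h1 : ∀ a : BitVec w × BitVec w, z ^ (if Accepts P.q thr a then c + 1 else c) =
        z ^ c * if Accepts P.q thr a then z else 1 := by
      intro a; split_ifs <;> simp [pow_succ]
    simp only [h1, PMF.expect_mul_left]
    ring

/-- The bound for the error of a majority among `R` rows, from the bad answers of each row: a wrong
majority has at least `R / 2` of them. -/
theorem expect_majority_le (H : ℕ → RowHash w) (E : Estimator w n) (ι : ℕ → E.St) (thr : BitVec w)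
    (s v : ℕ) {acc rej : Prop} (bad : ℕ → BitVec w × BitVec w → Prop)
    (hacc : acc → ∀ r a, ¬ bad r a → Accepts P.q thr a)
    (hrej : rej → ∀ r a, ¬ bad r a → ¬ Accepts P.q thr a) (hdisj : ¬ (acc ∧ rej)) :
    (testCount P H E ι thr s v).expect (fun c => open Classical in
      if (acc ∧ ¬ P.R < 2 * c) ∨ (rej ∧ P.R < 2 * c) then 1 else 0) ≤
    ∏ r ∈ Finset.range P.R, (2⁻¹ *
      (E.report (ι ((s * P.R + r) * P.B + nodeBucket P H (s * P.R + r) v))).expect fun a =>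
        open Classical in if bad r a then 4 else 1) := by
  classical
  by_cases ha : acc
  · have hr : ¬ rej := fun h => hdisj ⟨ha, h⟩
    calc (testCount P H E ι thr s v).expect (fun c => if (acc ∧ ¬ P.R < 2 * c) ∨
          (rej ∧ P.R < 2 * c) then 1 else 0)
        ≤ (testCount P H E ι thr s v).expect (fun c => 2 ^ P.R * (4⁻¹) ^ c) := by
          refine PMF.expect_mono _ fun c => ?_
          by_cases h : P.R < 2 * c
          · rw [if_neg (by tauto)]; exact zero_le
          · rw [if_pos (.inl ⟨ha, h⟩)]
            rw [not_lt] at h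
            have h4 : (4 : ℝ≥0∞)⁻¹ ^ c = (2 ^ (2 * c))⁻¹ := by
              rw [pow_mul, ← ENNReal.inv_pow]; norm_num
            rw [h4, ← div_eq_mul_inv, ENNReal.le_div_iff_mul_le (by simp) (by simp), one_mul]
            exact pow_le_pow_right₀ (by norm_num) h
      _ = ∏ r ∈ Finset.range P.R, (2 *
          (E.report (ι ((s * P.R + r) * P.B + nodeBucket P H (s * P.R + r) v))).expect fun a =>
            if Accepts P.q thr a then 4⁻¹ else 1) := by
          rw [PMF.expect_mul_left, testCount, expect_testSteps, pow_zero, one_mul,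
            Finset.prod_mul_distrib, Finset.prod_const, Finset.card_range]
      _ ≤ _ := by
          refine Finset.prod_le_prod' fun r _ => ?_
          rw [← PMF.expect_mul_left, ← PMF.expect_mul_left]
          refine PMF.expect_mono _ fun a => ?_
          have e1 : (2 : ℝ≥0∞) * 4⁻¹ = 2⁻¹ := by
            rw [show (4 : ℝ≥0∞) = 2 * 2 by norm_num, ENNReal.mul_inv (by simp) (by simp),
              ← mul_assoc, ENNReal.mul_inv_cancel (by simp) (by simp), one_mul]
          have e2 : (2 : ℝ≥0∞)⁻¹ * 4 = 2 := by
            rw [show (4 : ℝ≥0∞) = 2 * 2 by norm_num, ← mul_assoc,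
              ENNReal.inv_mul_cancel (by simp) (by simp), one_mul]
          by_cases hb : bad r a
          · rw [if_pos hb, e2]
            split_ifs
            · rw [e1]; exact (ENNReal.inv_le_one.2 (by norm_num)).trans (by norm_num)
            · simp
          · rw [if_neg hb, if_pos (hacc ha r a hb), e1, mul_one]
  · calc (testCount P H E ι thr s v).expect (fun c => if (acc ∧ ¬ P.R < 2 * c) ∨
          (rej ∧ P.R < 2 * c) then 1 else 0)
        ≤ (testCount P H E ι thr s v).expect (fun c => (if rej then 1 else 0) *
            (2⁻¹ ^ P.R * 4 ^ c)) := by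
          refine PMF.expect_mono _ fun c => ?_
          simp only [ha, false_and, false_or]
          by_cases hr : rej
          · simp only [hr, true_and, if_true, one_mul]
            split_ifs with h
            · have h4 : (4 : ℝ≥0∞) ^ c = 2 ^ (2 * c) := by rw [pow_mul]; norm_num
              rw [h4, ← ENNReal.inv_pow, mul_comm, ← div_eq_mul_inv,
                ENNReal.le_div_iff_mul_le (by simp) (by simp), one_mul]
              exact pow_le_pow_right₀ (by norm_num) h.le
            · exact zero_le
          · simp [hr]
      _ = (if rej then 1 else 0) * ∏ r ∈ Finset.range P.R, (2⁻¹ *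
          (E.report (ι ((s * P.R + r) * P.B + nodeBucket P H (s * P.R + r) v))).expect fun a =>
            if Accepts P.q thr a then 4 else 1) := by
          rw [PMF.expect_mul_left, PMF.expect_mul_left, testCount, expect_testSteps, pow_zero,
            one_mul, Finset.prod_mul_distrib, Finset.prod_const, Finset.card_range]
      _ ≤ _ := by
          by_cases hr : rej
          · rw [if_pos hr, one_mul]
            refine Finset.prod_le_prod' fun r _ => ?_
            gcongr
            refine PMF.expect_mono _ fun a => ?_
            by_cases hb : bad r a
            · rw [if_pos hb]; split_ifs <;> norm_num
            · rw [if_neg hb, if_neg (hrej hr r a hb)]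
          · simp [hr]

/-- A list of distinct nodes in `A` that contains all nodes with `Hv`. -/
structure GoodList (A : Finset ℕ) (Hv : ℕ → Prop) (x : List ℕ) : Prop where
  nodup : x.Nodup
  sub : ∀ v ∈ x, v ∈ A
  heavy : ∀ v, Hv v → v ∈ x

/-- The children of the nodes in a set. -/
def children (A : Finset ℕ) : Finset ℕ := A.image (fun u => 2 * u) ∪ A.image fun u => 2 * u + 1

theorem card_children_le (A : Finset ℕ) : (children A).card ≤ 2 * A.card := by
  refine (Finset.card_union_le _ _).trans ?_
  have h1 := Finset.card_image_le (s := A) (f := fun u => 2 * u)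
  have h2 := Finset.card_image_le (s := A) (f := fun u => 2 * u + 1)
  omega

theorem mem_children {A : Finset ℕ} {v : ℕ} : v ∈ children A ↔ v / 2 ∈ A := by
  simp only [children, Finset.mem_union, Finset.mem_image]
  constructor
  · rintro (⟨u, hu, rfl⟩ | ⟨u, hu, rfl⟩)
    · rwa [show 2 * u / 2 = u by omega]
    · rwa [show (2 * u + 1) / 2 = u by omega]
  · intro h
    rcases Nat.even_or_odd' v with ⟨u, rfl | rfl⟩
    · exact .inl ⟨u, by rwa [show 2 * u / 2 = u by omega] at h, rfl⟩
    · exact .inr ⟨u, by rwa [show (2 * u + 1) / 2 = u by omega] at h, rfl⟩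

theorem child_div (cur : List ℕ) (k : ℕ) : child cur k / 2 = cur.getD (k / 2) 0 := by
  unfold child; omega

theorem child_inj {cur : List ℕ} (h : cur.Nodup) {j k : ℕ} (hj : j < 2 * cur.length)
    (hk : k < 2 * cur.length) (hjk : child cur j = child cur k) : j = k := by
  have h1 := congrArg (· / 2) hjk
  simp only [child_div] at h1
  rw [← List.getElem_eq_getD (h := (by omega : j / 2 < cur.length)),
    ← List.getElem_eq_getD (h := (by omega : k / 2 < cur.length))] at h1
  have h2 := (List.Nodup.getElem_inj_iff h).1 h1
  unfold child at hjk
  rw [h2] at hjk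
  omega

theorem child_mem {cur : List ℕ} {k : ℕ} (hk : k < 2 * cur.length) :
    child cur k / 2 ∈ cur := by
  rw [child_div, ← List.getElem_eq_getD (h := (by omega : k / 2 < cur.length))]
  exact List.getElem_mem _

theorem exists_child {cur : List ℕ} {v : ℕ} (h : v / 2 ∈ cur) :
    ∃ k < 2 * cur.length, child cur k = v := by
  obtain ⟨j, hj, he⟩ := List.getElem_of_mem h
  refine ⟨2 * j + v % 2, by omega, ?_⟩
  rw [child, show (2 * j + v % 2) / 2 = j by omega, ← List.getElem_eq_getD (h := hj), he]
  omega

/-- The probability of a wrong outcome of the test of a node. -/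
noncomputable def testError (P : Layout) (H : ℕ → RowHash w) (E : Estimator w n) (ι : ℕ → E.St)
    (thr : BitVec w) (A : Finset ℕ) (Hv : ℕ → Prop) (s v : ℕ) : ℝ≥0∞ :=
  (testCount P H E ι thr s v).expect fun c => open Classical in
    if (Hv v ∧ ¬ P.R < 2 * c) ∨ (v ∉ A ∧ P.R < 2 * c) then 1 else 0

/-- The union bound for one level: its list is good unless the test of a child of a node in `A'`
goes wrong. As at most `q` nodes are in `A`, the list does not overflow before. -/
theorem expect_levelStep_le (H : ℕ → RowHash w) (E : Estimator w n) (ι : ℕ → E.St)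
    (thr : BitVec w) {A A' : Finset ℕ} {Hv Hv' : ℕ → Prop} (hA : A.card ≤ P.q)
    (hHv : ∀ v, Hv v → Hv' (v / 2)) {s : ℕ} {cur : List ℕ} (hcur : GoodList A' Hv' cur) :
    (levelStep P H E ι thr s cur).expect (fun new => open Classical in
      if GoodList A Hv new then 0 else 1) ≤
    ∑ v ∈ children A', testError P H E ι thr A Hv s v := by
  classical
  set I : ℕ → List ℕ → Prop := fun k new => new.Nodup ∧
    (∀ v ∈ new, v ∈ A ∧ ∃ j, k ≤ j ∧ j < 2 * cur.length ∧ v = child cur j) ∧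
    ∀ j, k ≤ j → j < 2 * cur.length → Hv (child cur j) → child cur j ∈ new with hI
  have hstep : ∀ k < 2 * cur.length, ∀ new, I (k + 1) new →
      (nodeStep P H E ι thr s cur k new).expect (fun new' => if I k new' then 0 else 1) ≤
        testError P H E ι thr A Hv s (child cur k) := by
    intro k hk new ⟨h1, h2, h3⟩
    rw [nodeStep, PMF.expect_map, testError]
    refine PMF.expect_mono _ fun c => ?_
    by_cases hbad : (Hv (child cur k) ∧ ¬ P.R < 2 * c) ∨ (child cur k ∉ A ∧ P.R < 2 * c)
    · rw [if_pos hbad]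
      split_ifs <;> simp
    · have hnew : child cur k ∉ new := fun h => by
        obtain ⟨-, j, hj, hj', he⟩ := h2 _ h
        have := child_inj hcur.nodup hk hj' he
        omega
      have hgood : I k (if P.R < 2 * c ∧ new.length < P.q then new ++ [child cur k] else new) := by
        split_ifs with hc
        · have hkA : child cur k ∈ A := by tauto
          refine ⟨List.nodup_append.2 ⟨h1, List.nodup_singleton _, ?_⟩, ?_, ?_⟩
          · intro a ha b hb
            rw [List.mem_singleton] at hb
            subst hb
            exact fun h => hnew (h ▸ ha)
          · intro v hv
            rcases List.mem_append.1 hv with hv | hv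
            · obtain ⟨hvA, j, hj, hj'⟩ := h2 v hv
              exact ⟨hvA, j, by omega, hj'⟩
            · rw [List.mem_singleton] at hv
              subst hv
              exact ⟨hkA, k, le_rfl, hk, rfl⟩
          · intro j hj hj' hh
            rcases Nat.eq_or_lt_of_le hj with rfl | hj
            · simp
            · exact List.mem_append_left _ (h3 j hj hj' hh)
        · refine ⟨h1, fun v hv => ?_, ?_⟩
          · obtain ⟨hvA, j, hj, hj'⟩ := h2 v hv
            exact ⟨hvA, j, by omega, hj'⟩
          · intro j hj hj' hh
            rcases Nat.eq_or_lt_of_le hj with rfl | hj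
            · exfalso
              have hR : P.R < 2 * c := by tauto
              have hkA : child cur k ∈ A := by tauto
              -- the list of accepted nodes is never full when an allowed node is accepted
              have hsub : insert (child cur k) new.toFinset ⊆ A := by
                intro v hv
                rw [Finset.mem_insert, List.mem_toFinset] at hv
                rcases hv with rfl | hv
                · exact hkA
                · exact (h2 v hv).1
              have hcard := Finset.card_le_card hsub
              rw [Finset.card_insert_of_notMem (by simpa using hnew),
                List.toFinset_card_of_nodup h1] at hcard
              exact hc ⟨hR, by omega⟩
            · exact h3 j hj hj' hh
      rw [if_pos hgood]
      exact zero_le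
  have hend : ∀ new, I 0 new → GoodList A Hv new := by
    rintro new ⟨h1, h2, h3⟩
    refine ⟨h1, fun v hv => (h2 v hv).1, fun v hv => ?_⟩
    obtain ⟨j, hj, rfl⟩ := exists_child (hcur.heavy _ (hHv v hv))
    exact h3 j (Nat.zero_le _) hj hv
  have h0 : I (2 * cur.length) [] :=
    ⟨List.nodup_nil, fun v hv => by simp at hv, fun j hj hj' => by omega⟩
  calc (levelStep P H E ι thr s cur).expect (fun new => if GoodList A Hv new then 0 else 1)
      ≤ (levelStep P H E ι thr s cur).expect (fun new => if I 0 new then 0 else 1) := by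
        refine PMF.expect_mono _ fun new => ?_
        by_cases h : I 0 new
        · rw [if_pos (hend new h)]; exact zero_le
        · rw [if_neg h]; split_ifs <;> simp
    _ ≤ ∑ k ∈ Finset.range (2 * cur.length), testError P H E ι thr A Hv s (child cur k) := by
        have := expect_iter_not_le (fun k hk b hb => by convert hstep k hk b hb) h0
        rw [levelStep]
        convert this
    _ = ∑ v ∈ (Finset.range (2 * cur.length)).image (child cur),
          testError P H E ι thr A Hv s v := by
        rw [Finset.sum_image]
        intro j hj k hk h
        simp only [Finset.coe_range, Set.mem_Iio] at hj hk
        exact child_inj hcur.nodup hj hk h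
    _ ≤ _ := by
        refine Finset.sum_le_sum_of_subset fun v hv => ?_
        obtain ⟨k, hk, rfl⟩ := Finset.mem_image.1 hv
        exact mem_children.2 (hcur.sub _ (child_mem (Finset.mem_range.1 hk)))

/-- The probability that the descent from the top level fails, given the random words and the states
of the black boxes. -/
theorem expect_levels_le (H : ℕ → RowHash w) (E : Estimator w n) (ι : ℕ → E.St)
    (thr : BitVec w) {A : ℕ → Finset ℕ} {Hv : ℕ → ℕ → Prop} (hA : ∀ s < P.L, (A s).card ≤ P.q)
    (hHv : ∀ s v, Hv s v → Hv (s + 1) (v / 2)) (htop : GoodList (A P.L) (Hv P.L) (List.range P.q)) :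
    (PMF.iter (levelStep P H E ι thr) P.L (List.range P.q)).expect (fun new => open Classical in
      if GoodList (A 0) (Hv 0) new then 0 else 1) ≤
    ∑ s ∈ Finset.range P.L, ∑ v ∈ children (A (s + 1)),
      testError P H E ι thr (A s) (Hv s) s v :=
  expect_iter_not_le (step := levelStep P H E ι thr) (I := fun s => GoodList (A s) (Hv s))
    (e := fun s => ∑ v ∈ children (A (s + 1)), testError P H E ι thr (A s) (Hv s) s v)
    (fun s hs _ hcur => expect_levelStep_le H E ι thr (hA s hs) (hHv s) hcur) htop

end HeavyHitters

/-! ### Frequency moments of buckets -/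

open scoped ENNReal

namespace HeavyHitters

variable {w n : ℕ} {box : Bool → Estimator w n} {P : Layout}

theorem vec_cons (u : Fin n × ℤ) (l : UpdStream n) (i : Fin n) :
    UpdStream.vec (u :: l) i = (if u.1 = i then u.2 else 0) + UpdStream.vec l i := by
  simp [UpdStream.vec]

theorem vec_filter (f : Fin n → Bool) (l : UpdStream n) (i : Fin n) :
    UpdStream.vec (l.filter fun u => f u.1) i = if f i then l.vec i else 0 := by
  induction l with
  | nil => simp [UpdStream.vec]
  | cons u l ih =>
    by_cases h : f u.1
    · rw [List.filter_cons_of_pos (by simpa using h), vec_cons, vec_cons, ih]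
      by_cases hi : u.1 = i
      · subst hi; simp [h]
      · simp [hi]
    · rw [List.filter_cons_of_neg (by simpa using h), vec_cons, ih]
      by_cases hi : u.1 = i
      · subst hi; simp [h]
      · simp [hi]

theorem valid_filter {m M : ℕ} {l : UpdStream n} (h : l.Valid m M) (f : Fin n × ℤ → Bool) :
    UpdStream.Valid m M (l.filter f) :=
  ⟨(List.length_filter_le _ _).trans h.1, fun u hu => h.2 u (List.mem_filter.1 hu).1⟩

theorem moment_nonneg (p : ℝ) (x : Fin n → ℤ) : 0 ≤ moment p x :=
  Finset.sum_nonneg fun _ _ => Real.rpow_nonneg (abs_nonneg _) _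

theorem one_le_abs_rpow {p : ℝ} (hp : 0 < p) {z : ℤ} (hz : z ≠ 0) : 1 ≤ |(z : ℝ)| ^ p := by
  refine Real.one_le_rpow ?_ hp.le
  rw [← Int.cast_abs]
  exact_mod_cast Int.one_le_abs hz

theorem moment_eq_zero_or {p : ℝ} (hp : 0 < p) (x : Fin n → ℤ) :
    (x = 0 ∧ moment p x = 0) ∨ 1 ≤ moment p x := by
  by_cases h : x = 0
  · left
    refine ⟨h, ?_⟩
    simp [h, moment, Real.zero_rpow hp.ne']
  · right
    obtain ⟨i, hi⟩ := Function.ne_iff.1 h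
    exact (one_le_abs_rpow hp hi).trans
      (Finset.single_le_sum (f := fun i => |(x i : ℝ)| ^ p)
        (fun i _ => Real.rpow_nonneg (abs_nonneg _) _) (Finset.mem_univ i))

/-- The contribution of a node of level `s` to the moment. -/
noncomputable def mass (p : ℝ) (x : Fin n → ℤ) (s v : ℕ) : ℝ :=
  ∑ i : Fin n, if (i : ℕ) / 2 ^ s = v then |(x i : ℝ)| ^ p else 0

/-- The contribution of the other nodes that share a bucket with `v` in a row of level `s`. -/
noncomputable def noise (p : ℝ) (x : Fin n → ℤ) (l s v : ℕ) (h : RowHash w) : ℝ :=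
  ∑ i : Fin n, if (i : ℕ) / 2 ^ s ≠ v ∧ h.bucket (w - l) (BitVec.ofNat w (i / 2 ^ s)) =
    h.bucket (w - l) (BitVec.ofNat w v) then |(x i : ℝ)| ^ p else 0

theorem rpow_abs_nonneg (p : ℝ) (z : ℤ) : 0 ≤ |(z : ℝ)| ^ p := Real.rpow_nonneg (abs_nonneg _) _

theorem noise_nonneg (p : ℝ) (x : Fin n → ℤ) (l s v : ℕ) (h : RowHash w) :
    0 ≤ noise p x l s v h :=
  Finset.sum_nonneg fun i _ => by split_ifs; exacts [rpow_abs_nonneg _ _, le_rfl]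

/-- The moment of the part of the stream in the bucket of a node. -/
theorem moment_subStream {p : ℝ} (hp : 0 < p) (H : ℕ → RowHash w) (t v : ℕ) (l : UpdStream n) :
    moment p (subStream P H t (nodeBucket P H t v) l).vec =
      mass p l.vec (t / P.R) v + noise p l.vec P.l (t / P.R) v (H t) := by
  rw [moment, mass, noise, ← Finset.sum_add_distrib]
  refine Finset.sum_congr rfl fun i _ => ?_
  rw [subStream, vec_filter (fun i => decide (bucketOf P H t i = nodeBucket P H t v))]
  simp only [bucketOf, nodeBucket, BitVec.toNat_inj, decide_eq_true_eq]
  by_cases h1 : (i : ℕ) / 2 ^ (t / P.R) = v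
  · simp [h1]
  · by_cases h2 : (H t).bucket (w - P.l) (BitVec.ofNat w (i / 2 ^ (t / P.R))) =
      (H t).bucket (w - P.l) (BitVec.ofNat w v)
    · simp [h1, h2]
    · simp [h1, h2, Real.zero_rpow hp.ne']

theorem expect_drawRow (f : RowHash w → ℝ≥0∞) :
    (drawRow w).expect f = (Prog.randWord w).expect fun a => (Prog.randWord w).expect fun b =>
      (Prog.randWord w).expect fun c => (Prog.randWord w).expect fun d => f ⟨a, b, c, d⟩ := by
  simp only [drawRow, PMF.expect_bind, PMF.expect_pure]

/-- Markov's inequality for the mass of the other nodes in the bucket of a node, which has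
expectation at most `moment p x / 2 ^ l`. -/
theorem expect_noise_gt_le {p : ℝ} (x : Fin n → ℤ) {l : ℕ} (hl : l < w) (s : ℕ) {v : ℕ}
    (hn : n ≤ 2 ^ (w - l)) (hv : v < 2 ^ (w - l)) {θ : ℝ} (hθ : 0 < θ) :
    ((drawRow w).expect fun h => open Classical in if θ < noise p x l s v h then 1 else 0) ≤
      ENNReal.ofReal (moment p x / θ) * (2 ^ l : ℝ≥0∞)⁻¹ := by
  classical
  set c : Fin n → RowHash w → ℝ≥0∞ := fun i h =>
    if h.bucket (w - l) (BitVec.ofNat w (i / 2 ^ s)) = h.bucket (w - l) (BitVec.ofNat w v) then 1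
    else 0 with hc
  calc ((drawRow w).expect fun h => if θ < noise p x l s v h then 1 else 0)
      ≤ (drawRow w).expect fun h => ∑ i ∈ Finset.univ.filter (fun i : Fin n => (i : ℕ) / 2 ^ s ≠ v),
          ENNReal.ofReal (|(x i : ℝ)| ^ p / θ) * c i h := by
        refine PMF.expect_mono _ fun h => ?_
        split_ifs with hh
        · have h1 : (1 : ℝ) ≤ noise p x l s v h / θ := by
            rw [le_div_iff₀ hθ, one_mul]; exact hh.le
          rw [← ENNReal.ofReal_one]
          refine (ENNReal.ofReal_le_ofReal h1).trans ?_
          rw [noise, Finset.sum_div, ENNReal.ofReal_sum_of_nonneg (fun i _ => by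
            split_ifs
            · exact div_nonneg (rpow_abs_nonneg _ _) hθ.le
            · simp), Finset.sum_filter]
          refine Finset.sum_le_sum fun i _ => ?_
          simp only [hc]
          by_cases h1 : (i : ℕ) / 2 ^ s = v
          · simp [h1]
          · by_cases h2 : h.bucket (w - l) (BitVec.ofNat w (i / 2 ^ s)) =
              h.bucket (w - l) (BitVec.ofNat w v)
            · simp [h1, h2]
            · simp [h1, h2]
        · exact zero_le
    _ = ∑ i ∈ Finset.univ.filter (fun i : Fin n => (i : ℕ) / 2 ^ s ≠ v),
          ENNReal.ofReal (|(x i : ℝ)| ^ p / θ) * (drawRow w).expect (c i) := by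
        simp only [PMF.expect_sum, PMF.expect_mul_left]
    _ ≤ ∑ i ∈ Finset.univ.filter (fun i : Fin n => (i : ℕ) / 2 ^ s ≠ v),
          ENNReal.ofReal (|(x i : ℝ)| ^ p / θ) * (2 ^ l : ℝ≥0∞)⁻¹ := by
        refine Finset.sum_le_sum fun i hi => ?_
        gcongr
        rw [Finset.mem_filter] at hi
        rw [expect_drawRow]
        have hi' := expect_collision_le hl hi.2
          ((Nat.div_le_self _ _).trans_lt (i.isLt.trans_le hn)) hv
        have h2 : ∀ a b c' d : BitVec w, c i ⟨a, b, c', d⟩ =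
            if (a * BitVec.ofNat w (↑i / 2 ^ s) + b) >>> (w - l) =
              (a * BitVec.ofNat w v + b) >>> (w - l) then 1 else 0 := fun _ _ _ _ => rfl
        simp only [h2, PMF.expect_const]
        exact hi'
    _ ≤ ∑ i, ENNReal.ofReal (|(x i : ℝ)| ^ p / θ) * (2 ^ l : ℝ≥0∞)⁻¹ :=
        Finset.sum_le_sum_of_subset (Finset.filter_subset _ _)
    _ = _ := by
        rw [← Finset.sum_mul, ← ENNReal.ofReal_sum_of_nonneg (fun i _ =>
          div_nonneg (rpow_abs_nonneg _ _) hθ.le), ← Finset.sum_div]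
        rfl

/-- An answer within the guarantee for a moment `F`. -/
def GoodAnswer (F : ℝ) (a : BitVec w × BitVec w) : Prop :=
  a.2 ≠ 0 ∧ ((a.1.toNat : ℝ) / (a.2.toNat : ℝ)) ∈ Set.Icc ((1 - 1 / 7) * F) ((1 + 1 / 7) * F)

theorem expect_not_goodAnswer_le {E : Estimator w n} {p d : ℝ} {m M : ℕ}
    (hE : E.Estimates p m M (1 / 7) d) {l : UpdStream n} (hl : l.Valid m M) :
    ((E.answer l).expect fun a => open Classical in
      if GoodAnswer (moment p l.vec) a then 0 else 1) ≤ ENNReal.ofReal d := by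
  classical
  have := PMF.expect_compl_le _ _ _ (hE l hl)
  convert this using 3
  exact if_congr Iff.rfl rfl rfl

/-- The event that a row misleads the test of the node `v`: too much noise, or a bad answer. -/
def RowBad (p : ℝ) (x : Fin n → ℤ) (l s v : ℕ) (θ : ℝ) (h : RowHash w)
    (a : BitVec w × BitVec w) : Prop :=
  θ < noise p x l s v h ∨ ¬ GoodAnswer (mass p x s v + noise p x l s v h) a

/-- The expected weight of a row in the bound for the error of a majority. -/
theorem expect_row_le {E : Estimator w n} {p : ℝ} (hp : 0 < p) {m M : ℕ}
    (hE : E.Estimates p m M (1 / 7) (1 / 5)) {l : UpdStream n} (hl : l.Valid m M) (hlw : P.l < w)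
    {t v : ℕ} (hn : n ≤ 2 ^ (w - P.l)) (hv : v < 2 ^ (w - P.l)) {θ : ℝ} (hθ : 0 < θ)
    (hsmall : ENNReal.ofReal (moment p l.vec / θ) * (2 ^ P.l : ℝ≥0∞)⁻¹ ≤ 1 / 40) :
    ((drawRow w).expect fun h => 2⁻¹ *
      (E.answer (subStream P (fun _ => h) t (nodeBucket P (fun _ => h) t v) l)).expect fun a =>
        open Classical in if RowBad p l.vec P.l (t / P.R) v θ h a then 4 else 1) ≤ 83 / 100 := by
  classical
  have h1 : ∀ h : RowHash w,
      ((E.answer (subStream P (fun _ => h) t (nodeBucket P (fun _ => h) t v) l)).expect fun a =>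
        if RowBad p l.vec P.l (t / P.R) v θ h a then 4 else 1) ≤
      8 / 5 + 12 / 5 * (if θ < noise p l.vec P.l (t / P.R) v h then 1 else 0) := by
    intro h
    by_cases hh : θ < noise p l.vec P.l (t / P.R) v h
    · rw [if_pos hh]
      calc _ ≤ (E.answer (subStream P (fun _ => h) t (nodeBucket P (fun _ => h) t v) l)).expect
            (fun _ => 4) := PMF.expect_mono _ fun a => by split_ifs <;> norm_num
        _ = 4 := PMF.expect_const _ _
        _ = _ := by
            rw [mul_one, ENNReal.div_add_div_same,
              ENNReal.eq_div_iff (by norm_num) (by norm_num)]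
            norm_num
    · rw [if_neg hh, mul_zero, add_zero]
      have hm := moment_subStream (P := P) hp (fun _ => h) t v l
      calc _ ≤ (E.answer (subStream P (fun _ => h) t (nodeBucket P (fun _ => h) t v) l)).expect
            (fun a => 1 + 3 * if GoodAnswer (moment p (subStream P (fun _ => h) t
              (nodeBucket P (fun _ => h) t v) l).vec) a then 0 else 1) := by
            refine PMF.expect_mono _ fun a => ?_
            rw [hm]
            by_cases hg : GoodAnswer (mass p l.vec (t / P.R) v + noise p l.vec P.l (t / P.R) v h) a
            · rw [if_neg (by rintro (h1 | h1); exacts [hh h1, h1 hg])]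
              simp
            · rw [if_pos (.inr hg), if_neg hg]
              norm_num
        _ ≤ 1 + 3 * ENNReal.ofReal (1 / 5) := by
            rw [PMF.expect_add, PMF.expect_const, PMF.expect_mul_left]
            gcongr
            exact expect_not_goodAnswer_le hE (valid_filter hl _)
        _ = _ := by
            rw [show (1 : ℝ≥0∞) = ENNReal.ofReal 1 by simp, show (3 : ℝ≥0∞) = ENNReal.ofReal 3 by simp,
              show (8 : ℝ≥0∞) = ENNReal.ofReal 8 by simp, show (5 : ℝ≥0∞) = ENNReal.ofReal 5 by simp,
              ← ENNReal.ofReal_mul (by norm_num), ← ENNReal.ofReal_add (by norm_num) (by norm_num),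
              ← ENNReal.ofReal_div_of_pos (by norm_num)]
            norm_num
  calc _ ≤ (drawRow w).expect fun h => 2⁻¹ * (8 / 5 + 12 / 5 *
        (if θ < noise p l.vec P.l (t / P.R) v h then 1 else 0)) := by
        refine PMF.expect_mono _ fun h => ?_
        gcongr
        exact h1 h
    _ ≤ 2⁻¹ * (8 / 5 + 12 / 5 * (1 / 40)) := by
        rw [PMF.expect_mul_left, PMF.expect_add, PMF.expect_const, PMF.expect_mul_left]
        gcongr
        exact (expect_noise_gt_le l.vec hlw _ hn hv hθ).trans hsmall
    _ = 83 / 100 := by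
        rw [show (8 / 5 : ℝ≥0∞) = ENNReal.ofReal (8 / 5) by
            rw [ENNReal.ofReal_div_of_pos (by norm_num)]; simp,
          show (12 / 5 : ℝ≥0∞) = ENNReal.ofReal (12 / 5) by
            rw [ENNReal.ofReal_div_of_pos (by norm_num)]; simp,
          show (1 / 40 : ℝ≥0∞) = ENNReal.ofReal (1 / 40) by
            rw [ENNReal.ofReal_div_of_pos (by norm_num)]; simp,
          show (83 / 100 : ℝ≥0∞) = ENNReal.ofReal (83 / 100) by
            rw [ENNReal.ofReal_div_of_pos (by norm_num)]; simp,
          show (2⁻¹ : ℝ≥0∞) = ENNReal.ofReal 2⁻¹ by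
            rw [ENNReal.ofReal_inv_of_pos (by norm_num)]; simp,
          ← ENNReal.ofReal_mul (by norm_num), ← ENNReal.ofReal_add (by norm_num) (by norm_num),
          ← ENNReal.ofReal_mul (by norm_num)]
        norm_num

end HeavyHitters

/-! ### The expected error of the descent -/

open scoped ENNReal

namespace HeavyHitters

variable {w n : ℕ} {box : Bool → Estimator w n} {P : Layout}

/-- The expected weight of all rows of a level in the bound for the error of a majority. -/
theorem expect_levelRows_le {p : ℝ} (hp : 0 < p) {m M : ℕ}
    (hE : (box false).Estimates p m M (1 / 7) (1 / 5)) {l : UpdStream n} (hl : l.Valid m M)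
    (hlw : P.l < w) {s v : ℕ} (hs : s < P.L) (hn : n ≤ 2 ^ (w - P.l)) (hv : v < 2 ^ (w - P.l))
    {θ : ℝ} (hθ : 0 < θ)
    (hsmall : ENNReal.ofReal (moment p l.vec / θ) * (2 ^ P.l : ℝ≥0∞)⁻¹ ≤ 1 / 40) :
    ((stateLaw P box l).expect fun x => ∏ r ∈ Finset.range P.R, (2⁻¹ *
      ((box false).report (x.2.1 ((s * P.R + r) * P.B +
        nodeBucket P x.1 (s * P.R + r) v))).expect fun a => open Classical in
          if RowBad p l.vec P.l s v θ (x.1 (s * P.R + r)) a then 4 else 1)) ≤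
      (83 / 100) ^ P.R := by
  classical
  set S := Finset.Ico (s * P.R) (s * P.R + P.R) with hS
  have hSN : ∀ t ∈ S, t < P.N := fun t ht => by
    rw [hS, Finset.mem_Ico] at ht
    have : (s + 1) * P.R ≤ P.N := Nat.mul_le_mul_right _ hs
    rw [Nat.succ_mul] at this
    omega
  have hSs : ∀ t ∈ S, t / P.R = s := fun t ht => by
    rw [hS, Finset.mem_Ico] at ht
    refine Nat.div_eq_of_lt_le ht.1 ?_
    rw [Nat.succ_mul]
    exact ht.2
  set g : (ℕ → RowHash w) → ℕ → (box false).St → ℝ≥0∞ := fun H t σ => 2⁻¹ *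
    ((box false).report σ).expect fun a =>
      if RowBad p l.vec P.l s v θ (H t) a then 4 else 1 with hg
  have h1 : ∀ x : (ℕ → RowHash w) × (ℕ → (box false).St) × (box true).St,
      (∏ r ∈ Finset.range P.R, (2⁻¹ *
      ((box false).report (x.2.1 ((s * P.R + r) * P.B +
        nodeBucket P x.1 (s * P.R + r) v))).expect fun a =>
          if RowBad p l.vec P.l s v θ (x.1 (s * P.R + r)) a then 4 else 1)) =
      ∏ t ∈ S, g x.1 t (x.2.1 (t * P.B + nodeBucket P x.1 t v)) := by
    intro x
    rw [hS, Finset.prod_Ico_eq_prod_range, Nat.add_sub_cancel_left]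
  simp only [h1]
  rw [expect_stateLaw_prod (b := fun H t => nodeBucket P H t v) hlw hSN
    (fun H t => nodeBucket_lt hlw t v) l g]
  set G : ℕ → RowHash w → ℝ≥0∞ := fun t h => 2⁻¹ *
    ((box false).answer (subStream P (fun _ => h) t (nodeBucket P (fun _ => h) t v) l)).expect
      fun a => if RowBad p l.vec P.l s v θ h a then 4 else 1 with hG
  have h2 : ∀ H : ℕ → RowHash w, (∏ t ∈ S, ((box false).init.bind ((box false).feed
      (subStream P H t (nodeBucket P H t v) l))).expect (g H t)) = ∏ t ∈ S, G t (H t) := by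
    intro H
    refine Finset.prod_congr rfl fun t _ => ?_
    simp only [hg, hG, PMF.expect_mul_left, Estimator.answer]
    rw [PMF.expect_bind (k := (box false).report)]
    rfl
  simp only [h2]
  rw [expect_hashLaw_prod hSN]
  refine (Finset.prod_le_pow_card _ _ (83 / 100) fun t ht => ?_).trans_eq ?_
  · have := expect_row_le (P := P) hp hE hl hlw (t := t) hn hv hθ hsmall
    rw [hSs t ht] at this
    exact this
  · rw [hS, Nat.card_Ico, Nat.add_sub_cancel_left]

/-- The nodes of level `s` that may be accepted. -/
noncomputable def allowed (p φ : ℝ) (x : Fin n → ℤ) (s : ℕ) : Finset ℕ := open Classical in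
  (Finset.range n).filter fun v => φ / 2 * moment p x ≤ mass p x s v

theorem exists_of_mass_pos {p : ℝ} {x : Fin n → ℤ} {s v : ℕ} (h : 0 < mass p x s v) :
    ∃ i : Fin n, (i : ℕ) / 2 ^ s = v := by
  by_contra! hne
  rw [mass, Finset.sum_eq_zero fun i _ => if_neg (hne i)] at h
  exact h.false

theorem lt_of_mass_pos {p : ℝ} {x : Fin n → ℤ} {s v : ℕ} (h : 0 < mass p x s v) : v < n := by
  obtain ⟨i, rfl⟩ := exists_of_mass_pos h
  exact (Nat.div_le_self _ _).trans_lt i.isLt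

theorem sum_mass_le (p : ℝ) (x : Fin n → ℤ) (s : ℕ) (A : Finset ℕ) :
    ∑ v ∈ A, mass p x s v ≤ moment p x := by
  simp only [mass]
  rw [Finset.sum_comm, moment]
  refine Finset.sum_le_sum fun i _ => ?_
  rw [Finset.sum_ite_eq]
  split_ifs
  exacts [le_rfl, rpow_abs_nonneg _ _]

/-- The masses of the nodes of a level add up to the moment, so that few of them are large. -/
theorem card_allowed_le {p φ : ℝ} {x : Fin n → ℤ} (hF : 0 < moment p x) (hφ : 0 < φ) {q : ℕ}
    (hq : 2 / φ ≤ q) (s : ℕ) : (allowed p φ x s).card ≤ q := by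
  have h1 : (allowed p φ x s).card * (φ / 2 * moment p x) ≤ moment p x := by
    refine le_trans ?_ (sum_mass_le p x s (allowed p φ x s))
    rw [← nsmul_eq_mul]
    exact Finset.card_nsmul_le_sum _ _ _ fun v hv => (Finset.mem_filter.1 hv).2
  have h2 : ((allowed p φ x s).card : ℝ) * (φ / 2) ≤ 1 := by
    by_contra! h
    nlinarith
  have h3 : ((allowed p φ x s).card : ℝ) ≤ 2 / φ := by
    rw [le_div_iff₀ hφ]; linarith
  exact_mod_cast h3.trans hq

theorem mass_le_mass_succ (p : ℝ) (x : Fin n → ℤ) (s v : ℕ) :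
    mass p x s v ≤ mass p x (s + 1) (v / 2) := by
  refine Finset.sum_le_sum fun i _ => ?_
  by_cases h : (i : ℕ) / 2 ^ s = v
  · rw [if_pos h, if_pos (by rw [pow_succ, ← Nat.div_div_eq_div_mul, h])]
  · rw [if_neg h]
    split_ifs
    exacts [rpow_abs_nonneg _ _, le_rfl]

/-- The moment in the bucket of a node is that of a vector of integers. -/
theorem mass_add_noise_eq {p : ℝ} (hp : 0 < p) (x : Fin n → ℤ) (l s v : ℕ) (h : RowHash w) :
    ∃ y : Fin n → ℤ, mass p x s v + noise p x l s v h = moment p y ∧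
      moment p y ≤ moment p x := by
  classical
  refine ⟨fun i => if (i : ℕ) / 2 ^ s = v ∨ h.bucket (w - l) (BitVec.ofNat w (i / 2 ^ s)) =
    h.bucket (w - l) (BitVec.ofNat w v) then x i else 0, ?_, ?_⟩
  · rw [mass, noise, ← Finset.sum_add_distrib, moment]
    refine Finset.sum_congr rfl fun i _ => ?_
    by_cases h1 : (i : ℕ) / 2 ^ s = v
    · simp [h1]
    · by_cases h2 : h.bucket (w - l) (BitVec.ofNat w (i / 2 ^ s)) =
        h.bucket (w - l) (BitVec.ofNat w v)
      · simp [h1, h2]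
      · simp [h1, h2, Real.zero_rpow hp.ne']
  · refine Finset.sum_le_sum fun i _ => ?_
    dsimp only
    split_ifs
    · exact le_rfl
    · rw [Int.cast_zero, abs_zero, Real.zero_rpow hp.ne']
      exact rpow_abs_nonneg _ _

/-- What the comparison with the threshold has to achieve: given a good answer for the moment `F`
of the stream, a good answer for `F'` is accepted if `F'` is at least `φ F`, and rejected if it is
at most `0.55 φ F`. -/
def Separates (q : ℕ) (w : ℕ) (φ F : ℝ) : Prop :=
  ∀ r : BitVec w × BitVec w, GoodAnswer F r → ∀ (F' : ℝ) (a : BitVec w × BitVec w),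
    F' = 0 ∨ 1 ≤ F' → F' ≤ F → GoodAnswer F' a →
      (φ * F ≤ F' → Accepts q (threshold r) a) ∧
      (F' < 11 / 20 * (φ * F) → ¬ Accepts q (threshold r) a)

/-- The probability that the list of leaves is wrong. -/
theorem expect_leaves_le {p φ d : ℝ} (hp : 0 < p) (hφ : 0 < φ) {m M : ℕ}
    (hE : (box false).Estimates p m M (1 / 7) (1 / 5))
    (hE' : (box true).Estimates p m M (1 / 7) d) {l : UpdStream n} (hl : l.Valid m M)
    (hF : 0 < moment p l.vec) (hL : 0 < P.L) (hlw : P.l < w) (hn : 2 * n ≤ 2 ^ (w - P.l))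
    (hq : 2 * P.q ≤ 2 ^ (w - P.l)) (hqφ : 2 / φ ≤ P.q) (hB : 800 / φ ≤ 2 ^ P.l)
    (htop : ∀ i < n, i / 2 ^ P.L < P.q) (hsep : Separates P.q w φ (moment p l.vec)) :
    ((stateLaw P box l).expect fun x => (reportLaw P x.1 box x.2).expect fun leaves =>
      open Classical in if GoodList (allowed p φ l.vec 0)
        (fun v => φ * moment p l.vec ≤ mass p l.vec 0 v) leaves then 0 else 1) ≤
      ENNReal.ofReal d + ((P.L * (2 * P.q) : ℕ) : ℝ≥0∞) * (83 / 100) ^ P.R := by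
  classical
  set F := moment p l.vec with hFdef
  set θ := φ * F / 20 with hθdef
  have hφF : 0 < φ * F := mul_pos hφ hF
  have hθ : 0 < θ := by positivity
  have hsmall : ENNReal.ofReal (F / θ) * (2 ^ P.l : ℝ≥0∞)⁻¹ ≤ 1 / 40 := by
    have h1 : F / θ = 20 / φ := by rw [hθdef]; field_simp
    have h2 : (2 ^ P.l : ℝ≥0∞) = ENNReal.ofReal (2 ^ P.l) := by
      rw [ENNReal.ofReal_pow (by norm_num)]; norm_num
    have h3 : (1 / 40 : ℝ≥0∞) = ENNReal.ofReal (1 / 40) := by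
      rw [ENNReal.ofReal_div_of_pos (by norm_num)]; simp
    rw [h1, h2, h3, ← ENNReal.ofReal_inv_of_pos (by positivity),
      ← ENNReal.ofReal_mul (by positivity)]
    refine ENNReal.ofReal_le_ofReal ?_
    rw [← div_eq_mul_inv, div_le_iff₀ (by positivity)]
    have : 800 / φ = 40 * (20 / φ) := by ring
    linarith
  set A : ℕ → Finset ℕ := fun s => if s < P.L then allowed p φ l.vec s else Finset.range P.q with hA
  set Hv : ℕ → ℕ → Prop := fun s v => φ * F ≤ mass p l.vec s v with hHv
  set T : ℕ → ℕ → ((ℕ → RowHash w) × (ℕ → (box false).St) × (box true).St) → ℝ≥0∞ :=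
    fun s v x => ∏ r ∈ Finset.range P.R, (2⁻¹ *
      ((box false).report (x.2.1 ((s * P.R + r) * P.B +
        nodeBucket P x.1 (s * P.R + r) v))).expect fun a =>
          if RowBad p l.vec P.l s v θ (x.1 (s * P.R + r)) a then 4 else 1) with hT
  have hA0 : ∀ s < P.L, A s = allowed p φ l.vec s := fun s hs => if_pos hs
  have hAc : ∀ s, (A s).card ≤ P.q := fun s => by
    simp only [hA]
    split_ifs
    · exact card_allowed_le hF hφ hqφ s
    · simp
  have hAlt : ∀ s, ∀ v ∈ children (A s), v < 2 ^ (w - P.l) := by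
    intro s v hv
    rw [mem_children] at hv
    simp only [hA] at hv
    split_ifs at hv
    · have := Finset.mem_range.1 (Finset.mem_filter.1 hv).1
      omega
    · have := Finset.mem_range.1 hv
      omega
  have hgoodlist : GoodList (A P.L) (Hv P.L) (List.range P.q) := by
    refine ⟨List.nodup_range, fun v hv => ?_, fun v hv => ?_⟩
    · simpa [hA] using hv
    · obtain ⟨i, rfl⟩ := exists_of_mass_pos (hφF.trans_le hv)
      simpa using htop i i.isLt
  -- the rows of a test separate heavy nodes from nodes that are not allowed
  have htest : ∀ x r, GoodAnswer F r → ∀ s < P.L, ∀ v,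
      testError P x.1 (box false) x.2.1 (threshold r) (A s) (Hv s) s v ≤ T s v x := by
    intro x r hr s hs v
    have hrow : ∀ (r' : ℕ) (a : BitVec w × BitVec w),
        ¬ RowBad p l.vec P.l s v θ (x.1 (s * P.R + r')) a →
        (Hv s v → Accepts P.q (threshold r) a) ∧ (v ∉ A s → ¬ Accepts P.q (threshold r) a) := by
      intro r' a ha
      rw [RowBad, not_or, not_lt, not_not] at ha
      obtain ⟨y, hy, hyF⟩ := mass_add_noise_eq hp l.vec P.l s v (x.1 (s * P.R + r'))
      have h01 : moment p y = 0 ∨ 1 ≤ moment p y := (moment_eq_zero_or hp y).imp_left And.right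
      rw [← hy] at h01 hyF
      have key := hsep r hr _ a h01 hyF ha.2
      have hno := noise_nonneg p l.vec P.l s v (x.1 (s * P.R + r'))
      refine ⟨fun h => key.1 (by simp only [hHv] at h; linarith), fun h => key.2 ?_⟩
      have hlt : mass p l.vec s v < φ / 2 * F := by
        by_contra! hge
        refine h ?_
        rw [hA0 s hs]
        refine Finset.mem_filter.2 ⟨Finset.mem_range.2 (lt_of_mass_pos (p := p) (x := l.vec)
          (s := s) ?_), hge⟩
        exact lt_of_lt_of_le (by linarith) hge
      have := ha.1
      rw [hθdef] at this
      linarith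
    have hdisj : ¬ (Hv s v ∧ v ∉ A s) := by
      rintro ⟨h1, h2⟩
      refine h2 ?_
      rw [hA0 s hs]
      refine Finset.mem_filter.2 ⟨Finset.mem_range.2 (lt_of_mass_pos (hφF.trans_le h1)), ?_⟩
      exact le_trans (by linarith) h1
    have := expect_majority_le x.1 (box false) x.2.1 (threshold r) s v
      (fun r' a => RowBad p l.vec P.l s v θ (x.1 (s * P.R + r')) a)
      (fun h r' a ha => (hrow r' a ha).1 h) (fun h r' a ha => (hrow r' a ha).2 h) hdisj
    simp only [testError, hT]
    convert this
  have hpoint : ∀ x : (ℕ → RowHash w) × (ℕ → (box false).St) × (box true).St,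
      ((reportLaw P x.1 box x.2).expect fun leaves =>
        if GoodList (allowed p φ l.vec 0) (Hv 0) leaves then 0 else 1) ≤
      (((box true).report x.2.2).expect fun r => if GoodAnswer F r then 0 else 1) +
        ∑ s ∈ Finset.range P.L, ∑ v ∈ children (A (s + 1)), T s v x := by
    intro x
    rw [reportLaw, PMF.expect_bind, ← PMF.expect_const ((box true).report x.2.2)
      (∑ s ∈ Finset.range P.L, ∑ v ∈ children (A (s + 1)), T s v x), ← PMF.expect_add]
    refine PMF.expect_mono _ fun r => ?_
    by_cases hr : GoodAnswer F r
    · rw [if_pos hr, zero_add]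
      rw [← hA0 0 hL]
      refine le_trans ?_ ((expect_levels_le x.1 (box false) x.2.1 (threshold r)
        (A := A) (Hv := Hv) (fun s _ => hAc s)
        (fun s v h => le_trans h (mass_le_mass_succ _ _ _ _)) hgoodlist).trans
        (Finset.sum_le_sum fun s hs => Finset.sum_le_sum fun v _ =>
          htest x r hr s (Finset.mem_range.1 hs) v))
      exact PMF.expect_mono _ fun _ => le_of_eq (by congr)
    · rw [if_neg hr]
      refine le_trans ?_ (le_add_right (le_refl (1 : ℝ≥0∞)))
      refine (PMF.expect_mono _ fun _ => ?_).trans_eq (PMF.expect_const _ 1)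
      split_ifs <;> simp
  calc _ ≤ (stateLaw P box l).expect fun x =>
        (((box true).report x.2.2).expect fun r => if GoodAnswer F r then 0 else 1) +
        ∑ s ∈ Finset.range P.L, ∑ v ∈ children (A (s + 1)), T s v x := PMF.expect_mono _ hpoint
    _ ≤ ENNReal.ofReal d + ∑ s ∈ Finset.range P.L, ∑ v ∈ children (A (s + 1)),
          (83 / 100) ^ P.R := by
        rw [PMF.expect_add]
        gcongr
        · rw [expect_stateLaw_total l fun σ => ((box true).report σ).expect
            fun r => if GoodAnswer F r then 0 else 1, ← PMF.expect_bind]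
          have := expect_not_goodAnswer_le hE' hl
          rw [Estimator.answer] at this
          convert this
        · simp only [PMF.expect_sum]
          refine Finset.sum_le_sum fun s hs => Finset.sum_le_sum fun v hv => ?_
          have := expect_levelRows_le (P := P) (box := box) hp hE hl hlw (Finset.mem_range.1 hs)
            (v := v) (by omega) (hAlt _ v hv) hθ hsmall
          convert this
    _ ≤ _ := by
        simp only [Finset.sum_const, nsmul_eq_mul]
        gcongr
        rw [← Finset.sum_mul]
        gcongr
        rw [← Nat.cast_sum]
        norm_cast
        refine (Finset.sum_le_card_nsmul _ _ (2 * P.q) fun s _ =>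
          (card_children_le _).trans (Nat.mul_le_mul_left _ (hAc _))).trans_eq ?_
        simp

end HeavyHitters

/-! ### The errors of the rows of the lowest level -/

open scoped ENNReal

namespace HeavyHitters

variable {w n : ℕ} {box : Bool → Estimator w n} {P : Layout}

/-- The other indices in the bucket of an index. -/
def collisions (l : ℕ) (i : Fin n) (h : RowHash w) : Finset (Fin n) :=
  Finset.univ.filter fun j => j ≠ i ∧
    h.bucket (w - l) (BitVec.ofNat w j) = h.bucket (w - l) (BitVec.ofNat w i)

/-- The signed sum of the other coordinates in the bucket of an index. -/
def leafNoise (x : Fin n → ℤ) (l : ℕ) (i : Fin n) (h : RowHash w) : ℤ :=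
  ∑ j ∈ collisions l i h, signOf h.c h.d (BitVec.ofNat w j) * x j

/-- The row gives the coordinate up to a factor of `1 ± 1/128`. -/
def GoodRow (x : Fin n → ℤ) (l : ℕ) (i : Fin n) (h : RowHash w) : Prop :=
  128 * |leafNoise x l i h| ≤ |x i|

instance (x : Fin n → ℤ) (l : ℕ) (i : Fin n) (h : RowHash w) : Decidable (GoodRow x l i h) := by
  unfold GoodRow; infer_instance

theorem noise_zero (p : ℝ) (x : Fin n → ℤ) (l : ℕ) (i : Fin n) (h : RowHash w) :
    noise p x l 0 i h = ∑ j ∈ collisions l i h, |(x j : ℝ)| ^ p := by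
  rw [noise, collisions, Finset.sum_filter]
  simp [Fin.ext_iff]

/-- As `p ≤ 2`, a small sum of `p`-th powers makes the sum of squares small. -/
theorem sum_sq_le {p : ℝ} (hp : 0 < p) (hp2 : p ≤ 2) (x : Fin n → ℤ) (i : Fin n) (hi : x i ≠ 0)
    (C : Finset (Fin n)) {θ : ℝ} (hθ : θ ≤ 1)
    (h : ∑ j ∈ C, |(x j : ℝ)| ^ p ≤ θ * |(x i : ℝ)| ^ p) :
    ∑ j ∈ C, (x j : ℝ) ^ 2 ≤ θ * (x i : ℝ) ^ 2 := by
  have hX : 0 < |(x i : ℝ)| := abs_pos.2 (by exact_mod_cast hi)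
  set X := |(x i : ℝ)| with hXdef
  have hXp : 0 < X ^ p := Real.rpow_pos_of_pos hX p
  have h1 : ∀ j ∈ C, (x j : ℝ) ^ 2 ≤ |(x j : ℝ)| ^ p * (X ^ 2 / X ^ p) := by
    intro j hj
    have h2 : |(x j : ℝ)| ^ p ≤ X ^ p :=
      ((Finset.single_le_sum (f := fun j => |(x j : ℝ)| ^ p) (fun _ _ => rpow_abs_nonneg _ _)
        hj).trans h).trans (mul_le_of_le_one_left hXp.le hθ)
    have h3 : |(x j : ℝ)| ≤ X := by
      by_contra! h3
      exact absurd h2 (not_le.2 (Real.rpow_lt_rpow hX.le h3 hp))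
    have h4 : (|(x j : ℝ)| / X) ^ (2 : ℝ) ≤ (|(x j : ℝ)| / X) ^ p := by
      rcases (abs_nonneg (x j : ℝ)).eq_or_lt with h0 | h0
      · rw [← h0, zero_div, Real.zero_rpow (by norm_num), Real.zero_rpow hp.ne']
      · exact Real.rpow_le_rpow_of_exponent_ge (by positivity) ((div_le_one hX).2 h3) hp2
    rw [Real.rpow_two, Real.div_rpow (abs_nonneg _) hX.le, div_pow, sq_abs,
      div_le_iff₀ (by positivity)] at h4
    calc (x j : ℝ) ^ 2 ≤ |(x j : ℝ)| ^ p / X ^ p * X ^ 2 := h4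
      _ = _ := by ring
  calc ∑ j ∈ C, (x j : ℝ) ^ 2 ≤ (∑ j ∈ C, |(x j : ℝ)| ^ p) * (X ^ 2 / X ^ p) := by
        rw [Finset.sum_mul]
        exact Finset.sum_le_sum h1
    _ ≤ θ * X ^ p * (X ^ 2 / X ^ p) := by gcongr
    _ = θ * (x i : ℝ) ^ 2 := by
        rw [hXdef, sq_abs]
        field_simp

theorem expect_randWord₂_ofReal (f : BitVec w → BitVec w → ℝ) (hf : ∀ c d, 0 ≤ f c d) :
    ((Prog.randWord w).expect fun c => (Prog.randWord w).expect fun d => ENNReal.ofReal (f c d)) =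
      ENNReal.ofReal ((2 ^ w * 2 ^ w)⁻¹ * ∑ c, ∑ d, f c d) := by
  have h2 : (2 ^ w : ℝ≥0∞)⁻¹ = ENNReal.ofReal (2 ^ w)⁻¹ := by
    rw [ENNReal.ofReal_inv_of_pos (by positivity), ENNReal.ofReal_pow (by norm_num)]
    norm_num
  simp only [expect_randWord]
  rw [← Finset.mul_sum, ← mul_assoc, h2, mul_inv, ENNReal.ofReal_mul (by positivity),
    ENNReal.ofReal_mul (by positivity), ENNReal.ofReal_sum_of_nonneg (fun c _ =>
      Finset.sum_nonneg fun d _ => hf c d)]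
  congr 1
  exact Finset.sum_congr rfl fun c _ => (ENNReal.ofReal_sum_of_nonneg fun d _ => hf c d).symm

/-- A row gives a heavy coordinate with good precision, except with probability `1/64` for too much
mass in its bucket and `1/64` for Chebyshev's inequality. -/
theorem expect_not_goodRow_le {p φ : ℝ} (hp : 0 < p) (hp2 : p ≤ 2) (hφ : 0 < φ) (x : Fin n → ℤ)
    {l : ℕ} (hl : l < w) (hn : n ≤ 2 ^ (w - l)) (i : Fin n) (hi : x i ≠ 0)
    (hheavy : φ / 2 * moment p x ≤ |(x i : ℝ)| ^ p) (hB : 2 ^ 27 / φ ≤ 2 ^ l) :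
    ((drawRow w).expect fun h => if GoodRow x l i h then 0 else 1) ≤ 1 / 32 := by
  classical
  have hX : 0 < |(x i : ℝ)| := abs_pos.2 (by exact_mod_cast hi)
  set X := |(x i : ℝ)| with hXdef
  have hXp : 0 < X ^ p := Real.rpow_pos_of_pos hX p
  set θ : ℝ := 1 / 2 ^ 20 with hθ
  have hθX : 0 < θ * X ^ p := by positivity
  have hnw : n ≤ 2 ^ w := hn.trans (Nat.pow_le_pow_right (by norm_num) (Nat.sub_le _ _))
  have h64 : (1 / 64 : ℝ≥0∞) = ENNReal.ofReal (1 / 64) := by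
    rw [ENNReal.ofReal_div_of_pos (by norm_num)]; simp
  have hfirst : ((drawRow w).expect fun h => if θ * X ^ p < noise p x l 0 i h then 1 else 0) ≤
      1 / 64 := by
    have h1 := expect_noise_gt_le (p := p) (w := w) x hl 0 hn (i.isLt.trans_le hn) hθX
    have h2 : (2 ^ l : ℝ≥0∞) = ENNReal.ofReal (2 ^ l) := by
      rw [ENNReal.ofReal_pow (by norm_num)]; norm_num
    refine le_trans (by convert h1) (?_ : _ ≤ _)
    rw [h2, h64, ← ENNReal.ofReal_inv_of_pos (by positivity),
      ← ENNReal.ofReal_mul (div_nonneg (moment_nonneg _ _) hθX.le)]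
    refine ENNReal.ofReal_le_ofReal ?_
    rw [← div_eq_mul_inv, div_div, div_le_iff₀ (by positivity)]
    rw [div_le_iff₀ hφ] at hB
    have h3 : X ^ p * (2 ^ 27 : ℝ) ≤ X ^ p * (2 ^ l * φ) := by gcongr
    have h4 : φ * moment p x ≤ φ * (1 / 64 * (θ * X ^ p * 2 ^ l)) := by
      rw [hθ]
      nlinarith
    exact le_of_mul_le_mul_left h4 hφ
  have hsecond : ((drawRow w).expect fun h => if noise p x l 0 i h ≤ θ * X ^ p then
      ENNReal.ofReal (128 ^ 2 / X ^ 2 * (leafNoise x l i h : ℝ) ^ 2) else 0) ≤ 1 / 64 := by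
    rw [expect_drawRow]
    have hab : ∀ a b : BitVec w, ((Prog.randWord w).expect fun c => (Prog.randWord w).expect fun d =>
        if noise p x l 0 i ⟨a, b, c, d⟩ ≤ θ * X ^ p then
        ENNReal.ofReal (128 ^ 2 / X ^ 2 * (leafNoise x l i ⟨a, b, c, d⟩ : ℝ) ^ 2) else 0) ≤
        1 / 64 := by
      intro a b
      have hC : ∀ c d : BitVec w, collisions l i ⟨a, b, c, d⟩ = collisions l i ⟨a, b, 0, 0⟩ :=
        fun c d => rfl
      have hN : ∀ c d : BitVec w, noise p x l 0 i ⟨a, b, c, d⟩ =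
        ∑ j ∈ collisions l i (⟨a, b, 0, 0⟩ : RowHash w), |(x j : ℝ)| ^ p := fun c d => by
          rw [noise_zero, hC]
      simp only [hN, leafNoise, hC]
      set C := collisions l i (⟨a, b, 0, 0⟩ : RowHash w)
      by_cases h : ∑ j ∈ C, |(x j : ℝ)| ^ p ≤ θ * X ^ p
      · simp only [h, if_true]
        rw [expect_randWord₂_ofReal _ (fun c d => by positivity), h64]
        refine ENNReal.ofReal_le_ofReal ?_
        simp only [← Finset.mul_sum]
        have h1 := congrArg (Int.cast : ℤ → ℝ) (sum_signed_sq (w := w) (by omega) hnw C x)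
        push_cast at h1 ⊢
        rw [h1]
        have h2 := sum_sq_le hp hp2 x i hi C (by norm_num [hθ]) h
        rw [← sq_abs (x i : ℝ), ← hXdef] at h2
        have h3 : ((2 : ℝ) ^ w * 2 ^ w)⁻¹ * (128 ^ 2 / X ^ 2 * (2 ^ w * 2 ^ w *
            ∑ j ∈ C, (x j : ℝ) ^ 2)) = 128 ^ 2 / X ^ 2 * ∑ j ∈ C, (x j : ℝ) ^ 2 := by
          field_simp
        rw [h3, div_mul_eq_mul_div, div_le_iff₀ (by positivity)]
        rw [hθ] at h2
        linarith
      · simp only [h, if_false, PMF.expect_const]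
        exact zero_le
    refine (PMF.expect_mono _ fun a => (PMF.expect_mono _ fun b => hab a b).trans_eq
      (PMF.expect_const _ _)).trans_eq (PMF.expect_const _ _)
  calc ((drawRow w).expect fun h => if GoodRow x l i h then 0 else 1)
      ≤ (drawRow w).expect fun h => (if θ * X ^ p < noise p x l 0 i h then 1 else 0) +
        if noise p x l 0 i h ≤ θ * X ^ p then
          ENNReal.ofReal (128 ^ 2 / X ^ 2 * (leafNoise x l i h : ℝ) ^ 2) else 0 := by
        refine PMF.expect_mono _ fun h => ?_
        by_cases hg : GoodRow x l i h
        · rw [if_pos hg]; exact zero_le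
        · rw [if_neg hg]
          by_cases hno : θ * X ^ p < noise p x l 0 i h
          · rw [if_pos hno]; exact le_add_right le_rfl
          · rw [if_neg hno, zero_add, if_pos (not_lt.1 hno), ← ENNReal.ofReal_one]
            refine ENNReal.ofReal_le_ofReal ?_
            rw [GoodRow, not_le] at hg
            have h1 : X < 128 * |(leafNoise x l i h : ℝ)| := by
              rw [hXdef]; exact_mod_cast hg
            rw [div_mul_eq_mul_div, le_div_iff₀ (by positivity), one_mul,
              ← sq_abs (leafNoise x l i h : ℝ)]
            nlinarith
    _ ≤ 1 / 64 + 1 / 64 := by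
        rw [PMF.expect_add]
        exact add_le_add hfirst hsecond
    _ = 1 / 32 := by
        rw [h64, ← ENNReal.ofReal_add (by norm_num) (by norm_num)]
        norm_num
        rw [ENNReal.ofReal_div_of_pos (by norm_num)]
        simp

/-- The number of rows of the lowest level that are misleading for an index. -/
def badRows (x : Fin n → ℤ) (l R : ℕ) (i : Fin n) (H : ℕ → RowHash w) : ℕ :=
  ((Finset.range R).filter fun r => ¬ GoodRow x l i (H r)).card

/-- The probability that half of the rows of the lowest level are bad for a heavy coordinate. -/
theorem expect_badRows_le {p φ : ℝ} (hp : 0 < p) (hp2 : p ≤ 2) (hφ : 0 < φ) (x : Fin n → ℤ)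
    (hL : 0 < P.L) (hl : P.l < w) (hn : n ≤ 2 ^ (w - P.l)) (i : Fin n) (hi : x i ≠ 0)
    (hheavy : φ / 2 * moment p x ≤ |(x i : ℝ)| ^ p) (hB : 2 ^ 27 / φ ≤ 2 ^ P.l) :
    ((hashLaw P w).expect fun H => if P.R ≤ 2 * badRows x P.l P.R i H then 1 else 0) ≤
      (83 / 100) ^ P.R := by
  have hN : ∀ r ∈ Finset.range P.R, r < P.N := fun r hr => by
    have : 1 * P.R ≤ P.L * P.R := Nat.mul_le_mul_right _ hL
    rw [Finset.mem_range] at hr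
    unfold Layout.N
    omega
  calc ((hashLaw P w).expect fun H => if P.R ≤ 2 * badRows x P.l P.R i H then 1 else 0)
      ≤ (hashLaw P w).expect fun H => ∏ r ∈ Finset.range P.R,
          (2⁻¹ * if GoodRow x P.l i (H r) then 1 else 4) := by
        refine PMF.expect_mono _ fun H => ?_
        split_ifs with h
        · rw [Finset.prod_mul_distrib, Finset.prod_const, Finset.card_range, Finset.prod_ite,
            Finset.prod_const_one, one_mul, Finset.prod_const]
          change 1 ≤ 2⁻¹ ^ P.R * 4 ^ badRows x P.l P.R i H
          have h4 : (4 : ℝ≥0∞) ^ badRows x P.l P.R i H = 2 ^ (2 * badRows x P.l P.R i H) := by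
            rw [pow_mul]; norm_num
          rw [h4, ← ENNReal.inv_pow, mul_comm, ← div_eq_mul_inv,
            ENNReal.le_div_iff_mul_le (by simp) (by simp), one_mul]
          exact pow_le_pow_right₀ (by norm_num) h
        · exact zero_le
    _ = ∏ r ∈ Finset.range P.R, (drawRow w).expect
          (fun h => 2⁻¹ * if GoodRow x P.l i h then 1 else 4) :=
        expect_hashLaw_prod hN fun _ h => 2⁻¹ * if GoodRow x P.l i h then 1 else 4
    _ ≤ (83 / 100) ^ (Finset.range P.R).card := by
        refine Finset.prod_le_pow_card _ _ _ fun r _ => ?_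
        calc (drawRow w).expect (fun h => 2⁻¹ * if GoodRow x P.l i h then 1 else 4)
            ≤ (drawRow w).expect (fun h => 2⁻¹ *
                (1 + 3 * if GoodRow x P.l i h then 0 else 1)) := by
              refine PMF.expect_mono _ fun h => ?_
              split_ifs <;> norm_num
          _ ≤ 2⁻¹ * (1 + 3 * (1 / 32)) := by
              rw [PMF.expect_mul_left, PMF.expect_add, PMF.expect_const, PMF.expect_mul_left]
              gcongr
              exact expect_not_goodRow_le hp hp2 hφ x hl hn i hi hheavy hB
          _ ≤ 83 / 100 := by
              rw [show (1 / 32 : ℝ≥0∞) = ENNReal.ofReal (1 / 32) by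
                  rw [ENNReal.ofReal_div_of_pos (by norm_num)]; simp,
                show (83 / 100 : ℝ≥0∞) = ENNReal.ofReal (83 / 100) by
                  rw [ENNReal.ofReal_div_of_pos (by norm_num)]; simp,
                show (2⁻¹ : ℝ≥0∞) = ENNReal.ofReal 2⁻¹ by
                  rw [ENNReal.ofReal_inv_of_pos (by norm_num)]; simp,
                show (3 : ℝ≥0∞) = ENNReal.ofReal 3 by simp, ← ENNReal.ofReal_one,
                ← ENNReal.ofReal_mul (by norm_num),
                ← ENNReal.ofReal_add (by norm_num) (by norm_num),
                ← ENNReal.ofReal_mul (by norm_num)]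
              exact ENNReal.ofReal_le_ofReal (by norm_num)
    _ = _ := by rw [Finset.card_range]

end HeavyHitters

/-! ### The total probability of failure -/

open scoped ENNReal

namespace HeavyHitters

variable {w n : ℕ} {box : Bool → Estimator w n} {P : Layout}

theorem mass_zero (p : ℝ) (x : Fin n → ℤ) (i : Fin n) : mass p x 0 i = |(x i : ℝ)| ^ p := by
  rw [mass, Finset.sum_eq_single i]
  · simp
  · intro j _ hj
    rw [if_neg]
    simpa [Fin.ext_iff] using hj
  · simp

theorem card_heavy_le {p φ : ℝ} {x : Fin n → ℤ} (hF : 0 < moment p x) (hφ : 0 < φ) {q : ℕ}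
    (hq : 2 / φ ≤ q) (s : Finset (Fin n)) (hs : ∀ i ∈ s, φ / 2 * moment p x ≤ |(x i : ℝ)| ^ p) :
    s.card ≤ q := by
  refine le_trans ?_ (card_allowed_le hF hφ hq 0)
  rw [← Finset.card_map Fin.valEmbedding]
  refine Finset.card_le_card fun v hv => ?_
  obtain ⟨i, hi, rfl⟩ := Finset.mem_map.1 hv
  refine Finset.mem_filter.2 ⟨Finset.mem_range.2 i.isLt, ?_⟩
  exact (hs i hi).trans_eq (mass_zero p x i).symm

/-- The outcomes on which the output is correct: the list of leaves is right, and for each leaf most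
rows of the lowest level are good. -/
def Success (P : Layout) (p φ : ℝ) (x : Fin n → ℤ) (y : (ℕ → RowHash w) × List ℕ) : Prop :=
  GoodList (allowed p φ x 0) (fun v => φ * moment p x ≤ mass p x 0 v) y.2 ∧
    ∀ i : Fin n, φ / 2 * moment p x ≤ |(x i : ℝ)| ^ p → 2 * badRows x P.l P.R i y.1 < P.R

/-- The number of rows makes the sum of the probabilities of all errors of majorities small. -/
theorem error_sum_le {q L D k : ℕ} {δ : ℝ} (hD : 1 / δ ≤ 2 ^ D) (hδ : 0 < δ) (hk : k ≤ 3 * (q * L)) :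
    (k : ℝ≥0∞) * (83 / 100) ^ ((Nat.size (q * L) + D + 3) * 5) ≤ ENNReal.ofReal (δ / 2) := by
  have h83 : (83 / 100 : ℝ≥0∞) = ENNReal.ofReal (83 / 100) := by
    rw [ENNReal.ofReal_div_of_pos (by norm_num)]; simp
  rw [h83, ← ENNReal.ofReal_pow (by norm_num), ← ENNReal.ofReal_natCast,
    ← ENNReal.ofReal_mul (by positivity)]
  refine ENNReal.ofReal_le_ofReal ?_
  have h1 : (k : ℝ) ≤ 3 * 2 ^ Nat.size (q * L) := by
    have := (Nat.lt_size_self (q * L)).le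
    exact_mod_cast hk.trans (Nat.mul_le_mul_left 3 this)
  have h2 : (83 / 100 : ℝ) ^ ((Nat.size (q * L) + D + 3) * 5) ≤
      (1 / 2) ^ (Nat.size (q * L) + D + 3) := by
    rw [mul_comm, pow_mul]
    exact pow_le_pow_left₀ (by positivity) (by norm_num) _
  calc (k : ℝ) * (83 / 100) ^ ((Nat.size (q * L) + D + 3) * 5)
      ≤ 3 * 2 ^ Nat.size (q * L) * (1 / 2) ^ (Nat.size (q * L) + D + 3) :=
        mul_le_mul h1 h2 (by positivity) (by positivity)
    _ = 3 / 8 * (1 / 2 ^ D) := by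
        rw [pow_add, pow_add, one_div_pow, one_div_pow]
        field_simp
        norm_num
    _ ≤ 3 / 8 * δ := by
        gcongr
        rw [div_le_iff₀ (by positivity)]
        rwa [div_le_iff₀ hδ, mul_comm] at hD
    _ ≤ δ / 2 := by linarith

/-- The total probability of failure: `δ / 2` for the answer about the whole stream, and another `δ
/ 2` for all tests of nodes and all rows of leaves together. -/
theorem expect_answerLaw_le {p φ δ d : ℝ} (hp : 0 < p) (hp2 : p ≤ 2) (hφ : 0 < φ) {m M : ℕ}
    (hE : (box false).Estimates p m M (1 / 7) (1 / 5))
    (hE' : (box true).Estimates p m M (1 / 7) d) {l : UpdStream n} (hl : l.Valid m M)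
    (hF : 0 < moment p l.vec) {q D : ℕ} (hP : P = layout n q D) (hlw : P.l < w)
    (hn : 2 * n ≤ 2 ^ (w - P.l)) (hq : 2 * q ≤ 2 ^ (w - P.l)) (hqφ : 2 / φ ≤ q)
    (hB : 2 ^ 27 / φ ≤ 2 ^ P.l) (hD : 1 / δ ≤ 2 ^ D) (hδ : 0 < δ) (hd : d ≤ δ / 2)
    (hsep : Separates q w φ (moment p l.vec)) :
    ((answerLaw P box l).expect fun y => open Classical in
      if Success P p φ l.vec y then 0 else 1) ≤ ENNReal.ofReal δ := by
  classical
  have hPq : P.q = q := by rw [hP]; rfl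
  have hPL : P.L = Nat.size (n / (q + 1)) + 1 := by rw [hP]; rfl
  have hL : 0 < P.L := by omega
  have hq0 : 0 < q := by
    have : (0 : ℝ) < q := lt_of_lt_of_le (by positivity) hqφ
    exact_mod_cast this
  have htop : ∀ i < n, i / 2 ^ P.L < P.q := by
    intro i hi
    rw [hPL, hPq, Nat.div_lt_iff_lt_mul (by positivity), pow_succ]
    have h1 := Nat.lt_size_self (n / (q + 1))
    rw [Nat.div_lt_iff_lt_mul (by omega)] at h1
    have h2 : 2 ^ Nat.size (n / (q + 1)) * (q + 1) ≤ 2 ^ Nat.size (n / (q + 1)) * (q * 2) :=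
      Nat.mul_le_mul_left _ (by omega)
    calc i < 2 ^ Nat.size (n / (q + 1)) * (q + 1) := hi.trans h1
      _ ≤ _ := h2
      _ = _ := by ring
  set hv : Finset (Fin n) := Finset.univ.filter fun i =>
    φ / 2 * moment p l.vec ≤ |(l.vec i : ℝ)| ^ p with hhv
  have hcard : hv.card ≤ q := card_heavy_le hF hφ hqφ hv fun i hi => (Finset.mem_filter.1 hi).2
  have hleaf : ∀ i ∈ hv, ((hashLaw P w).expect fun H =>
      if P.R ≤ 2 * badRows l.vec P.l P.R i H then 1 else 0) ≤ (83 / 100) ^ P.R := by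
    intro i hi
    have hi2 := (Finset.mem_filter.1 hi).2
    refine expect_badRows_le hp hp2 hφ l.vec hL hlw (by omega) i (fun h0 => ?_) hi2 hB
    rw [h0, Int.cast_zero, abs_zero, Real.zero_rpow hp.ne'] at hi2
    have : 0 < φ / 2 * moment p l.vec := by positivity
    linarith
  have hlist := expect_leaves_le (P := P) (box := box) hp hφ hE hE' hl hF hL hlw hn (by rwa [hPq])
    (by rwa [hPq]) (le_trans (by gcongr; norm_num) hB) htop (by rwa [hPq])
  calc (answerLaw P box l).expect (fun y => if Success P p φ l.vec y then 0 else 1)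
      = (stateLaw P box l).expect fun x => (reportLaw P x.1 box x.2).expect fun leaves =>
          if Success P p φ l.vec (x.1, leaves) then 0 else 1 := by
        simp only [answerLaw, stateLaw, PMF.expect_bind, PMF.expect_map]
    _ ≤ (stateLaw P box l).expect fun x => ((reportLaw P x.1 box x.2).expect fun leaves =>
          if GoodList (allowed p φ l.vec 0) (fun v => φ * moment p l.vec ≤ mass p l.vec 0 v) leaves
          then 0 else 1) + ∑ i ∈ hv, if P.R ≤ 2 * badRows l.vec P.l P.R i x.1 then 1 else 0 := by
        refine PMF.expect_mono _ fun x => ?_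
        rw [← PMF.expect_const (reportLaw P x.1 box x.2)
          (∑ i ∈ hv, if P.R ≤ 2 * badRows l.vec P.l P.R i x.1 then 1 else 0), ← PMF.expect_add]
        refine PMF.expect_mono _ fun leaves => ?_
        by_cases h1 : GoodList (allowed p φ l.vec 0)
          (fun v => φ * moment p l.vec ≤ mass p l.vec 0 v) leaves
        · rw [if_pos h1, zero_add]
          by_cases h2 : Success P p φ l.vec (x.1, leaves)
          · rw [if_pos h2]; exact zero_le
          · rw [if_neg h2]
            have h3 : ∃ i, φ / 2 * moment p l.vec ≤ |(l.vec i : ℝ)| ^ p ∧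
                P.R ≤ 2 * badRows l.vec P.l P.R i x.1 := by
              by_contra! h3
              exact h2 ⟨h1, h3⟩
            obtain ⟨i, hi, hi'⟩ := h3
            refine le_trans (by rw [if_pos hi']) (Finset.single_le_sum
              (f := fun i => if P.R ≤ 2 * badRows l.vec P.l P.R i x.1 then (1 : ℝ≥0∞) else 0)
              (fun _ _ => zero_le) (Finset.mem_filter.2 ⟨Finset.mem_univ i, hi⟩))
        · rw [if_neg h1]
          refine le_trans ?_ (le_add_right (le_refl (1 : ℝ≥0∞)))
          split_ifs <;> simp
    _ ≤ (ENNReal.ofReal d + ((P.L * (2 * P.q) : ℕ) : ℝ≥0∞) * (83 / 100) ^ P.R) +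
          hv.card * (83 / 100) ^ P.R := by
        rw [PMF.expect_add]
        refine add_le_add (by convert hlist) ?_
        rw [PMF.expect_sum, ← nsmul_eq_mul]
        refine Finset.sum_le_card_nsmul _ _ _ fun i hi => ?_
        exact (expect_stateLaw_hash l fun H =>
          if P.R ≤ 2 * badRows l.vec P.l P.R i H then 1 else 0).trans_le (hleaf i hi)
    _ = ENNReal.ofReal d + ((P.L * (2 * P.q) + hv.card : ℕ) : ℝ≥0∞) * (83 / 100) ^ P.R := by
        push_cast
        ring
    _ ≤ ENNReal.ofReal (δ / 2) + ENNReal.ofReal (δ / 2) := by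
        refine add_le_add (ENNReal.ofReal_le_ofReal hd) ?_
        have hR : P.R = (Nat.size (q * P.L) + D + 3) * 5 := by rw [hP]; rfl
        rw [hR]
        refine error_sum_le hD hδ ?_
        rw [hPq]
        have h5 : q * 1 ≤ q * P.L := Nat.mul_le_mul_left _ hL
        have h6 : P.L * (2 * q) = 2 * (q * P.L) := by ring
        omega
    _ = ENNReal.ofReal δ := by
        rw [← ENNReal.ofReal_add (by positivity) (by positivity)]
        norm_num

end HeavyHitters

/-! ### Fixed-point arithmetic and the threshold -/

namespace HeavyHitters

variable {w n : ℕ}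

theorem fixedPoint_bounds {a b : BitVec w} (hb : b ≠ 0) {V : ℝ}
    (hV : (a.toNat : ℝ) / b.toNat ≤ V) (hVw : V * 2 ^ 36 < 2 ^ w) :
    4096 * ((a.toNat : ℝ) / b.toNat) - 1 < (fixedPoint a b).toNat ∧
      ((fixedPoint a b).toNat : ℝ) ≤ 4097 * ((a.toNat : ℝ) / b.toNat) := by
  have hb0 : 0 < b.toNat := by
    rcases Nat.eq_zero_or_pos b.toNat with h | h
    · exact absurd (BitVec.eq_of_toNat_eq (by simpa using h)) hb
    · exact h
  have hbR : (0 : ℝ) < b.toNat := by exact_mod_cast hb0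
  have hcond : (b >>> 24 = 0#w) ↔ b.toNat < 2 ^ 24 := by
    rw [← BitVec.toNat_inj, BitVec.toNat_ushiftRight, Nat.shiftRight_eq_div_pow]
    simp
  set x := a.toNat with hx
  set y := b.toNat with hy
  by_cases h : y < 2 ^ 24
  · have hov : x <<< 12 < 2 ^ w := by
      rw [Nat.shiftLeft_eq]
      have h1 : (x : ℝ) ≤ V * y := by rwa [div_le_iff₀ hbR] at hV
      have h2 : (y : ℝ) ≤ 2 ^ 24 := by exact_mod_cast h.le
      have hV0 : 0 ≤ V := le_trans (by positivity) hV
      have h3 : (x : ℝ) * 2 ^ 12 < 2 ^ w := by nlinarith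
      exact_mod_cast h3
    have e : (fixedPoint a b).toNat = x * 4096 / y := by
      rw [fixedPoint, if_pos (hcond.2 h)]
      simp only [BitVec.mul_one, BitVec.sub_self, BitVec.mul_zero, BitVec.add_zero,
        BitVec.toNat_udiv, BitVec.toNat_shiftLeft]
      rw [Nat.mod_eq_of_lt hov, Nat.shiftLeft_eq]
    rw [e]
    have h1 := Nat.lt_div_mul_add (a := x * 4096) hb0
    have h2 := Nat.div_mul_le_self (x * 4096) y
    have h1' : (x : ℝ) * 4096 < (x * 4096 / y : ℕ) * y + y := by exact_mod_cast h1
    have h2' : ((x * 4096 / y : ℕ) : ℝ) * y ≤ x * 4096 := by exact_mod_cast h2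
    constructor
    · rw [sub_lt_iff_lt_add, mul_div_assoc', div_lt_iff₀ hbR]
      linarith
    · rw [mul_div_assoc', le_div_iff₀ hbR]
      linarith [Nat.cast_nonneg (α := ℝ) x]
  · have e : (fixedPoint a b).toNat = x / (y / 4096) := by
      rw [fixedPoint, if_neg (by rw [hcond]; exact h)]
      simp only [BitVec.mul_zero, BitVec.sub_zero, BitVec.mul_one, BitVec.zero_add,
        BitVec.toNat_udiv, BitVec.toNat_ushiftRight, Nat.shiftRight_eq_div_pow]
      rfl
    rw [e]
    set z := y / 4096 with hz
    have hz1 : 4096 ≤ z := by omega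
    have hz2 : z * 4096 ≤ y := by omega
    have hz3 : y < z * 4096 + 4096 := by omega
    have h1 := Nat.lt_div_mul_add (a := x) (b := z) (by omega)
    have h2 := Nat.div_mul_le_self x z
    generalize x / z = k at *
    clear_value x y z
    have h1' : (x : ℝ) < k * z + z := by exact_mod_cast h1
    have h2' : (k : ℝ) * z ≤ x := by exact_mod_cast h2
    have hz1' : (4096 : ℝ) ≤ z := by exact_mod_cast hz1
    have hz2' : (z : ℝ) * 4096 ≤ y := by exact_mod_cast hz2
    have hz3' : (y : ℝ) < z * 4096 + 4096 := by exact_mod_cast hz3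
    constructor
    · rw [sub_lt_iff_lt_add, mul_div_assoc', div_lt_iff₀ hbR]
      nlinarith [Nat.cast_nonneg (α := ℝ) k]
    · rw [mul_div_assoc', le_div_iff₀ hbR]
      nlinarith [Nat.cast_nonneg (α := ℝ) k]

/-- The constants of the comparison separate `φ F` from `0.55 φ F`, in spite of the errors of the two
answers, of the fixed-point arithmetic and of the rounding of `1024 / φ`. -/
theorem separates {q : ℕ} {φ F : ℝ} (hφ : 0 < φ) (hφ2 : φ < 1 / 2) (hq1 : 1024 - φ ≤ q * φ)
    (hq2 : q * φ ≤ 1024) (hF : 1 ≤ F) (hw : F * q * 2 ^ 38 ≤ 2 ^ w) : Separates q w φ F := by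
  have hq0 : (1 : ℝ) ≤ q := by
    have : 0 < q := by
      rcases Nat.eq_zero_or_pos q with h | h
      · rw [h] at hq1; norm_num at hq1; linarith
      · exact h
    exact_mod_cast this
  have hFq : F ≤ F * q := le_mul_of_one_le_right (by linarith) hq0
  have hqF : (q : ℝ) ≤ F * q := le_mul_of_one_le_left (by linarith) hF
  have hval : ∀ (G : ℝ) (r : BitVec w × BitVec w), 1 ≤ G → G ≤ F → GoodAnswer G r →
      4094 * (6 / 7) * G ≤ (fixedPoint r.1 r.2).toNat ∧
        ((fixedPoint r.1 r.2).toNat : ℝ) ≤ 4097 * (8 / 7) * G := by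
    rintro G r hG hGF ⟨h0, h1, h2⟩
    obtain ⟨h3, h4⟩ := fixedPoint_bounds h0 h2 (by nlinarith)
    constructor <;> linarith
  have hmul : ∀ (x : BitVec w) (k : ℕ), x.toNat * k < 2 ^ w → k < 2 ^ w →
      (x * BitVec.ofNat w k).toNat = x.toNat * k := by
    intro x k h hk
    rw [BitVec.toNat_mul, toNat_ofNat_of_lt hk, Nat.mod_eq_of_lt h]
  intro r hr F' a h01 hF'F ha
  obtain ⟨t1, t2⟩ := hval F r hF le_rfl hr
  set T := (fixedPoint r.1 r.2).toNat with hT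
  have c1 : 37888 < 2 ^ w := by
    have : (37888 : ℝ) < 2 ^ w := by nlinarith
    exact_mod_cast this
  have c2 : 50 * q < 2 ^ w := by
    have : (50 : ℝ) * q < 2 ^ w := by nlinarith
    exact_mod_cast this
  have c3 : T * 37888 < 2 ^ w := by
    have : (T : ℝ) * 37888 < 2 ^ w := by nlinarith
    exact_mod_cast this
  rw [Accepts, threshold, hmul _ _ c3 c1, ← hT]
  rcases h01 with h0 | h1
  · have hx : a.1.toNat = 0 := by
      obtain ⟨g1, -, g3⟩ := ha
      rw [h0, mul_zero] at g3
      have hb : (0 : ℝ) < a.2.toNat := by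
        have : 0 < a.2.toNat := by
          rcases Nat.eq_zero_or_pos a.2.toNat with h | h
          · exact absurd (BitVec.eq_of_toNat_eq (by simpa using h)) g1
          · exact h
        exact_mod_cast this
      rw [div_le_iff₀ hb, zero_mul] at g3
      exact_mod_cast le_antisymm g3 (Nat.cast_nonneg _)
    have hf := (fixedPoint_bounds (a := a.1) (V := 1) ha.1 (by simp [hx]) (by nlinarith)).2
    have hf0 : (fixedPoint a.1 a.2).toNat = 0 := by
      rw [hx] at hf
      norm_num at hf
      simp [hf]
    have hz : fixedPoint a.1 a.2 = 0#w := BitVec.eq_of_toNat_eq (by simpa using hf0)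
    refine ⟨fun h => by rw [h0] at h; nlinarith, fun _ h => ?_⟩
    rw [hz] at h
    simp only [BitVec.zero_mul, BitVec.toNat_ofNat, Nat.zero_mod, Nat.le_zero] at h
    have hT0 : T = 0 := by omega
    rw [hT0] at t1
    norm_num at t1
    linarith
  · obtain ⟨u1, u2⟩ := hval F' a h1 hF'F ha
    set t := (fixedPoint a.1 a.2).toNat with ht
    have c4 : t * (50 * q) < 2 ^ w := by
      have h5 : F' * q ≤ F * q := by gcongr
      have : (t : ℝ) * (50 * q) < 2 ^ w := by nlinarith
      exact_mod_cast this
    rw [hmul _ _ c4 c2, ← ht]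
    constructor
    · intro h
      have h6 : φ * F * q ≤ F' * q := by gcongr
      have h7 : (1024 - φ) * F ≤ q * φ * F := by gcongr
      have h8 : φ * F ≤ 1 / 2 * F := by gcongr
      have h9 : 4094 * (6 / 7) * F' * (50 * q) ≤ (t : ℝ) * (50 * q) := by gcongr
      have : (T : ℝ) * 37888 ≤ t * (50 * q) := by linarith
      exact_mod_cast this
    · intro h
      rw [not_le]
      have h6 : F' * q ≤ 11 / 20 * (φ * F) * q := by gcongr
      have h7 : q * φ * F ≤ 1024 * F := by gcongr
      have h9 : (t : ℝ) * (50 * q) ≤ 4097 * (8 / 7) * F' * (50 * q) := by gcongr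
      have : (t : ℝ) * (50 * q) < T * 37888 := by linarith
      exact_mod_cast this

end HeavyHitters

/-! ### The counters -/

namespace HeavyHitters

variable {w n : ℕ} {P : Layout}

theorem vec_append (l l' : UpdStream n) (i : Fin n) :
    UpdStream.vec (l ++ l') i = l.vec i + l'.vec i := by
  simp [UpdStream.vec]

theorem ofInt_one_sub_two (hw : 0 < w) (x : BitVec w) :
    1#w - (x >>> (w - 1) + x >>> (w - 1)) =
      BitVec.ofInt w (if x.toNat < 2 ^ (w - 1) then 1 else -1) := by
  have h2 : 2 ^ w = 2 ^ (w - 1) * 2 := by rw [← pow_succ, Nat.sub_add_cancel hw]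
  by_cases h : x.toNat < 2 ^ (w - 1)
  · have h0 : x >>> (w - 1) = 0#w := by
      apply BitVec.eq_of_toNat_eq
      rw [BitVec.toNat_ushiftRight, Nat.shiftRight_eq_div_pow, Nat.div_eq_of_lt h]
      simp
    rw [if_pos h, h0]
    simp
  · have h1 : x >>> (w - 1) = 1#w := by
      apply BitVec.eq_of_toNat_eq
      rw [BitVec.toNat_ushiftRight, Nat.shiftRight_eq_div_pow,
        toNat_ofNat_of_lt (Nat.one_lt_two_pow hw.ne')]
      have := x.isLt
      exact Nat.div_eq_of_lt_le (by omega) (by omega)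
    rw [if_neg h, h1, BitVec.ofInt_neg, show BitVec.ofInt w 1 = 1#w from BitVec.ofInt_natCast w 1,
      ← sub_sub, sub_self, zero_sub]

theorem sgn_eq_ofInt (hw : 0 < w) (h : RowHash w) (x : BitVec w) :
    h.sgn x = BitVec.ofInt w (signOf h.c h.d x) :=
  ofInt_one_sub_two hw _

/-- A counter is the signed sum of the coordinates in its bucket. -/
theorem counters_eq (hw : 0 < w) (H : ℕ → RowHash w) (l : UpdStream n) {t b : ℕ} :
    counters P H l t b = BitVec.ofInt w (∑ j : Fin n, if bucketOf P H t j = b then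
      signOf (H t).c (H t).d (BitVec.ofNat w j) * l.vec j else 0) := by
  induction l using List.reverseRecOn with
  | nil => simp [counters, UpdStream.vec]
  | append_singleton l u ih =>
    have h1 : ∀ j : Fin n, (if bucketOf P H t j = b then
        signOf (H t).c (H t).d (BitVec.ofNat w j) * UpdStream.vec (l ++ [u]) j else 0) =
        (if bucketOf P H t j = b then
          signOf (H t).c (H t).d (BitVec.ofNat w j) * UpdStream.vec l j else 0) +
        if u.1 = j then (if b = bucketOf P H t j then
          signOf (H t).c (H t).d (BitVec.ofNat w j) * u.2 else 0) else 0 := by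
      intro j
      rw [vec_append, vec_cons]
      by_cases h2 : bucketOf P H t j = b
      · by_cases h3 : u.1 = j
        · simp [h2, h3, UpdStream.vec, mul_add]
        · simp [h2, h3, UpdStream.vec]
      · simp [h2, Ne.symm h2]
    rw [counters_append_singleton]
    simp only [h1]
    rw [Finset.sum_add_distrib, Finset.sum_ite_eq, if_pos (Finset.mem_univ _), BitVec.ofInt_add,
      ← ih, addUpdate]
    by_cases h2 : b = bucketOf P H t u.1
    · rw [if_pos h2, if_pos h2, sgn_eq_ofInt hw, BitVec.ofInt_mul]
    · rw [if_neg h2, if_neg h2]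
      simp

theorem counterOf_eq (hw : 0 < w) (H : ℕ → RowHash w) (l : UpdStream n) (i : Fin n) {r : ℕ}
    (hr : r < P.R) :
    counterOf P H (counters P H l) r (BitVec.ofNat w i) = BitVec.ofInt w
      (signOf (H r).c (H r).d (BitVec.ofNat w i) * l.vec i + leafNoise l.vec P.l i (H r)) := by
  rw [counterOf, counters_eq hw H l]
  congr 1
  simp only [bucketOf, Nat.div_eq_of_lt hr, pow_zero, Nat.div_one, BitVec.toNat_inj]
  rw [leafNoise, collisions, ← Finset.sum_erase_add _ _ (Finset.mem_univ i), if_pos rfl, add_comm,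
    ← Finset.sum_filter]
  congr 1
  refine Finset.sum_congr ?_ fun _ _ => rfl
  ext j
  simp

theorem sum_abs_vec_le {m M : ℕ} {l : UpdStream n} (hl : l.Valid m M) :
    ∑ j, |l.vec j| ≤ (m * M : ℕ) := by
  have key : ∀ l : UpdStream n, (∀ u ∈ l, |u.2| ≤ (M : ℤ)) → ∑ j, |l.vec j| ≤ l.length * (M : ℤ) := by
    intro l
    induction l with
    | nil => intro _; simp [UpdStream.vec]
    | cons u l ih =>
      intro h
      have h1 := ih fun v hv => h v (List.mem_cons_of_mem _ hv)
      have h2 := h u List.mem_cons_self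
      calc ∑ j, |UpdStream.vec (u :: l) j| ≤ ∑ j, ((if u.1 = j then |u.2| else 0) + |UpdStream.vec l j|) := by
            refine Finset.sum_le_sum fun j _ => ?_
            rw [vec_cons]
            refine (abs_add_le _ _).trans ?_
            split_ifs <;> simp
        _ = |u.2| + ∑ j, |UpdStream.vec l j| := by simp [Finset.sum_add_distrib]
        _ ≤ _ := by rw [List.length_cons]; push_cast; linarith
  refine (key l hl.2).trans ?_
  push_cast
  exact mul_le_mul_of_nonneg_right (by exact_mod_cast hl.1) (by positivity)

/-- The value of a row for an index is the coordinate plus a signed sum of other coordinates. -/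
theorem exists_rowAbs_eq (hw : 1 < w) (H : ℕ → RowHash w) (l : UpdStream n) (i : Fin n) {r : ℕ}
    (hr : r < P.R) (hsmall : ∑ j, |l.vec j| < 2 ^ (w - 1)) :
    ∃ Y : ℤ, |Y| = |leafNoise l.vec P.l i (H r)| ∧ |l.vec i| + |Y| ≤ ∑ j, |l.vec j| ∧
      (rowSign P H (counters P H l) i r).toNat = (if l.vec i + Y < 0 then 1 else 0) ∧
      ((rowAbs P H (counters P H l) i r).toNat : ℤ) = |l.vec i + Y| := by
  rw [rowSign, rowAbs, absValue, signBit, counterOf_eq (by omega) H l i hr,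
    sgn_eq_ofInt (by omega), ← BitVec.ofInt_mul]
  set s := signOf (H r).c (H r).d (BitVec.ofNat w i) with hs
  set Z := leafNoise l.vec P.l i (H r) with hZ
  have hss : s * s = 1 := signOf_mul_self _ _ _
  have hs1 : ∀ c d x : BitVec w, |signOf c d x| = 1 := fun c d x => by
    rw [signOf]; split_ifs <;> simp
  have e : (s * l.vec i + Z) * s = l.vec i + Z * s := by
    rw [add_mul, mul_right_comm, hss, one_mul]
  have hZs : |Z * s| = |Z| := by rw [abs_mul, hs1, mul_one]
  have hsum : |l.vec i| + |Z| ≤ ∑ j, |l.vec j| := by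
    rw [← Finset.add_sum_erase _ _ (Finset.mem_univ i)]
    refine add_le_add le_rfl ((Finset.abs_sum_le_sum_abs _ _).trans ?_)
    calc _ = ∑ j ∈ collisions P.l i (H r), |l.vec j| := by
          simp only [abs_mul, hs1, one_mul]
      _ ≤ _ := by
          refine Finset.sum_le_sum_of_subset_of_nonneg (fun j hj => ?_) fun _ _ _ => abs_nonneg _
          exact Finset.mem_erase.2 ⟨(Finset.mem_filter.1 hj).2.1, Finset.mem_univ j⟩
  refine ⟨Z * s, hZs, by rwa [hZs], ?_⟩
  rw [e]
  have hz := (abs_add_le (l.vec i) (Z * s)).trans_lt ((by rwa [hZs] : _ ≤ _).trans_lt hsmall)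
  generalize l.vec i + Z * s = z at *
  rw [abs_lt] at hz
  have h2 : (2 : ℤ) ^ w = 2 ^ (w - 1) * 2 := by rw [← pow_succ, Nat.sub_add_cancel (by omega)]
  have hsgn := ofInt_one_sub_two (w := w) (by omega) (BitVec.ofInt w z)
  have htn : ∀ y, ((BitVec.ofInt w y).toNat : ℤ) = y % 2 ^ w := fun y => by
    rw [BitVec.toNat_ofInt, Int.toNat_of_nonneg]
    · push_cast; rfl
    · exact Int.emod_nonneg _ (by positivity)
  have hz' := htn z
  have hcast : ((2 ^ (w - 1) : ℕ) : ℤ) = 2 ^ (w - 1) := by push_cast; rfl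
  rcases lt_or_ge z 0 with hneg | hpos
  · have hm : z % 2 ^ w = z + 2 ^ w := by
      rw [← Int.add_emod_right, Int.emod_eq_of_lt] <;> omega
    have hlt : ¬ (BitVec.ofInt w z).toNat < 2 ^ (w - 1) := by omega
    rw [if_neg hlt] at hsgn
    rw [hsgn, ← BitVec.ofInt_mul, if_pos hneg, htn, abs_of_neg hneg, Int.emod_eq_of_lt (by omega)
      (by omega)]
    refine ⟨?_, by ring⟩
    rw [BitVec.toNat_ushiftRight, Nat.shiftRight_eq_div_pow]
    exact Nat.div_eq_of_lt_le (by omega) (by omega)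
  · have hm : z % 2 ^ w = z := by
      rw [Int.emod_eq_of_lt] <;> omega
    have hlt : (BitVec.ofInt w z).toNat < 2 ^ (w - 1) := by omega
    rw [if_pos hlt] at hsgn
    rw [hsgn, ← BitVec.ofInt_mul, mul_one, if_neg (by omega), htn, hm, abs_of_nonneg hpos]
    refine ⟨?_, rfl⟩
    rw [BitVec.toNat_ushiftRight, Nat.shiftRight_eq_div_pow, Nat.div_eq_of_lt hlt]

end HeavyHitters

/-! ### The majority vote -/

namespace HeavyHitters

variable {w n : ℕ} {P : Layout}

theorem size_eq_succ_iff {a e : ℕ} : Nat.size a = e + 1 ↔ 2 ^ e ≤ a ∧ a < 2 ^ (e + 1) := by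
  rw [← Nat.lt_size, ← Nat.size_le]
  omega

theorem testBit_of_size {a e : ℕ} (h : Nat.size a = e + 1) : a.testBit e = true := by
  obtain ⟨h1, h2⟩ := size_eq_succ_iff.1 h
  rw [Nat.testBit_eq_decide_div_mod_eq, Nat.div_eq_of_lt_le (k := 1) (by omega) (by omega)]
  rfl

/-- Equality of the numbers of digits, by means of bitwise operations. -/
theorem not_and_lt_xor_iff (a b : ℕ) : ¬ (a &&& b) < (a ^^^ b) ↔ Nat.size a = Nat.size b := by
  have key : ∀ a b : ℕ, Nat.size a < Nat.size b → (a &&& b) < (a ^^^ b) := by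
    intro a b h
    obtain ⟨e, he⟩ : ∃ e, Nat.size b = e + 1 := ⟨Nat.size b - 1, by omega⟩
    have ha : a < 2 ^ e := Nat.size_le.1 (by omega)
    refine lt_of_lt_of_le (lt_of_le_of_lt Nat.and_le_left ha) (Nat.ge_two_pow_of_testBit (i := e) ?_)
    rw [Nat.testBit_xor, testBit_of_size he, Nat.testBit_lt_two_pow ha]
    rfl
  constructor
  · intro h
    by_contra hne
    rcases lt_or_gt_of_ne hne with h1 | h1
    · exact h (key a b h1)
    · exact h (by rw [Nat.and_comm, Nat.xor_comm]; exact key b a h1)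
  · intro h
    rcases Nat.eq_zero_or_pos (Nat.size a) with h0 | h0
    · have ha : a = 0 := Nat.size_eq_zero.1 h0
      have hb : b = 0 := Nat.size_eq_zero.1 (h ▸ h0)
      simp [ha, hb]
    · obtain ⟨e, he⟩ : ∃ e, Nat.size a = e + 1 := ⟨Nat.size a - 1, by omega⟩
      have he' : Nat.size b = e + 1 := by omega
      have h1 : a ^^^ b < 2 ^ e := by
        refine Nat.lt_pow_two_of_testBit _ fun i hi => ?_
        rw [Nat.testBit_xor]
        rcases Nat.eq_or_lt_of_le hi with rfl | hi
        · rw [testBit_of_size he, testBit_of_size he']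
          rfl
        · rw [Nat.testBit_lt_two_pow (Nat.size_le.1 (by omega)),
            Nat.testBit_lt_two_pow (Nat.size_le.1 (by omega))]
          rfl
      have h2 : 2 ^ e ≤ a &&& b := by
        refine Nat.ge_two_pow_of_testBit ?_
        rw [Nat.testBit_and, testBit_of_size he, testBit_of_size he']
        rfl
      omega

/-- The cell of a grid that contains a word: the numbers of digits of its multiples. -/
def cell (ks : List ℕ) (x : BitVec w) : List ℕ := ks.map fun k => Nat.size (BitVec.ofNat w k * x).toNat

theorem sameCell_iff (ks : List ℕ) (x y : BitVec w) :
    sameCell ks x y = true ↔ cell ks x = cell ks y := by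
  simp only [sameCell, cell, List.all_eq_true, decide_eq_true_eq, BitVec.toNat_and,
    BitVec.toNat_xor, not_and_lt_xor_iff, List.map_inj_left]
  exact forall₂_congr fun k _ => eq_comm

theorem cellCount_congr {ks : List ℕ} {c c' : BitVec w} (h : cell ks c = cell ks c')
    (x : ℕ → BitVec w) (R k : ℕ) : cellCount ks x c R k = cellCount ks x c' R k := by
  simp only [cellCount, sameCell_iff, h]

/-- The invariant of the vote of Boyer and Moore. -/
theorem vote_invariant (ks : List ℕ) (x : ℕ → BitVec w) (c : BitVec w) (R j : ℕ) (hj : j ≤ R) :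
    if 0 < (vote ks x R j).2 ∧ cell ks (vote ks x R j).1 = cell ks c then
      2 * cellCount ks x c R (R - j) ≤ j + (vote ks x R j).2
    else 2 * cellCount ks x c R (R - j) + (vote ks x R j).2 ≤ j := by
  induction j with
  | zero => simp [vote, cellCount]
  | succ j ih =>
    have ih := ih (by omega)
    have hc : cellCount ks x c R (R - (j + 1)) =
        (if cell ks (x (R - (j + 1))) = cell ks c then 1 else 0) + cellCount ks x c R (R - j) := by
      rw [cellCount, Finset.sum_eq_sum_Ico_succ_bot (by omega),
        show R - (j + 1) + 1 = R - j by omega]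
      simp only [sameCell_iff, cellCount]
    rw [hc, vote, voteStep]
    simp only [sameCell_iff]
    generalize vote ks x R j = v at *
    generalize x (R - (j + 1)) = y at *
    generalize cellCount ks x c R (R - j) = k at *
    obtain ⟨u, m⟩ := v
    dsimp only at ih ⊢
    by_cases hm : m = 0
    · subst hm
      simp only [lt_irrefl, false_and, if_false, if_true] at ih ⊢
      by_cases hy : cell ks y = cell ks c
      · simp only [hy, and_true, if_true]; simp only [zero_lt_one, if_true]; omega
      · simp only [hy, and_false, if_false]; omega
    · simp only [hm, if_false]
      have hm0 : 0 < m := by omega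
      simp only [hm0, true_and] at ih
      by_cases hu : cell ks u = cell ks c
      · simp only [hu, if_true] at ih
        by_cases hy : cell ks y = cell ks c
        · simp only [hy, hu, if_true, and_true]; rw [if_pos (by omega)]; omega
        · have hyu : ¬ cell ks y = cell ks u := fun h => hy (h.trans hu)
          rw [if_neg hyu, if_neg hy]
          simp only [hu, and_true]
          split_ifs <;> omega
      · simp only [hu, if_false] at ih
        by_cases hy : cell ks y = cell ks c
        · have hyu : ¬ cell ks y = cell ks u := fun h => hu (h.symm.trans hy)
          rw [if_neg hyu, if_pos hy]
          simp only [hu, and_false, if_false]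
          omega
        · simp only [hy, if_false]
          by_cases hyu : cell ks y = cell ks u
          · simp only [hyu, if_true, hu, and_false, if_false]; omega
          · simp only [hyu, if_false, hu, and_false]; omega

/-- The candidate at the end of the vote is in the cell that has a strict majority, if there is one.
-/
theorem vote_majority {ks : List ℕ} {x : ℕ → BitVec w} {c : BitVec w} {R : ℕ}
    (h : R < 2 * cellCount ks x c R 0) : cell ks (vote ks x R R).1 = cell ks c := by
  have := vote_invariant ks x c R R le_rfl
  rw [Nat.sub_self] at this
  split_ifs at this with h1
  · exact h1.2
  · omega

theorem vote_induction {ks : List ℕ} {x : ℕ → BitVec w} {R : ℕ} {p : BitVec w → Prop} (h0 : p 0#w)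
    (h : ∀ r < R, p (x r)) (j : ℕ) (hj : j ≤ R) : p (vote ks x R j).1 := by
  induction j with
  | zero => exact h0
  | succ j ih =>
    have ih := ih (by omega)
    rw [vote, voteStep]
    split_ifs
    exacts [h _ (by omega), ih, ih]

/-- The members of a cell of a grid differ by a factor of at most `17/16`. -/
theorem ratio_le_of_cells {c y z : ℕ} (hc : c = 32 ∨ c = 33) (hy : 0 < y)
    (h : ∀ i < 16, Nat.size ((c + 2 * i) * y) = Nat.size ((c + 2 * i) * z)) : 16 * z ≤ 17 * y := by
  by_contra! hlt
  obtain ⟨e, he⟩ : ∃ e, Nat.size (c * y) = e + 1 := by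
    refine ⟨Nat.size (c * y) - 1, ?_⟩
    have : 0 < Nat.size (c * y) := Nat.size_pos.2 (Nat.mul_pos (by omega) hy)
    omega
  have hlow := (size_eq_succ_iff.1 he).1
  have key : ∀ i < 16, (c + 2 * i) * z < 2 ^ (e + 1) := by
    intro i
    induction i with
    | zero =>
      intro _
      have := h 0 (by omega)
      rw [mul_zero, add_zero, he] at this
      simpa using (size_eq_succ_iff.1 this.symm).2
    | succ i ih =>
      intro hi
      have ih := ih (by omega)
      have h1 : (c + 2 * (i + 1)) * y < 2 ^ (e + 1) := by
        have u1 : 16 * (c + 2 * (i + 1)) * y ≤ 17 * (c + 2 * i) * y :=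
          Nat.mul_le_mul_right _ (by omega)
        have u2 : (c + 2 * i) * (17 * y) ≤ (c + 2 * i) * (16 * z) :=
          Nat.mul_le_mul_left _ hlt.le
        nlinarith
      have h2 : 2 ^ e ≤ (c + 2 * (i + 1)) * y := hlow.trans (Nat.mul_le_mul_right _ (by omega))
      have h3 := h (i + 1) hi
      rw [size_eq_succ_iff.2 ⟨h2, h1⟩] at h3
      exact (size_eq_succ_iff.1 h3.symm).2
  have h15 := key 15 (by omega)
  rw [pow_succ] at h15
  rcases hc with rfl | rfl <;> omega

/-- Words in a small interval are in one cell of one of the two grids: the points of subdivision of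
the two grids differ by more than the length of the interval. -/
theorem grid_separated {k k' e e' X : ℕ} (hX : 0 < X) (hk : k % 2 = 0) (hk' : k' % 2 = 1)
    (h1 : 32 ≤ k) (h2 : k ≤ 62) (h3 : 33 ≤ k') (h4 : k' ≤ 63)
    (a1 : 127 * X * k ≤ 128 * 2 ^ e) (a2 : 128 * 2 ^ e ≤ 129 * X * k)
    (b1 : 127 * X * k' ≤ 128 * 2 ^ e') (b2 : 128 * 2 ^ e' ≤ 129 * X * k') : False := by
  rcases lt_trichotomy e e' with h | rfl | h
  · have h5 : 2 * 2 ^ e ≤ 2 ^ e' := by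
      rw [← pow_succ']; exact Nat.pow_le_pow_right (by norm_num) h
    have : X * (254 * k) ≤ X * (129 * k') := by nlinarith
    have := Nat.le_of_mul_le_mul_left this hX
    omega
  · have u1 : X * (127 * k) ≤ X * (129 * k') := by nlinarith
    have u2 : X * (127 * k') ≤ X * (129 * k) := by nlinarith
    have u1 := Nat.le_of_mul_le_mul_left u1 hX
    have u2 := Nat.le_of_mul_le_mul_left u2 hX
    rcases (by omega : k + 1 ≤ k' ∨ k' + 1 ≤ k) with h | h <;> omega
  · have h5 : 2 * 2 ^ e' ≤ 2 ^ e := by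
      rw [← pow_succ']; exact Nat.pow_le_pow_right (by norm_num) h
    have : X * (254 * k') ≤ X * (129 * k) := by nlinarith
    have := Nat.le_of_mul_le_mul_left this hX
    omega

theorem exists_pow_between {k y z : ℕ} (h : Nat.size (k * y) ≠ Nat.size (k * z)) {X : ℕ}
    (hy1 : 127 * X ≤ 128 * y) (hy2 : 128 * y ≤ 129 * X) (hz1 : 127 * X ≤ 128 * z)
    (hz2 : 128 * z ≤ 129 * X) :
    ∃ e, 127 * X * k ≤ 128 * 2 ^ e ∧ 128 * 2 ^ e ≤ 129 * X * k := by
  have key : ∀ y z : ℕ, Nat.size (k * y) < Nat.size (k * z) → 127 * X ≤ 128 * y →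
      128 * z ≤ 129 * X → ∃ e, 127 * X * k ≤ 128 * 2 ^ e ∧ 128 * 2 ^ e ≤ 129 * X * k := by
    intro y z h h1 h2
    refine ⟨Nat.size (k * z) - 1, ?_, ?_⟩
    · have : k * y < 2 ^ (Nat.size (k * z) - 1) := Nat.size_le.1 (by omega)
      nlinarith
    · have : 2 ^ (Nat.size (k * z) - 1) ≤ k * z := Nat.lt_size.1 (by omega)
      nlinarith
  rcases lt_or_gt_of_ne h with h | h
  · exact key y z h hy1 hz2
  · exact key z y h hz1 hy2

end HeavyHitters

/-! ### Correctness of the output -/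

namespace HeavyHitters

variable {w n : ℕ} {P : Layout}

theorem cellCount_eq_card (ks : List ℕ) (x : ℕ → BitVec w) (c : BitVec w) (R : ℕ) :
    cellCount ks x c R 0 = ((Finset.range R).filter fun r => cell ks (x r) = cell ks c).card := by
  simp only [cellCount, sameCell_iff, Finset.range_eq_Ico, Finset.card_filter]

/-- If good words are in the majority and all near `X`, then the word chosen by the two votes is near
`X`. -/
theorem estimate_near {x : ℕ → BitVec w} {R X : ℕ} {good : ℕ → Prop} [DecidablePred good]
    (hX : 0 < X) (hbad : 2 * ((Finset.range R).filter fun r => ¬ good r).card < R)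
    (hgood : ∀ r < R, good r → 127 * X ≤ 128 * (x r).toNat ∧ 128 * (x r).toNat ≤ 129 * X)
    (hbound : ∀ r < R, 64 * (x r).toNat < 2 ^ w) :
    16 * 127 * X ≤ 17 * 128 * (estimate x R).toNat ∧
      16 * 128 * (estimate x R).toNat ≤ 17 * 129 * X := by
  have hw : 64 < 2 ^ w := by
    obtain ⟨r, hr, hg⟩ : ∃ r < R, good r := by
      by_contra! h
      rw [Finset.filter_true_of_mem fun r hr => h r (Finset.mem_range.1 hr), Finset.card_range]
        at hbad
      omega
    have := hgood r hr hg
    have := hbound r hr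
    omega
  have hsplit : ((Finset.range R).filter good).card +
      ((Finset.range R).filter fun r => ¬ good r).card = R := by
    rw [Finset.card_filter_add_card_filter_not, Finset.card_range]
  have hmult : ∀ y : BitVec w, 64 * y.toNat < 2 ^ w → ∀ k < 64,
      (BitVec.ofNat w k * y).toNat = k * y.toNat := by
    intro y hy k hk
    rw [BitVec.toNat_mul, toNat_ofNat_of_lt (by omega), Nat.mod_eq_of_lt]
    exact (Nat.mul_le_mul_right _ hk.le).trans_lt hy
  have hvote : ∀ ks, 64 * (vote ks x R R).1.toNat < 2 ^ w := fun ks =>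
    vote_induction (p := fun y => 64 * y.toNat < 2 ^ w) (by simp) hbound R le_rfl
  -- a word in the cell of a good word is near `X`
  have hnear : ∀ (c : ℕ) (z : BitVec w) (r : ℕ), c = 32 ∨ c = 33 → 64 * z.toNat < 2 ^ w → r < R →
      good r → cell ((List.range 16).map fun j => c + 2 * j) (x r) =
        cell ((List.range 16).map fun j => c + 2 * j) z →
      16 * 127 * X ≤ 17 * 128 * z.toNat ∧ 16 * 128 * z.toNat ≤ 17 * 129 * X := by
    intro c z r hc hz hr hg h
    have hsize : ∀ i < 16, Nat.size ((c + 2 * i) * (x r).toNat) =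
        Nat.size ((c + 2 * i) * z.toNat) := by
      intro i hi
      simp only [cell, List.map_map, List.map_inj_left, List.mem_range, Function.comp_apply] at h
      have := h i hi
      rwa [hmult _ (hbound r hr) _ (by omega), hmult _ hz _ (by omega)] at this
    have hg' := hgood r hr hg
    have hz0 : 0 < z.toNat := by
      rcases Nat.eq_zero_or_pos z.toNat with h0 | h0
      · exfalso
        have := hsize 0 (by omega)
        rw [h0, mul_zero (c + _), Nat.size_zero, Nat.size_eq_zero] at this
        have := Nat.mul_eq_zero.1 this
        omega
      · exact h0
    have r1 := ratio_le_of_cells hc (by omega) hsize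
    have r2 := ratio_le_of_cells hc hz0 fun i hi => (hsize i hi).symm
    omega
  -- a cell without good words is not in the majority, and one with all good words is
  have hmem : ∀ ks (c : BitVec w), R < 2 * cellCount ks x c R 0 →
      ∃ r < R, good r ∧ cell ks (x r) = cell ks c := by
    intro ks c h
    by_contra! hne
    rw [cellCount_eq_card] at h
    have : ((Finset.range R).filter fun r => cell ks (x r) = cell ks c).card ≤
        ((Finset.range R).filter fun r => ¬ good r).card :=
      Finset.card_le_card fun r hr => by
        rw [Finset.mem_filter, Finset.mem_range] at hr ⊢
        exact ⟨hr.1, fun hg => hne r hr.1 hg hr.2⟩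
    omega
  have hall : ∀ ks (c : BitVec w), (∀ r < R, good r → cell ks (x r) = cell ks c) →
      R < 2 * cellCount ks x c R 0 := by
    intro ks c h
    rw [cellCount_eq_card]
    have : ((Finset.range R).filter good).card ≤
        ((Finset.range R).filter fun r => cell ks (x r) = cell ks c).card :=
      Finset.card_le_card fun r hr => by
        rw [Finset.mem_filter, Finset.mem_range] at hr ⊢
        exact ⟨hr.1, h r hr.1 hr.2⟩
    omega
  rw [estimate]
  split_ifs with hA
  · obtain ⟨r, hr, hg, he⟩ := hmem _ _ hA
    exact hnear 32 _ r (.inl rfl) (hvote _) hr hg he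
  · have hsplitA : ∃ r < R, ∃ r' < R, good r ∧ good r' ∧ cell gridA (x r) ≠ cell gridA (x r') := by
      by_contra! hne
      obtain ⟨r₀, h₀, g₀⟩ : ∃ r < R, good r := by
        by_contra! h
        rw [Finset.filter_true_of_mem fun r hr => h r (Finset.mem_range.1 hr), Finset.card_range]
          at hbad
        omega
      have h1 := hall gridA (x r₀) fun r hr hg => hne r hr r₀ h₀ hg g₀
      have h2 := vote_majority h1
      rw [cellCount_congr h2] at hA
      exact hA h1
    obtain ⟨r₁, h₁, r₂, h₂, g₁, g₂, hne⟩ := hsplitA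
    have hdiff : ∀ (c r r' : ℕ), c = 32 ∨ c = 33 → r < R → r' < R → good r → good r' →
        cell ((List.range 16).map fun j => c + 2 * j) (x r) ≠
          cell ((List.range 16).map fun j => c + 2 * j) (x r') →
        ∃ i < 16, ∃ e, 127 * X * (c + 2 * i) ≤ 128 * 2 ^ e ∧
          128 * 2 ^ e ≤ 129 * X * (c + 2 * i) := by
      intro c r r' hc hr hr' g g' h
      simp only [cell, List.map_map, ne_eq, List.map_inj_left, List.mem_range,
        Function.comp_apply, not_forall] at h
      obtain ⟨i, hi, h⟩ := h
      rw [hmult _ (hbound r hr) _ (by omega), hmult _ (hbound r' hr') _ (by omega)] at h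
      obtain ⟨u1, u2⟩ := hgood r hr g
      obtain ⟨u3, u4⟩ := hgood r' hr' g'
      exact ⟨i, hi, exists_pow_between h u1 u2 u3 u4⟩
    have hB : ∀ r < R, good r → cell gridB (x r) = cell gridB (x r₁) := by
      intro r hr hg
      by_contra hneB
      obtain ⟨i, hi, e, a1, a2⟩ := hdiff 32 r₁ r₂ (.inl rfl) h₁ h₂ g₁ g₂ hne
      obtain ⟨j, hj, e', b1, b2⟩ := hdiff 33 r r₁ (.inr rfl) hr h₁ hg g₁ hneB
      exact grid_separated hX (by omega) (by omega) (by omega) (by omega) (by omega) (by omega)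
        a1 a2 b1 b2
    exact hnear 33 _ r₁ (.inr rfl) (hvote _) h₁ g₁ (vote_majority (hall gridB (x r₁) hB)).symm

/-- The precision of the estimates is enough for all `p ≤ 2`. -/
theorem rpow_mem_of_near {p X y : ℝ} (hp : 0 < p) (hp2 : p ≤ 2) (hX : 0 < X)
    (h1 : 16 * 127 * X ≤ 17 * 128 * y) (h2 : 16 * 128 * y ≤ 17 * 129 * X) :
    y ^ p ∈ Set.Icc (6 / 7 * X ^ p) (9 / 7 * X ^ p) := by
  have hXp : 0 < X ^ p := Real.rpow_pos_of_pos hX p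
  have hy : 0 < y := by nlinarith
  have hratio : y ^ p = (y / X) ^ p * X ^ p := by
    rw [Real.div_rpow hy.le hX.le, div_mul_cancel₀ _ hXp.ne']
  have l1 : (127 * 16 / (128 * 17) : ℝ) ≤ y / X := by rw [le_div_iff₀ hX]; linarith
  have l2 : y / X ≤ (129 * 17 / (128 * 16) : ℝ) := by rw [div_le_iff₀ hX]; linarith
  rw [hratio]
  constructor
  · refine mul_le_mul_of_nonneg_right ?_ hXp.le
    calc (6 / 7 : ℝ) ≤ (127 * 16 / (128 * 17)) ^ (2 : ℝ) := by rw [Real.rpow_two]; norm_num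
      _ ≤ (127 * 16 / (128 * 17)) ^ p :=
          Real.rpow_le_rpow_of_exponent_ge (by norm_num) (by norm_num) hp2
      _ ≤ _ := Real.rpow_le_rpow (by norm_num) l1 hp.le
  · refine mul_le_mul_of_nonneg_right ?_ hXp.le
    calc (y / X) ^ p ≤ (129 * 17 / (128 * 16)) ^ p := Real.rpow_le_rpow (by positivity) l2 hp.le
      _ ≤ (129 * 17 / (128 * 16)) ^ (2 : ℝ) :=
          Real.rpow_le_rpow_of_exponent_le (by norm_num) hp2
      _ ≤ 9 / 7 := by rw [Real.rpow_two]; norm_num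

/-- If good rows are in the majority and agree about the sign, then the vote yields that sign. -/
theorem signWord_of_majority (hw : 1 < w) {x : ℕ → BitVec w} {R : ℕ} {good : ℕ → Prop}
    [DecidablePred good] {b : Prop} [Decidable b]
    (hbad : 2 * ((Finset.range R).filter fun r => ¬ good r).card < R)
    (hle : ∀ r < R, (x r).toNat ≤ 1)
    (hgood : ∀ r < R, good r → (x r).toNat = if b then 1 else 0) :
    (signWord x R).toInt = if b then -1 else 1 := by
  have hsplit : ((Finset.range R).filter good).card +
      ((Finset.range R).filter fun r => ¬ good r).card = R := by
    rw [Finset.card_filter_add_card_filter_not, Finset.card_range]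
  have hcount : R < 2 * signCount x R 0 ↔ b := by
    rw [signCount, ← Finset.range_eq_Ico]
    by_cases hb : b
    · simp only [hb, if_true, iff_true] at hgood ⊢
      have : ((Finset.range R).filter good).card ≤ ∑ r ∈ Finset.range R, (x r).toNat := by
        rw [Finset.card_filter]
        refine Finset.sum_le_sum fun r hr => ?_
        split_ifs with hg
        · rw [hgood r (Finset.mem_range.1 hr) hg]
        · exact Nat.zero_le _
      omega
    · simp only [hb, if_false, iff_false] at hgood ⊢
      have : ∑ r ∈ Finset.range R, (x r).toNat ≤
          ((Finset.range R).filter fun r => ¬ good r).card := by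
        rw [Finset.card_filter]
        refine Finset.sum_le_sum fun r hr => ?_
        by_cases hg : good r
        · rw [hgood r (Finset.mem_range.1 hr) hg]; exact Nat.zero_le _
        · rw [if_pos hg]; exact hle r (Finset.mem_range.1 hr)
      omega
  have h1 : 2 * 1 < 2 ^ w := (Nat.pow_lt_pow_right (by norm_num) hw : 2 ^ 1 < 2 ^ w)
  simp only [signWord, hcount]
  split_ifs
  · rw [← sub_sub, sub_self, zero_sub, BitVec.toInt_neg, BitVec.toInt_eq_toNat_of_lt,
      toNat_ofNat_of_lt (by omega)]
    · rw [Int.bmod_def]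
      have h2 : (2 : ℤ) ^ w = 2 ^ (w - 2) * 4 := by
        rw [show (4 : ℤ) = 2 ^ 2 by norm_num, ← pow_add, Nat.sub_add_cancel (by omega)]
      have h3 : (0 : ℤ) < 2 ^ (w - 2) := by positivity
      push_cast
      have h4 : (-1 : ℤ) % 2 ^ w = 2 ^ w - 1 := by
        rw [← Int.add_emod_right, Int.emod_eq_of_lt] <;> omega
      rw [h4, if_neg (by omega)]
      ring
    · rwa [toNat_ofNat_of_lt (by omega)]
  · rw [BitVec.toInt_eq_toNat_of_lt] <;> rw [toNat_ofNat_of_lt (by omega)]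
    · rfl
    · exact h1

/-- On success the output is correct. -/
theorem correctHH_of_success {p φ : ℝ} (hp : 0 < p) (hp2 : p ≤ 2) (hφ : 0 < φ) (hw : 1 < w)
    {m M : ℕ} {l : UpdStream n} (hl : l.Valid m M) (hF : 0 < moment p l.vec)
    (hM : 64 * (m * M) < 2 ^ w) (hn : n < 2 ^ w) {H : ℕ → RowHash w} {leaves : List ℕ}
    (h : Success P p φ l.vec (H, leaves)) :
    CorrectHH p φ l.vec (leaves.map (entry P H (counters P H l))) := by
  obtain ⟨⟨hnodup, hsub, hheavy⟩, hbad⟩ := h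
  dsimp only at hnodup hsub hheavy hbad
  have hlt : ∀ v ∈ leaves, v < n := fun v hv =>
    Finset.mem_range.1 (Finset.mem_filter.1 (hsub v hv)).1
  have hidx : (leaves.map (entry P H (counters P H l))).map HHEntry.index = leaves := by
    rw [List.map_map]
    refine (List.map_congr_left fun v hv => ?_).trans (List.map_id _)
    exact toNat_ofNat_of_lt ((hlt v hv).trans hn)
  have hsum := sum_abs_vec_le hl
  have h2 : 2 ^ w = 2 ^ (w - 1) * 2 := by rw [← pow_succ, Nat.sub_add_cancel (by omega)]
  have hsmall : ∑ j, |l.vec j| < 2 ^ (w - 1) := by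
    refine hsum.trans_lt ?_
    exact_mod_cast (by omega : m * M < 2 ^ (w - 1))
  refine ⟨by rwa [hidx], fun i hi => ?_, fun e he => ?_⟩
  · rw [hidx]
    exact hheavy i (by rw [mass_zero]; exact hi)
  · obtain ⟨v, hv, rfl⟩ := List.mem_map.1 he
    have hvn := hlt v hv
    set i : Fin n := ⟨v, hvn⟩ with hi
    have hiv : (i : ℕ) = v := rfl
    have hmass : φ / 2 * moment p l.vec ≤ |(l.vec i : ℝ)| ^ p := by
      rw [← mass_zero p l.vec i]
      exact (Finset.mem_filter.1 (hsub v hv)).2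
    have hx : l.vec i ≠ 0 := fun h0 => by
      rw [h0, Int.cast_zero, abs_zero, Real.zero_rpow hp.ne'] at hmass
      have : 0 < φ / 2 * moment p l.vec := by positivity
      linarith
    have hmaj := hbad i hmass
    have hX : 0 < (l.vec i).natAbs := Int.natAbs_pos.2 hx
    have hcast : ((l.vec i).natAbs : ℤ) = |l.vec i| := Int.natCast_natAbs _
    have hrow := fun r (hr : r < P.R) => exists_rowAbs_eq (P := P) hw H l i hr hsmall
    have hest := estimate_near (x := rowAbs P H (counters P H l) v) (X := (l.vec i).natAbs)
      (good := fun r => GoodRow l.vec P.l i (H r)) hX hmaj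
      (fun r hr hg => by
        obtain ⟨Y, hY, -, -, ha⟩ := hrow r hr
        rw [GoodRow, ← hY] at hg
        rw [hiv] at ha
        have h3 := abs_add_le (l.vec i) Y
        have h4 := abs_sub_abs_le_abs_sub (l.vec i) (-Y)
        rw [abs_neg, sub_neg_eq_add] at h4
        omega)
      (fun r hr => by
        obtain ⟨Y, -, hY, -, ha⟩ := hrow r hr
        rw [hiv] at ha
        have h3 := abs_add_le (l.vec i) Y
        omega)
    have hsgn := signWord_of_majority hw (x := rowSign P H (counters P H l) v) (b := l.vec i < 0)
      (good := fun r => GoodRow l.vec P.l i (H r)) hmaj (fun r _ => signBit_le_one _ _ _)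
      (fun r hr hg => by
        obtain ⟨Y, hY, -, hs, -⟩ := hrow r hr
        rw [GoodRow, ← hY] at hg
        rw [hiv] at hs
        rw [hs]
        refine if_congr ?_ rfl rfl
        have h3 := le_abs_self Y
        have h4 := neg_abs_le Y
        rcases abs_cases (l.vec i) with h5 | h5 <;> omega)
    refine ⟨i, toNat_ofNat_of_lt (hvn.trans hn), ?_, ?_, ?_⟩
    · exact hmass
    · refine hsgn.trans ?_
      split_ifs with h0
      · exact (Int.sign_eq_neg_one_of_neg h0).symm
      · exact (Int.sign_eq_one_of_pos (by omega)).symm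
    · have hXR : ((l.vec i).natAbs : ℝ) = |(l.vec i : ℝ)| := by
        rw [← Int.cast_abs, ← hcast]; simp
      rw [← hXR]
      refine rpow_mem_of_near hp hp2 (by exact_mod_cast hX) ?_ ?_
      · exact_mod_cast hest.1
      · exact_mod_cast hest.2

end HeavyHitters

/-! ### The word size -/

namespace HeavyHitters

variable {w n : ℕ}

theorem size_le_self (x : ℕ) : Nat.size x ≤ x := Nat.size_le.2 Nat.lt_two_pow_self

theorem two_pow_size_le {x : ℕ} (hx : 0 < x) : 2 ^ Nat.size x ≤ 2 * x := by
  obtain ⟨e, he⟩ : ∃ e, Nat.size x = e + 1 :=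
    ⟨Nat.size x - 1, by have := Nat.size_pos.2 hx; omega⟩
  rw [he, pow_succ']
  exact Nat.mul_le_mul_left _ (size_eq_succ_iff.1 he).1

/-- Polynomial bounds for the parameters make everything fit into words of logarithmic size. -/
theorem setupFits_of_le {q D Y : ℕ} (hY : 2 ≤ Y) (hq0 : 0 < q) (hn : n ≤ Y) (hq : q ≤ 512 * Y)
    (hD : D ≤ Y + 1) (hw : Y ^ 4 * 2 ^ 60 ≤ 2 ^ w) :
    SetupFits n q D w ∧ (layout n q D).B * Y * 2 ^ 20 ≤ 2 ^ w := by
  set P := layout n q D with hP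
  have hl : P.l = Nat.size (q * 262144) := rfl
  have hY2 : 2 * Y ≤ Y ^ 2 := by nlinarith
  have hY4 : Y ^ 2 * 4 ≤ Y ^ 4 := by nlinarith
  have hL : P.L ≤ 2 * Y := by
    have h1 := size_le_self (n / (q + 1))
    have h2 := Nat.div_le_self n (q + 1)
    have h3 : P.L = Nat.size (n / (q + 1)) + 1 := rfl
    omega
  have hqL : q * P.L ≤ 1024 * Y ^ 2 := by
    calc q * P.L ≤ 512 * Y * (2 * Y) := Nat.mul_le_mul hq hL
      _ = _ := by ring
  have hR : P.R ≤ 2 ^ 13 * Y ^ 2 := by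
    have h1 := size_le_self (q * P.L)
    have h3 : P.R = (Nat.size (q * P.L) + D + 3) * 5 := rfl
    nlinarith
  have hB : P.B ≤ 2 ^ 28 * Y := by
    refine (two_pow_size_le (by omega)).trans ?_
    omega
  have hB1 := P.B_pos
  have hN : P.N ≤ 2 ^ 14 * Y ^ 3 := by
    calc P.L * P.R ≤ 2 * Y * (2 ^ 13 * Y ^ 2) := Nat.mul_le_mul hL hR
      _ = _ := by ring
  have hNB : P.N * (P.B + 4) ≤ 2 ^ 43 * Y ^ 4 := by
    calc P.N * (P.B + 4) ≤ 2 ^ 14 * Y ^ 3 * (2 ^ 29 * Y) := Nat.mul_le_mul hN (by omega)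
      _ = _ := by ring
  have htop : P.top = 64 + P.N * (P.B + 4) + (P.L + 1) * (q + 1) + 3 * q := rfl
  have hlast : (P.L + 1) * (q + 1) ≤ 2 ^ 12 * Y ^ 2 := by
    calc (P.L + 1) * (q + 1) ≤ (3 * Y) * (513 * Y) := Nat.mul_le_mul (by omega) (by omega)
      _ ≤ _ := by nlinarith
  have hinst : P.N * P.B ≤ P.N * (P.B + 4) := Nat.mul_le_mul_left _ (by omega)
  have hBY : P.B * Y * 2 ^ 20 ≤ 2 ^ w := by
    calc P.B * Y * 2 ^ 20 ≤ 2 ^ 28 * Y * Y * 2 ^ 20 := by gcongr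
      _ = Y ^ 2 * 2 ^ 48 := by ring
      _ ≤ Y ^ 4 * 2 ^ 60 :=
          Nat.mul_le_mul (Nat.pow_le_pow_right (by omega) (by norm_num)) (by norm_num)
      _ ≤ _ := hw
  have f1 : P.top < 2 ^ w := by omega
  have f2 : P.N * P.B < 2 ^ w := by omega
  have f3 : P.l < w := by
    have : 2 ^ P.l < 2 ^ w := lt_of_le_of_lt (show 2 ^ P.l ≤ 2 ^ 28 * Y from hB) (by omega)
    exact (Nat.pow_lt_pow_iff_right (by norm_num)).1 this
  have f4 : 0 < P.R := Nat.mul_pos (by omega) (by norm_num)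
  have f5 : 2 * P.R < 2 ^ w := by omega
  have f6 : n < 2 ^ w := by omega
  have f7 : q * P.L < 2 ^ w := by omega
  have f8 : q * 262144 < 2 ^ w := by omega
  exact ⟨⟨⟨f1, f2, f3, f4, f5⟩, f6, f7, f8⟩, hBY⟩

theorem toInt_ofInt_of_le {M : ℕ} {v : ℤ} (hv : |v| ≤ M) (hM : 4 * M < 2 ^ w) :
    (BitVec.ofInt w v).toInt = v := by
  rw [BitVec.toInt_ofInt]
  have h := abs_le.1 hv
  have h2 : (4 * M : ℤ) < (2 ^ w : ℕ) := by exact_mod_cast hM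
  refine Int.bmod_eq_of_le ?_ ?_ <;> omega

theorem moment_le {p : ℝ} (hp : 0 < p) (hp2 : p ≤ 2) {m M : ℕ} (hm : 1 ≤ m) (hM : 1 ≤ M)
    {l : UpdStream n} (hl : l.Valid m M) : moment p l.vec ≤ ((n * m * M : ℕ) : ℝ) ^ 2 := by
  have h1 : ∀ i, |(l.vec i : ℝ)| ^ p ≤ ((m * M : ℕ) : ℝ) ^ 2 := by
    intro i
    have h2 : |l.vec i| ≤ (m * M : ℕ) :=
      (Finset.single_le_sum (f := fun j => |l.vec j|) (fun _ _ => abs_nonneg _)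
        (Finset.mem_univ i)).trans (sum_abs_vec_le hl)
    have h3 : |(l.vec i : ℝ)| ≤ (m * M : ℕ) := by exact_mod_cast h2
    have h4 : (1 : ℝ) ≤ (m * M : ℕ) := by exact_mod_cast Nat.mul_pos hm hM
    calc |(l.vec i : ℝ)| ^ p ≤ ((m * M : ℕ) : ℝ) ^ p := Real.rpow_le_rpow (abs_nonneg _) h3 hp.le
      _ ≤ ((m * M : ℕ) : ℝ) ^ (2 : ℝ) := Real.rpow_le_rpow_of_exponent_le h4 hp2
      _ = _ := Real.rpow_two _
  calc moment p l.vec ≤ ∑ _i : Fin n, ((m * M : ℕ) : ℝ) ^ 2 := Finset.sum_le_sum fun i _ => h1 i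
    _ = n * ((m * M : ℕ) : ℝ) ^ 2 := by simp
    _ ≤ _ := by
        have h5 : n * (m * M) ^ 2 ≤ (n * m * M) ^ 2 := by
          have : n ≤ n ^ 2 := Nat.le_self_pow (by norm_num) n
          calc n * (m * M) ^ 2 ≤ n ^ 2 * (m * M) ^ 2 := Nat.mul_le_mul_right _ this
            _ = _ := by ring
        exact_mod_cast h5

end HeavyHitters

/-! ### Costs -/

namespace HeavyHitters

variable {w n : ℕ} {box : Bool → Estimator w n}

theorem le_logb_two {k : ℕ} {x : ℝ} (h : (2 : ℝ) ^ k ≤ x) : (k : ℝ) ≤ Real.logb 2 x := by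
  rw [Real.le_logb_iff_rpow_le (by norm_num) (lt_of_lt_of_le (by positivity) h), Real.rpow_natCast]
  exact h

theorem one_le_logb {x : ℝ} (h : 2 ≤ x) : 1 ≤ Real.logb 2 x := by
  have := le_logb_two (k := 1) (x := x) (by simpa using h)
  exact_mod_cast this

theorem levels_le {φ : ℝ} {q D : ℕ} (hφ : 0 < φ) (hφn : 2 ≤ φ * n) (hq : 1024 - φ ≤ q * φ) :
    ((layout n q D).L : ℝ) ≤ 2 * Real.logb 2 (φ * n) := by
  have h1 := one_le_logb hφn
  have hL : ((layout n q D).L : ℝ) = Nat.size (n / (q + 1)) + 1 := by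
    exact_mod_cast (rfl : (layout n q D).L = Nat.size (n / (q + 1)) + 1)
  rw [hL]
  rcases Nat.eq_zero_or_pos (n / (q + 1)) with h0 | h0
  · rw [h0, Nat.size_zero]
    push_cast
    linarith
  · have h2 : (2 : ℝ) ^ Nat.size (n / (q + 1)) ≤ φ * n := by
      have h3 : (2 : ℝ) ^ Nat.size (n / (q + 1)) ≤ 2 * ((n / (q + 1) : ℕ) : ℝ) := by
        exact_mod_cast two_pow_size_le h0
      have h4 : ((n / (q + 1) : ℕ) : ℝ) * (q + 1) ≤ n := by
        exact_mod_cast Nat.div_mul_le_self n (q + 1)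
      have h5 : (0 : ℝ) ≤ ((n / (q + 1) : ℕ) : ℝ) := Nat.cast_nonneg _
      generalize ((n / (q + 1) : ℕ) : ℝ) = y at *
      have h6 : φ * (y * (q + 1)) ≤ φ * n := by gcongr
      nlinarith
    have := le_logb_two h2
    linarith

theorem one_div_hhDelta (n : ℕ) (φ δ : ℝ) :
    1 / hhDelta n φ δ = 12 * (Real.logb 2 (φ * n) + 1) / (φ * δ) := by
  rw [hhDelta, one_div_div]

theorem rows_le {φ δ : ℝ} {q : ℕ} (hφ : 0 < φ) (hφ2 : φ < 1 / 2)
    (hφn : 2 ≤ φ * n) (hδ : 0 < δ) (hδ2 : δ < 1 / 2) (hq0 : 0 < q) (hq : 1024 - φ ≤ q * φ)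
    (hq2 : q * φ ≤ 1024) :
    ((layout n q ⌈Real.logb 2 (1 / δ)⌉₊).R : ℝ) ≤ 20 * Real.logb 2 (1 / hhDelta n φ δ) ∧
      6 ≤ Real.logb 2 (1 / hhDelta n φ δ) := by
  set D := ⌈Real.logb 2 (1 / δ)⌉₊ with hD
  set lam := Real.logb 2 (φ * n) with hlam
  have h1 : 1 ≤ lam := one_le_logb hφn
  have hL : ((layout n q D).L : ℝ) ≤ 2 * lam := levels_le hφ hφn hq
  have hR : ((layout n q D).R : ℝ) = (Nat.size (q * (layout n q D).L) + D + 3) * 5 := by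
    exact_mod_cast (rfl : (layout n q D).R = (Nat.size (q * (layout n q D).L) + D + 3) * 5)
  rw [hR]
  have hL0 : 0 < (layout n q D).L := Nat.succ_pos _
  generalize (layout n q D).L = L at *
  rw [one_div_hhDelta, ← hlam]
  have hφδ : 0 < φ * δ := by positivity
  set Δ := 12 * (lam + 1) / (φ * δ) with hΔ
  have hΔφ : Δ * (φ * δ) = 12 * (lam + 1) := by rw [hΔ]; field_simp
  have hφδ4 : φ * δ ≤ 1 / 4 := by nlinarith
  have hΔ0 : 0 < Δ := by positivity
  have hΔ96 : 96 ≤ Δ := by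
    rw [hΔ, le_div_iff₀ hφδ]; nlinarith
  have h6 : 6 ≤ Real.logb 2 Δ := by
    have := le_logb_two (k := 6) (x := Δ) (by norm_num; linarith)
    exact_mod_cast this
  have hδΔ : 1 / δ ≤ Δ := by
    rw [hΔ, div_le_div_iff₀ hδ hφδ]
    nlinarith
  have hDle : (D : ℝ) ≤ Real.logb 2 Δ + 1 := by
    have h2 : Real.logb 2 (1 / δ) ≤ Real.logb 2 Δ :=
      Real.logb_le_logb_of_le (by norm_num) (by positivity) hδΔ
    have h3 : (0 : ℝ) ≤ Real.logb 2 (1 / δ) :=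
      Real.logb_nonneg (by norm_num) (by rw [le_div_iff₀ hδ]; linarith)
    have h4 := Nat.ceil_lt_add_one h3
    rw [← hD] at h4
    linarith
  have hsize : (Nat.size (q * L) : ℝ) ≤ Real.logb 2 Δ + 8 := by
    have h2 : (2 : ℝ) ^ Nat.size (q * L) ≤ 2 * ((q : ℝ) * L) := by
      exact_mod_cast two_pow_size_le (Nat.mul_pos hq0 hL0)
    have h3 : 2 * ((q : ℝ) * L) ≤ Δ * 2 ^ 8 := by
      have h4 : (q : ℝ) * φ * L ≤ 1024 * (2 * lam) := by gcongr
      have h5 : 2 * ((q : ℝ) * L) * (φ * δ) ≤ Δ * 2 ^ 8 * (φ * δ) := by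
        have h6 : (q : ℝ) * φ * L * δ ≤ 1024 * (2 * lam) * (1 / 2) := by gcongr
        calc 2 * ((q : ℝ) * L) * (φ * δ) = 2 * ((q : ℝ) * φ * L * δ) := by ring
          _ ≤ 2 * (1024 * (2 * lam) * (1 / 2)) := by linarith
          _ ≤ 2 ^ 8 * (12 * (lam + 1)) := by linarith
          _ = 2 ^ 8 * (Δ * (φ * δ)) := by rw [hΔφ]
          _ = _ := by ring
      exact le_of_mul_le_mul_right h5 hφδ
    have h4 := le_logb_two (h2.trans h3)
    rwa [Real.logb_mul hΔ0.ne' (by norm_num), Real.logb_pow, Real.logb_self_eq_one (by norm_num),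
      mul_one] at h4
  exact ⟨by linarith, h6⟩

/-- The memory of the program takes at most ten times the space of the instances in the buckets. -/
theorem space_le {q D b : ℕ} (hq : 0 < q) (hb : w ≤ b) :
    (layout n q D).top * w + (layout n q D).N * (layout n q D).B * b ≤
      11 * ((layout n q D).N * (layout n q D).B * b) := by
  have hB : q * 262144 < (layout n q D).B := Nat.lt_size_self _
  have htop : (layout n q D).top = 64 + (layout n q D).N * ((layout n q D).B + 4) +
    ((layout n q D).L + 1) * (q + 1) + 3 * q := rfl
  have hL : 0 < (layout n q D).L := Nat.succ_pos _
  have hR : 0 < (layout n q D).R := Nat.mul_pos (by omega) (by norm_num)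
  have hN : (layout n q D).N = (layout n q D).L * (layout n q D).R := rfl
  generalize layout n q D = P at *
  have hLN : P.L ≤ P.N := by rw [hN]; exact Nat.le_mul_of_pos_right _ hR
  generalize P.N = N at *
  generalize P.B = B at *
  generalize P.L = L at *
  have hBN : 1 * B ≤ N * B := Nat.mul_le_mul_right _ (by omega)
  have h1 : N * (B + 4) ≤ N * (2 * B) := Nat.mul_le_mul_left _ (by omega)
  have h2 : (L + 1) * (q + 1) ≤ (2 * N) * B := Nat.mul_le_mul (by omega) (by omega)
  have h3 : P.top ≤ 10 * (N * B) := by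
    have e1 : N * (2 * B) = 2 * (N * B) := by ring
    have e2 : 2 * N * B = 2 * (N * B) := by ring
    omega
  calc P.top * w + N * B * b ≤ 10 * (N * B) * b + N * B * b :=
        Nat.add_le_add_right (Nat.mul_le_mul h3 hb) _
    _ = _ := by ring

theorem updBound_le (P : Layout) (box : Bool → Estimator w n) :
    updBound P box ≤ 41 * (P.N * (box false).updTime) + 11 * (box true).updTime := by
  have h1 := (box false).updTime_pos
  have h2 := (box true).updTime_pos
  have h3 : P.N * (40 + (box false).updTime) ≤ P.N * (41 * (box false).updTime) :=
    Nat.mul_le_mul_left _ (by omega)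
  have h4 : P.N * (41 * (box false).updTime) = 41 * (P.N * (box false).updTime) := by ring
  unfold updBound
  omega

theorem repBound_le {P : Layout} (box : Bool → Estimator w n) (hq : 0 < P.q) (hL : 0 < P.L)
    (hR : 0 < P.R) :
    repBound P box ≤ 741 * (P.q * P.N * (box false).repTime) + (box true).repTime := by
  have hr := (box false).repTime_pos
  unfold repBound levelCost nodeCost entryCost Layout.N
  generalize (box false).repTime = r at *
  generalize P.q = q at *
  generalize P.L = L at *
  generalize P.R = R at *
  have hRr : 1 * 1 ≤ R * r := Nat.mul_le_mul hR hr
  have hqR : 1 * 1 ≤ q * (R * r) := Nat.mul_le_mul hq hRr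
  have h1 : R * (40 + r) + 30 ≤ 71 * (R * r) := by nlinarith
  have h2 : 2 * q * (R * (40 + r) + 30) + 15 ≤ 157 * (q * (R * r)) := by nlinarith
  have h3 : L * (2 * q * (R * (40 + r) + 30) + 15) ≤ L * (157 * (q * (R * r))) :=
    Nat.mul_le_mul_left _ h2
  have h4 : 3 * (R * 160) + 60 + 4 ≤ 544 * (R * r) := by nlinarith
  have h5 : q * (3 * (R * 160) + 60 + 4) ≤ q * (544 * (R * r)) := Nat.mul_le_mul_left _ h4
  have h6 : 1 * (q * (R * r)) ≤ L * (q * (R * r)) := Nat.mul_le_mul_right _ hL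
  have e1 : L * (157 * (q * (R * r))) = 157 * (L * (q * (R * r))) := by ring
  have e2 : q * (544 * (R * r)) = 544 * (q * (R * r)) := by ring
  have e3 : q * (L * R) * r = L * (q * (R * r)) := by ring
  rw [e3]
  omega

end HeavyHitters

/-! ### The guarantee with explicit costs -/

open scoped ENNReal

namespace HeavyHitters

variable {w n : ℕ} {box : Bool → Estimator w n}

/-- The probability of success, transferred from the law of the outcomes to that of the machine. -/
theorem le_toOuterMeasure_of_refines {α β : Type} {μ : PMF α} {ν : PMF β} {r : α → β → Prop}
    (h : μ.Refines ν r) {s : Set α} {good : β → Prop} (hs : ∀ a b, r a b → good b → a ∈ s) {δ : ℝ}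
    (hδ : 0 ≤ δ)
    (hν : (ν.expect fun b => open Classical in if good b then 0 else 1) ≤ ENNReal.ofReal δ) :
    ENNReal.ofReal (1 - δ) ≤ μ.toOuterMeasure s := by
  classical
  rw [ENNReal.ofReal_sub _ hδ, ENNReal.ofReal_one]
  refine PMF.le_toOuterMeasure_of_expect_le μ s _
    (fun a => ⨅ b, ⨅ _ : r a b, if good b then 0 else 1) (fun a ha => ?_)
    ((h _).trans (by convert hν))
  refine le_iInf fun b => le_iInf fun hab => ?_
  rw [if_neg fun hb => ha (hs a b hab hb)]

/-- The requirements on a set of parameters, for the analysis of the algorithm. -/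
structure Parameters (p : ℝ) (n m M w : ℕ) (φ δ : ℝ) : Prop where
  p_pos : 0 < p
  p_le : p ≤ 2
  m_pos : 1 ≤ m
  M_pos : 1 ≤ M
  φ_pos : 0 < φ
  φ_lt : φ < 1 / 2
  φn : 2 ≤ φ * n
  δ_pos : 0 < δ
  δ_lt : δ < 1 / 2
  δ_le : Real.logb 2 (1 / δ) ≤ n * m * M
  le_w : 100 * Real.logb 2 (n * m * M) ≤ w

namespace Parameters

variable {p : ℝ} {m M : ℕ} {φ δ : ℝ}

theorem four_lt (h : Parameters p n m M w φ δ) : 4 < n := by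
  have h1 : (4 : ℝ) < n := by
    by_contra! h4
    have := h.φn
    have := mul_le_mul_of_nonneg_left h4 h.φ_pos.le
    have := h.φ_lt
    linarith
  exact_mod_cast h1

theorem n_le (h : Parameters p n m M w φ δ) : n ≤ n * m * M := by
  rw [mul_assoc]
  exact Nat.le_mul_of_pos_right _ (Nat.mul_pos h.m_pos h.M_pos)

theorem pow_le (h : Parameters p n m M w φ δ) : (n * m * M) ^ 4 * 2 ^ 60 ≤ 2 ^ w := by
  have h0 := h.four_lt.trans_le h.n_le
  have h1 := h.le_w
  set Y := n * m * M with hY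
  have hYc : ((n : ℝ) * m * M) = (Y : ℝ) := by rw [hY]; push_cast; rfl
  rw [hYc] at h1
  have hY0 : (0 : ℝ) < Y := by exact_mod_cast (by omega : 0 < Y)
  have h2 : Real.logb 2 ((Y : ℝ) ^ 100) ≤ w := by rw [Real.logb_pow]; exact_mod_cast h1
  rw [Real.logb_le_iff_le_rpow (by norm_num) (by positivity), Real.rpow_natCast] at h2
  have h3 : Y ^ 100 ≤ 2 ^ w := by exact_mod_cast h2
  calc Y ^ 4 * 2 ^ 60 ≤ Y ^ 4 * Y ^ 60 := by gcongr; omega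
    _ = Y ^ 64 := by ring
    _ ≤ Y ^ 100 := Nat.pow_le_pow_right (by omega) (by norm_num)
    _ ≤ _ := h3

theorem floor_bounds (h : Parameters p n m M w φ δ) :
    1024 - φ ≤ (⌊1024 / φ⌋₊ : ℝ) * φ ∧ (⌊1024 / φ⌋₊ : ℝ) * φ ≤ 1024 ∧ 0 < ⌊1024 / φ⌋₊ ∧
      ⌊1024 / φ⌋₊ ≤ 512 * n := by
  have h1 := h.φ_pos
  have h2 := Nat.lt_floor_add_one (1024 / φ)
  have h3 := Nat.floor_le (div_nonneg (by norm_num : (0 : ℝ) ≤ 1024) h1.le)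
  rw [div_lt_iff₀ h1] at h2
  rw [le_div_iff₀ h1] at h3
  generalize ⌊1024 / φ⌋₊ = q at *
  refine ⟨by linarith, h3, ?_, ?_⟩
  · rcases Nat.eq_zero_or_pos q with h0 | h0
    · rw [h0] at h2
      have := h.φ_lt
      push_cast at h2
      linarith
    · exact h0
  · have h4 : (q : ℝ) * φ ≤ (512 * n) * φ := by have := h.φn; linarith
    exact_mod_cast le_of_mul_le_mul_right h4 h1

theorem ceil_le (h : Parameters p n m M w φ δ) : ⌈Real.logb 2 (1 / δ)⌉₊ ≤ n * m * M + 1 := by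
  refine (Nat.ceil_le.2 ?_).trans (Nat.le_succ _)
  push_cast
  exact h.δ_le

theorem setupFits (h : Parameters p n m M w φ δ) :
    SetupFits n ⌊1024 / φ⌋₊ ⌈Real.logb 2 (1 / δ)⌉₊ w ∧
      (layout n ⌊1024 / φ⌋₊ ⌈Real.logb 2 (1 / δ)⌉₊).B * (n * m * M) * 2 ^ 20 ≤ 2 ^ w :=
  setupFits_of_le (by have := h.four_lt.trans_le h.n_le; omega) h.floor_bounds.2.2.1 h.n_le
    (h.floor_bounds.2.2.2.trans (Nat.mul_le_mul_left _ h.n_le)) h.ceil_le h.pow_le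

theorem one_div_le (h : Parameters p n m M w φ δ) : 1 / δ ≤ 2 ^ ⌈Real.logb 2 (1 / δ)⌉₊ := by
  have h1 : 0 < 1 / δ := one_div_pos.2 h.δ_pos
  rw [← Real.rpow_natCast, ← Real.logb_le_iff_le_rpow (by norm_num) h1]
  exact Nat.le_ceil _

end Parameters

/-- The algorithm finds heavy hitters, with explicit bounds for its costs. -/
theorem algorithm_findsHeavyHitters {p : ℝ} {m M : ℕ} {φ δ : ℝ} (h : Parameters p n m M w φ δ)
    (hE : (box false).Estimates p m M (1 / 7) (1 / 5))
    (hE' : (box true).Estimates p m M (1 / 7) (hhDelta n φ δ)) {S U T : ℝ}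
    (hS : 2 ^ 40 * (φ⁻¹ * Real.logb 2 (φ * n) *
      (Real.logb 2 (1 / hhDelta n φ δ) * (box false).bits)) + (box true).bits ≤ S)
    (hU : 2 ^ 40 * (Real.logb 2 (φ * n) *
      (Real.logb 2 (1 / hhDelta n φ δ) * (box false).updTime)) + 11 * (box true).updTime ≤ U)
    (hT : 2 ^ 40 * (φ⁻¹ * Real.logb 2 (φ * n) *
      (Real.logb 2 (1 / hhDelta n φ δ) * (box false).repTime)) + (box true).repTime ≤ T) :
    algorithm.FindsHeavyHitters box p φ δ m M S U T := by
  obtain ⟨hq1, hq2, hq0, hqn⟩ := h.floor_bounds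
  obtain ⟨hfits, hBY⟩ := h.setupFits
  have hYn := h.n_le
  have hn4 := h.four_lt
  have hpow := h.pow_le
  have hDδ := h.one_div_le
  have hφ := h.φ_pos
  obtain ⟨hrows, h6⟩ := rows_le hφ h.φ_lt h.φn h.δ_pos h.δ_lt hq0 hq1 hq2
  have hlev := levels_le (D := ⌈Real.logb 2 (1 / δ)⌉₊) hφ h.φn hq1
  have hlam := one_le_logb h.φn
  have hd : hhDelta n φ δ ≤ δ / 2 := by
    rw [hhDelta, div_le_iff₀ (by positivity)]
    have := h.φ_lt
    have := h.δ_pos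
    nlinarith
  set q := ⌊1024 / φ⌋₊ with hq
  set D := ⌈Real.logb 2 (1 / δ)⌉₊ with hD
  set Λ := Real.logb 2 (1 / hhDelta n φ δ) with hΛ
  set lam := Real.logb 2 (φ * n) with hlamdef
  set Y := n * m * M with hY
  have hPq : (layout n q D).q = q := rfl
  have hPB : (layout n q D).B = 2 ^ (layout n q D).l := rfl
  have hB1 : q * 262144 < (layout n q D).B := Nat.lt_size_self _
  have hB2 : (layout n q D).B ≤ 2 * (q * 262144) := two_pow_size_le (by omega)
  have hR0 : 0 < (layout n q D).R := Nat.mul_pos (by omega) (by norm_num)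
  have hL0 : 0 < (layout n q D).L := Nat.succ_pos _
  have hspace : ∀ b : ℕ, w ≤ b → (layout n q D).top * w + (layout n q D).N * (layout n q D).B * b ≤
    11 * ((layout n q D).N * (layout n q D).B * b) := fun b => space_le hq0
  have hN : (((layout n q D).N : ℕ) : ℝ) ≤ 40 * (lam * Λ) := by
    rw [show (layout n q D).N = (layout n q D).L * (layout n q D).R from rfl]
    push_cast
    calc _ ≤ (2 * lam) * (20 * Λ) := by gcongr
      _ = _ := by ring
  have hM4 : 64 * (m * M) < 2 ^ w := by
    have h1 : 1 * (m * M) ≤ n * (m * M) := Nat.mul_le_mul_right _ (by omega)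
    have h2 : n * (m * M) = Y := by rw [hY, mul_assoc]
    have h3 : Y * 1 ≤ Y ^ 4 := by
      rw [mul_one]; exact Nat.le_self_pow (by norm_num) Y
    omega
  have hMm : M ≤ m * M := Nat.le_mul_of_pos_left _ h.m_pos
  have hrep := repBound_le (P := layout n q D) box hq0 hL0 hR0
  have hupd := updBound_le (layout n q D) box
  rw [hPq] at hrep
  have hw1 : 1 < w := by
    have : 2 ^ 1 < 2 ^ w := by
      have : 1 * 2 ^ 60 ≤ Y ^ 4 * 2 ^ 60 := Nat.mul_le_mul_right _ (Nat.pow_pos (by omega))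
      omega
    exact (Nat.pow_lt_pow_iff_right (by norm_num)).1 this
  refine ⟨2 ^ w, fun l hl => ?_⟩
  have hv : ∀ u ∈ l, (BitVec.ofInt w u.2).toInt = u.2 := fun u hu =>
    toInt_ofInt_of_le (hl.2 u hu) (by omega)
  have hproc := refines_process (box := box) (input := hhInput n m M φ δ) (l := l) (q := q) (D := D)
    (fuel := 2 ^ w)
    rfl rfl rfl hfits le_rfl hv
  have hans := refines_answer (box := box) (input := hhInput n m M φ δ) (l := l) (q := q) (D := D)
    (fuel := 2 ^ w)
    rfl rfl rfl hfits le_rfl hq0 hv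
  have hlaw : 0 < moment p l.vec → ((answerLaw (layout n q D) box l).expect fun y =>
      open Classical in if Success (layout n q D) p φ l.vec y then 0 else 1) ≤
        ENNReal.ofReal δ := by
    intro hF
    have hlw := hfits.fits.l_lt
    have hsplit : 2 ^ w = (layout n q D).B * 2 ^ (w - (layout n q D).l) := by
      rw [hPB, ← pow_add, Nat.add_sub_cancel' hlw.le]
    have hroom : ∀ k ≤ Y * 2 ^ 20, k ≤ 2 ^ (w - (layout n q D).l) := fun k hk => by
      refine Nat.le_of_mul_le_mul_left ?_ (layout n q D).B_pos
      rw [← hsplit]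
      exact (Nat.mul_le_mul_left _ hk).trans (by rwa [← mul_assoc])
    refine expect_answerLaw_le h.p_pos h.p_le hφ hE hE' hl hF rfl hlw
      (hroom _ (by omega)) (hroom _ (by omega)) ?_ ?_ hDδ h.δ_pos hd ?_
    · rw [div_le_iff₀ hφ]; have := h.φ_lt; linarith
    · have h1 : (q : ℝ) * 262144 ≤ 2 ^ (layout n q D).l := by
        rw [hPB] at hB1
        exact_mod_cast hB1.le
      rw [div_le_iff₀ hφ]
      have := h.φ_lt
      have : (q : ℝ) * 262144 * φ ≤ 2 ^ (layout n q D).l * φ := by gcongr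
      linarith
    · have hF1 : 1 ≤ moment p l.vec :=
        ((moment_eq_zero_or h.p_pos l.vec).resolve_left fun h0 => hF.ne' h0.2)
      refine separates hφ h.φ_lt hq1 hq2 hF1 ?_
      have h1 := moment_le h.p_pos h.p_le h.m_pos h.M_pos hl
      have h2 : (q : ℝ) ≤ 512 * Y := by exact_mod_cast hqn.trans (Nat.mul_le_mul_left _ hYn)
      have h3 : (Y : ℝ) ^ 4 * 2 ^ 60 ≤ 2 ^ w := by exact_mod_cast hpow
      have h4 : (1 : ℝ) ≤ Y := by exact_mod_cast (by omega : 1 ≤ Y)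
      calc moment p l.vec * q * 2 ^ 38 ≤ (Y : ℝ) ^ 2 * (512 * Y) * 2 ^ 38 := by gcongr
        _ = (Y : ℝ) ^ 3 * 2 ^ 47 := by ring
        _ ≤ (Y : ℝ) ^ 4 * 2 ^ 60 := by gcongr <;> norm_num
        _ ≤ _ := h3
  clear_value q D Λ lam Y
  generalize layout n q D = P at *
  have hb5 : w ≤ (box false).bits := Nat.le_mul_of_pos_left _ (box false).words_pos
  have hinv : (q : ℝ) ≤ 1024 * φ⁻¹ := by
    rw [← div_eq_mul_inv, le_div_iff₀ hφ]; exact hq2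
  have hφi : 0 < φ⁻¹ := inv_pos.2 hφ
  have hspc : ∀ s : Conf box, s.slots false ≤ P.N * P.B → s.slots true ≤ 1 → s.top ≤ P.top →
      (s.space : ℝ) ≤ S := by
    intro s h1 h2 h3
    refine le_trans ?_ hS
    have h4 : s.space ≤ 11 * (P.N * P.B * (box false).bits) + (box true).bits := by
      have h5 : s.top * w ≤ P.top * w := Nat.mul_le_mul_right _ h3
      have h6 : s.slots false * (box false).bits ≤ P.N * P.B * (box false).bits :=
        Nat.mul_le_mul_right _ h1
      have h7 : s.slots true * (box true).bits ≤ 1 * (box true).bits := Nat.mul_le_mul_right _ h2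
      have h8 := hspace _ hb5
      unfold Conf.space
      omega
    have h5 : (s.space : ℝ) ≤ 11 * ((P.N : ℝ) * P.B * (box false).bits) + (box true).bits := by
      exact_mod_cast h4
    have h6 : (P.B : ℝ) ≤ 2 ^ 29 * φ⁻¹ := by
      have : (P.B : ℝ) ≤ 2 * (q * 262144) := by exact_mod_cast hB2
      linarith
    have h7 : (P.N : ℝ) * P.B * (box false).bits ≤
        40 * (lam * Λ) * (2 ^ 29 * φ⁻¹) * (box false).bits := by gcongr
    have h8 : 0 ≤ φ⁻¹ * lam * (Λ * (box false).bits) := by positivity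
    have h9 : 40 * (lam * Λ) * (2 ^ 29 * φ⁻¹) * (box false).bits =
      40 * 2 ^ 29 * (φ⁻¹ * lam * (Λ * (box false).bits)) := by ring
    linarith
  refine ⟨fun s hs => ?_, fun s hs => ?_, fun hx => ?_⟩
  · obtain ⟨x, hcore, htime⟩ := hproc.exists_of_mem_support hs
    refine ⟨hcore.ok, hspc s hcore.slots hcore.slots_total hcore.top, le_trans ?_ hU⟩
    have h4 : (s.time : ℝ) ≤ 41 * ((P.N : ℝ) * (box false).updTime) + 11 * (box true).updTime := by
      exact_mod_cast htime.trans hupd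
    have h7 : (P.N : ℝ) * (box false).updTime ≤ 40 * (lam * Λ) * (box false).updTime := by gcongr
    have h8 : 0 ≤ lam * (Λ * (box false).updTime) := by positivity
    have h9 : 40 * (lam * Λ) * (box false).updTime = 40 * (lam * (Λ * (box false).updTime)) := by
      ring
    linarith
  · obtain ⟨x, hr⟩ := hans.exists_of_mem_support hs
    refine ⟨hr.ok, hspc s hr.slots hr.slots_total hr.top, le_trans ?_ hT⟩
    have h4 : (s.time : ℝ) ≤ 741 * ((q : ℝ) * P.N * (box false).repTime) + (box true).repTime := by
      exact_mod_cast hr.time.trans hrep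
    have h7 : (q : ℝ) * P.N * (box false).repTime ≤
        1024 * φ⁻¹ * (40 * (lam * Λ)) * (box false).repTime := by gcongr
    have h8 : 0 ≤ φ⁻¹ * lam * (Λ * (box false).repTime) := by positivity
    have h9 : 1024 * φ⁻¹ * (40 * (lam * Λ)) * (box false).repTime =
      40960 * (φ⁻¹ * lam * (Λ * (box false).repTime)) := by ring
    linarith
  · have hF : 0 < moment p l.vec := by
      rcases moment_eq_zero_or h.p_pos l.vec with h0 | h0
      · exact absurd h0.1 hx
      · linarith
    refine le_toOuterMeasure_of_refines hans (fun s y hs hy => ?_) h.δ_pos.le (hlaw hF)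
    change CorrectHH p φ l.vec s.output
    rw [hs.output]
    exact correctHH_of_success h.p_pos h.p_le hφ hw1 hl hF hM4 hfits.n_lt hy

end HeavyHitters

/-! ### Comparison with the claimed bounds -/

namespace HeavyHitters

variable {n : ℕ}

/-- `log (1 / δ')` is at most a constant times `log (log (φ n) / (δ φ))`, which is at least `1`. -/
theorem logb_one_div_hhDelta_le {φ δ : ℝ} (hφ : 0 < φ) (hφ2 : φ < 1 / 2) (hφn : 2 ≤ φ * n)
    (hδ : 0 < δ) (hδ2 : δ < 1 / 2) :
    Real.logb 2 (1 / hhDelta n φ δ) ≤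
      4 * Real.logb 2 (Real.logb 2 (φ * n) / (δ * φ)) := by
  have h1 := one_le_logb hφn
  rw [one_div_hhDelta]
  set lam := Real.logb 2 (φ * n)
  have hδφ : 0 < δ * φ := by positivity
  have hδφ4 : δ * φ ≤ 1 / 4 := by nlinarith
  set Z := lam / (δ * φ) with hZ
  have hZ4 : 4 ≤ Z := by rw [hZ, le_div_iff₀ hδφ]; linarith
  have h2 : 2 ≤ Real.logb 2 Z := by
    have := le_logb_two (k := 2) (x := Z) (by norm_num; linarith)
    exact_mod_cast this
  have h3 : 12 * (lam + 1) / (φ * δ) ≤ Z * 2 ^ 5 := by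
    rw [hZ, div_mul_eq_mul_div, mul_comm φ δ]
    exact div_le_div_of_nonneg_right (by linarith) hδφ.le
  have h4 := Real.logb_le_logb_of_le (b := 2) (by norm_num) (by positivity) h3
  rw [Real.logb_mul (by linarith) (by norm_num), Real.logb_pow,
    Real.logb_self_eq_one (by norm_num)] at h4
  push_cast at h4
  linarith

theorem logb_five_le : Real.logb 2 (1 / (1 / 5)) ≤ 3 := by
  rw [Real.logb_le_iff_le_rpow (by norm_num) (by norm_num)]
  norm_num

/-- The bound for the first kind of costs, for one of the three costs: `a` is that of the cheap black
box, `b` that of the other, and `y` collects the factors in front. -/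
theorem cost_le_of_proportional {K Λ a b y z : ℝ} (hy : 1 ≤ y) (hz : 0 ≤ z) (hb : 0 ≤ b)
    (h : Λ * a ≤ K * b) :
    2 ^ 40 * (y * (Λ * a)) + 11 * b ≤ 2 ^ 42 * (|K| + 1) * (y * b + z) := by
  have h1 : Λ * a ≤ |K| * b := h.trans (mul_le_mul_of_nonneg_right (le_abs_self K) hb)
  have h2 : y * (Λ * a) ≤ y * (|K| * b) := mul_le_mul_of_nonneg_left h1 (by linarith)
  have hK := abs_nonneg K
  have h3 : 1 * b ≤ y * b := mul_le_mul_of_nonneg_right hy hb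
  have h4 : 0 ≤ |K| * (y * b) := by positivity
  have h5 : 0 ≤ |K| * z := by positivity
  nlinarith

/-- The bound for the second kind of costs, for one of the three costs. -/
theorem cost_le_of_logarithmic {K Λ Z a b y v : ℝ} (hy : 1 ≤ y) (hv : 0 ≤ v) (hΛ : 0 ≤ Λ)
    (hΛZ : Λ ≤ 4 * Z) (ha : a ≤ K * (v * Real.logb 2 (1 / (1 / 5)))) (hb : b ≤ K * (v * Λ)) :
    2 ^ 40 * (y * (Λ * a)) + 11 * b ≤ 2 ^ 48 * (|K| + 1) * (y * v * Z) := by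
  have hK := abs_nonneg K
  have hZ : 0 ≤ Z := by linarith
  have h5 : 0 ≤ Real.logb 2 (1 / (1 / 5)) := Real.logb_nonneg (by norm_num) (by norm_num)
  have ha' : a ≤ |K| * (v * 3) := ha.trans <|
    (mul_le_mul_of_nonneg_right (le_abs_self K) (by positivity)).trans (by
      gcongr
      exact logb_five_le)
  have hb' : b ≤ |K| * (v * (4 * Z)) := hb.trans <|
    (mul_le_mul_of_nonneg_right (le_abs_self K) (by positivity)).trans (by gcongr)
  have h1 : y * (Λ * a) ≤ y * (4 * Z * (|K| * (v * 3))) := by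
    refine mul_le_mul_of_nonneg_left ?_ (by linarith)
    exact (mul_le_mul_of_nonneg_left ha' hΛ).trans (mul_le_mul_of_nonneg_right hΛZ (by positivity))
  have h2 : 1 * (|K| * (v * (4 * Z))) ≤ y * (|K| * (v * (4 * Z))) :=
    mul_le_mul_of_nonneg_right hy (by positivity)
  have h3 : 0 ≤ |K| * (y * v * Z) := by positivity
  have h4 : 0 ≤ y * v * Z := by positivity
  nlinarith

end HeavyHitters

theorem mainTheorem4 :
    ∃ (A : StreamProg) (c : ℕ), ∀ K : ℝ, ∃ C : ℝ, 0 < C ∧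
      ∀ (p : ℝ) (n m M w : ℕ) (φ δ : ℝ) (E : ℝ → Estimator w n),
        0 < p → p ≤ 2 →
        1 ≤ m → 1 ≤ M →
        0 < φ → φ < 1 / 2 → 2 ≤ φ * n →
        0 < δ → δ < 1 / 2 → Real.logb 2 (1 / δ) ≤ n * m * M →
        -- the word size is of order `log (nmM)`
        c * Real.logb 2 (n * m * M) ≤ w → w ≤ K * Real.logb 2 (n * m * M) →
        -- `E d` is the black box with error `1/7` and failure probability `d`
        (E (1 / 5)).Estimates p m M (1 / 7) (1 / 5) →
        (E (hhDelta n φ δ)).Estimates p m M (1 / 7) (hhDelta n φ δ) →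
        -- the bounds in terms of the costs of the black box
        ((Real.logb 2 (1 / hhDelta n φ δ) * (E (1 / 5)).bits ≤ K * (E (hhDelta n φ δ)).bits →
          Real.logb 2 (1 / hhDelta n φ δ) * (E (1 / 5)).updTime
            ≤ K * (E (hhDelta n φ δ)).updTime →
          Real.logb 2 (1 / hhDelta n φ δ) * (E (1 / 5)).repTime
            ≤ K * (E (hhDelta n φ δ)).repTime →
          A.FindsHeavyHitters (fun k => if k then E (hhDelta n φ δ) else E (1 / 5)) p φ δ m M
            (C * (φ⁻¹ * Real.logb 2 (φ * n) * (E (hhDelta n φ δ)).bits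
              + φ⁻¹ * Real.logb 2 (1 / (δ * φ)) * Real.logb 2 (n * m * M)))
            (C * (Real.logb 2 (φ * n) * (E (hhDelta n φ δ)).updTime
              + Real.logb 2 (1 / (δ * φ))))
            (C * (φ⁻¹ * (Real.logb 2 (φ * n) * (E (hhDelta n φ δ)).repTime
              + Real.logb 2 (1 / (δ * φ)))))) ∧
        -- the bounds for a black box of space `O(log (nmM) log (1/d))` and times `O(log (1/d))`
        ((∀ d : ℝ, d = 1 / 5 ∨ d = hhDelta n φ δ →
            (E d).bits ≤ K * (Real.logb 2 (n * m * M) * Real.logb 2 (1 / d)) ∧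
            (E d).updTime ≤ K * Real.logb 2 (1 / d) ∧
            (E d).repTime ≤ K * Real.logb 2 (1 / d)) →
          A.FindsHeavyHitters (fun k => if k then E (hhDelta n φ δ) else E (1 / 5)) p φ δ m M
            (C * (φ⁻¹ * Real.logb 2 (φ * n) * Real.logb 2 (n * m * M)
              * Real.logb 2 (Real.logb 2 (φ * n) / (δ * φ))))
            (C * (Real.logb 2 (φ * n) * Real.logb 2 (Real.logb 2 (φ * n) / (δ * φ))))
            (C * (φ⁻¹ * (Real.logb 2 (φ * n)
              * Real.logb 2 (Real.logb 2 (φ * n) / (δ * φ))))))) := by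
  -- A word of `100 log (nmM)` bits holds all addresses and all intermediate results, which are at
  -- most polynomial in `nmM`: as `nmM ≥ 4`, the constant factors are powers of `nmM` as well.
  refine ⟨HeavyHitters.algorithm, 100, fun K => ⟨2 ^ 48 * (|K| + 1), by positivity, ?_⟩⟩
  intro p n m M w φ δ E hp hp2 hm hM hφ hφ2 hφn hδ hδ2 hδle hw _ hE hE'
  have hpar : HeavyHitters.Parameters p n m M w φ δ :=
    ⟨hp, hp2, hm, hM, hφ, hφ2, hφn, hδ, hδ2, hδle, by exact_mod_cast hw⟩
  have hlam := HeavyHitters.one_le_logb hφn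
  obtain ⟨-, hΛ⟩ := HeavyHitters.rows_le hφ hφ2 hφn hδ hδ2 hpar.floor_bounds.2.2.1
    hpar.floor_bounds.1 hpar.floor_bounds.2.1
  have hΛZ := HeavyHitters.logb_one_div_hhDelta_le hφ hφ2 hφn hδ hδ2
  have hφi : 1 ≤ φ⁻¹ := (one_le_inv₀ hφ).2 (by linarith)
  have hy : 1 ≤ φ⁻¹ * Real.logb 2 (φ * n) := one_le_mul_of_one_le_of_one_le hφi hlam
  have hY : 0 ≤ Real.logb 2 (n * m * M) := by
    refine Real.logb_nonneg (by norm_num) ?_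
    exact_mod_cast (by have := hpar.four_lt.trans_le hpar.n_le; omega : 1 ≤ n * m * M)
  have hδφ : 0 ≤ Real.logb 2 (1 / (δ * φ)) := by
    refine Real.logb_nonneg (by norm_num) ?_
    rw [le_div_iff₀ (by positivity)]
    nlinarith
  have hC : (2 : ℝ) ^ 42 * (|K| + 1) ≤ 2 ^ 48 * (|K| + 1) := by
    gcongr <;> norm_num
  set box : Bool → Estimator w n := fun k => if k then E (hhDelta n φ δ) else E (1 / 5) with hbox
  have hfalse : box false = E (1 / 5) := rfl
  have htrue : box true = E (hhDelta n φ δ) := rfl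
  constructor
  · intro hs hu hr
    refine HeavyHitters.algorithm_findsHeavyHitters hpar hE hE' ?_ ?_ ?_
    · rw [hfalse, htrue]
      have := HeavyHitters.cost_le_of_proportional (z := φ⁻¹ * Real.logb 2 (1 / (δ * φ)) *
        Real.logb 2 (n * m * M)) hy (by positivity) (Nat.cast_nonneg _) hs
      refine le_trans ?_ (this.trans (mul_le_mul_of_nonneg_right hC (by positivity)))
      linarith [Nat.cast_nonneg (α := ℝ) (E (hhDelta n φ δ)).bits]
    · rw [hfalse, htrue]
      exact (HeavyHitters.cost_le_of_proportional hlam hδφ (Nat.cast_nonneg _) hu).trans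
        (mul_le_mul_of_nonneg_right hC (by positivity))
    · rw [hfalse, htrue]
      have := HeavyHitters.cost_le_of_proportional (z := φ⁻¹ * Real.logb 2 (1 / (δ * φ)))
        hy (by positivity) (Nat.cast_nonneg _) hr
      rw [mul_add φ⁻¹, ← mul_assoc φ⁻¹]
      refine le_trans ?_ (this.trans (mul_le_mul_of_nonneg_right hC (by positivity)))
      linarith [Nat.cast_nonneg (α := ℝ) (E (hhDelta n φ δ)).repTime]
  · intro hcost
    obtain ⟨s1, u1, r1⟩ := hcost (1 / 5) (.inl rfl)
    obtain ⟨s2, u2, r2⟩ := hcost (hhDelta n φ δ) (.inr rfl)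
    rw [← one_mul (Real.logb 2 (1 / (1 / 5)))] at u1 r1
    rw [← one_mul (Real.logb 2 (1 / hhDelta n φ δ))] at u2 r2
    refine HeavyHitters.algorithm_findsHeavyHitters hpar hE hE' ?_ ?_ ?_
    · rw [hfalse, htrue]
      refine le_trans ?_ (HeavyHitters.cost_le_of_logarithmic hy hY (by linarith) hΛZ s1 s2)
      linarith [Nat.cast_nonneg (α := ℝ) (E (hhDelta n φ δ)).bits]
    · rw [hfalse, htrue]
      have := HeavyHitters.cost_le_of_logarithmic hlam zero_le_one (by linarith) hΛZ u1 u2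
      rwa [mul_one] at this
    · rw [hfalse, htrue]
      have := HeavyHitters.cost_le_of_logarithmic hy zero_le_one (by linarith) hΛZ r1 r2
      rw [mul_one] at this
      rw [← mul_assoc φ⁻¹]
      refine le_trans ?_ this
      linarith [Nat.cast_nonneg (α := ℝ) (E (hhDelta n φ δ)).repTime]
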